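/- **Setting.** Let $(X,g)$ be a Kähler manifold of complex dimension $n$ (Hausdorff, second countable) with Kähler form $\omega=\frac{\sqrt{-1}}2 g_{\bar kj}\,dz^j\wedge d\bar z^k$, let $L\to X$ be a holomorphic line bundle and $h$ a smooth Hermitian metric on $L$. In holomorphic coordinates and a local holomorphic frame of $L$ put $F_{\bar kj}=-\partial_j\partial_{\bar k}\log h$, $F=\frac12F_{\bar kj}\,dz^j\wedge d\bar z^k$, $\eta_{\bar kj}=g_{\bar kj}+F_{\bar kl}g^{l\bar m}F_{\bar mj}$, and $$\zeta=\frac{(\omega-F)^n}{\omega^n},\qquad v=|\zeta|,\qquad d\mu(h)=|\zeta|\frac{\omega^n}{n!},\qquad \theta=\sum_{i=1}^n\arctan\lambda_i,\qquad H=d\theta ,$$ where $\lambda_1,\dots,\lambda_n$ are the eigenvalues of the endomorphism $g^{j\bar k}F_{\bar kl}\,\frac{\partial}{\partial z^j}\otimes dz^l$ of $T^{1,0}X$. On $T^{1,0}X\oplus\Lambda^{0,1}X$ use the Hermitian metric $$\langle\overline{\mathcal Y},\mathcal Z\rangle=g_{\bar jk}\overline{Y^j}Z^k+g^{j\bar k}\overline{Y_{\bar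 j}}Z_{\bar k},\qquad \mathcal Y=Y^j\frac{\partial}{\partial z^j}\oplus Y_{\bar j}\,d\bar z^j,\quad \mathcal Z=Z^k\frac{\partial}{\partial z^k}\oplus Z_{\bar k}\,d\bar z^k .$$ Let $Th$ be the subbundle spanned by $\mathcal E_i=\frac{\partial}{\partial z^i}\oplus F_{\bar ji}\,d\bar z^j$ ($1\le i\le n$), let $\mathcal Y^\top$ be the orthogonal projection of $\mathcal Y$ to $Th$, and let $\widetilde{\mathcal Y^\top}$ be its image under the isomorphism $Th\to T^{1,0}X$, $\mathcal E_i\mapsto\partial/\partial z^i$. With the Levi-Civita connection $\nabla$ of $g$, define for a $(1,0)$-field $V$ and a section $\mathcal Y$ $$\operatorname{div}_vV=v^{-1}\nabla_i(vV^i),\qquad \operatorname{div}_h\mathcal Y=\nabla_iY^k\,\eta^{i\bar j}g_{\bar jk}+\nabla_iY_{\bar k}\,\eta^{i\bar j}F_{\bar jl}g^{l\bar k},$$ $$\mathcal H=\Bigl(-g^{q\bar k}H_{\bar p}\,\eta^{l\bar p}F_{\bar kl}\frac{\partial}{\partial z^q}\Bigr)\oplus\Bigl(g_{\bar qk}H_{\bar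 l}\,\eta^{k\bar l}\,d\bar z^q\Bigr).$$ An open set $U\subset X$ is said to have piecewise smooth boundary if the set of boundary points near which $U=\{\rho<0\}$ for a smooth real function $\rho$ with $d\rho\neq0$ (the smooth part of $\partial U$) has finite area for $g$ and its complement in $\partial U$ is a null set for the $(2n-1)$-dimensional Hausdorff measure. On the smooth part, $\nu$ denotes the outer unit normal and $d\mu|_{\partial U}$ the measure induced by the Riemannian metric $g$; the remaining part of $\partial U$ is given measure $0$. For a $(1,0)$-vector $V$, $g(V,\nu)$ is taken for the complex bilinear extension of the Riemannian metric, so $g(V,\nu)=\frac12 g_{\bar kj}V^j\overline{\nu^k}$ if $\nu=\nu^k\frac{\partial}{\partial z^k}+\overline{\nu^k}\frac{\partial}{\partial\bar z^k}$. **Theorem (divergence theorem along $h$).** Let $\mathcal Y$ be a smooth section of $T^{1,0}X\oplus\Lambda^{0,1}X$. Then at every point, in every holomorphic chart and every local holomorphic frame of $L$ given by a local trivialization, $$\operatorname{div}_v\widetilde{\mathcal Y^\top}=\operatorname{div}_h\mathcal Y+\langle\overline{\mathcal H},\mathcal Y\rangle .$$ Moreover, for every relatively compact open set $U\subset X$ with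 piecewise smooth boundary, all integrands below are integrable and $$\int_U\operatorname{div}_h\mathcal Y\,d\mu(h)=-\int_U\langle\overline{\mathcal H},\mathcal Y\rangle\,d\mu(h)+\int_{\partial U}g\bigl(v\,\widetilde{\mathcal Y^\top},\nu\bigr)\,d\mu|_{\partial U}.$$ -/

import Mathlib

open scoped Manifold ContDiff ComplexConjugate
open MeasureTheory

noncomputable section

namespace HermDiv

/-- The model space `ℂⁿ`. -/
abbrev Cn (n : ℕ) : Type := Fin n → ℂ

/-! ### Calculus on open subsets of `ℂⁿ`

A matrix `G` with entries `G k j` stands for the coefficients `g_{k̄ j}`; the entry `G⁻¹ j k` of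
its inverse is `g^{j k̄}`. Likewise `F k j = F_{k̄ j}`. -/

section Local

variable {n : ℕ}

/-- The Wirtinger derivative `∂f/∂zʲ = ½ (∂f/∂xʲ - √-1 ∂f/∂yʲ)`. -/
def dWirt (j : Fin n) (f : Cn n → ℂ) (z : Cn n) : ℂ :=
  (1 / 2) * (fderiv ℝ f z (Pi.single j 1) - Complex.I * fderiv ℝ f z (Pi.single j Complex.I))

/-- The Wirtinger derivative `∂f/∂z̄ʲ = ½ (∂f/∂xʲ + √-1 ∂f/∂yʲ)`. -/
def dWirtBar (j : Fin n) (f : Cn n → ℂ) (z : Cn n) : ℂ :=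
  (1 / 2) * (fderiv ℝ f z (Pi.single j 1) + Complex.I * fderiv ℝ f z (Pi.single j Complex.I))

/-- The Christoffel symbols `Γᵏ_{il} = g^{k m̄} ∂_i g_{m̄ l}` of a Kähler metric. -/
def christoffel (G : Cn n → Matrix (Fin n) (Fin n) ℂ) (k i l : Fin n) (z : Cn n) : ℂ :=
  ∑ m, (G z)⁻¹ k m * dWirt i (fun w => G w m l) z

/-- The covariant derivative `∇_i Vᵏ = ∂_i Vᵏ + Γᵏ_{il} Vˡ` of a field `Vᵏ ∂/∂zᵏ` of type `(1,0)`. -/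
def covDeriv (G : Cn n → Matrix (Fin n) (Fin n) ℂ) (V : Cn n → Fin n → ℂ) (i k : Fin n)
    (z : Cn n) : ℂ :=
  dWirt i (fun w => V w k) z + ∑ l, christoffel G k i l z * V z l

/-- The induced metric `η_{k̄ j} = g_{k̄ j} + F_{k̄ l} g^{l m̄} F_{m̄ j}`. -/
def etaMat (G F : Matrix (Fin n) (Fin n) ℂ) : Matrix (Fin n) (Fin n) ℂ :=
  G + F * G⁻¹ * F

/-- The algebra of complex valued alternating forms at a point of `ℂⁿ`: the exterior algebra on
the space with basis `dz¹, …, dzⁿ, dz̄¹, …, dz̄ⁿ`. -/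
abbrev Forms (n : ℕ) : Type := ExteriorAlgebra ℂ (Fin n ⊕ Fin n → ℂ)

/-- The form `dzʲ`. -/
def dz (j : Fin n) : Forms n := ExteriorAlgebra.ι ℂ (Pi.single (Sum.inl j) 1)

/-- The form `dz̄ʲ`. -/
def dzBar (j : Fin n) : Forms n := ExteriorAlgebra.ι ℂ (Pi.single (Sum.inr j) 1)

/-- The Kähler form `ω = (√-1/2) g_{k̄ j} dzʲ ∧ dz̄ᵏ`. -/
def kahlerForm (G : Matrix (Fin n) (Fin n) ℂ) : Forms n :=
  ∑ j, ∑ k, ((Complex.I / 2) * G k j) • (dz j * dzBar k)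

/-- The curvature form `½ F_{k̄ j} dzʲ ∧ dz̄ᵏ`. -/
def curvForm (F : Matrix (Fin n) (Fin n) ℂ) : Forms n :=
  ∑ j, ∑ k, ((1 / 2) * F k j) • (dz j * dzBar k)

/-- The Euclidean volume form `∏ⱼ (√-1/2) dzʲ ∧ dz̄ʲ = dx¹ ∧ dy¹ ∧ ⋯ ∧ dxⁿ ∧ dyⁿ`. -/
def euclVolForm (n : ℕ) : Forms n :=
  (List.ofFn fun j : Fin n => (Complex.I / 2) • (dz j * dzBar j)).prod

/-- The quotient `α / β` of two forms of top degree (with `β ≠ 0`): the number `c` with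
`α = c β`. -/
def formRatio (α β : Forms n) : ℂ := Classical.epsilon fun c : ℂ => α = c • β

/-- `ζ = (ω - F)ⁿ / ωⁿ`. -/
def zetaLoc (G F : Matrix (Fin n) (Fin n) ℂ) : ℂ :=
  formRatio ((kahlerForm G - curvForm F) ^ n) (kahlerForm G ^ n)

/-- The density of `ωⁿ / n!` with respect to Lebesgue measure `dx¹ dy¹ ⋯ dxⁿ dyⁿ`. -/
def volDensity (G : Matrix (Fin n) (Fin n) ℂ) : ℝ :=
  (formRatio (((n.factorial : ℂ)⁻¹) • kahlerForm G ^ n) (euclVolForm n)).re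

/-- The angle `θ = ∑ᵢ arctan λᵢ`, where `λᵢ` are the eigenvalues (with multiplicity) of
`Kʲ_l = g^{j k̄} F_{k̄ l}`; they are real when `G` is positive definite and `F` Hermitian. -/
def thetaLoc (G F : Matrix (Fin n) (Fin n) ℂ) : ℝ :=
  ((G⁻¹ * F).charpoly.roots.map fun l => Real.arctan l.re).sum

/-- Components `(Yʲ, Y_{j̄})` of an element `Yʲ ∂/∂zʲ ⊕ Y_{j̄} dz̄ʲ` of `T^{1,0} ⊕ Λ^{0,1}`. -/
abbrev Fib (n : ℕ) : Type := (Fin n → ℂ) × (Fin n → ℂ)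

/-- The Hermitian metric
`⟨Ȳ, Z⟩ = g_{j̄ k} conj(Yʲ) Zᵏ + g^{j k̄} conj(Y_{j̄}) Z_{k̄}` on `T^{1,0} ⊕ Λ^{0,1}`. -/
def pairing (G : Matrix (Fin n) (Fin n) ℂ) (y z : Fib n) : ℂ :=
  (∑ j, ∑ k, G j k * conj (y.1 j) * z.1 k) + ∑ j, ∑ k, G⁻¹ j k * conj (y.2 j) * z.2 k

/-- `ℰ_i = ∂/∂zⁱ ⊕ F_{j̄ i} dz̄ʲ`. -/
def frameE (F : Matrix (Fin n) (Fin n) ℂ) (i : Fin n) : Fib n :=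
  (Pi.single i 1, fun j => F j i)

/-- The fibre of the tangent bundle `Th` of `h`: the span of `ℰ_1, …, ℰ_n`. -/
def tangentFib (F : Matrix (Fin n) (Fin n) ℂ) : Submodule ℂ (Fib n) :=
  Submodule.span ℂ (Set.range (frameE F))

/-- The tangential part `y^⊤`: the component in `Th` of the decomposition of `y` into an element
of `Th` and an element orthogonal to `Th`. -/
def tangentialPart (G F : Matrix (Fin n) (Fin n) ℂ) (y : Fib n) : Fib n :=
  Classical.epsilon fun t => t ∈ tangentFib F ∧ ∀ w ∈ tangentFib F, pairing G w (y - t) = 0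

/-- The components of the field of type `(1,0)` associated with `y`: the image of `y^⊤` under the
isomorphism `Th → T^{1,0}`, `ℰ_i ↦ ∂/∂zⁱ`, which is the first projection restricted to `Th`. -/
def assocLoc (G F : Matrix (Fin n) (Fin n) ℂ) (y : Fib n) : Fin n → ℂ :=
  (tangentialPart G F y).1

/-- The component `H_{p̄} = ∂θ/∂z̄ᵖ` of the mean curvature 1-form `H = dθ`. -/
def meanCurvBar (G F : Cn n → Matrix (Fin n) (Fin n) ℂ) (p : Fin n) (z : Cn n) : ℂ :=
  dWirtBar p (fun w => (thetaLoc (G w) (F w) : ℂ)) z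

/-- The mean curvature section
`(- g^{q k̄} H_{p̄} η^{l p̄} F_{k̄ l} ∂/∂z^q) ⊕ (g_{q̄ k} H_{l̄} η^{k l̄} dz̄^q)`. -/
def meanCurvLoc (G F : Cn n → Matrix (Fin n) (Fin n) ℂ) (z : Cn n) : Fib n :=
  (fun q => -∑ k, ∑ p, ∑ l,
      (G z)⁻¹ q k * meanCurvBar G F p z * (etaMat (G z) (F z))⁻¹ l p * F z k l,
    fun q => ∑ k, ∑ l, G z q k * meanCurvBar G F l z * (etaMat (G z) (F z))⁻¹ k l)

/-- The divergence along `h`: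
`∇_i Yᵏ η^{i j̄} g_{j̄ k} + ∇_i Y_{k̄} η^{i j̄} F_{j̄ l} g^{l k̄}`; on a Kähler manifold
`∇_i Y_{k̄} = ∂_i Y_{k̄}`. -/
def divHLoc (G F : Cn n → Matrix (Fin n) (Fin n) ℂ) (Y : Cn n → Fib n) (z : Cn n) : ℂ :=
  (∑ i, ∑ j, ∑ k, covDeriv G (fun w => (Y w).1) i k z * (etaMat (G z) (F z))⁻¹ i j * G z j k) +
  ∑ i, ∑ j, ∑ k, ∑ l,
    dWirt i (fun w => (Y w).2 k) z * (etaMat (G z) (F z))⁻¹ i j * F z j l * (G z)⁻¹ l k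

/-- The weighted divergence `div_v V = v⁻¹ ∇_i (v Vⁱ)` with weight `v = |ζ|`. -/
def divVLoc (G F : Cn n → Matrix (Fin n) (Fin n) ℂ) (V : Cn n → Fin n → ℂ) (z : Cn n) : ℂ :=
  ((‖zetaLoc (G z) (F z)‖ : ℝ) : ℂ)⁻¹ *
    ∑ i, covDeriv G (fun w => ((‖zetaLoc (G w) (F w)‖ : ℝ) : ℂ) • V w) i i z

end Local

/-! ### Kähler manifolds and Hermitian line bundles -/

section Manifold

variable {n : ℕ} {X : Type*} [TopologicalSpace X] [ChartedSpace (Cn n) X]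

/-- The holomorphic charts of a complex manifold. -/
def holCharts (n : ℕ) (X : Type*) [TopologicalSpace X] [ChartedSpace (Cn n) X] :
    Set (OpenPartialHomeomorph X (Cn n)) :=
  IsManifold.maximalAtlas 𝓘(ℂ, Cn n) ω X

/-- The holomorphic tangent space `T^{1,0}_x X`. -/
abbrev HTan (n : ℕ) {X : Type*} [TopologicalSpace X] [ChartedSpace (Cn n) X] (x : X) : Type :=
  TangentSpace 𝓘(ℂ, Cn n) x

/-- The real tangent space `T_x X`. -/
abbrev RTan (n : ℕ) {X : Type*} [TopologicalSpace X] [ChartedSpace (Cn n) X] (x : X) : Type :=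
  TangentSpace 𝓘(ℝ, Cn n) x

/-- The real isomorphism `T_x X → T^{1,0}_x X` sending a real vector `u = uᵏ ∂/∂zᵏ + conj(uᵏ) ∂/∂z̄ᵏ`
to its `(1,0)`-part `uᵏ ∂/∂zᵏ`; on the model space it is the identity of `ℂⁿ`. -/
def part10 (x : X) (u : RTan n x) : HTan n x := u

/-- The value at `x` of the coordinate field `∂/∂zʲ` of the holomorphic chart `φ`: the tangent
vector that the derivative of `φ` takes to the `j`-th basis vector of `ℂⁿ`. -/
def coordVec (φ : OpenPartialHomeomorph X (Cn n)) (x : X) (j : Fin n) : HTan n x :=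
  (mfderiv 𝓘(ℂ, Cn n) 𝓘(ℂ, Cn n) φ x).inverse (Pi.single j (1 : ℂ) : Cn n)

/-- A Kähler metric. It is given by a Hermitian inner product on each `T^{1,0}_x X` (conjugate
linear in the first argument) whose coefficients `g_{k̄ j}` are smooth in holomorphic charts and
whose Kähler form is closed, `∂_i g_{k̄ j} = ∂_j g_{k̄ i}`. The Riemannian metric is
`g(u, w) = Re (g_{k̄ j} conj(uᵏ) wʲ)`, and its Kähler form is `(√-1/2) g_{k̄ j} dzʲ ∧ dz̄ᵏ`. -/
structure KahlerMetric (n : ℕ) (X : Type*) [TopologicalSpace X] [ChartedSpace (Cn n) X] where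
  /-- The Hermitian inner product on `T^{1,0}_x X`. -/
  form : ∀ x : X, HTan n x →ₗ⋆[ℂ] HTan n x →ₗ[ℂ] ℂ
  symm : ∀ (x : X) (u w : HTan n x), conj (form x u w) = form x w u
  pos : ∀ (x : X) (u : HTan n x), u ≠ 0 → 0 < (form x u u).re
  smooth : ∀ φ ∈ holCharts n X, ∀ k j : Fin n, ContDiffOn ℝ ∞
    (fun z => form (φ.symm z) (coordVec φ (φ.symm z) k) (coordVec φ (φ.symm z) j)) φ.target
  closed : ∀ φ ∈ holCharts n X, ∀ i j k : Fin n, ∀ z ∈ φ.target,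
    dWirt i (fun w => form (φ.symm w) (coordVec φ (φ.symm w) k) (coordVec φ (φ.symm w) j)) z =
    dWirt j (fun w => form (φ.symm w) (coordVec φ (φ.symm w) k) (coordVec φ (φ.symm w) i)) z

/-- The coefficients `g_{k̄ j}` in the chart `φ`. -/
def gCoeff (g : KahlerMetric n X) (φ : OpenPartialHomeomorph X (Cn n)) (z : Cn n) :
    Matrix (Fin n) (Fin n) ℂ :=
  Matrix.of fun k j => g.form (φ.symm z) (coordVec φ (φ.symm z) k) (coordVec φ (φ.symm z) j)

/-- The Riemannian metric. -/
def riem (g : KahlerMetric n X) (x : X) (u w : RTan n x) : ℝ :=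
  (g.form x (part10 x u) (part10 x w)).re

/-- `g(V, u)` for `V` of type `(1,0)` and `u` a real tangent vector, where `g` is the complex
bilinear extension of the Riemannian metric, that is,
`g(Vʲ ∂/∂zʲ, uᵏ ∂/∂zᵏ + conj(uᵏ) ∂/∂z̄ᵏ) = ½ g_{k̄ j} Vʲ conj(uᵏ)`. -/
def riemC (g : KahlerMetric n X) (x : X) (V : HTan n x) (u : RTan n x) : ℂ :=
  (1 / 2) * g.form x (part10 x u) V

section LineBundle

variable {L : X → Type*} [∀ x, AddCommGroup (L x)] [∀ x, Module ℂ (L x)]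
  [∀ x, TopologicalSpace (L x)] [TopologicalSpace (Bundle.TotalSpace ℂ L)]
  [FiberBundle ℂ L]

/-- The local holomorphic frame of `L` given by a local trivialization. -/
def localFrame (t : Bundle.Trivialization ℂ (Bundle.TotalSpace.proj : Bundle.TotalSpace ℂ L → X))
    (x : X) : L x :=
  t.symm x 1

/-- A smooth Hermitian metric on the holomorphic line bundle `L`. -/
structure HermitianMetric (n : ℕ) {X : Type*} [TopologicalSpace X] [ChartedSpace (Cn n) X]
    (L : X → Type*) [∀ x, AddCommGroup (L x)] [∀ x, Module ℂ (L x)]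
    [∀ x, TopologicalSpace (L x)] [TopologicalSpace (Bundle.TotalSpace ℂ L)]
    [FiberBundle ℂ L] where
  /-- The Hermitian inner product on the fibre `L x`. -/
  form : ∀ x : X, L x →ₗ⋆[ℂ] L x →ₗ[ℂ] ℂ
  symm : ∀ (x : X) (a b : L x), conj (form x a b) = form x b a
  pos : ∀ (x : X) (a : L x), a ≠ 0 → 0 < (form x a a).re
  smooth : ∀ φ ∈ holCharts n X,
    ∀ t : Bundle.Trivialization ℂ (Bundle.TotalSpace.proj : Bundle.TotalSpace ℂ L → X),
    MemTrivializationAtlas t → ContDiffOn ℝ ∞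
      (fun z => form (φ.symm z) (localFrame t (φ.symm z)) (localFrame t (φ.symm z)))
      (φ.target ∩ φ.symm ⁻¹' t.baseSet)

/-- The function `log h(ē, e)` in the chart `φ`, where `e` is the frame given by `t`. -/
def logH (h : HermitianMetric n L) (φ : OpenPartialHomeomorph X (Cn n))
    (t : Bundle.Trivialization ℂ (Bundle.TotalSpace.proj : Bundle.TotalSpace ℂ L → X)) (z : Cn n) : ℂ :=
  (Real.log (h.form (φ.symm z) (localFrame t (φ.symm z)) (localFrame t (φ.symm z))).re : ℂ)

/-- The curvature coefficients `F_{k̄ j} = -∂_j ∂_{k̄} log h` in the chart `φ`. -/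
def curvCoeff (h : HermitianMetric n L) (φ : OpenPartialHomeomorph X (Cn n))
    (t : Bundle.Trivialization ℂ (Bundle.TotalSpace.proj : Bundle.TotalSpace ℂ L → X)) (z : Cn n) :
    Matrix (Fin n) (Fin n) ℂ :=
  Matrix.of fun k j => -dWirt j (dWirtBar k (logH h φ t)) z

/-- Sections of `T^{1,0}X ⊕ Λ^{0,1}X`. A form of type `(0,1)` at `x` is a conjugate linear
functional on `T^{1,0}_x X`, namely `u ↦ β(ū)`. -/
abbrev Sec (n : ℕ) (X : Type*) [TopologicalSpace X] [ChartedSpace (Cn n) X] : Type _ :=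
  ∀ x : X, HTan n x × (HTan n x →ₗ⋆[ℂ] ℂ)

/-- The components `(Yʲ, Y_{j̄})` of a section in the chart `φ`. -/
def secCoeff (Y : Sec n X) (φ : OpenPartialHomeomorph X (Cn n)) (z : Cn n) : Fib n :=
  ((mfderiv 𝓘(ℂ, Cn n) 𝓘(ℂ, Cn n) φ (φ.symm z) (Y (φ.symm z)).1 : Cn n),
    fun j => (Y (φ.symm z)).2 (coordVec φ (φ.symm z) j))

/-- Smoothness of a section: its components in holomorphic charts are smooth. -/
def IsSmoothSec (Y : Sec n X) : Prop :=
  ∀ φ ∈ holCharts n X, ContDiffOn ℝ ∞ (secCoeff Y φ) φ.target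

/-! The following are evaluated at `x` in a chart `φ` and a frame given by `t`. -/

/-- `|ζ|`. -/
def vIn (g : KahlerMetric n X) (h : HermitianMetric n L) (φ : OpenPartialHomeomorph X (Cn n))
    (t : Bundle.Trivialization ℂ (Bundle.TotalSpace.proj : Bundle.TotalSpace ℂ L → X)) (x : X) : ℝ :=
  ‖zetaLoc (gCoeff g φ (φ x)) (curvCoeff h φ t (φ x))‖

/-- The components of the associated field of `Y`. -/
def assocIn (g : KahlerMetric n X) (h : HermitianMetric n L)
    (φ : OpenPartialHomeomorph X (Cn n))
    (t : Bundle.Trivialization ℂ (Bundle.TotalSpace.proj : Bundle.TotalSpace ℂ L → X))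
    (Y : Sec n X) (z : Cn n) : Fin n → ℂ :=
  assocLoc (gCoeff g φ z) (curvCoeff h φ t z) (secCoeff Y φ z)

/-- `div_v` of the associated field of `Y`. -/
def divVIn (g : KahlerMetric n X) (h : HermitianMetric n L) (φ : OpenPartialHomeomorph X (Cn n))
    (t : Bundle.Trivialization ℂ (Bundle.TotalSpace.proj : Bundle.TotalSpace ℂ L → X))
    (Y : Sec n X) (x : X) : ℂ :=
  divVLoc (gCoeff g φ) (curvCoeff h φ t) (assocIn g h φ t Y) (φ x)

/-- `div_h Y`. -/
def divHIn (g : KahlerMetric n X) (h : HermitianMetric n L) (φ : OpenPartialHomeomorph X (Cn n))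
    (t : Bundle.Trivialization ℂ (Bundle.TotalSpace.proj : Bundle.TotalSpace ℂ L → X))
    (Y : Sec n X) (x : X) : ℂ :=
  divHLoc (gCoeff g φ) (curvCoeff h φ t) (secCoeff Y φ) (φ x)

/-- `⟨H̄, Y⟩`, where `H` is the mean curvature section. -/
def meanPairIn (g : KahlerMetric n X) (h : HermitianMetric n L)
    (φ : OpenPartialHomeomorph X (Cn n))
    (t : Bundle.Trivialization ℂ (Bundle.TotalSpace.proj : Bundle.TotalSpace ℂ L → X))
    (Y : Sec n X) (x : X) : ℂ :=
  pairing (gCoeff g φ (φ x)) (meanCurvLoc (gCoeff g φ) (curvCoeff h φ t) (φ x))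
    (secCoeff Y φ (φ x))

/-! The corresponding global objects. As the local expressions do not depend on the chart and the
frame, the value at `x` is computed in the preferred chart and frame around `x`. -/

/-- The function `v = |ζ|` on `X`. -/
def vFun (g : KahlerMetric n X) (h : HermitianMetric n L) (x : X) : ℝ :=
  vIn g h (chartAt (Cn n) x) (trivializationAt ℂ L x) x

/-- The associated field of `Y`, a field of type `(1,0)` on `X`. -/
def assocField (g : KahlerMetric n X) (h : HermitianMetric n L) (Y : Sec n X) (x : X) :
    HTan n x :=
  ∑ j, assocIn g h (chartAt (Cn n) x) (trivializationAt ℂ L x) Y (chartAt (Cn n) x x) j •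
    coordVec (chartAt (Cn n) x) x j

/-- The function `div_h Y` on `X`. -/
def divH (g : KahlerMetric n X) (h : HermitianMetric n L) (Y : Sec n X) (x : X) : ℂ :=
  divHIn g h (chartAt (Cn n) x) (trivializationAt ℂ L x) Y x

/-- The function `⟨H̄, Y⟩` on `X`. -/
def meanPair (g : KahlerMetric n X) (h : HermitianMetric n L) (Y : Sec n X) (x : X) : ℂ :=
  meanPairIn g h (chartAt (Cn n) x) (trivializationAt ℂ L x) Y x

/-! ### Measures -/

/-- The measure `ωⁿ / n!`. On the domain of each holomorphic chart it is the Lebesgue measure of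
the chart weighted by the density of `ωⁿ / n!`. These local measures agree on overlaps, so the
measure they define on `X` is their least upper bound. -/
def volMeasure [MeasurableSpace X] (g : KahlerMetric n X) : Measure X :=
  ⨆ φ ∈ holCharts n X,
    (((volume : Measure (Cn n)).restrict φ.target).withDensity
      fun z => ENNReal.ofReal (volDensity (gCoeff g φ z))).map φ.symm

/-- The measure `dμ(h) = |ζ| ωⁿ / n!`. -/
def muMeasure [MeasurableSpace X] (g : KahlerMetric n X) (h : HermitianMetric n L) : Measure X :=
  (volMeasure g).withDensity fun x => ENNReal.ofReal (vFun g h x)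

end LineBundle

/-- The parameter space of real hypersurfaces of a complex `n`-dimensional manifold. -/
abbrev HPar (n : ℕ) : Type := Fin (2 * n - 1) → ℝ

/-- `ψ`, restricted to the open set `W`, is an injective smooth immersion into `S`. -/
structure IsHyperParam (S : Set X) (W : Set (HPar n)) (ψ : HPar n → X) : Prop where
  isOpen : IsOpen W
  smooth : ContMDiffOn 𝓘(ℝ, HPar n) 𝓘(ℝ, Cn n) ∞ ψ W
  injOn : Set.InjOn ψ W
  immersion : ∀ w ∈ W, Function.Injective (mfderiv 𝓘(ℝ, HPar n) 𝓘(ℝ, Cn n) ψ w)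
  mapsTo : Set.MapsTo ψ W S

/-- The area density `√det (g(∂_a ψ, ∂_b ψ))` of a parametrization of a real hypersurface. -/
def areaDensity (g : KahlerMetric n X) (ψ : HPar n → X) (w : HPar n) : ℝ :=
  Real.sqrt (Matrix.of fun a b : Fin (2 * n - 1) =>
    riem g (ψ w) (mfderiv 𝓘(ℝ, HPar n) 𝓘(ℝ, Cn n) ψ w (Pi.single a (1 : ℝ) : HPar n))
      (mfderiv 𝓘(ℝ, HPar n) 𝓘(ℝ, Cn n) ψ w (Pi.single b (1 : ℝ) : HPar n))).det

/-- The measure induced by the Riemannian metric on a smooth embedded real hypersurface `S`, as a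
measure on `X` concentrated on `S`. On the image of each local parametrization it is the Lebesgue
measure of the parameter domain weighted by the area density. These local measures agree on
overlaps, so the measure they define is their least upper bound. -/
def areaMeasure [MeasurableSpace X] (g : KahlerMetric n X) (S : Set X) : Measure X :=
  ⨆ (W : Set (HPar n)) (ψ : HPar n → X) (_ : IsHyperParam S W ψ),
    (((volume : Measure (HPar n)).restrict W).withDensity
      fun w => ENNReal.ofReal (areaDensity g ψ w)).map ψ

/-- `ρ` is a smooth local defining function of `U` near its boundary point `p`, on the open
neighbourhood `W` of `p`. -/
structure IsDefFun (n : ℕ) {X : Type*} [TopologicalSpace X] [ChartedSpace (Cn n) X]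
    (U : Set X) (p : X) (W : Set X) (ρ : X → ℝ) : Prop where
  isOpen : IsOpen W
  mem : p ∈ W
  smooth : ContMDiffOn 𝓘(ℝ, Cn n) 𝓘(ℝ, ℝ) ∞ ρ W
  zero : ρ p = 0
  deriv_ne : mfderiv 𝓘(ℝ, Cn n) 𝓘(ℝ, ℝ) ρ p ≠ 0
  neg_iff : ∀ q ∈ W, q ∈ U ↔ ρ q < 0

/-- The smooth part of the boundary of an open set `U`: the points near which the boundary is a
smooth real hypersurface with `U` on exactly one side of it. -/
def smoothBdry (n : ℕ) {X : Type*} [TopologicalSpace X] [ChartedSpace (Cn n) X] (U : Set X) :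
    Set X :=
  {p | p ∈ frontier U ∧ ∃ W ρ, IsDefFun n U p W ρ}

/-- The boundary of `U` is piecewise smooth: outside the smooth part it is negligible for the
Hausdorff measure of dimension `2n - 1`, and the smooth part has finite area. -/
structure HasPiecewiseSmoothBdry [MeasurableSpace X] (g : KahlerMetric n X) (U : Set X) :
    Prop where
  null : ∀ φ ∈ holCharts n X,
    Measure.hausdorffMeasure (2 * (n : ℝ) - 1)
      (φ '' (φ.source ∩ (frontier U \ smoothBdry n U))) = 0
  finite : areaMeasure g (smoothBdry n U) Set.univ < ⊤

/-- The derivative `dρ_p(u)` of a real function. -/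
def dirDeriv (ρ : X → ℝ) (p : X) (u : RTan n p) : ℝ := mfderiv 𝓘(ℝ, Cn n) 𝓘(ℝ, ℝ) ρ p u

/-- `ν` is the outer unit normal of `U` at `p`: a unit vector that is a positive multiple of the
gradient of a local defining function. -/
def IsOuterUnitNormal (g : KahlerMetric n X) (U : Set X) (p : X) (ν : RTan n p) : Prop :=
  riem g p ν ν = 1 ∧ ∃ W ρ, IsDefFun n U p W ρ ∧ ∃ c : ℝ, 0 < c ∧
    ∀ u : RTan n p, riem g p ν u = c * dirDeriv ρ p u

/-- The outer unit normal of `U` at a point of the smooth part of its boundary. -/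
def outerNormal (g : KahlerMetric n X) (U : Set X) (p : X) : RTan n p :=
  Classical.epsilon fun ν => IsOuterUnitNormal g U p ν

end Manifold

end HermDiv

end

noncomputable section

open scoped ComplexOrder

namespace HermDiv

/-! ### Top powers of `(1,1)`-forms -/

section FormPowers

/-! In a chart everything is governed by the matrices g ± √-1F. The form ω - F has coefficient
matrix (√-1/2)(g + √-1F), so ζ = det(g + √-1F)/det g (`zetaLoc_eq`), and dμ(h) has Lebesgue density
D = |det(g + √-1F)| (`densD`). From the factorization η = (g + √-1F)g⁻¹(g - √-1F) one reads off that
the inverses of g ± √-1F have sum 2η⁻¹ and difference -2√-1 η⁻¹Fg⁻¹. With Jacobi's formula this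
gives ∂ log D = tr(η⁻¹∂g) + tr(η⁻¹Fg⁻¹∂F) (`GoodPair.cder_densD`) and ∂θ = tr(η⁻¹∂F) - tr(η⁻¹Fg⁻¹∂g)
(`GoodPair.cder_theta`). The second formula presupposes that θ, a sum over an unordered family of
eigenvalues, is differentiable. An integral representation shows that θ is continuous, and
exp(2√-1θ) det(g - √-1F) = det(g + √-1F) fixes it modulo π, so θ is locally a branch of a logarithm
(`GoodPair.theta_eventuallyEq`).

The bundle Th is the graph of F, whence the associated field is V = η⁻¹(gY₁ + Fg⁻¹Y₂), where Y₁ and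
Y₂ are the two components of the section. With U = g⁻¹FV and X = g⁻¹Y₂ this reads gV + FU = gY₁ +
FX. Differentiation expresses ∂_iV by the integrand of div_h, by terms linear in V, and by terms
linear in b = X - U = η⁻¹(Y₂ - FY₁). Because g and F are closed, the sum over i of the i-th
components turns the last two groups into traces (`sum_mulVec_of_symm`): the V terms are -∂ log D ·
V, and the b terms are ∂θ · b, which is the pairing with the mean curvature section. Hence Σ ∂_i(D
Vⁱ) = D (div_h Y + ⟨H̄, Y⟩) (`GoodData.sum_dWirt_densD_mul`), and the Kähler identity for ∇_i turns
this into the pointwise statement.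

All local expressions are invariant under changes of chart and frame, so Z = vV is a global smooth
field with known divergence (`hasDivergence_assocField`). The integral formula is then the
divergence theorem for Z. Both of its sides are additive in a cutoff τ multiplying Z, so a partition
of unity reduces it to small supports inside U, outside its closure, or near a smooth boundary
point. At such a point U is a subgraph, and the formula follows from a volume preserving shear and
the fundamental theorem of calculus (`stokesFor_graph`). The singular boundary points are removed by
cutoffs that vanish near them and whose gradients are small in L¹; these exist because the singular
set is null for the (2n-1)-dimensional Hausdorff measure (`exists_cutoff`, `stokesFor_chart`). -/

theorem mul_prod_ofFn_eq_zero_of_sq_zero {R : Type*} [Ring R] :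
    ∀ {n : ℕ} (c : Fin n → R) (_ : ∀ i j, c i * c j = c j * c i) (_ : ∀ i, c i * c i = 0)
      (i : Fin n), c i * (List.ofFn c).prod = 0
  | 0, _, _, _, i => i.elim0
  | n + 1, c, hc, h0, i => by
    rw [List.ofFn_succ, List.prod_cons]
    refine Fin.cases ?_ (fun j => ?_) i
    · rw [← mul_assoc, h0, zero_mul]
    · rw [← mul_assoc, hc, mul_assoc,
        mul_prod_ofFn_eq_zero_of_sq_zero (fun k : Fin n => c k.succ) (fun _ _ => hc _ _)
          (fun _ => h0 _) j, mul_zero]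

/-- In the multinomial expansion only the terms in which each index occurs once survive, and there
are n! of them. The induction splits off `c 0`. -/
theorem sum_pow_eq_factorial_nsmul_prod {R : Type*} [Ring R] :
    ∀ {n : ℕ} (c : Fin n → R) (_ : ∀ i j, c i * c j = c j * c i) (_ : ∀ i, c i * c i = 0),
      (∑ i, c i) ^ n = n.factorial • (List.ofFn c).prod
  | 0, _, _, _ => by simp
  | n + 1, c, hc, h0 => by
    have ih := sum_pow_eq_factorial_nsmul_prod (fun k : Fin n => c k.succ) (fun _ _ => hc _ _)
      (fun _ => h0 _)
    have hz := mul_prod_ofFn_eq_zero_of_sq_zero (fun k : Fin n => c k.succ) (fun _ _ => hc _ _)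
      (fun _ => h0 _)
    rw [Fin.sum_univ_succ, List.ofFn_succ, List.prod_cons]
    set S := ∑ k : Fin n, c k.succ with hS
    set P := (List.ofFn fun k : Fin n => c k.succ).prod
    have hcS : Commute (c 0) S := by
      rw [hS]; exact Commute.sum_right _ _ _ fun i _ => hc _ _
    -- By induction the n-th power of `S` is already a multiple of the full product, which each
    -- summand of `S` annihilates.
    have hSP : S ^ (n + 1) = 0 := by
      rw [pow_succ', ih, mul_smul_comm, hS, Finset.sum_mul, Finset.sum_eq_zero fun i _ => hz i,
        smul_zero]
    -- The binomial formula stops after the linear term because `c 0` squares to zero.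
    have key : ∀ m : ℕ, (c 0 + S) ^ (m + 1) = S ^ (m + 1) + (m + 1) • (c 0 * S ^ m) := by
      intro m
      induction m with
      | zero => simp [add_comm]
      | succ m ihm =>
        rw [pow_succ', ihm, add_mul, mul_add, mul_add, mul_smul_comm, mul_smul_comm, ← mul_assoc,
          h0, zero_mul, smul_zero, add_zero, ← pow_succ', ← mul_assoc S, ← hcS.eq, mul_assoc,
          ← pow_succ', succ_nsmul (c 0 * S ^ (m + 1)) (m + 1)]
        abel
    rw [key, hSP, zero_add, ih, mul_smul_comm, smul_smul, Nat.factorial_succ]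

variable {M : Type*} [AddCommGroup M] [Module ℂ M]

theorem ι_mul_ιMulti_comm (y : M) : ∀ {n : ℕ} (x : Fin n → M),
    ExteriorAlgebra.ι ℂ y * ExteriorAlgebra.ιMulti ℂ n x =
      (-1 : ℂ) ^ n • (ExteriorAlgebra.ιMulti ℂ n x * ExteriorAlgebra.ι ℂ y)
  | 0, x => by simp
  | n + 1, x => by
    have h : ExteriorAlgebra.ι ℂ y * ExteriorAlgebra.ι ℂ (x 0) =
        -(ExteriorAlgebra.ι ℂ (x 0) * ExteriorAlgebra.ι ℂ y) :=
      eq_neg_of_add_eq_zero_left (ExteriorAlgebra.ι_add_mul_swap y (x 0))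
    rw [ExteriorAlgebra.ιMulti_succ_apply, ← mul_assoc, h, neg_mul, mul_assoc,
      ι_mul_ιMulti_comm y (Matrix.vecTail x), mul_smul_comm, pow_succ, mul_assoc]
    simp

/-- Moving each y to the right past the later x's produces a sign that depends on n only. It cancels
in every quotient of top forms, so it suffices that it is nonzero. -/
theorem prod_ofFn_ι_mul_ι : ∀ n : ℕ, ∃ s : ℂ, s ≠ 0 ∧ ∀ x y : Fin n → M,
    (List.ofFn fun j => ExteriorAlgebra.ι ℂ (x j) * ExteriorAlgebra.ι ℂ (y j)).prod =
      s • (ExteriorAlgebra.ιMulti ℂ n x * ExteriorAlgebra.ιMulti ℂ n y)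
  | 0 => ⟨1, one_ne_zero, fun x y => by simp⟩
  | n + 1 => by
    obtain ⟨s, hs, h⟩ := prod_ofFn_ι_mul_ι n
    refine ⟨s * (-1) ^ n, mul_ne_zero hs (pow_ne_zero _ (by norm_num)), fun x y => ?_⟩
    rw [List.ofFn_succ, List.prod_cons, h (fun j => x j.succ) (fun j => y j.succ),
      ExteriorAlgebra.ιMulti_succ_apply x, ExteriorAlgebra.ιMulti_succ_apply y, mul_smul_comm]
    have e1 : (fun j : Fin n => x j.succ) = Matrix.vecTail x := rfl
    have e2 : (fun j : Fin n => y j.succ) = Matrix.vecTail y := rfl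
    rw [e1, e2, mul_assoc, ← mul_assoc (ExteriorAlgebra.ι ℂ (y 0)),
      ι_mul_ιMulti_comm (y 0) (Matrix.vecTail x)]
    simp only [smul_mul_assoc, mul_smul_comm, smul_smul, mul_assoc]

/-- An alternating map in n vectors of ℂⁿ is determined by its value on the standard basis, and the
determinant is the one with value 1 there. -/
theorem ιMulti_comp_matrix {n : ℕ} (J : (Fin n → ℂ) →ₗ[ℂ] M) (A : Matrix (Fin n) (Fin n) ℂ) :
    ExteriorAlgebra.ιMulti ℂ n (fun j => J (A j)) =
      A.det • ExteriorAlgebra.ιMulti ℂ n (fun j => J (Pi.single j 1)) := by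
  set f : (Fin n → ℂ) [⋀^Fin n]→ₗ[ℂ] ExteriorAlgebra ℂ M :=
    (ExteriorAlgebra.ιMulti ℂ n).compLinearMap J with hf
  have h : f = (LinearMap.toSpanSingleton ℂ _ (f fun j => Pi.single j 1)).compAlternatingMap
      Matrix.detRowAlternating := by
    refine Module.Basis.ext_alternating (Pi.basisFun ℂ (Fin n)) fun v hv => ?_
    obtain ⟨σ, rfl⟩ : ∃ σ : Equiv.Perm (Fin n), v = σ :=
      ⟨Equiv.ofBijective v (Finite.injective_iff_bijective.1 hv), rfl⟩
    have hd : Matrix.detRowAlternating (fun i : Fin n => (Pi.single (σ i) (1 : ℂ) : Fin n → ℂ)) =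
        ((Equiv.Perm.sign σ : ℤ) : ℂ) := by
      have : (fun i : Fin n => (Pi.single (σ i) (1 : ℂ) : Fin n → ℂ)) =
          fun i => (1 : Matrix (Fin n) (Fin n) ℂ) (σ i) := by
        ext i j; simp [Matrix.one_apply, Pi.single_apply, eq_comm]
      rw [this]
      have h2 := Matrix.det_permute σ (1 : Matrix (Fin n) (Fin n) ℂ)
      rw [Matrix.det_one, mul_one] at h2
      exact h2
    have hp := f.map_perm (fun j => Pi.single j 1) σ
    simp only [LinearMap.compAlternatingMap_apply, Pi.basisFun_apply, hd,
      LinearMap.toSpanSingleton_apply]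
    have : ((fun j : Fin n => (Pi.single j 1 : Fin n → ℂ)) ∘ σ) = fun i => Pi.single (σ i) 1 := rfl
    rw [this] at hp
    rw [hp, Units.smul_def, Int.cast_smul_eq_zsmul]
  exact congrArg (fun g => g A) h

/-- The determinant with respect to `b`, extended by zero in the other degrees, lifts to a linear
functional on the exterior algebra that takes the value 1 on this product. -/
theorem ιMulti_ne_zero_of_basis {ι : Type*} [Fintype ι] (b : Module.Basis ι ℂ M) {n : ℕ}
    (e : Fin n ≃ ι) : ExteriorAlgebra.ιMulti ℂ n (b ∘ e) ≠ 0 := by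
  intro h
  classical
  have h1 := ExteriorAlgebra.liftAlternating_apply_ιMulti (R := ℂ)
    (fun i => if hi : i = n then hi ▸ (b.reindex e.symm).det else 0) (b ∘ e)
  rw [h, map_zero] at h1
  have h2 : (b.reindex e.symm).det (b ∘ e) = 1 := by
    have : b ∘ e = b.reindex e.symm := by ext i; simp
    rw [this, Module.Basis.det_self]
  simp [h2] at h1

variable {n : ℕ}

/-- The form `∑ A_{k̄ j} dzʲ ∧ dz̄ᵏ`. -/
def formOf (A : Matrix (Fin n) (Fin n) ℂ) : Forms n := ∑ j, ∑ k, A k j • (dz j * dzBar k)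

/-- The inclusion of the span of the `dz̄ᵏ`. -/
def inrMap (n : ℕ) : (Fin n → ℂ) →ₗ[ℂ] (Fin n ⊕ Fin n → ℂ) where
  toFun v := Sum.elim 0 v
  map_add' v w := by ext (i | i) <;> simp
  map_smul' c v := by ext (i | i) <;> simp

theorem inrMap_eq_sum (v : Fin n → ℂ) :
    inrMap n v = ∑ k, v k • (Pi.single (Sum.inr k) 1 : Fin n ⊕ Fin n → ℂ) := by
  ext (i | i) <;> simp [inrMap, Finset.sum_apply, Pi.single_apply]

theorem inrMap_single (k : Fin n) :
    inrMap n (Pi.single k 1) = (Pi.single (Sum.inr k) 1 : Fin n ⊕ Fin n → ℂ) := by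
  ext (i | i) <;> simp [inrMap, Pi.single_apply]

/-- The product `∏ⱼ dzʲ ∧ dz̄ʲ`. -/
def baseVol (n : ℕ) : Forms n := (List.ofFn fun j : Fin n => dz j * dzBar j).prod

/-- Put b_j = Σ_k A_{k̄j} dz̄ᵏ. The 2-forms dzʲ ∧ b_j commute and square to zero, so the n-th power
of their sum is n! times their product; the wedge of the b_j contributes det A. -/
theorem formOf_pow (A : Matrix (Fin n) (Fin n) ℂ) :
    formOf A ^ n = ((n.factorial : ℂ) * A.det) • baseVol n := by
  set b : Fin n → Fin n ⊕ Fin n → ℂ := fun j => inrMap n (A.transpose j) with hb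
  have h1 : formOf A = ∑ j, dz j * ExteriorAlgebra.ι ℂ (b j) := by
    refine Finset.sum_congr rfl fun j _ => ?_
    rw [hb]
    simp only [inrMap_eq_sum, map_sum, map_smul, Finset.mul_sum, mul_smul_comm, dzBar,
      Matrix.transpose_apply]
  have anti : ∀ u w : Fin n ⊕ Fin n → ℂ, ExteriorAlgebra.ι ℂ u * ExteriorAlgebra.ι ℂ w =
      -(ExteriorAlgebra.ι ℂ w * ExteriorAlgebra.ι ℂ u) := fun u w =>
    eq_neg_of_add_eq_zero_left (ExteriorAlgebra.ι_add_mul_swap u w)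
  have hsq : ∀ u : Fin n ⊕ Fin n → ℂ, ExteriorAlgebra.ι ℂ u * ExteriorAlgebra.ι ℂ u = 0 :=
    ExteriorAlgebra.ι_sq_zero
  have hswap : ∀ x y z w : Fin n ⊕ Fin n → ℂ,
      ExteriorAlgebra.ι ℂ x * ExteriorAlgebra.ι ℂ y * (ExteriorAlgebra.ι ℂ z *
        ExteriorAlgebra.ι ℂ w) = ExteriorAlgebra.ι ℂ z * ExteriorAlgebra.ι ℂ w *
        (ExteriorAlgebra.ι ℂ x * ExteriorAlgebra.ι ℂ y) := by
    intro x y z w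
    calc _ = ExteriorAlgebra.ι ℂ x * (ExteriorAlgebra.ι ℂ y * ExteriorAlgebra.ι ℂ z) *
        ExteriorAlgebra.ι ℂ w := by simp only [mul_assoc]
      _ = -(ExteriorAlgebra.ι ℂ x * ExteriorAlgebra.ι ℂ z * (ExteriorAlgebra.ι ℂ y *
        ExteriorAlgebra.ι ℂ w)) := by rw [anti y z]; simp only [mul_assoc, neg_mul, mul_neg]
      _ = -(ExteriorAlgebra.ι ℂ z * (ExteriorAlgebra.ι ℂ x * ExteriorAlgebra.ι ℂ w) *
        ExteriorAlgebra.ι ℂ y) := by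
          rw [anti x z, anti y w]; simp only [mul_assoc, neg_mul, mul_neg, neg_neg]
      _ = _ := by rw [anti x w]; simp only [mul_assoc, neg_mul, mul_neg, neg_neg]
  rw [h1, sum_pow_eq_factorial_nsmul_prod (fun j => dz j * ExteriorAlgebra.ι ℂ (b j))
    (fun i j => hswap _ _ _ _) ?_]
  · obtain ⟨s, -, hs⟩ := prod_ofFn_ι_mul_ι (M := Fin n ⊕ Fin n → ℂ) n
    have e1 : (List.ofFn fun j => dz j * ExteriorAlgebra.ι ℂ (b j)).prod = _ :=
      hs (fun j => Pi.single (Sum.inl j) 1) b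
    have e2 : baseVol n = _ := hs (fun j => Pi.single (Sum.inl j) 1)
      (fun j => Pi.single (Sum.inr j) 1)
    have e3 : ExteriorAlgebra.ιMulti ℂ n b = A.det •
        ExteriorAlgebra.ιMulti ℂ n (fun j => (Pi.single (Sum.inr j) 1 : Fin n ⊕ Fin n → ℂ)) := by
      have := ιMulti_comp_matrix (inrMap n) A.transpose
      simpa only [inrMap_single, Matrix.det_transpose] using this
    rw [e1, e2, e3, mul_smul_comm, ← Nat.cast_smul_eq_nsmul ℂ, smul_comm s, smul_smul]
  · intro i
    have := hsq (Pi.single (Sum.inl i) 1)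
    calc _ = dz i * (ExteriorAlgebra.ι ℂ (b i) * dz i) * ExteriorAlgebra.ι ℂ (b i) := by
          simp only [mul_assoc]
      _ = 0 := by
        rw [dz, anti (b i)]
        simp only [mul_neg, ← mul_assoc, this, zero_mul, neg_zero]

/-- Up to a nonzero factor this is the wedge product of a basis of the 2n-dimensional space of
covectors. -/
theorem baseVol_ne_zero (n : ℕ) : baseVol n ≠ 0 := by
  obtain ⟨s, hs0, hs⟩ := prod_ofFn_ι_mul_ι (M := Fin n ⊕ Fin n → ℂ) n
  have e2 : baseVol n = _ := hs (fun j => Pi.single (Sum.inl j) 1)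
      (fun j => Pi.single (Sum.inr j) 1)
  rw [e2, ExteriorAlgebra.ιMulti_mul_ιMulti]
  refine smul_ne_zero hs0 ?_
  have := ιMulti_ne_zero_of_basis (Pi.basisFun ℂ (Fin n ⊕ Fin n)) finSumFinEquiv.symm
  convert! this using 2
  ext1 i
  refine Fin.addCases (fun i => ?_) (fun i => ?_) i
  · simp only [Fin.append_left, Function.comp_apply, finSumFinEquiv_symm_apply_castAdd,
      Pi.basisFun_apply]
  · simp only [Fin.append_right, Function.comp_apply, finSumFinEquiv_symm_apply_natAdd,
      Pi.basisFun_apply]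

/-- The choice made in `formRatio` is forced, since scalars act injectively on a nonzero form. -/
theorem formRatio_smul {β : Forms n} (hβ : β ≠ 0) (c d : ℂ) (hd : d ≠ 0) :
    formRatio (c • β) (d • β) = c / d := by
  have h : ∃ x : ℂ, c • β = x • d • β := ⟨c / d, by rw [smul_smul, div_mul_cancel₀ _ hd]⟩
  have := Classical.epsilon_spec h
  have h2 : c • β = (formRatio (c • β) (d • β) * d) • β := by rw [mul_smul]; exact this
  have h3 := smul_left_injective ℂ hβ h2
  rw [eq_div_iff hd]; exact h3.symm

theorem kahlerForm_eq (G : Matrix (Fin n) (Fin n) ℂ) :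
    kahlerForm G = formOf ((Complex.I / 2) • G) := rfl

/-- The factor √-1 in front of `F` arises from -1/2 = (√-1/2)·√-1. -/
theorem kahlerForm_sub_curvForm (G F : Matrix (Fin n) (Fin n) ℂ) :
    kahlerForm G - curvForm F = formOf ((Complex.I / 2) • (G + Complex.I • F)) := by
  simp only [kahlerForm, curvForm, formOf, ← Finset.sum_sub_distrib, ← sub_smul]
  refine Finset.sum_congr rfl fun j _ => Finset.sum_congr rfl fun k _ => ?_
  congr 1
  simp only [Matrix.smul_apply, Matrix.add_apply, smul_eq_mul]
  linear_combination (-(F k j) / 2) * Complex.I_mul_I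

/-- `ζ = det (g + √-1 F) / det g`. -/
theorem zetaLoc_eq (G F : Matrix (Fin n) (Fin n) ℂ) (hG : G.det ≠ 0) :
    zetaLoc G F = (G + Complex.I • F).det / G.det := by
  have hI : (Complex.I / 2) ^ n ≠ 0 := pow_ne_zero _ (by simp)
  have hf : (n.factorial : ℂ) ≠ 0 := by exact_mod_cast n.factorial_ne_zero
  rw [zetaLoc, kahlerForm_sub_curvForm, kahlerForm_eq, formOf_pow, formOf_pow,
    formRatio_smul (baseVol_ne_zero n), Matrix.det_smul, Matrix.det_smul, Fintype.card_fin]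
  · field_simp
  · rw [Matrix.det_smul, Fintype.card_fin]
    exact mul_ne_zero hf (mul_ne_zero hI hG)

theorem prod_ofFn_smul {R : Type*} [Ring R] [Algebra ℂ R] (a : ℂ) : ∀ {n : ℕ} (c : Fin n → R),
    (List.ofFn fun j => a • c j).prod = a ^ n • (List.ofFn c).prod
  | 0, c => by simp
  | n + 1, c => by
    rw [List.ofFn_succ, List.ofFn_succ, List.prod_cons, List.prod_cons,
      prod_ofFn_smul a fun j => c j.succ, smul_mul_smul_comm, pow_succ']

/-- Both forms carry the factor (√-1/2)ⁿ, and the factorial cancels against the one produced by the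
n-th power. -/
theorem volDensity_eq (G : Matrix (Fin n) (Fin n) ℂ) : volDensity G = G.det.re := by
  have hI : (Complex.I / 2) ^ n ≠ 0 := pow_ne_zero _ (by simp)
  have hf : (n.factorial : ℂ) ≠ 0 := by exact_mod_cast n.factorial_ne_zero
  have e : euclVolForm n = (Complex.I / 2) ^ n • baseVol n := prod_ofFn_smul _ _
  rw [volDensity, e, kahlerForm_eq, formOf_pow, smul_smul,
    formRatio_smul (baseVol_ne_zero n) _ _ hI, Matrix.det_smul, Fintype.card_fin]
  congr 1
  field_simp

end FormPowers

/-! ### Calculus of matrix valued functions -/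

section MatrixCalculus

open Matrix

variable {n : ℕ} {E : Type*} [NormedAddCommGroup E] [NormedSpace ℝ E]

/-- Jacobi's formula. -/
theorem hasFDerivAt_det {A : E → Matrix (Fin n) (Fin n) ℂ}
    {A' : Fin n → Fin n → E →L[ℝ] ℂ} {z : E}
    (h : ∀ i j, HasFDerivAt (fun w => A w i j) (A' i j) z) :
    HasFDerivAt (fun w => (A w).det) (∑ i, ∑ j, (A z).adjugate j i • A' i j) z := by
  have h1 : HasFDerivAt (fun w => (A w).det)
      (∑ σ : Equiv.Perm (Fin n), ((Equiv.Perm.sign σ : ℤ) : ℂ) •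
        ∑ i, (∏ j ∈ Finset.univ.erase i, A z j (σ j)) • A' i (σ i)) z := by
    have : (fun w => (A w).det) =
        fun w => ∑ σ : Equiv.Perm (Fin n), ((Equiv.Perm.sign σ : ℤ) : ℂ) * ∏ i, A w i (σ i) := by
      ext w
      rw [← det_transpose, det_apply']
      rfl
    rw [this]
    refine HasFDerivAt.fun_sum fun σ _ => HasFDerivAt.const_mul ?_ _
    exact HasFDerivAt.finsetProd fun i _ => h i (σ i)
  convert! h1 using 1
  -- The cofactor is the part of the Leibniz formula with σ i = j, with the i-th factor removed;
  -- this is the coefficient of `A' i j` in the differentiated product.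
  have key : ∀ i j, (A z).adjugate j i =
      ∑ σ : Equiv.Perm (Fin n), if σ i = j then
        ((Equiv.Perm.sign σ : ℤ) : ℂ) * ∏ k ∈ Finset.univ.erase i, A z k (σ k) else 0 := by
    intro i j
    rw [adjugate_apply, ← det_transpose, det_apply']
    refine Finset.sum_congr rfl fun σ _ => ?_
    rw [← Finset.mul_prod_erase _ _ (Finset.mem_univ i)]
    have : ∏ x ∈ Finset.univ.erase i, ((A z).updateRow i (Pi.single j 1))ᵀ (σ x) x =
        ∏ k ∈ Finset.univ.erase i, A z k (σ k) :=
      Finset.prod_congr rfl fun k hk => by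
        rw [transpose_apply, updateRow_ne (Finset.ne_of_mem_erase hk)]
    rw [this, transpose_apply, updateRow_self, Pi.single_apply]
    split_ifs <;> simp
  ext u
  simp only [_root_.sum_apply, _root_.smul_apply, key, smul_eq_mul,
    Finset.mul_sum, Finset.sum_mul]
  calc _ = ∑ i, ∑ σ : Equiv.Perm (Fin n), ∑ j, (if σ i = j then
        ((Equiv.Perm.sign σ : ℤ) : ℂ) * ∏ k ∈ Finset.univ.erase i, A z k (σ k) else 0)
          * A' i j u := Finset.sum_congr rfl fun i _ => Finset.sum_comm
    _ = ∑ i, ∑ σ : Equiv.Perm (Fin n), ((Equiv.Perm.sign σ : ℤ) : ℂ) *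
          ((∏ k ∈ Finset.univ.erase i, A z k (σ k)) * A' i (σ i) u) := by
        refine Finset.sum_congr rfl fun i _ => Finset.sum_congr rfl fun σ _ => ?_
        simp [ite_mul, mul_assoc]
    _ = _ := Finset.sum_comm

/-- The entries of `A` are differentiable at `z`. -/
def DiffM (A : E → Matrix (Fin n) (Fin n) ℂ) (z : E) : Prop :=
  ∀ i j, DifferentiableAt ℝ (fun w => A w i j) z

/-- The derivative of the function `f` in the complexified direction `T`. -/
def cder (T : (E →L[ℝ] ℂ) →ₗ[ℂ] ℂ) (f : E → ℂ) (z : E) : ℂ := T (fderiv ℝ f z)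

/-- The entrywise derivative of a matrix. -/
def mder (T : (E →L[ℝ] ℂ) →ₗ[ℂ] ℂ) (A : E → Matrix (Fin n) (Fin n) ℂ) (z : E) :
    Matrix (Fin n) (Fin n) ℂ := Matrix.of fun i j => cder T (fun w => A w i j) z

/-- The entrywise derivative of a vector. -/
def vder (T : (E →L[ℝ] ℂ) →ₗ[ℂ] ℂ) (v : E → Fin n → ℂ) (z : E) : Fin n → ℂ :=
  fun i => cder T (fun w => v w i) z

variable (T : (E →L[ℝ] ℂ) →ₗ[ℂ] ℂ) {z : E}

theorem cder_congr {f g : E → ℂ} (h : f =ᶠ[nhds z] g) : cder T f z = cder T g z := by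
  rw [cder, cder, h.fderiv_eq]

theorem cder_const (c : ℂ) : cder T (fun _ => c) z = 0 := by simp [cder]

theorem cder_add {f g : E → ℂ} (hf : DifferentiableAt ℝ f z) (hg : DifferentiableAt ℝ g z) :
    cder T (fun w => f w + g w) z = cder T f z + cder T g z := by
  rw [cder, fderiv_fun_add hf hg, map_add]; rfl

theorem cder_neg {f : E → ℂ} : cder T (fun w => -f w) z = -cder T f z := by
  rw [cder, fderiv_fun_neg, map_neg]; rfl

theorem cder_sum {ι : Type*} {s : Finset ι} {f : ι → E → ℂ}
    (hf : ∀ i ∈ s, DifferentiableAt ℝ (f i) z) :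
    cder T (fun w => ∑ i ∈ s, f i w) z = ∑ i ∈ s, cder T (f i) z := by
  rw [cder, fderiv_fun_sum hf, map_sum]; rfl

theorem cder_mul {f g : E → ℂ} (hf : DifferentiableAt ℝ f z) (hg : DifferentiableAt ℝ g z) :
    cder T (fun w => f w * g w) z = f z * cder T g z + g z * cder T f z := by
  rw [cder, fderiv_fun_mul hf hg, map_add, map_smul, map_smul]; rfl

theorem cder_const_mul {f : E → ℂ} (c : ℂ) (hf : DifferentiableAt ℝ f z) :
    cder T (fun w => c * f w) z = c * cder T f z := by
  rw [cder_mul T (differentiableAt_const c) hf, cder_const, mul_zero, add_zero]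

theorem vder_mulVec {A : E → Matrix (Fin n) (Fin n) ℂ} {v : E → Fin n → ℂ} (hA : DiffM A z)
    (hv : ∀ i, DifferentiableAt ℝ (fun w => v w i) z) :
    vder T (fun w => A w *ᵥ v w) z = mder T A z *ᵥ v z + A z *ᵥ vder T v z := by
  ext i
  simp only [vder, mulVec, dotProduct, Pi.add_apply, mder, Matrix.of_apply]
  rw [cder_sum T fun j _ => (hA i j).fun_mul (hv j), ← Finset.sum_add_distrib]
  refine Finset.sum_congr rfl fun j _ => ?_
  rw [cder_mul T (hA i j) (hv j)]
  ring

theorem mder_add {A B : E → Matrix (Fin n) (Fin n) ℂ} (hA : DiffM A z) (hB : DiffM B z) :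
    mder T (fun w => A w + B w) z = mder T A z + mder T B z := by
  ext i k
  exact cder_add T (hA i k) (hB i k)

theorem mder_smul {A : E → Matrix (Fin n) (Fin n) ℂ} (c : ℂ) (hA : DiffM A z) :
    mder T (fun w => c • A w) z = c • mder T A z := by
  ext i k
  exact cder_const_mul T c (hA i k)

theorem DiffM.smul {A : E → Matrix (Fin n) (Fin n) ℂ} (c : ℂ) (hA : DiffM A z) :
    DiffM (fun w => c • A w) z := fun i j => (hA i j).const_mul c

theorem differentiableAt_det {A : E → Matrix (Fin n) (Fin n) ℂ} (hA : DiffM A z) :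
    DifferentiableAt ℝ (fun w => (A w).det) z :=
  (hasFDerivAt_det fun i j => (hA i j).hasFDerivAt).differentiableAt

theorem cder_det {A : E → Matrix (Fin n) (Fin n) ℂ} (hA : DiffM A z) (h0 : (A z).det ≠ 0) :
    cder T (fun w => (A w).det) z = (A z).det * ((A z)⁻¹ * mder T A z).trace := by
  rw [cder, (hasFDerivAt_det fun i j => (hA i j).hasFDerivAt).fderiv]
  simp only [map_sum, map_smul, trace, diag_apply, Matrix.mul_apply, inv_def, Matrix.smul_apply,
    Ring.inverse_eq_inv', smul_eq_mul, Finset.mul_sum, mder, cder, Matrix.of_apply]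
  rw [Finset.sum_comm]
  refine Finset.sum_congr rfl fun i _ => Finset.sum_congr rfl fun j _ => ?_
  field_simp

/-- The entries of `A` are smooth at `z`. -/
def SmoothM (A : E → Matrix (Fin n) (Fin n) ℂ) (z : E) : Prop :=
  ∀ i j, ContDiffAt ℝ ∞ (fun w => A w i j) z

theorem SmoothM.diffM {A : E → Matrix (Fin n) (Fin n) ℂ} (hA : SmoothM A z) : DiffM A z :=
  fun i j => (hA i j).differentiableAt (by simp)

theorem SmoothM.det {A : E → Matrix (Fin n) (Fin n) ℂ} (hA : SmoothM A z) :
    ContDiffAt ℝ ∞ (fun w => (A w).det) z := by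
  simp only [det_apply']
  exact ContDiffAt.sum fun σ _ => contDiffAt_const.mul (contDiffAt_prod fun i _ => hA _ _)

theorem SmoothM.adjugate {A : E → Matrix (Fin n) (Fin n) ℂ} (hA : SmoothM A z) :
    SmoothM (fun w => (A w).adjugate) z := by
  intro i j
  simp only [adjugate_apply]
  refine SmoothM.det fun k l => ?_
  by_cases hk : k = j
  · subst hk
    simp only [updateRow_self]
    exact contDiffAt_const
  · simp only [updateRow_ne hk]
    exact hA k l

theorem SmoothM.inv {A : E → Matrix (Fin n) (Fin n) ℂ} (hA : SmoothM A z)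
    (h0 : (A z).det ≠ 0) : SmoothM (fun w => (A w)⁻¹) z := by
  intro i j
  simp only [inv_def, Matrix.smul_apply, Ring.inverse_eq_inv', smul_eq_mul]
  exact (hA.det.inv h0).mul (hA.adjugate i j)

theorem SmoothM.mul {A B : E → Matrix (Fin n) (Fin n) ℂ} (hA : SmoothM A z) (hB : SmoothM B z) :
    SmoothM (fun w => A w * B w) z := fun i j => by
  simp only [Matrix.mul_apply]
  exact ContDiffAt.sum fun k _ => (hA i k).mul (hB k j)

theorem SmoothM.add {A B : E → Matrix (Fin n) (Fin n) ℂ} (hA : SmoothM A z) (hB : SmoothM B z) :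
    SmoothM (fun w => A w + B w) z := fun i j => (hA i j).add (hB i j)

theorem SmoothM.smul {A : E → Matrix (Fin n) (Fin n) ℂ} (c : ℂ) (hA : SmoothM A z) :
    SmoothM (fun w => c • A w) z := fun i j => contDiffAt_const.mul (hA i j)

theorem SmoothM.mulVec {A : E → Matrix (Fin n) (Fin n) ℂ} {v : E → Fin n → ℂ} (hA : SmoothM A z)
    (hv : ∀ i, ContDiffAt ℝ ∞ (fun w => v w i) z) (i : Fin n) :
    ContDiffAt ℝ ∞ (fun w => (A w *ᵥ v w) i) z := by
  simp only [Matrix.mulVec, dotProduct]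
  exact ContDiffAt.sum fun k _ => (hA i k).mul (hv k)

end MatrixCalculus

/-! ### The induced metric -/

section LinearAlgebra

open Matrix

variable {n : ℕ} {G F : Matrix (Fin n) (Fin n) ℂ}

theorem det_ne_zero_of_posDef (hG : G.PosDef) : G.det ≠ 0 := hG.det_pos.ne'

theorem isUnit_det_of_posDef (hG : G.PosDef) : IsUnit G.det := hG.det_pos.ne'.isUnit

/-- As F is Hermitian, the added term F g⁻¹ F equals F g⁻¹ F* and is positive semidefinite. -/
theorem etaMat_posDef (hG : G.PosDef) (hF : F.IsHermitian) : (etaMat G F).PosDef := by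
  refine hG.add_posSemidef ?_
  have := hG.inv.posSemidef.mul_mul_conjTranspose_same F
  rwa [hF.eq] at this

/-- The mixed terms cancel. This factorization links η to ζ: it shows that g ± √-1F are invertible
and expresses η⁻¹ by their inverses. -/
theorem plus_mul_minus (hG : G.PosDef) :
    (G + Complex.I • F) * G⁻¹ * (G - Complex.I • F) = etaMat G F := by
  have h := isUnit_det_of_posDef hG
  rw [etaMat, add_mul, Matrix.mul_nonsing_inv _ h, add_mul, mul_sub, one_mul,
    Matrix.smul_mul, Matrix.smul_mul, one_mul, mul_sub, Matrix.mul_smul,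
    Matrix.nonsing_inv_mul_cancel_right _ _ h, smul_sub, smul_smul, Complex.I_mul_I]
  module

theorem minus_mul_plus (hG : G.PosDef) :
    (G - Complex.I • F) * G⁻¹ * (G + Complex.I • F) = etaMat G F := by
  have h := isUnit_det_of_posDef hG
  rw [etaMat, sub_mul, Matrix.mul_nonsing_inv _ h, sub_mul, mul_add, one_mul,
    Matrix.smul_mul, Matrix.smul_mul, one_mul, mul_add, Matrix.mul_smul,
    Matrix.nonsing_inv_mul_cancel_right _ _ h, smul_add, smul_smul, Complex.I_mul_I]
  module

theorem det_plus_ne_zero (hG : G.PosDef) (hF : F.IsHermitian) :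
    (G + Complex.I • F).det ≠ 0 := by
  intro h
  have h1 := congrArg Matrix.det (plus_mul_minus (F := F) hG)
  rw [det_mul, det_mul, h, zero_mul, zero_mul] at h1
  exact det_ne_zero_of_posDef (etaMat_posDef hG hF) h1.symm

theorem det_minus_ne_zero (hG : G.PosDef) (hF : F.IsHermitian) :
    (G - Complex.I • F).det ≠ 0 := by
  intro h
  have h1 := congrArg Matrix.det (plus_mul_minus (F := F) hG)
  rw [det_mul, h, mul_zero] at h1
  exact det_ne_zero_of_posDef (etaMat_posDef hG hF) h1.symm

/-- Partial fractions: P⁻¹ + Q⁻¹ = P⁻¹(P + Q)Q⁻¹ with P + Q = 2g, and P⁻¹gQ⁻¹ = η⁻¹ by the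
factorization of η. -/
theorem inv_plus_add_inv_minus (hG : G.PosDef) (hF : F.IsHermitian) :
    (G + Complex.I • F)⁻¹ + (G - Complex.I • F)⁻¹ = (2 : ℂ) • (etaMat G F)⁻¹ := by
  have hp : IsUnit (G + Complex.I • F).det := (det_plus_ne_zero hG hF).isUnit
  have hq : IsUnit (G - Complex.I • F).det := (det_minus_ne_zero hG hF).isUnit
  have hg := isUnit_det_of_posDef hG
  have he : (etaMat G F)⁻¹ = (G + Complex.I • F)⁻¹ * G * (G - Complex.I • F)⁻¹ := by
    rw [← minus_mul_plus hG, Matrix.mul_inv_rev, Matrix.mul_inv_rev,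
      Matrix.nonsing_inv_nonsing_inv _ hg, mul_assoc]
  rw [he]
  have : (2 : ℂ) • G = (G - Complex.I • F) + (G + Complex.I • F) := by module
  rw [← Matrix.smul_mul, ← Matrix.mul_smul, this, mul_add, add_mul,
    Matrix.mul_nonsing_inv_cancel_right _ _ hq, Matrix.nonsing_inv_mul _ hp, one_mul]

/-- Partial fractions again: P⁻¹ - Q⁻¹ = P⁻¹(Q - P)Q⁻¹ with Q - P = -2√-1F, followed by a
rearrangement that brings out η⁻¹. -/
theorem inv_plus_sub_inv_minus (hG : G.PosDef) (hF : F.IsHermitian) :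
    (G + Complex.I • F)⁻¹ - (G - Complex.I • F)⁻¹ =
      (-(2 * Complex.I)) • ((etaMat G F)⁻¹ * F * G⁻¹) := by
  have hp : IsUnit (G + Complex.I • F).det := (det_plus_ne_zero hG hF).isUnit
  have hq : IsUnit (G - Complex.I • F).det := (det_minus_ne_zero hG hF).isUnit
  have hg := isUnit_det_of_posDef hG
  have he : (etaMat G F)⁻¹ = (G + Complex.I • F)⁻¹ * G * (G - Complex.I • F)⁻¹ := by
    rw [← minus_mul_plus hG, Matrix.mul_inv_rev, Matrix.mul_inv_rev,
      Matrix.nonsing_inv_nonsing_inv _ hg, mul_assoc]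
  -- Both sides come from Fg⁻¹(g - √-1F) = F - √-1Fg⁻¹F = (g - √-1F)g⁻¹F, multiplied by the inverse
  -- of g - √-1F on both sides.
  have hc : (G - Complex.I • F)⁻¹ * F * G⁻¹ = G⁻¹ * F * (G - Complex.I • F)⁻¹ := by
    have h1 : F * G⁻¹ * (G - Complex.I • F) = (G - Complex.I • F) * G⁻¹ * F := by
      rw [mul_sub, sub_mul, sub_mul, Matrix.nonsing_inv_mul_cancel_right _ _ hg,
        Matrix.mul_nonsing_inv _ hg, one_mul, Matrix.mul_smul, Matrix.smul_mul, Matrix.smul_mul]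
    calc _ = (G - Complex.I • F)⁻¹ * (F * G⁻¹ * (G - Complex.I • F)) * (G - Complex.I • F)⁻¹ := by
          rw [mul_assoc (_)⁻¹ (F * G⁻¹ * _), Matrix.mul_nonsing_inv_cancel_right _ _ hq, mul_assoc]
      _ = _ := by
          rw [h1, mul_assoc (G - Complex.I • F), Matrix.nonsing_inv_mul_cancel_left _ _ hq]
  have h2 : (etaMat G F)⁻¹ * F * G⁻¹ = (G + Complex.I • F)⁻¹ * F * (G - Complex.I • F)⁻¹ := by
    rw [he, mul_assoc, mul_assoc, ← mul_assoc _ F, hc, mul_assoc, mul_assoc,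
      Matrix.mul_nonsing_inv_cancel_left _ _ hg, ← mul_assoc]
  have : (-(2 * Complex.I)) • F = (G - Complex.I • F) - (G + Complex.I • F) := by module
  rw [h2, ← Matrix.smul_mul, ← Matrix.mul_smul, this, mul_sub, sub_mul,
    Matrix.mul_nonsing_inv_cancel_right _ _ hq, Matrix.nonsing_inv_mul _ hp, one_mul]

theorem star_det_plus (hG : G.PosDef) (hF : F.IsHermitian) :
    conj (G + Complex.I • F).det = (G - Complex.I • F).det := by
  have := det_conjTranspose (G + Complex.I • F)
  rw [conjTranspose_add, conjTranspose_smul, hG.isHermitian.eq, hF.eq] at this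
  rw [starRingEnd_apply, ← this]
  simp [sub_eq_add_neg]

/-- The density of dμ(h) in a chart is v det g, and the determinant of g in the denominator of ζ
cancels. -/
theorem norm_zetaLoc_mul_det (hG : G.PosDef) :
    ‖zetaLoc G F‖ * G.det.re = ‖(G + Complex.I • F).det‖ := by
  have h1 := hG.det_pos
  have h2 : ‖G.det‖ = G.det.re := by
    exact_mod_cast Complex.norm_of_nonneg' h1.le |>.trans (Complex.eq_re_of_ofReal_le h1.le)
  rw [zetaLoc_eq _ _ (det_ne_zero_of_posDef hG), norm_div, h2, div_mul_cancel₀]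
  rw [← h2]
  exact norm_ne_zero_iff.2 h1.ne'

/-- The projection to `Th` in components. -/
theorem assocLoc_eq (hG : G.PosDef) (hF : F.IsHermitian) (y : Fib n) :
    assocLoc G F y = (etaMat G F)⁻¹ *ᵥ (G *ᵥ y.1 + (F * G⁻¹) *ᵥ y.2) := by
  have hη := isUnit_det_of_posDef (etaMat_posDef hG hF)
  have hg := isUnit_det_of_posDef hG
  -- The span of the ℰ_i is the graph of F. Orthogonality to it thereby becomes one linear equation
  -- for the first component.
  have hmem : ∀ t : Fib n, t ∈ tangentFib F ↔ t.2 = F *ᵥ t.1 := by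
    intro t
    constructor
    · intro h
      induction h using Submodule.span_induction with
      | mem x hx =>
        obtain ⟨i, rfl⟩ := hx
        ext j
        simp [frameE]
      | zero => simp
      | add x y _ _ hx hy => simp [hx, hy, mulVec_add]
      | smul c x _ hx => simp [hx, mulVec_smul]
    · intro h
      have : t = ∑ i, t.1 i • frameE F i := by
        refine Prod.ext ?_ ?_
        · ext j
          simp [frameE, Prod.fst_sum, Finset.sum_apply, Pi.single_apply]
        · ext j
          simp [frameE, Prod.snd_sum, Finset.sum_apply, h, mulVec, dotProduct, mul_comm]
      rw [this]
      exact Submodule.sum_mem _ fun i _ => Submodule.smul_mem _ _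
        (Submodule.subset_span ⟨i, rfl⟩)
  have hpair : ∀ w y : Fib n, w.2 = F *ᵥ w.1 →
      pairing G w y = star w.1 ⬝ᵥ (G *ᵥ y.1 + (F * G⁻¹) *ᵥ y.2) := by
    intro w y hw
    have e : star w.1 ⬝ᵥ ((F * G⁻¹) *ᵥ y.2) = star w.2 ⬝ᵥ (G⁻¹ *ᵥ y.2) := by
      rw [hw, star_mulVec, hF.eq, ← dotProduct_mulVec, mulVec_mulVec]
    rw [dotProduct_add, e, pairing]
    congr 1 <;>
    · simp only [dotProduct, mulVec, Finset.mul_sum]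
      refine Finset.sum_congr rfl fun j _ => Finset.sum_congr rfl fun k _ => ?_
      simp only [Pi.star_apply, RCLike.star_def]
      ring
  have hE : ∀ v : Fin n → ℂ, G *ᵥ v + (F * G⁻¹) *ᵥ (F *ᵥ v) = etaMat G F *ᵥ v := by
    intro v
    rw [mulVec_mulVec, ← add_mulVec, etaMat]
  set V := (etaMat G F)⁻¹ *ᵥ (G *ᵥ y.1 + (F * G⁻¹) *ᵥ y.2) with hV
  have hηV : etaMat G F *ᵥ V = G *ᵥ y.1 + (F * G⁻¹) *ᵥ y.2 := by
    rw [hV, mulVec_mulVec, Matrix.mul_nonsing_inv _ hη, one_mulVec]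
  have hex : ∃ t, t ∈ tangentFib F ∧ ∀ w ∈ tangentFib F, pairing G w (y - t) = 0 := by
    refine ⟨(V, F *ᵥ V), (hmem _).2 rfl, fun w hw => ?_⟩
    rw [hpair _ _ ((hmem w).1 hw)]
    simp only [Prod.fst_sub, Prod.snd_sub, mulVec_sub]
    rw [sub_add_sub_comm, hE, hηV, sub_self, dotProduct_zero]
  obtain ⟨h1, h2⟩ := Classical.epsilon_spec hex
  change tangentialPart G F y ∈ _ at h1
  change ∀ w ∈ tangentFib F, pairing G w (y - tangentialPart G F y) = 0 at h2
  set t := tangentialPart G F y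
  -- The chosen `t` need not be the one exhibited above. Testing its orthogonality on the graph
  -- element over the defect `u` itself gives u*u = 0, so it solves the same equation.
  have h3 : G *ᵥ y.1 + (F * G⁻¹) *ᵥ y.2 - etaMat G F *ᵥ t.1 = 0 := by
    rw [← dotProduct_star_self_eq_zero]
    set u := G *ᵥ y.1 + (F * G⁻¹) *ᵥ y.2 - etaMat G F *ᵥ t.1 with hu
    have := h2 (u, F *ᵥ u) ((hmem _).2 rfl)
    rw [hpair _ _ rfl] at this
    simp only [Prod.fst_sub, Prod.snd_sub, mulVec_sub] at this
    rw [sub_add_sub_comm, (hmem t).1 h1, hE, ← hu] at this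
    exact this
  change t.1 = V
  rw [hV, sub_eq_zero.1 h3, mulVec_mulVec, Matrix.nonsing_inv_mul _ hη, one_mulVec]

end LinearAlgebra

/-! ### The angle -/

section Angle

open Matrix

variable {n : ℕ} {G F : Matrix (Fin n) (Fin n) ℂ}

theorem exists_fin_map_eq {α : Type*} (s : Multiset α) {m : ℕ} (h : Multiset.card s = m) :
    ∃ f : Fin m → α, s = Finset.univ.val.map f := by
  subst h
  induction s using Quotient.inductionOn with
  | h l => exact ⟨l.get, ((Fin.univ_val_map l.get).trans (congrArg _ (List.ofFn_get l))).symm⟩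

/-- An eigenvector satisfies Fu = l·gu. Here u*Fu is real and u*gu is positive, so l is real. -/
theorem eigenvalue_im_eq_zero (hG : G.PosDef) (hF : F.IsHermitian) {l : ℂ}
    (hl : l ∈ (G⁻¹ * F).charpoly.roots) : l.im = 0 := by
  have h0 : ((scalar (Fin n)) l - G⁻¹ * F).det = 0 := by
    rw [← eval_charpoly]
    exact Polynomial.isRoot_of_mem_roots hl
  obtain ⟨u, hu, hu2⟩ := exists_mulVec_eq_zero_iff.2 h0
  have hg := isUnit_det_of_posDef hG
  have h1 : F *ᵥ u = l • (G *ᵥ u) := by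
    have h2 : (G⁻¹ * F) *ᵥ u = l • u := by
      rw [sub_mulVec, sub_eq_zero] at hu2
      rw [← hu2]
      simp
    rw [← mulVec_smul, ← h2, mulVec_mulVec, Matrix.mul_nonsing_inv_cancel_left _ _ hg]
  have hGu := hG.dotProduct_mulVec_pos hu
  have hFu : (star u ⬝ᵥ (F *ᵥ u)).im = 0 := hF.im_star_dotProduct_mulVec_self u
  rw [h1, dotProduct_smul, smul_eq_mul, Complex.mul_im] at hFu
  have hre : 0 < (star u ⬝ᵥ (G *ᵥ u)).re := (Complex.pos_iff.1 hGu).1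
  have him : (star u ⬝ᵥ (G *ᵥ u)).im = 0 := (Complex.pos_iff.1 hGu).2.symm
  rw [him, mul_zero, zero_add] at hFu
  exact (mul_eq_zero.1 hFu).resolve_right hre.ne'

/-- One enumeration of the eigenvalues serves both clauses. The values s = ±1 give det(g ± √-1F)/det
g; the other s are needed for the path from 1 to 1 + √-1g⁻¹F. -/
theorem exists_eigenvalues (hG : G.PosDef) (hF : F.IsHermitian) :
    ∃ l : Fin n → ℝ, thetaLoc G F = ∑ i, Real.arctan (l i) ∧
      ∀ s : ℝ, (1 + (Complex.I * s) • (G⁻¹ * F)).det = ∏ i, (1 + Complex.I * s * l i) := by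
  set M := G⁻¹ * F with hM
  have hcard : Multiset.card M.charpoly.roots = n := by
    rw [← (IsAlgClosed.splits M.charpoly).natDegree_eq_card_roots, charpoly_natDegree_eq_dim,
      Fintype.card_fin]
  obtain ⟨f, hf⟩ := exists_fin_map_eq M.charpoly.roots hcard
  have hre : ∀ i, ((f i).re : ℂ) = f i := by
    intro i
    have : f i ∈ M.charpoly.roots := by rw [hf]; exact Multiset.mem_map_of_mem _ (Finset.mem_univ i)
    exact Complex.ext rfl (by simpa using (eigenvalue_im_eq_zero hG hF this).symm)
  refine ⟨fun i => (f i).re, ?_, fun s => ?_⟩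
  · rw [thetaLoc, ← hM, hf, Multiset.map_map]; rfl
  · simp only [hre]
    rcases eq_or_ne s 0 with rfl | hs
    · simp
    have hs' : (s : ℂ) ≠ 0 := by exact_mod_cast hs
    have h1 : ∀ t : ℂ, (scalar (Fin n) t - M).det = ∏ i, (t - f i) := by
      intro t
      have h2 := (IsAlgClosed.splits M.charpoly).eq_prod_roots_of_monic M.charpoly_monic
      rw [← eval_charpoly, h2, hf, Multiset.map_map, Polynomial.eval_multiset_prod,
        Multiset.map_map]
      simp [Finset.prod]
    -- This writes the determinant as the characteristic polynomial at √-1/s, which is why s = 0 was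
    -- treated apart.
    have h3 : 1 + (Complex.I * s) • M = (-(Complex.I * s)) • (scalar (Fin n) (Complex.I / s) - M) := by
      have : (scalar (Fin n) (Complex.I / s) : Matrix (Fin n) (Fin n) ℂ) = (Complex.I / s) • 1 := by
        rw [smul_one_eq_diagonal]; rfl
      rw [this, smul_sub, smul_smul]
      have : -(Complex.I * s) * (Complex.I / s) = 1 := by
        field_simp
        simp
      rw [this]
      module
    rw [h3, det_smul, h1, Fintype.card_fin]
    have : (-(Complex.I * s)) ^ n = ∏ _i : Fin n, (-(Complex.I * s)) := by simp
    rw [this, ← Finset.prod_mul_distrib]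
    refine Finset.prod_congr rfl fun i _ => ?_
    field_simp
    linear_combination (-1 : ℂ) * Complex.I_mul_I

theorem one_add_I_mul_ne_zero (x : ℝ) : (1 + Complex.I * x : ℂ) ≠ 0 := by
  intro h
  have := congrArg Complex.re h
  simp at this

/-- Polar form: 1 + √-1x = √(1 + x²) exp(√-1 arctan x), compared with its conjugate. -/
theorem exp_two_arctan (x : ℝ) :
    Complex.exp (2 * Complex.I * (Real.arctan x : ℝ)) * (1 - Complex.I * x) = 1 + Complex.I * x := by
  have h : Complex.exp ((Real.arctan x : ℝ) * Complex.I) * (Real.sqrt (1 + x ^ 2) : ℝ) =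
      1 + Complex.I * x := by
    have hs : (Real.sqrt (1 + x ^ 2)) ≠ 0 := (Real.sqrt_pos.2 (by positivity)).ne'
    rw [Complex.exp_mul_I, ← Complex.ofReal_cos, ← Complex.ofReal_sin, Real.cos_arctan,
      Real.sin_arctan]
    have hs' : ((Real.sqrt (1 + x ^ 2) : ℝ) : ℂ) ≠ 0 := by exact_mod_cast hs
    push_cast
    field_simp
  have h2 : Complex.exp (-((Real.arctan x : ℝ) * Complex.I)) * (Real.sqrt (1 + x ^ 2) : ℝ) =
      1 - Complex.I * x := by
    have := congrArg conj h
    simpa only [map_mul, ← Complex.exp_conj, Complex.conj_ofReal, Complex.conj_I, map_add,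
      map_one, mul_neg, neg_mul, ← sub_eq_add_neg] using this
  rw [← h2, ← h, ← mul_assoc, ← Complex.exp_add]
  congr 2
  ring

/-- Product of the scalar identity over the eigenvalues. It determines θ only modulo π; continuity
of θ supplies the rest. -/
theorem exp_theta_mul (hG : G.PosDef) (hF : F.IsHermitian) :
    Complex.exp (2 * Complex.I * (thetaLoc G F : ℝ)) * (G - Complex.I • F).det =
      (G + Complex.I • F).det := by
  obtain ⟨l, hl, hd⟩ := exists_eigenvalues hG hF
  have hg := isUnit_det_of_posDef hG
  have hp : (G + Complex.I • F).det = G.det * ∏ i, (1 + Complex.I * l i) := by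
    have h1 := hd 1
    simp only [Complex.ofReal_one, mul_one] at h1
    rw [← h1, ← det_mul, mul_add, mul_one, Matrix.mul_smul, Matrix.mul_nonsing_inv_cancel_left _ _ hg]
  have hq : (G - Complex.I • F).det = G.det * ∏ i, (1 - Complex.I * l i) := by
    have h1 := hd (-1)
    simp only [Complex.ofReal_neg, Complex.ofReal_one, mul_neg, mul_one, neg_mul,
      ← sub_eq_add_neg] at h1
    rw [← h1, ← det_mul, neg_smul, ← sub_eq_add_neg, mul_sub, mul_one, Matrix.mul_smul,
      Matrix.mul_nonsing_inv_cancel_left _ _ hg]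
  rw [hp, hq, hl, Complex.ofReal_sum, Finset.mul_sum, Complex.exp_sum, mul_left_comm,
    ← Finset.prod_mul_distrib]
  congr 1
  exact Finset.prod_congr rfl fun i _ => exp_two_arctan (l i)

theorem det_one_add_ne_zero (hG : G.PosDef) (hF : F.IsHermitian) (s : ℝ) :
    (1 + (Complex.I * s) • (G⁻¹ * F)).det ≠ 0 := by
  obtain ⟨l, -, hd⟩ := exists_eigenvalues hG hF
  rw [hd]
  refine Finset.prod_ne_zero_iff.2 fun i _ => ?_
  have := one_add_I_mul_ne_zero (s * l i)
  rwa [Complex.ofReal_mul, ← mul_assoc] at this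

/-- The angle as an integral over a path of matrices. -/
theorem thetaLoc_eq_integral (hG : G.PosDef) (hF : F.IsHermitian) :
    thetaLoc G F = ∫ s in (0 : ℝ)..1,
      ((1 + (Complex.I * s) • (G⁻¹ * F))⁻¹ * (G⁻¹ * F)).trace.re := by
  obtain ⟨l, hl, hd⟩ := exists_eigenvalues hG hF
  set M := G⁻¹ * F with hM
  have hne : ∀ (s : ℝ) i, (1 + Complex.I * s * l i : ℂ) ≠ 0 := fun s i => by
    have := one_add_I_mul_ne_zero (s * l i)
    rwa [Complex.ofReal_mul, ← mul_assoc] at this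
  -- The derivative of det(1 + √-1sM) in s is computed twice, by Jacobi's formula and from the
  -- product over the eigenvalues. The real part of l/(1 + √-1sl) is the derivative of arctan(sl).
  have hint : ∀ s : ℝ, ((1 + (Complex.I * s) • M)⁻¹ * M).trace.re =
      ∑ i, l i / (1 + (s * l i) ^ 2) := by
    intro s
    have hB : ∀ i j, HasFDerivAt (fun s : ℝ => (1 + (Complex.I * s) • M) i j)
        ((Complex.I * M i j) • Complex.ofRealCLM) s := by
      intro i j
      have h1 : HasFDerivAt (fun s : ℝ => (s : ℂ)) Complex.ofRealCLM s := Complex.ofRealCLM.hasFDerivAt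
      have h2 := (h1.const_mul (Complex.I * M i j)).const_add ((1 : Matrix (Fin n) (Fin n) ℂ) i j)
      refine h2.congr_of_eventuallyEq (Filter.Eventually.of_forall fun t => ?_)
      simp only [Matrix.add_apply, Matrix.smul_apply, smul_eq_mul]
      ring
    have h1 := (hasFDerivAt_det hB).hasDerivAt
    have h2 : HasDerivAt (fun s : ℝ => (1 + (Complex.I * s) • M).det)
        (∑ i, (∏ j ∈ Finset.univ.erase i, (1 + Complex.I * s * l j)) • (Complex.I * l i)) s := by
      have : (fun s : ℝ => (1 + (Complex.I * s) • M).det) =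
          fun s : ℝ => ∏ i, (1 + Complex.I * s * l i) := funext hd
      rw [this]
      refine HasDerivAt.fun_finsetProd fun i _ => ?_
      have h1 : HasDerivAt (fun s : ℝ => (s : ℂ)) 1 s := Complex.ofRealCLM.hasDerivAt
      have h2 := (h1.const_mul (Complex.I * l i)).const_add 1
      rw [mul_one] at h2
      refine h2.congr_of_eventuallyEq (Filter.Eventually.of_forall fun t => ?_)
      ring
    have h3 := h1.unique h2
    have h4 : (Complex.I * ((1 + (Complex.I * s) • M)⁻¹ * M).trace) *
        (1 + (Complex.I * s) • M).det =
        (∑ i, (Complex.I * l i) / (1 + Complex.I * s * l i)) * (1 + (Complex.I * s) • M).det := by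
      calc _ = (∑ i, ∑ j, (1 + (Complex.I * s) • M).adjugate j i •
              (Complex.I * M i j) • Complex.ofRealCLM) (1 : ℝ) := by
            simp only [trace, diag_apply, Matrix.mul_apply, inv_def, Matrix.smul_apply,
              Ring.inverse_eq_inv', smul_eq_mul, Finset.mul_sum, Finset.sum_mul,
              _root_.sum_apply, _root_.smul_apply, Complex.ofRealCLM_apply]
            rw [Finset.sum_comm]
            refine Finset.sum_congr rfl fun i _ => Finset.sum_congr rfl fun j _ => ?_
            have := det_one_add_ne_zero hG hF s
            rw [← hM] at this
            field_simp
            simp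
        _ = _ := by
            rw [h3, Finset.sum_mul]
            refine Finset.sum_congr rfl fun i _ => ?_
            rw [hd, ← Finset.mul_prod_erase _ _ (Finset.mem_univ i), smul_eq_mul]
            field_simp [hne s i]
    have h5 := mul_right_cancel₀ (det_one_add_ne_zero hG hF s) h4
    have h6 : ((1 + (Complex.I * s) • M)⁻¹ * M).trace =
        ∑ i, (l i : ℂ) / (1 + Complex.I * s * l i) := by
      have : ∑ i, (Complex.I * l i) / (1 + Complex.I * s * l i) =
          Complex.I * ∑ i, (l i : ℂ) / (1 + Complex.I * s * l i) := by
        rw [Finset.mul_sum]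
        exact Finset.sum_congr rfl fun i _ => mul_div_assoc _ _ _
      rw [this] at h5
      exact mul_left_cancel₀ Complex.I_ne_zero h5
    rw [h6, Complex.re_sum]
    refine Finset.sum_congr rfl fun i _ => ?_
    rw [Complex.div_re]
    simp [Complex.normSq_apply]
    ring_nf
  rw [hl]
  simp only [hint]
  have hd2 : ∀ s ∈ Set.uIcc (0 : ℝ) 1,
      HasDerivAt (fun s : ℝ => ∑ i, Real.arctan (s * l i)) (∑ i, l i / (1 + (s * l i) ^ 2)) s := by
    intro s _
    refine HasDerivAt.fun_sum fun i _ => ?_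
    have := ((hasDerivAt_id s).mul_const (l i)).arctan
    simpa [div_eq_inv_mul] using this
  rw [intervalIntegral.integral_eq_sub_of_hasDerivAt hd2]
  · simp
  · refine (continuous_finsetSum _ fun i _ => ?_).intervalIntegrable _ _
    exact continuous_const.div (by fun_prop) fun s => by positivity

variable {E : Type*} [NormedAddCommGroup E] [NormedSpace ℝ E]
  {G F : E → Matrix (Fin n) (Fin n) ℂ} {z : E}

/-- In the integral representation no eigenvalue is singled out: the integrand is jointly continuous
in the point and in s, because 1 + √-1s g⁻¹F stays invertible along the whole path. -/
theorem continuousAt_theta (hG : SmoothM G z) (hF : SmoothM F z)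
    (hGp : ∀ᶠ w in nhds z, (G w).PosDef) (hFh : ∀ᶠ w in nhds z, (F w).IsHermitian) :
    ContinuousAt (fun w => thetaLoc (G w) (F w)) z := by
  have hev : ∀ᶠ w in nhds z, (G w).PosDef ∧ (F w).IsHermitian ∧
      ∀ i j, ContinuousAt (fun w => G w i j) w ∧ ContinuousAt (fun w => F w i j) w := by
    filter_upwards [hGp, hFh, Filter.eventually_all.2 fun i => Filter.eventually_all.2 fun j =>
      ((hG i j).of_le (m := 1) (by simp)).eventually (by simp),
      Filter.eventually_all.2 fun i => Filter.eventually_all.2 fun j =>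
      ((hF i j).of_le (m := 1) (by simp)).eventually (by simp)] with w h1 h2 h3 h4
    exact ⟨h1, h2, fun i j => ⟨(h3 i j).continuousAt, (h4 i j).continuousAt⟩⟩
  obtain ⟨O, hO, hOo, hzO⟩ := eventually_nhds_iff.1 hev
  suffices h : ContinuousOn (fun w => thetaLoc (G w) (F w)) O from h.continuousAt (hOo.mem_nhds hzO)
  rw [continuousOn_iff_continuous_domRestrict]
  have hGc : Continuous fun w : O => G w := continuous_matrix fun i j =>
    continuous_iff_continuousAt.2 fun w =>
      ContinuousAt.comp (f := ((↑) : O → E)) (x := w) ((hO w w.2).2.2 i j).1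
        continuous_subtype_val.continuousAt
  have hFc : Continuous fun w : O => F w := continuous_matrix fun i j =>
    continuous_iff_continuousAt.2 fun w =>
      ContinuousAt.comp (f := ((↑) : O → E)) (x := w) ((hO w w.2).2.2 i j).2
        continuous_subtype_val.continuousAt
  have hinv : ∀ {Z : Type _} [TopologicalSpace Z] (A : Z → Matrix (Fin n) (Fin n) ℂ),
      Continuous A → (∀ x, (A x).det ≠ 0) → Continuous fun x => (A x)⁻¹ := by
    intro Z _ A hA h0
    simp only [inv_def, Ring.inverse_eq_inv']
    exact (hA.matrix_det.inv₀ h0).smul hA.matrix_adjugate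
  have hMc : Continuous fun w : O => (G w)⁻¹ * F w :=
    (hinv (fun w : O => G w) hGc fun w => det_ne_zero_of_posDef (hO w w.2).1).matrix_mul hFc
  have he : O.domRestrict (fun w => thetaLoc (G w) (F w)) = fun w : O => ∫ s in (0 : ℝ)..1,
      ((1 + (Complex.I * s) • ((G w)⁻¹ * F w))⁻¹ * ((G w)⁻¹ * F w)).trace.re := by
    ext w
    exact thetaLoc_eq_integral (hO w w.2).1 (hO w w.2).2.1
  rw [he]
  refine intervalIntegral.continuous_parametric_intervalIntegral_of_continuous' ?_ 0 1
  refine Complex.continuous_re.comp (Continuous.matrix_trace (Continuous.matrix_mul ?_ ?_))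
  · refine hinv (fun x : O × ℝ => 1 + (Complex.I * x.2) • ((G x.1)⁻¹ * F x.1)) ?_ ?_
    · refine continuous_const.add (Continuous.smul
        (continuous_const.mul (Complex.continuous_ofReal.comp continuous_snd)) (hMc.comp continuous_fst))
    · exact fun x => det_one_add_ne_zero (hO x.1 x.1.2).1 (hO x.1 x.1.2).2.1 x.2
  · exact hMc.comp continuous_fst

end Angle

/-! ### Derivatives of the angle and of the density -/

section Density

open Matrix

variable {n : ℕ} {E : Type*} [NormedAddCommGroup E] [NormedSpace ℝ E]
  {G F : E → Matrix (Fin n) (Fin n) ℂ} {z : E}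

/-- `G` and `F` are smooth near `z`, `G` is positive definite and `F` Hermitian. -/
structure GoodPair (G F : E → Matrix (Fin n) (Fin n) ℂ) (z : E) : Prop where
  smoothG : SmoothM G z
  smoothF : SmoothM F z
  pos : ∀ᶠ w in nhds z, (G w).PosDef
  herm : ∀ᶠ w in nhds z, (F w).IsHermitian

theorem GoodPair.posDef (h : GoodPair G F z) : (G z).PosDef := h.pos.self_of_nhds

theorem GoodPair.isHermitian (h : GoodPair G F z) : (F z).IsHermitian := h.herm.self_of_nhds

theorem GoodPair.smooth_plus (h : GoodPair G F z) : SmoothM (fun w => G w + Complex.I • F w) z :=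
  h.smoothG.add (h.smoothF.smul _)

theorem GoodPair.smooth_minus (h : GoodPair G F z) :
    SmoothM (fun w => G w - Complex.I • F w) z := by
  have := h.smoothG.add (h.smoothF.smul (-Complex.I))
  simpa [sub_eq_add_neg] using this

theorem GoodPair.cder_plus (h : GoodPair G F z) (T : (E →L[ℝ] ℂ) →ₗ[ℂ] ℂ) :
    cder T (fun w => (G w + Complex.I • F w).det) z = (G z + Complex.I • F z).det *
      ((G z + Complex.I • F z)⁻¹ * (mder T G z + Complex.I • mder T F z)).trace := by
  rw [cder_det T h.smooth_plus.diffM (det_plus_ne_zero h.posDef h.isHermitian),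
    mder_add T h.smoothG.diffM (h.smoothF.diffM.smul _), mder_smul T _ h.smoothF.diffM]

theorem GoodPair.cder_minus (h : GoodPair G F z) (T : (E →L[ℝ] ℂ) →ₗ[ℂ] ℂ) :
    cder T (fun w => (G w - Complex.I • F w).det) z = (G z - Complex.I • F z).det *
      ((G z - Complex.I • F z)⁻¹ * (mder T G z - Complex.I • mder T F z)).trace := by
  rw [cder_det T h.smooth_minus.diffM (det_minus_ne_zero h.posDef h.isHermitian)]
  congr 3
  have := mder_add T h.smoothG.diffM (h.smoothF.diffM.smul (-Complex.I))
  rw [mder_smul T _ h.smoothF.diffM] at this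
  simpa [sub_eq_add_neg] using this

/-- The argument of the logarithm is exp(2√-1(θ(w) - θ(z))). Near z, continuity keeps the exponent
in the strip where the principal logarithm inverts the exponential, so θ is exhibited as a smooth
function. -/
theorem GoodPair.theta_eventuallyEq (h : GoodPair G F z) :
    (fun w => (thetaLoc (G w) (F w) : ℂ)) =ᶠ[nhds z] fun w => (thetaLoc (G z) (F z) : ℂ) +
      (2 * Complex.I)⁻¹ * Complex.log ((G w + Complex.I • F w).det / (G w - Complex.I • F w).det *
        ((G z - Complex.I • F z).det / (G z + Complex.I • F z).det)) := by
  have hc := continuousAt_theta h.smoothG h.smoothF h.pos h.herm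
  -- The bound 1 suffices because twice it is less than π.
  have hev : ∀ᶠ w in nhds z, |thetaLoc (G w) (F w) - thetaLoc (G z) (F z)| < 1 := by
    have := Metric.continuousAt_iff'.1 hc 1 one_pos
    simpa [Real.dist_eq] using this
  filter_upwards [hev, h.pos, h.herm] with w hw h1 h2
  have e1 := exp_theta_mul h1 h2
  have e2 := exp_theta_mul h.posDef h.isHermitian
  have n1 := det_minus_ne_zero h1 h2
  have n2 := det_minus_ne_zero h.posDef h.isHermitian
  have e3 : (G w + Complex.I • F w).det / (G w - Complex.I • F w).det *
        ((G z - Complex.I • F z).det / (G z + Complex.I • F z).det) =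
      Complex.exp (2 * Complex.I * ((thetaLoc (G w) (F w) : ℂ) - thetaLoc (G z) (F z))) := by
    rw [← e1, ← e2, mul_sub, Complex.exp_sub]
    have := Complex.exp_ne_zero (2 * Complex.I * (thetaLoc (G z) (F z) : ℂ))
    field_simp
  have him : (2 * Complex.I * ((thetaLoc (G w) (F w) : ℂ) - thetaLoc (G z) (F z))).im =
      2 * (thetaLoc (G w) (F w) - thetaLoc (G z) (F z)) := by
    simp
  have hpi := Real.pi_gt_three
  rw [abs_lt] at hw
  rw [e3, Complex.log_exp]
  · field_simp
    ring
  · rw [him]; linarith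
  · rw [him]; linarith

theorem GoodPair.smooth_theta (h : GoodPair G F z) :
    ContDiffAt ℝ ∞ (fun w => (thetaLoc (G w) (F w) : ℂ)) z := by
  refine ContDiffAt.congr_of_eventuallyEq ?_ h.theta_eventuallyEq
  have n1 := det_plus_ne_zero h.posDef h.isHermitian
  have n2 := det_minus_ne_zero h.posDef h.isHermitian
  refine contDiffAt_const.add (contDiffAt_const.mul (ContDiffAt.comp z (g := Complex.log) ?_
    (ContDiffAt.mul ?_ contDiffAt_const)))
  rotate_left
  · simp only [div_eq_mul_inv]
    exact h.smooth_plus.det.mul (h.smooth_minus.det.inv n2)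
  refine (Complex.contDiffAt_log ?_).restrict_scalars ℝ
  have : (G z + Complex.I • F z).det / (G z - Complex.I • F z).det *
      ((G z - Complex.I • F z).det / (G z + Complex.I • F z).det) = 1 := by
    field_simp
  rw [this]
  exact Complex.one_mem_slitPlane

theorem hasFDerivAt_log {f : E → ℂ} (hf : DifferentiableAt ℝ f z) (h1 : f z = 1) :
    HasFDerivAt (fun w => Complex.log (f w)) (fderiv ℝ f z) z := by
  have h2 : HasFDerivAt Complex.log ((f z)⁻¹ • (1 : ℂ →L[ℝ] ℂ)) (f z) :=
    (Complex.hasStrictFDerivAt_log_real (by rw [h1]; exact Complex.one_mem_slitPlane)).hasFDerivAt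
  rw [h1, inv_one, one_smul, ← h1] at h2
  have h3 := h2.comp z hf.hasFDerivAt
  rwa [show (1 : ℂ →L[ℝ] ℂ).comp (fderiv ℝ f z) = fderiv ℝ f z from rfl] at h3

theorem cder_log {f : E → ℂ} (T : (E →L[ℝ] ℂ) →ₗ[ℂ] ℂ) (hf : DifferentiableAt ℝ f z)
    (h1 : f z = 1) : cder T (fun w => Complex.log (f w)) z = cder T f z := by
  rw [cder, (hasFDerivAt_log hf h1).fderiv, cder]

/-- With A = ∂g and B = ∂F the left side is the logarithmic derivative of det(g + √-1F) det(g -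
√-1F). -/
theorem trace_inv_mul_add (h : GoodPair G F z) (A B : Matrix (Fin n) (Fin n) ℂ) :
    ((G z + Complex.I • F z)⁻¹ * (A + Complex.I • B)).trace +
      ((G z - Complex.I • F z)⁻¹ * (A - Complex.I • B)).trace =
    2 * (((etaMat (G z) (F z))⁻¹ * A).trace +
      ((etaMat (G z) (F z))⁻¹ * F z * (G z)⁻¹ * B).trace) := by
  have h1 := congrArg (fun M => (M * A).trace) (inv_plus_add_inv_minus h.posDef h.isHermitian)
  have h2 := congrArg (fun M => (M * B).trace) (inv_plus_sub_inv_minus h.posDef h.isHermitian)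
  simp only [add_mul, sub_mul, trace_add, trace_sub, Matrix.smul_mul, trace_smul,
    smul_eq_mul] at h1 h2
  simp only [mul_add, mul_sub, trace_add, trace_sub, Matrix.mul_smul, trace_smul, smul_eq_mul]
  linear_combination h1 + Complex.I * h2 - 2 * ((etaMat (G z) (F z))⁻¹ * F z * (G z)⁻¹ * B).trace *
    Complex.I_mul_I

/-- With A = ∂g and B = ∂F the left side is the logarithmic derivative of det(g + √-1F)/det(g -
√-1F), that is, 2√-1∂θ. -/
theorem trace_inv_mul_sub (h : GoodPair G F z) (A B : Matrix (Fin n) (Fin n) ℂ) :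
    ((G z + Complex.I • F z)⁻¹ * (A + Complex.I • B)).trace -
      ((G z - Complex.I • F z)⁻¹ * (A - Complex.I • B)).trace =
    2 * Complex.I * (((etaMat (G z) (F z))⁻¹ * B).trace -
      ((etaMat (G z) (F z))⁻¹ * F z * (G z)⁻¹ * A).trace) := by
  have h1 := congrArg (fun M => (M * B).trace) (inv_plus_add_inv_minus h.posDef h.isHermitian)
  have h2 := congrArg (fun M => (M * A).trace) (inv_plus_sub_inv_minus h.posDef h.isHermitian)
  simp only [add_mul, sub_mul, trace_add, trace_sub, Matrix.smul_mul, trace_smul,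
    smul_eq_mul] at h1 h2
  simp only [mul_add, mul_sub, trace_add, trace_sub, Matrix.mul_smul, trace_smul, smul_eq_mul]
  linear_combination Complex.I * h1 + h2

/-- The derivative of the angle. -/
theorem GoodPair.cder_theta (h : GoodPair G F z) (T : (E →L[ℝ] ℂ) →ₗ[ℂ] ℂ) :
    cder T (fun w => (thetaLoc (G w) (F w) : ℂ)) z =
      ((etaMat (G z) (F z))⁻¹ * mder T F z).trace -
        ((etaMat (G z) (F z))⁻¹ * F z * (G z)⁻¹ * mder T G z).trace := by
  have n1 := det_plus_ne_zero h.posDef h.isHermitian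
  have n2 := det_minus_ne_zero h.posDef h.isHermitian
  set c := (G z - Complex.I • F z).det / (G z + Complex.I • F z).det with hc
  set p := fun w => (G w + Complex.I • F w).det with hp
  set q := fun w => (G w - Complex.I • F w).det with hq
  have hpd : DifferentiableAt ℝ p z := h.smooth_plus.det.differentiableAt (by simp)
  have hqd : DifferentiableAt ℝ q z := h.smooth_minus.det.differentiableAt (by simp)
  have hpz : p z ≠ 0 := n1
  have hqz : q z ≠ 0 := n2
  have hc0 : c ≠ 0 := div_ne_zero n2 n1
  obtain ⟨R, hRd⟩ : ∃ R : E → ℂ, R = fun w => p w / q w * c := ⟨_, rfl⟩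
  have hR : DifferentiableAt ℝ R z := by
    rw [hRd]
    simpa only [div_eq_mul_inv] using (hpd.fun_mul (hqd.fun_inv n2)).mul_const c
  have hR1 : R z = 1 := by
    simp only [hRd, hp, hq, hc]; field_simp
  have hcq : q z * c⁻¹ = p z := by
    simp only [hp, hq, hc]; field_simp
  have hp' : cder T p z = p z * _ := h.cder_plus T
  have hq' : cder T q z = q z * _ := h.cder_minus T
  -- The quotient is differentiated in product form. As R z = 1, the common factor p z cancels, and
  -- ∂R is the difference of the two logarithmic derivatives.
  have he : p =ᶠ[nhds z] fun w => q w * (c⁻¹ * R w) := by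
    filter_upwards [h.smooth_minus.det.continuousAt.eventually_ne n2] with w hw
    have hw' : q w ≠ 0 := hw
    rw [hRd]
    field_simp
  have hpq := cder_congr T he
  rw [cder_mul T hqd (hR.const_mul _), cder_const_mul T _ hR, hR1, mul_one, ← mul_assoc, hcq,
    hp', hq', mul_left_comm, ← mul_assoc, hcq, ← mul_add] at hpq
  have hkey := mul_left_cancel₀ hpz hpq
  have hev := h.theta_eventuallyEq
  change _ =ᶠ[nhds z] (fun w => (thetaLoc (G z) (F z) : ℂ) +
      (2 * Complex.I)⁻¹ * Complex.log (p w / q w * c)) at hev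
  have hRw : ∀ w, p w / q w * c = R w := fun w => by rw [hRd]
  simp only [hRw] at hev
  have hlog := (hasFDerivAt_log hR hR1).differentiableAt
  rw [cder_congr T hev, cder_add T (differentiableAt_const _) (hlog.const_mul _), cder_const,
    zero_add, cder_const_mul T _ hlog, cder_log T hR hR1, ← sub_eq_of_eq_add hkey,
    trace_inv_mul_sub h]
  have : (2 * Complex.I) ≠ 0 := by simp
  field_simp

/-- The density of `|ζ| ωⁿ / n!`. -/
def densD (G F : Matrix (Fin n) (Fin n) ℂ) : ℝ := ‖(G + Complex.I • F).det‖

theorem densD_pos {G F : Matrix (Fin n) (Fin n) ℂ} (hG : G.PosDef) (hF : F.IsHermitian) :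
    0 < densD G F := norm_pos_iff.2 (det_plus_ne_zero hG hF)

theorem densD_sq {G F : Matrix (Fin n) (Fin n) ℂ} (hG : G.PosDef) (hF : F.IsHermitian) :
    (densD G F : ℂ) * densD G F = (G + Complex.I • F).det * (G - Complex.I • F).det := by
  rw [← star_det_plus hG hF, Complex.mul_conj, densD, Complex.normSq_eq_norm_sq]
  push_cast
  ring

theorem GoodPair.smooth_densD (h : GoodPair G F z) :
    ContDiffAt ℝ ∞ (fun w => (densD (G w) (F w) : ℂ)) z :=
  Complex.ofRealCLM.contDiff.contDiffAt.comp z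
    (h.smooth_plus.det.norm ℝ (det_plus_ne_zero h.posDef h.isHermitian))

/-- The absolute value is avoided by differentiating D² = det(g + √-1F) det(g - √-1F) and dividing
by 2D, which is nonzero. -/
theorem GoodPair.cder_densD (h : GoodPair G F z) (T : (E →L[ℝ] ℂ) →ₗ[ℂ] ℂ) :
    cder T (fun w => (densD (G w) (F w) : ℂ)) z = (densD (G z) (F z) : ℂ) *
      (((etaMat (G z) (F z))⁻¹ * mder T G z).trace +
        ((etaMat (G z) (F z))⁻¹ * F z * (G z)⁻¹ * mder T F z).trace) := by
  have hd : DifferentiableAt ℝ (fun w => (densD (G w) (F w) : ℂ)) z :=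
    h.smooth_densD.differentiableAt (by simp)
  have he : (fun w => (densD (G w) (F w) : ℂ) * densD (G w) (F w)) =ᶠ[nhds z]
      fun w => (G w + Complex.I • F w).det * (G w - Complex.I • F w).det := by
    filter_upwards [h.pos, h.herm] with w h1 h2 using densD_sq h1 h2
  have h1 := cder_congr T he
  rw [cder_mul T hd hd, cder_mul T (h.smooth_plus.det.differentiableAt (by simp))
    (h.smooth_minus.det.differentiableAt (by simp)), h.cder_plus, h.cder_minus] at h1
  have hne : (densD (G z) (F z) : ℂ) ≠ 0 := by
    exact_mod_cast (densD_pos h.posDef h.isHermitian).ne'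
  have h2 := trace_inv_mul_add h (mder T G z) (mder T F z)
  have h3 := densD_sq h.posDef h.isHermitian
  have h4 : (2 * (densD (G z) (F z) : ℂ)) * cder T (fun w => (densD (G w) (F w) : ℂ)) z =
      (2 * (densD (G z) (F z) : ℂ)) * ((densD (G z) (F z) : ℂ) *
      (((etaMat (G z) (F z))⁻¹ * mder T G z).trace +
        ((etaMat (G z) (F z))⁻¹ * F z * (G z)⁻¹ * mder T F z).trace)) := by
    linear_combination h1 + (G z + Complex.I • F z).det * (G z - Complex.I • F z).det * h2 -
      2 * (((etaMat (G z) (F z))⁻¹ * mder T G z).trace +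
        ((etaMat (G z) (F z))⁻¹ * F z * (G z)⁻¹ * mder T F z).trace) * h3
  exact mul_left_cancel₀ (mul_ne_zero two_ne_zero hne) h4

theorem GoodPair.smooth_det_inv (h : GoodPair G F z) :
    ContDiffAt ℝ ∞ (fun w => ((G w).det)⁻¹) z :=
  h.smoothG.det.inv (det_ne_zero_of_posDef h.posDef)

theorem norm_zetaLoc_eq {G F : Matrix (Fin n) (Fin n) ℂ} (hG : G.PosDef) :
    ((‖zetaLoc G F‖ : ℝ) : ℂ) = densD G F * (G.det)⁻¹ := by
  have h0 := det_ne_zero_of_posDef hG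
  have hre : ((G.det.re : ℝ) : ℂ) = G.det :=
    (Complex.eq_re_of_ofReal_le (r := 0) (by simpa using hG.det_pos.le)).symm
  rw [eq_mul_inv_iff_mul_eq₀ h0, ← hre, densD, ← norm_zetaLoc_mul_det hG]
  push_cast
  rfl

theorem GoodPair.smooth_zeta (h : GoodPair G F z) :
    ContDiffAt ℝ ∞ (fun w => ((‖zetaLoc (G w) (F w)‖ : ℝ) : ℂ)) z := by
  refine (h.smooth_densD.mul h.smooth_det_inv).congr_of_eventuallyEq ?_
  filter_upwards [h.pos] with w hw using norm_zetaLoc_eq hw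

end Density

/-! ### The divergence identity in a chart -/

section Pointwise

open Matrix

variable {n : ℕ}

/-- `dWirt` as a complexified direction. -/
def wirtL (j : Fin n) : (Cn n →L[ℝ] ℂ) →ₗ[ℂ] ℂ where
  toFun A := (1 / 2) * (A (Pi.single j 1) - Complex.I * A (Pi.single j Complex.I))
  map_add' A B := by simp only [_root_.add_apply]; ring
  map_smul' c A := by simp only [_root_.smul_apply, smul_eq_mul, RingHom.id_apply]; ring

/-- `dWirtBar` as a complexified direction. -/
def wirtBarL (j : Fin n) : (Cn n →L[ℝ] ℂ) →ₗ[ℂ] ℂ where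
  toFun A := (1 / 2) * (A (Pi.single j 1) + Complex.I * A (Pi.single j Complex.I))
  map_add' A B := by simp only [_root_.add_apply]; ring
  map_smul' c A := by simp only [_root_.smul_apply, smul_eq_mul, RingHom.id_apply]; ring

theorem dWirt_eq_cder (j : Fin n) (f : Cn n → ℂ) (z : Cn n) :
    dWirt j f z = cder (wirtL j) f z := rfl

theorem dWirtBar_eq_cder (j : Fin n) (f : Cn n → ℂ) (z : Cn n) :
    dWirtBar j f z = cder (wirtBarL j) f z := rfl

theorem fderiv_conj_apply {f : Cn n → ℂ} {z : Cn n} (hf : DifferentiableAt ℝ f z) (u : Cn n) :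
    fderiv ℝ (fun w => conj (f w)) z u = conj (fderiv ℝ f z u) := by
  have h := Complex.conjCLE.toContinuousLinearMap.hasFDerivAt.comp z hf.hasFDerivAt
  have h2 : HasFDerivAt (fun w => conj (f w)) _ z := h
  rw [h2.fderiv]
  rfl

theorem conj_dWirtBar {f : Cn n → ℂ} {z : Cn n} (hf : DifferentiableAt ℝ f z) (j : Fin n) :
    conj (dWirtBar j f z) = dWirt j (fun w => conj (f w)) z := by
  rw [dWirtBar, dWirt, fderiv_conj_apply hf, fderiv_conj_apply hf]
  have h2 : conj (2 : ℂ) = 2 := map_ofNat _ 2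
  simp [sub_eq_add_neg, h2]

theorem conj_dWirt {f : Cn n → ℂ} {z : Cn n} (hf : DifferentiableAt ℝ f z) (j : Fin n) :
    conj (dWirt j f z) = dWirtBar j (fun w => conj (f w)) z := by
  rw [dWirtBar, dWirt, fderiv_conj_apply hf, fderiv_conj_apply hf]
  have h2 : conj (2 : ℂ) = 2 := map_ofNat _ 2
  simp [sub_eq_add_neg, h2]

theorem pairing_eq (G : Matrix (Fin n) (Fin n) ℂ) (y z : Fib n) :
    pairing G y z = star y.1 ⬝ᵥ (G *ᵥ z.1) + star y.2 ⬝ᵥ (G⁻¹ *ᵥ z.2) := by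
  rw [pairing]
  congr 1 <;>
  · simp only [dotProduct, mulVec, Finset.mul_sum]
    refine Finset.sum_congr rfl fun j _ => Finset.sum_congr rfl fun k _ => ?_
    simp only [Pi.star_apply, RCLike.star_def]
    ring

variable {G F : Cn n → Matrix (Fin n) (Fin n) ℂ} {z : Cn n}

theorem meanCurvLoc_fst (G F : Cn n → Matrix (Fin n) (Fin n) ℂ) (z : Cn n) :
    (meanCurvLoc G F z).1 =
      -(((G z)⁻¹ * F z * (etaMat (G z) (F z))⁻¹) *ᵥ fun p => meanCurvBar G F p z) := by
  funext q
  simp only [Pi.neg_apply, mulVec, dotProduct, Matrix.mul_apply, Finset.sum_mul]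
  refine congrArg Neg.neg (Finset.sum_comm.trans (Finset.sum_congr rfl fun p _ =>
    Finset.sum_comm.trans (Finset.sum_congr rfl fun l _ => Finset.sum_congr rfl fun k _ => ?_)))
  ring

theorem meanCurvLoc_snd (G F : Cn n → Matrix (Fin n) (Fin n) ℂ) (z : Cn n) :
    (meanCurvLoc G F z).2 =
      (G z * (etaMat (G z) (F z))⁻¹) *ᵥ fun p => meanCurvBar G F p z := by
  ext q
  simp only [meanCurvLoc, mulVec, dotProduct, Matrix.mul_apply, Finset.sum_mul]
  refine Finset.sum_comm.trans
    (Finset.sum_congr rfl fun l _ => Finset.sum_congr rfl fun k _ => ?_)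
  ring

/-- The factors g and g⁻¹ in the mean curvature section cancel those of the metric, and since θ is
real, conjugation turns its ∂̄ derivative into ∂θ. The vector left over is the b met again in the
divergence of the associated field. -/
theorem pairing_meanCurvLoc (h : GoodPair G F z) (y : Fib n) :
    pairing (G z) (meanCurvLoc G F z) y =
      ∑ p, dWirt p (fun w => (thetaLoc (G w) (F w) : ℂ)) z *
        ((etaMat (G z) (F z))⁻¹ *ᵥ (y.2 - F z *ᵥ y.1)) p := by
  have hg := isUnit_det_of_posDef h.posDef
  have hηh := (etaMat_posDef h.posDef h.isHermitian).isHermitian.inv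
  have hstar : star (fun p => meanCurvBar G F p z) =
      fun p => dWirt p (fun w => (thetaLoc (G w) (F w) : ℂ)) z := by
    ext p
    have := conj_dWirtBar (h.smooth_theta.differentiableAt (by simp)) p
    simp only [Complex.conj_ofReal] at this
    exact this
  rw [pairing_eq, meanCurvLoc_fst, meanCurvLoc_snd, star_neg, star_mulVec, star_mulVec, hstar,
    conjTranspose_mul, conjTranspose_mul, conjTranspose_mul, hηh.eq, h.isHermitian.eq,
    h.posDef.isHermitian.eq, h.posDef.isHermitian.inv.eq, neg_dotProduct, ← dotProduct_mulVec,
    ← dotProduct_mulVec, mulVec_mulVec, mulVec_mulVec, mul_assoc, mul_assoc, mul_assoc,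
    Matrix.nonsing_inv_mul _ hg, Matrix.mul_nonsing_inv _ hg, mul_one, mul_one, mulVec_sub,
    mulVec_mulVec]
  simp only [dotProduct, Pi.sub_apply, mul_sub, Finset.sum_sub_distrib]
  ring

/-- Since Γ_i = g⁻¹∂_i g, lowering the index with g absorbs the Christoffel symbols: g∇_iY₁ =
∂_i(gY₁). -/
theorem divHLoc_eq (hG : (G z).det ≠ 0) (Y : Cn n → Fib n) :
    divHLoc G F Y z = ∑ i, ((etaMat (G z) (F z))⁻¹ *ᵥ (mder (wirtL i) G z *ᵥ (Y z).1 +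
      G z *ᵥ vder (wirtL i) (fun w => (Y w).1) z +
      (F z * (G z)⁻¹) *ᵥ vder (wirtL i) (fun w => (Y w).2) z)) i := by
  have hg : IsUnit (G z).det := hG.isUnit
  have hcov : ∀ i, (fun k => covDeriv G (fun w => (Y w).1) i k z) =
      vder (wirtL i) (fun w => (Y w).1) z + ((G z)⁻¹ * mder (wirtL i) G z) *ᵥ (Y z).1 := by
    intro i
    ext k
    rfl
  have h1 : ∀ i, ∑ j, ∑ k, covDeriv G (fun w => (Y w).1) i k z * (etaMat (G z) (F z))⁻¹ i j *
      G z j k = ((etaMat (G z) (F z))⁻¹ *ᵥ (mder (wirtL i) G z *ᵥ (Y z).1 +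
      G z *ᵥ vder (wirtL i) (fun w => (Y w).1) z)) i := by
    intro i
    have : mder (wirtL i) G z *ᵥ (Y z).1 + G z *ᵥ vder (wirtL i) (fun w => (Y w).1) z =
        G z *ᵥ (fun k => covDeriv G (fun w => (Y w).1) i k z) := by
      rw [hcov, mulVec_add, mulVec_mulVec, Matrix.mul_nonsing_inv_cancel_left _ _ hg, add_comm]
    rw [this]
    simp only [mulVec, dotProduct, Finset.mul_sum]
    refine Finset.sum_congr rfl fun j _ => Finset.sum_congr rfl fun k _ => ?_
    ring
  have h2 : ∀ i, ∑ j, ∑ k, ∑ l, dWirt i (fun w => (Y w).2 k) z * (etaMat (G z) (F z))⁻¹ i j *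
      F z j l * (G z)⁻¹ l k = ((etaMat (G z) (F z))⁻¹ *ᵥ
        ((F z * (G z)⁻¹) *ᵥ vder (wirtL i) (fun w => (Y w).2) z)) i := by
    intro i
    simp only [mulVec, dotProduct, Finset.mul_sum, Matrix.mul_apply, Finset.sum_mul]
    refine Finset.sum_congr rfl fun j _ => Finset.sum_congr rfl fun k _ =>
      Finset.sum_congr rfl fun l _ => ?_
    rw [dWirt_eq_cder, vder]
    ring
  simp only [divHLoc, h1, h2]
  rw [← Finset.sum_add_distrib]
  refine Finset.sum_congr rfl fun i _ => ?_
  rw [mulVec_add _ (_ + _), Pi.add_apply]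

/-- The symmetry lets the differentiation index change places with the contracted one, which turns a
divergence into a trace. It is applied with N_i = ∂_i g and ∂_i F, where the symmetry is closedness.
-/
theorem sum_mulVec_of_symm (B : Matrix (Fin n) (Fin n) ℂ) (N : Fin n → Matrix (Fin n) (Fin n) ℂ)
    (hN : ∀ i k l, N i k l = N l k i) (b : Fin n → ℂ) :
    ∑ i, (B *ᵥ (N i *ᵥ b)) i = ∑ l, (B * N l).trace * b l := by
  simp only [mulVec, dotProduct, trace, diag_apply, Matrix.mul_apply, Finset.mul_sum,
    Finset.sum_mul]
  calc _ = ∑ i, ∑ l, ∑ k, B i k * (N i k l * b l) :=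
        Finset.sum_congr rfl fun i _ => Finset.sum_comm
    _ = ∑ l, ∑ i, ∑ k, B i k * (N i k l * b l) := Finset.sum_comm
    _ = _ := by
      refine Finset.sum_congr rfl fun l _ => Finset.sum_congr rfl fun i _ =>
        Finset.sum_congr rfl fun k _ => ?_
      rw [hN i k l]; ring

/-- On a Kähler manifold `∇_i Zⁱ = (det g)⁻¹ ∂_i (det g Zⁱ)`. -/
theorem sum_covDeriv_eq (hGd : DiffM G z) (h0 : (G z).det ≠ 0)
    (hcl : ∀ i j k, dWirt i (fun w => G w k j) z = dWirt j (fun w => G w k i) z)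
    {Z : Cn n → Fin n → ℂ} (hZ : ∀ i, DifferentiableAt ℝ (fun w => Z w i) z) :
    ∑ i, covDeriv G Z i i z =
      ((G z).det)⁻¹ * ∑ i, dWirt i (fun w => (G w).det * Z w i) z := by
  have h1 : ∀ i, dWirt i (fun w => (G w).det * Z w i) z = (G z).det *
      (dWirt i (fun w => Z w i) z + ((G z)⁻¹ * mder (wirtL i) G z).trace * Z z i) := by
    intro i
    rw [dWirt_eq_cder, cder_mul _ (differentiableAt_det hGd) (hZ i), cder_det _ hGd h0,
      dWirt_eq_cder]
    ring
  have h2 := sum_mulVec_of_symm (G z)⁻¹ (fun i => mder (wirtL i) G z)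
    (fun i k l => hcl i l k) (Z z)
  have h3 : ∀ i, ∑ l, christoffel G i i l z * Z z l =
      ((G z)⁻¹ *ᵥ (mder (wirtL i) G z *ᵥ Z z)) i := by
    intro i
    rw [mulVec_mulVec]
    rfl
  simp only [covDeriv, h1, ← Finset.mul_sum]
  rw [inv_mul_cancel_left₀ h0, Finset.sum_add_distrib, Finset.sum_add_distrib, ← h2]
  simp only [h3]

/-- The data of a local computation: smooth closed `G` and `F`, and a smooth section. -/
structure GoodData (G F : Cn n → Matrix (Fin n) (Fin n) ℂ) (Y : Cn n → Fib n) (z : Cn n) : Prop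
    extends GoodPair G F z where
  closedG : ∀ i j k, dWirt i (fun w => G w k j) z = dWirt j (fun w => G w k i) z
  closedF : ∀ i j k, dWirt i (fun w => F w k j) z = dWirt j (fun w => F w k i) z
  smoothY1 : ∀ i, ContDiffAt ℝ ∞ (fun w => (Y w).1 i) z
  smoothY2 : ∀ i, ContDiffAt ℝ ∞ (fun w => (Y w).2 i) z

variable {Y : Cn n → Fib n}

theorem smoothM_eta (h : GoodPair G F z) : SmoothM (fun w => etaMat (G w) (F w)) z :=
  h.smoothG.add ((h.smoothF.mul (h.smoothG.inv (det_ne_zero_of_posDef h.posDef))).mul h.smoothF)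

theorem assocLoc_eventuallyEq (h : GoodPair G F z) (Y : Cn n → Fib n) :
    (fun w => assocLoc (G w) (F w) (Y w)) =ᶠ[nhds z] fun w => (etaMat (G w) (F w))⁻¹ *ᵥ
      (G w *ᵥ (Y w).1 + (F w * (G w)⁻¹) *ᵥ (Y w).2) := by
  filter_upwards [h.pos, h.herm] with w h1 h2 using assocLoc_eq h1 h2 _

theorem GoodData.smooth_assocLoc (h : GoodData G F Y z) (i : Fin n) :
    ContDiffAt ℝ ∞ (fun w => assocLoc (G w) (F w) (Y w) i) z := by
  have hg0 := det_ne_zero_of_posDef h.posDef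
  have hη0 := det_ne_zero_of_posDef (etaMat_posDef h.posDef h.isHermitian)
  have h1 := ((smoothM_eta h.toGoodPair).inv hη0).mulVec (v := fun w =>
    G w *ᵥ (Y w).1 + (F w * (G w)⁻¹) *ᵥ (Y w).2) (fun j => (h.smoothG.mulVec h.smoothY1 j).add
      ((h.smoothF.mul (h.smoothG.inv hg0)).mulVec h.smoothY2 j)) i
  refine h1.congr_of_eventuallyEq ?_
  filter_upwards [assocLoc_eventuallyEq h.toGoodPair Y] with w hw
  rw [hw]

/-- The divergence of the associated field. -/
theorem GoodData.sum_dWirt_densD_mul (h : GoodData G F Y z) :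
    ∑ i, dWirt i (fun w => (densD (G w) (F w) : ℂ) * assocLoc (G w) (F w) (Y w) i) z =
      densD (G z) (F z) * (divHLoc G F Y z + pairing (G z) (meanCurvLoc G F z) (Y z)) := by
  have hg0 := det_ne_zero_of_posDef h.posDef
  have hg : IsUnit (G z).det := hg0.isUnit
  have hηp := etaMat_posDef h.posDef h.isHermitian
  have hη0 := det_ne_zero_of_posDef hηp
  have hη : IsUnit (etaMat (G z) (F z)).det := hη0.isUnit
  have hsi := h.smoothG.inv hg0
  set V : Cn n → Fin n → ℂ := fun w => assocLoc (G w) (F w) (Y w) with hV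
  -- With the raised vectors `U` and `X` the equation for V becomes gV + FU = gY₁ + FX, and no
  -- inverse matrix has to be differentiated.
  set U : Cn n → Fin n → ℂ := fun w => (G w)⁻¹ *ᵥ (F w *ᵥ V w) with hU
  set X : Cn n → Fin n → ℂ := fun w => (G w)⁻¹ *ᵥ (Y w).2 with hX
  have hVs : ∀ i, ContDiffAt ℝ ∞ (fun w => V w i) z := h.smooth_assocLoc
  have hUs : ∀ i, ContDiffAt ℝ ∞ (fun w => U w i) z := hsi.mulVec (h.smoothF.mulVec hVs)
  have hXs : ∀ i, ContDiffAt ℝ ∞ (fun w => X w i) z := hsi.mulVec h.smoothY2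
  have hd : ∀ {f : Cn n → Fin n → ℂ}, (∀ i, ContDiffAt ℝ ∞ (fun w => f w i) z) →
      ∀ i, DifferentiableAt ℝ (fun w => f w i) z :=
    fun hf i => (hf i).differentiableAt (by simp)
  have hvc : ∀ (T : (Cn n →L[ℝ] ℂ) →ₗ[ℂ] ℂ) {f g : Cn n → Fin n → ℂ}, f =ᶠ[nhds z] g →
      vder T f z = vder T g z := by
    intro T f g hfg
    ext i
    refine cder_congr T ?_
    filter_upwards [hfg] with w hw
    rw [hw]
  have hva : ∀ (T : (Cn n →L[ℝ] ℂ) →ₗ[ℂ] ℂ) {f g : Cn n → Fin n → ℂ},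
      (∀ i, DifferentiableAt ℝ (fun w => f w i) z) →
      (∀ i, DifferentiableAt ℝ (fun w => g w i) z) →
      vder T (fun w => f w + g w) z = vder T f z + vder T g z := by
    intro T f g hf hg
    ext i
    exact cder_add T (hf i) (hg i)
  have eU : ∀ w, (G w).PosDef → G w *ᵥ U w = F w *ᵥ V w := by
    intro w hw
    rw [hU, mulVec_mulVec, Matrix.mul_nonsing_inv _ (isUnit_det_of_posDef hw), one_mulVec]
  have eX : ∀ w, (G w).PosDef → G w *ᵥ X w = (Y w).2 := by
    intro w hw
    rw [hX, mulVec_mulVec, Matrix.mul_nonsing_inv _ (isUnit_det_of_posDef hw), one_mulVec]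
  have eV : ∀ w, (G w).PosDef → (F w).IsHermitian →
      G w *ᵥ V w + F w *ᵥ U w = G w *ᵥ (Y w).1 + F w *ᵥ X w := by
    intro w h1 h2
    have h3 : etaMat (G w) (F w) *ᵥ V w = G w *ᵥ (Y w).1 + (F w * (G w)⁻¹) *ᵥ (Y w).2 := by
      rw [hV]
      simp only
      rw [assocLoc_eq h1 h2, mulVec_mulVec,
        Matrix.mul_nonsing_inv _ (isUnit_det_of_posDef (etaMat_posDef h1 h2)), one_mulVec]
    rw [etaMat, add_mulVec, ← mulVec_mulVec, ← mulVec_mulVec, ← mulVec_mulVec] at h3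
    exact h3
  have dU : ∀ i, mder (wirtL i) G z *ᵥ U z + G z *ᵥ vder (wirtL i) U z =
      mder (wirtL i) F z *ᵥ V z + F z *ᵥ vder (wirtL i) V z := by
    intro i
    rw [← vder_mulVec _ h.smoothG.diffM (hd hUs), ← vder_mulVec _ h.smoothF.diffM (hd hVs)]
    refine hvc _ ?_
    filter_upwards [h.pos] with w hw using eU w hw
  have dX : ∀ i, mder (wirtL i) G z *ᵥ X z + G z *ᵥ vder (wirtL i) X z =
      vder (wirtL i) (fun w => (Y w).2) z := by
    intro i
    rw [← vder_mulVec _ h.smoothG.diffM (hd hXs)]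
    refine hvc _ ?_
    filter_upwards [h.pos] with w hw using eX w hw
  have dV : ∀ i, mder (wirtL i) G z *ᵥ V z + G z *ᵥ vder (wirtL i) V z +
      (mder (wirtL i) F z *ᵥ U z + F z *ᵥ vder (wirtL i) U z) =
      mder (wirtL i) G z *ᵥ (Y z).1 + G z *ᵥ vder (wirtL i) (fun w => (Y w).1) z +
      (mder (wirtL i) F z *ᵥ X z + F z *ᵥ vder (wirtL i) X z) := by
    intro i
    rw [← vder_mulVec _ h.smoothG.diffM (hd hVs), ← vder_mulVec _ h.smoothF.diffM (hd hUs),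
      ← vder_mulVec _ h.smoothG.diffM (hd h.smoothY1), ← vder_mulVec _ h.smoothF.diffM (hd hXs),
      ← hva _ (hd (h.smoothG.mulVec hVs)) (hd (h.smoothF.mulVec hUs)),
      ← hva _ (hd (h.smoothG.mulVec h.smoothY1)) (hd (h.smoothF.mulVec hXs))]
    refine hvc _ ?_
    filter_upwards [h.pos, h.herm] with w h1 h2 using eV w h1 h2
  set K := (etaMat (G z) (F z))⁻¹ with hK
  set b := X z - U z with hb
  have hinv : ∀ a, (G z)⁻¹ *ᵥ (G z *ᵥ a) = a := fun a => by
    rw [mulVec_mulVec, Matrix.nonsing_inv_mul _ hg, one_mulVec]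
  -- The three groups have different fates: the first is the integrand of div_h, the one with `b`
  -- becomes ∂θ · b, and the one with `V z` is compensated by the derivative of the density.
  have key : ∀ i, vder (wirtL i) V z = K *ᵥ (mder (wirtL i) G z *ᵥ (Y z).1 +
      G z *ᵥ vder (wirtL i) (fun w => (Y w).1) z +
      (F z * (G z)⁻¹) *ᵥ vder (wirtL i) (fun w => (Y w).2) z) +
      (K *ᵥ (mder (wirtL i) F z *ᵥ b) - (K * F z * (G z)⁻¹) *ᵥ (mder (wirtL i) G z *ᵥ b)) -
      (K *ᵥ (mder (wirtL i) G z *ᵥ V z) +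
        (K * F z * (G z)⁻¹) *ᵥ (mder (wirtL i) F z *ᵥ V z)) := by
    intro i
    have u1 := congrArg (fun a => F z *ᵥ ((G z)⁻¹ *ᵥ a)) (dU i)
    -- Applying Fg⁻¹ to the differentiated definitions of U and X eliminates their derivatives from
    -- `dV`.
    have x1 := congrArg (fun a => F z *ᵥ ((G z)⁻¹ *ᵥ a)) (dX i)
    simp only [mulVec_add, hinv] at u1 x1
    have e1 : etaMat (G z) (F z) *ᵥ vder (wirtL i) V z =
        mder (wirtL i) G z *ᵥ (Y z).1 +
      G z *ᵥ vder (wirtL i) (fun w => (Y w).1) z +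
      F z *ᵥ ((G z)⁻¹ *ᵥ vder (wirtL i) (fun w => (Y w).2) z) +
      (mder (wirtL i) F z *ᵥ b - F z *ᵥ ((G z)⁻¹ *ᵥ (mder (wirtL i) G z *ᵥ b))) -
      (mder (wirtL i) G z *ᵥ V z + F z *ᵥ ((G z)⁻¹ *ᵥ (mder (wirtL i) F z *ᵥ V z))) := by
      rw [etaMat, add_mulVec, ← mulVec_mulVec, ← mulVec_mulVec, hb]
      simp only [mulVec_sub]
      have := dV i
      linear_combination (exp := 1) this + x1 - u1
    have e2 := congrArg (fun a => K *ᵥ a) e1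
    beta_reduce at e2
    rw [mulVec_mulVec, hK, Matrix.nonsing_inv_mul _ hη, one_mulVec, ← hK] at e2
    rw [e2]
    simp only [mulVec_add, mulVec_sub, mulVec_mulVec, mul_assoc]
  have hbη : K *ᵥ ((Y z).2 - F z *ᵥ (Y z).1) = b := by
    have : (Y z).2 - F z *ᵥ (Y z).1 = etaMat (G z) (F z) *ᵥ b := by
      have h1 := congrArg (fun a => F z *ᵥ ((G z)⁻¹ *ᵥ a)) (eV z h.posDef h.isHermitian)
      simp only [mulVec_add, hinv] at h1
      rw [etaMat, add_mulVec, ← mulVec_mulVec, ← mulVec_mulVec, hb, mulVec_sub, mulVec_sub,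
        mulVec_sub, mulVec_sub, eX z h.posDef, eU z h.posDef]
      linear_combination (exp := 1) h1
    rw [this, mulVec_mulVec, hK, Matrix.nonsing_inv_mul _ hη, one_mulVec]
  have hD : DifferentiableAt ℝ (fun w => (densD (G w) (F w) : ℂ)) z :=
    h.smooth_densD.differentiableAt (by simp)
  have hterm : ∀ i, dWirt i (fun w => (densD (G w) (F w) : ℂ) * V w i) z =
      densD (G z) (F z) * (vder (wirtL i) V z i + ((K * mder (wirtL i) G z).trace +
        (K * F z * (G z)⁻¹ * mder (wirtL i) F z).trace) * V z i) := by
    intro i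
    rw [dWirt_eq_cder, cder_mul _ hD (hd hVs i), h.cder_densD, vder]
    ring
  have symG : ∀ i k l, mder (wirtL i) G z k l = mder (wirtL l) G z k i :=
    fun i k l => h.closedG i l k
  have symF : ∀ i k l, mder (wirtL i) F z k l = mder (wirtL l) F z k i :=
    fun i k l => h.closedF i l k
  rw [Finset.sum_congr rfl fun i _ => hterm i, ← Finset.mul_sum, divHLoc_eq hg0,
    pairing_meanCurvLoc h.toGoodPair, hbη]
  congr 1
  simp only [dWirt_eq_cder, h.cder_theta, key, Pi.add_apply, Pi.sub_apply,
    Finset.sum_add_distrib, Finset.sum_sub_distrib, add_mul, sub_mul]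
  -- Once the indices are exchanged, the V terms are exactly minus the logarithmic derivative of the
  -- density, and the b terms are the trace formula for ∂θ.
  rw [← hK, sum_mulVec_of_symm K _ symF, sum_mulVec_of_symm (K * F z * (G z)⁻¹) _ symG,
    sum_mulVec_of_symm K _ symG, sum_mulVec_of_symm (K * F z * (G z)⁻¹) _ symF]
  ring

/-- `v ∇_i (v Vⁱ)` in terms of the density `v det g`. -/
theorem GoodData.divVLoc_eq (h : GoodData G F Y z) :
    divVLoc G F (fun w => assocLoc (G w) (F w) (Y w)) z =
      divHLoc G F Y z + pairing (G z) (meanCurvLoc G F z) (Y z) := by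
  have hg0 := det_ne_zero_of_posDef h.posDef
  have hv : ∀ i, DifferentiableAt ℝ (fun w =>
      (((‖zetaLoc (G w) (F w)‖ : ℝ) : ℂ) • assocLoc (G w) (F w) (Y w)) i) z := by
    intro i
    exact (h.smooth_zeta.differentiableAt (by simp)).fun_mul
      ((h.smooth_assocLoc i).differentiableAt (by simp))
  rw [divVLoc, sum_covDeriv_eq h.smoothG.diffM hg0 h.closedG hv]
  have he : ∀ i, dWirt i (fun w => (G w).det *
      (((‖zetaLoc (G w) (F w)‖ : ℝ) : ℂ) • assocLoc (G w) (F w) (Y w)) i) z =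
      dWirt i (fun w => (densD (G w) (F w) : ℂ) * assocLoc (G w) (F w) (Y w) i) z := by
    intro i
    refine cder_congr (wirtL i) ?_
    filter_upwards [h.pos] with w hw
    have := det_ne_zero_of_posDef hw
    rw [norm_zetaLoc_eq hw, Pi.smul_apply, smul_eq_mul]
    field_simp
  simp only [he]
  rw [h.sum_dWirt_densD_mul, norm_zetaLoc_eq h.posDef]
  have hD : (densD (G z) (F z) : ℂ) ≠ 0 := by
    exact_mod_cast (densD_pos h.posDef h.isHermitian).ne'
  field_simp

end Pointwise

/-! ### Wirtinger calculus -/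

section Wirtinger

open Matrix

variable {n : ℕ}

theorem single_eq_smul (a : Fin n) (c : ℂ) :
    (Pi.single a c : Cn n) = c.re • (Pi.single a 1 : Cn n) +
      c.im • (Pi.single a Complex.I : Cn n) := by
  ext b
  by_cases h : b = a
  · subst h
    apply Complex.ext <;> simp
  · simp [Pi.single_eq_of_ne h]

/-- A real linear functional in terms of its Wirtinger components. -/
theorem apply_eq_sum_wirt (A : Cn n →L[ℝ] ℂ) (u : Cn n) :
    A u = ∑ a, (u a * wirtL a A + conj (u a) * wirtBarL a A) := by
  have h : u = ∑ a, Pi.single a (u a) := (Finset.univ_sum_single u).symm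
  conv_lhs => rw [h, map_sum]
  refine Finset.sum_congr rfl fun a _ => ?_
  rw [single_eq_smul, map_add, map_smul, map_smul]
  have h1 : u a = (u a).re + (u a).im * Complex.I := (Complex.re_add_im _).symm
  have h2 : conj (u a) = (u a).re - (u a).im * Complex.I := by
    apply Complex.ext <;> simp
  rw [h2]
  conv_rhs => rw [h1]
  change _ = _ * ((1 / 2) * (A (Pi.single a 1) - Complex.I * A (Pi.single a Complex.I))) +
    _ * ((1 / 2) * (A (Pi.single a 1) + Complex.I * A (Pi.single a Complex.I)))
  simp only [Complex.real_smul, Complex.add_re, Complex.ofReal_re, Complex.mul_re, Complex.I_re,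
    mul_zero, Complex.ofReal_im, Complex.I_im, mul_one, sub_self, add_zero, Complex.add_im,
    Complex.mul_im, zero_add]
  linear_combination ((u a).im * A (Pi.single a Complex.I)) * Complex.I_mul_I

/-- The combination on the left is the complex linear part of A, so only the (1,0) components
remain. -/
theorem wirtL_apply_eq (A : Cn n →L[ℝ] ℂ) (u : Cn n) :
    (1 / 2) * (A u - Complex.I * A (Complex.I • u)) = ∑ a, u a * wirtL a A := by
  rw [apply_eq_sum_wirt A u, apply_eq_sum_wirt A (Complex.I • u), Finset.mul_sum,
    ← Finset.sum_sub_distrib, Finset.mul_sum]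
  refine Finset.sum_congr rfl fun a _ => ?_
  simp only [Pi.smul_apply, smul_eq_mul, map_mul, Complex.conj_I]
  linear_combination (-(1 / 2) * (u a) * wirtL a A + (1 / 2) * conj (u a) * wirtBarL a A) *
    Complex.I_mul_I

/-- The Jacobian matrix of a holomorphic map. -/
def jac (κ : Cn n → Cn n) (z : Cn n) : Matrix (Fin n) (Fin n) ℂ :=
  Matrix.of fun a i => fderiv ℂ κ z (Pi.single i 1) a

theorem fderiv_single_eq_jac (κ : Cn n → Cn n) (z : Cn n) (i : Fin n) (c : ℂ) :
    fderiv ℂ κ z (Pi.single i c) = fun a => c * jac κ z a i := by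
  have : (Pi.single i c : Cn n) = c • Pi.single i 1 := by simp [← Pi.single_smul]
  rw [this, map_smul]
  rfl

theorem fderiv_eq_jac_mulVec (κ : Cn n → Cn n) (z u : Cn n) :
    fderiv ℂ κ z u = jac κ z *ᵥ u := by
  have h : u = ∑ a, Pi.single a (u a) := (Finset.univ_sum_single u).symm
  conv_lhs => rw [h, map_sum]
  ext b
  simp only [fderiv_single_eq_jac, Finset.sum_apply, mulVec, dotProduct]
  exact Finset.sum_congr rfl fun a _ => mul_comm _ _

theorem fderiv_comp_hol {κ : Cn n → Cn n} {z : Cn n} (hκ : DifferentiableAt ℂ κ z)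
    {f : Cn n → ℂ} (hf : DifferentiableAt ℝ f (κ z)) (u : Cn n) :
    fderiv ℝ (fun w => f (κ w)) z u = fderiv ℝ f (κ z) (fderiv ℂ κ z u) := by
  have h1 := hf.hasFDerivAt.comp z (hκ.hasFDerivAt.restrictScalars ℝ)
  have h2 : HasFDerivAt (fun w => f (κ w)) _ z := h1
  rw [h2.fderiv]
  rfl

/-- The derivative of κ commutes with multiplication by √-1, so no antiholomorphic derivatives enter
the chain rule. -/
theorem dWirt_comp_hol {κ : Cn n → Cn n} {z : Cn n} (hκ : DifferentiableAt ℂ κ z)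
    {f : Cn n → ℂ} (hf : DifferentiableAt ℝ f (κ z)) (i : Fin n) :
    dWirt i (fun w => f (κ w)) z = ∑ a, jac κ z a i * dWirt a f (κ z) := by
  have h := wirtL_apply_eq (fderiv ℝ f (κ z)) (fderiv ℂ κ z (Pi.single i 1))
  rw [← map_smul] at h
  rw [dWirt, fderiv_comp_hol hκ hf, fderiv_comp_hol hκ hf]
  have e : (Pi.single i Complex.I : Cn n) = Complex.I • Pi.single i 1 := by
    simp [← Pi.single_smul]
  rw [e, h]
  rfl

theorem dWirt_conj {f : Cn n → ℂ} {z : Cn n} (hf : DifferentiableAt ℝ f z) (j : Fin n) :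
    dWirt j (fun w => conj (f w)) z = conj (dWirtBar j f z) := (conj_dWirtBar hf j).symm

theorem dWirtBar_conj {f : Cn n → ℂ} {z : Cn n} (hf : DifferentiableAt ℝ f z) (j : Fin n) :
    dWirtBar j (fun w => conj (f w)) z = conj (dWirt j f z) := (conj_dWirt hf j).symm

theorem DifferentiableAt.conj' {f : Cn n → ℂ} {z : Cn n} (hf : DifferentiableAt ℝ f z) :
    DifferentiableAt ℝ (fun w => conj (f w)) z :=
  Complex.conjCLE.toContinuousLinearMap.differentiableAt.comp z hf

theorem dWirtBar_comp_hol {κ : Cn n → Cn n} {z : Cn n} (hκ : DifferentiableAt ℂ κ z)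
    {f : Cn n → ℂ} (hf : DifferentiableAt ℝ f (κ z)) (i : Fin n) :
    dWirtBar i (fun w => f (κ w)) z = ∑ a, conj (jac κ z a i) * dWirtBar a f (κ z) := by
  have hfκ : DifferentiableAt ℝ (fun w => f (κ w)) z := hf.comp z (hκ.restrictScalars ℝ)
  have h := dWirt_comp_hol hκ (DifferentiableAt.conj' hf) i
  rw [dWirt_conj hfκ] at h
  have h2 := congrArg conj h
  rw [Complex.conj_conj] at h2
  rw [h2, map_sum]
  refine Finset.sum_congr rfl fun a _ => ?_
  rw [dWirt_conj hf, map_mul, Complex.conj_conj]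

theorem dWirtBar_hol {f : Cn n → ℂ} {z : Cn n} (hf : DifferentiableAt ℂ f z) (i : Fin n) :
    dWirtBar i f z = 0 := by
  have e : (Pi.single i Complex.I : Cn n) = Complex.I • Pi.single i 1 := by
    simp [← Pi.single_smul]
  rw [dWirtBar, hf.fderiv_restrictScalars ℝ, e]
  simp only [ContinuousLinearMap.coe_restrictScalars', map_smul, smul_eq_mul]
  rw [← mul_assoc, Complex.I_mul_I]
  ring

theorem dWirt_hol {f : Cn n → ℂ} {z : Cn n} (hf : DifferentiableAt ℂ f z) (i : Fin n) :
    dWirt i f z = fderiv ℂ f z (Pi.single i 1) := by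
  have e : (Pi.single i Complex.I : Cn n) = Complex.I • Pi.single i 1 := by
    simp [← Pi.single_smul]
  rw [dWirt, hf.fderiv_restrictScalars ℝ, e]
  simp only [ContinuousLinearMap.coe_restrictScalars', map_smul, smul_eq_mul]
  rw [← mul_assoc, Complex.I_mul_I]
  ring

theorem contDiffAt_fderiv_apply {f : Cn n → ℂ} {z : Cn n} (hf : ContDiffAt ℝ ∞ f z) (u : Cn n) :
    ContDiffAt ℝ ∞ (fun w => fderiv ℝ f w u) z :=
  (hf.fderiv_right (m := ∞) (by simp)).clm_apply contDiffAt_const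

theorem contDiffAt_dWirt {f : Cn n → ℂ} {z : Cn n} (hf : ContDiffAt ℝ ∞ f z) (i : Fin n) :
    ContDiffAt ℝ ∞ (dWirt i f) z :=
  contDiffAt_const.mul ((contDiffAt_fderiv_apply hf _).sub
    (contDiffAt_const.mul (contDiffAt_fderiv_apply hf _)))

theorem contDiffAt_dWirtBar {f : Cn n → ℂ} {z : Cn n} (hf : ContDiffAt ℝ ∞ f z) (i : Fin n) :
    ContDiffAt ℝ ∞ (dWirtBar i f) z :=
  contDiffAt_const.mul ((contDiffAt_fderiv_apply hf _).add
    (contDiffAt_const.mul (contDiffAt_fderiv_apply hf _)))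

theorem fderiv_fderiv_comm {f : Cn n → ℂ} {z : Cn n} (hf : ContDiffAt ℝ ∞ f z) (u v : Cn n) :
    fderiv ℝ (fun w => fderiv ℝ f w u) z v = fderiv ℝ (fun w => fderiv ℝ f w v) z u := by
  have hd : DifferentiableAt ℝ (fderiv ℝ f) z :=
    (hf.fderiv_right (m := ∞) (by simp)).differentiableAt (by simp)
  have h : ∀ u v, fderiv ℝ (fun w => fderiv ℝ f w u) z v = fderiv ℝ (fderiv ℝ f) z v u := by
    intro u v
    rw [fderiv_clm_apply hd (differentiableAt_const _)]
    simp
  rw [h, h]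
  refine hf.isSymmSndFDerivAt ?_ v u
  rw [minSmoothness_of_isRCLikeNormedField]
  exact WithTop.coe_le_coe.2 le_top

theorem fderiv_combo {f : Cn n → ℂ} {z : Cn n} (hf : ContDiffAt ℝ ∞ f z) (u u' v : Cn n) (c : ℂ) :
    fderiv ℝ (fun w => (1 / 2 : ℂ) * (fderiv ℝ f w u + c * fderiv ℝ f w u')) z v =
      (1 / 2) * (fderiv ℝ (fun w => fderiv ℝ f w u) z v +
        c * fderiv ℝ (fun w => fderiv ℝ f w u') z v) := by
  have h1 : ∀ u, DifferentiableAt ℝ (fun w => fderiv ℝ f w u) z := fun u =>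
    (contDiffAt_fderiv_apply hf u).differentiableAt (by simp)
  rw [fderiv_const_mul ((h1 u).fun_add ((h1 u').const_mul c)),
    fderiv_fun_add (h1 u) ((h1 u').const_mul c), fderiv_const_mul (h1 u')]
  simp
  ring

theorem dWirt_def' (i : Fin n) (f : Cn n → ℂ) : dWirt i f = fun w =>
    (1 / 2 : ℂ) * (fderiv ℝ f w (Pi.single i 1) + (-Complex.I) *
      fderiv ℝ f w (Pi.single i Complex.I)) := by
  ext w
  rw [dWirt]
  ring

theorem dWirt_comm {f : Cn n → ℂ} {z : Cn n} (hf : ContDiffAt ℝ ∞ f z) (i j : Fin n) :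
    dWirt i (dWirt j f) z = dWirt j (dWirt i f) z := by
  rw [dWirt_def' j f, dWirt_def' i f, dWirt, dWirt]
  simp only [fderiv_combo hf]
  rw [fderiv_fderiv_comm hf (Pi.single j 1) (Pi.single i 1),
    fderiv_fderiv_comm hf (Pi.single j Complex.I) (Pi.single i 1),
    fderiv_fderiv_comm hf (Pi.single j 1) (Pi.single i Complex.I),
    fderiv_fderiv_comm hf (Pi.single j Complex.I) (Pi.single i Complex.I)]
  ring

theorem dWirt_dWirtBar_comm {f : Cn n → ℂ} {z : Cn n} (hf : ContDiffAt ℝ ∞ f z) (i j : Fin n) :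
    dWirt i (dWirtBar j f) z = dWirtBar j (dWirt i f) z := by
  rw [show dWirtBar j f = fun w => (1 / 2 : ℂ) * (fderiv ℝ f w (Pi.single j 1) + Complex.I *
      fderiv ℝ f w (Pi.single j Complex.I)) from rfl, dWirt_def' i f, dWirt, dWirtBar]
  simp only [fderiv_combo hf]
  rw [fderiv_fderiv_comm hf (Pi.single j 1) (Pi.single i 1),
    fderiv_fderiv_comm hf (Pi.single j Complex.I) (Pi.single i 1),
    fderiv_fderiv_comm hf (Pi.single j 1) (Pi.single i Complex.I),
    fderiv_fderiv_comm hf (Pi.single j Complex.I) (Pi.single i Complex.I)]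
  ring

/-- `log |f|²` is pluriharmonic for `f` holomorphic and nonvanishing. -/
theorem dWirt_dWirtBar_log_norm {f : Cn n → ℂ} {z : Cn n} (hf : ContDiffAt ℂ ∞ f z)
    (h0 : f z ≠ 0) (j k : Fin n) :
    dWirt j (dWirtBar k fun w => (Real.log (‖f w‖ ^ 2) : ℂ)) z = 0 := by
  -- Division by f z makes the argument 1 at z, so the principal branch is holomorphic nearby. Then
  -- log |f|² is L plus its conjugate plus a constant, and each summand is killed by one of the two
  -- derivatives.
  set L : Cn n → ℂ := fun w => Complex.log (f w / f z) with hL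
  have hLs : ContDiffAt ℂ ∞ L z := by
    refine ContDiffAt.comp z (g := Complex.log) (Complex.contDiffAt_log ?_) ?_
    rotate_left
    · simp only [div_eq_mul_inv]
      exact hf.mul contDiffAt_const
    · rw [div_self h0]; exact Complex.one_mem_slitPlane
  have hev : ∀ᶠ w in nhds z, DifferentiableAt ℂ L w := by
    have h1 : ContDiffAt ℂ 1 L z := hLs.of_le (by simp)
    filter_upwards [h1.eventually (by simp)] with w hw using hw.differentiableAt (by simp)
  have hfe : ∀ᶠ w in nhds z, f w ≠ 0 := hf.continuousAt.eventually_ne h0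
  have he : (fun w => (Real.log (‖f w‖ ^ 2) : ℂ)) =ᶠ[nhds z]
      fun w => (L w + conj (L w)) + (Real.log (‖f z‖ ^ 2) : ℂ) := by
    filter_upwards [hfe] with w hw
    rw [Complex.add_conj, hL]
    simp only [Complex.log_re]
    rw [norm_div, Real.log_div (norm_ne_zero_iff.2 hw) (norm_ne_zero_iff.2 h0), Real.log_pow,
      Real.log_pow]
    push_cast
    ring
  have h1 : dWirtBar k (fun w => (Real.log (‖f w‖ ^ 2) : ℂ)) =ᶠ[nhds z]
      fun w => conj (fderiv ℂ L w (Pi.single k 1)) := by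
    filter_upwards [he.eventuallyEq_nhds, hev] with w h2 h3
    have hd := h3.restrictScalars ℝ
    have hdc := DifferentiableAt.conj' hd
    rw [dWirtBar_eq_cder, cder_congr _ h2, cder_add _ (hd.fun_add hdc) (differentiableAt_const _),
      cder_const, cder_add _ hd hdc, ← dWirtBar_eq_cder, ← dWirtBar_eq_cder, dWirtBar_hol h3,
      dWirtBar_conj hd, dWirt_hol h3, zero_add, add_zero]
  have h2 : DifferentiableAt ℂ (fun w => fderiv ℂ L w (Pi.single k 1)) z :=
    (((hLs.fderiv_right (m := ∞) (by simp)).clm_apply contDiffAt_const).differentiableAt (by simp))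
  rw [dWirt_eq_cder, cder_congr _ h1, ← dWirt_eq_cder, dWirt_conj (h2.restrictScalars ℝ),
    dWirtBar_hol h2, map_zero]

end Wirtinger

/-! ### Holomorphic charts -/

set_option linter.unusedSectionVars false

section Charts

open Matrix

variable {n : ℕ} {X : Type*} [TopologicalSpace X] [ChartedSpace (Cn n) X]

/-- It provides the underlying real smooth structure on the same charted space, in which
hypersurfaces, cutoffs and partitions of unity live. -/
theorem contDiffGroupoid_le_real :
    contDiffGroupoid ω 𝓘(ℂ, Cn n) ≤ contDiffGroupoid ∞ 𝓘(ℝ, Cn n) := by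
  intro e he
  replace he := (mem_groupoid_of_pregroupoid (PG := contDiffPregroupoid ω 𝓘(ℂ, Cn n))).1 he
  refine (mem_groupoid_of_pregroupoid (PG := contDiffPregroupoid ∞ 𝓘(ℝ, Cn n))).2 ?_
  simp only [contDiffPregroupoid, modelWithCornersSelf_coe, modelWithCornersSelf_coe_symm,
    Function.id_comp, Function.comp_id, Set.preimage_id, Set.range_id, Set.inter_univ] at he ⊢
  exact ⟨(he.1.restrict_scalars ℝ).of_le le_top, (he.2.restrict_scalars ℝ).of_le le_top⟩

variable [IsManifold 𝓘(ℂ, Cn n) ω X]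

instance isManifold_real : IsManifold 𝓘(ℝ, Cn n) ∞ X where
  __ := hasGroupoid_of_le (inferInstanceAs (HasGroupoid X (contDiffGroupoid ω 𝓘(ℂ, Cn n))))
    contDiffGroupoid_le_real

variable {φ φ' : OpenPartialHomeomorph X (Cn n)}

theorem mem_maximalAtlas_real (hφ : φ ∈ holCharts n X) :
    φ ∈ IsManifold.maximalAtlas 𝓘(ℝ, Cn n) ∞ X :=
  StructureGroupoid.maximalAtlas_mono contDiffGroupoid_le_real hφ

theorem chartAt_mem_holCharts (x : X) : chartAt (Cn n) x ∈ holCharts n X :=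
  IsManifold.chart_mem_maximalAtlas x

theorem mdifferentiable_of_holCharts (hφ : φ ∈ holCharts n X) :
    φ.MDifferentiable 𝓘(ℂ, Cn n) 𝓘(ℂ, Cn n) :=
  ⟨(contMDiffOn_of_mem_maximalAtlas hφ).mdifferentiableOn (by simp),
    (contMDiffOn_symm_of_mem_maximalAtlas hφ).mdifferentiableOn (by simp)⟩

theorem mdifferentiable_real_of_holCharts (hφ : φ ∈ holCharts n X) :
    φ.MDifferentiable 𝓘(ℝ, Cn n) 𝓘(ℝ, Cn n) :=
  ⟨(contMDiffOn_of_mem_maximalAtlas (mem_maximalAtlas_real hφ)).mdifferentiableOn (by simp),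
    (contMDiffOn_symm_of_mem_maximalAtlas (mem_maximalAtlas_real hφ)).mdifferentiableOn (by simp)⟩

theorem isOpen_transDomain (φ φ' : OpenPartialHomeomorph X (Cn n)) :
    IsOpen (φ.target ∩ φ.symm ⁻¹' φ'.source) :=
  φ.symm.isOpen_inter_preimage φ'.open_source

theorem contDiffOn_trans (hφ : φ ∈ holCharts n X) (hφ' : φ' ∈ holCharts n X) :
    ContDiffOn ℂ ω (fun z => φ' (φ.symm z)) (φ.target ∩ φ.symm ⁻¹' φ'.source) := by
  have h := StructureGroupoid.compatible_of_mem_maximalAtlas hφ hφ'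
  rw [contDiffGroupoid, mem_groupoid_of_pregroupoid] at h
  simp only [contDiffPregroupoid, modelWithCornersSelf_coe, modelWithCornersSelf_coe_symm,
    Function.id_comp, Function.comp_id, Set.preimage_id, Set.range_id, Set.inter_univ] at h
  exact h.1

theorem contDiffAt_trans (hφ : φ ∈ holCharts n X) (hφ' : φ' ∈ holCharts n X) {z : Cn n}
    (hz : z ∈ φ.target) (hz' : φ.symm z ∈ φ'.source) :
    ContDiffAt ℂ ω (fun z => φ' (φ.symm z)) z :=
  (contDiffOn_trans hφ hφ').contDiffAt ((isOpen_transDomain φ φ').mem_nhds ⟨hz, hz'⟩)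

theorem differentiableAt_trans (hφ : φ ∈ holCharts n X) (hφ' : φ' ∈ holCharts n X) {z : Cn n}
    (hz : z ∈ φ.target) (hz' : φ.symm z ∈ φ'.source) :
    DifferentiableAt ℂ (fun z => φ' (φ.symm z)) z :=
  (contDiffAt_trans hφ hφ' hz hz').differentiableAt (by simp)

/-- The derivative of a chart. -/
def chartDeriv (φ : OpenPartialHomeomorph X (Cn n)) (x : X) : HTan n x →L[ℂ] Cn n :=
  mfderiv 𝓘(ℂ, Cn n) 𝓘(ℂ, Cn n) φ x

/-- The derivative of a holomorphic chart is an isomorphism. -/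
def chartDerivEquiv (hφ : φ ∈ holCharts n X) {x : X} (hx : x ∈ φ.source) :
    HTan n x ≃L[ℂ] Cn n :=
  (mdifferentiable_of_holCharts hφ).mfderiv hx

theorem chartDerivEquiv_apply (hφ : φ ∈ holCharts n X) {x : X} (hx : x ∈ φ.source)
    (u : HTan n x) : chartDerivEquiv hφ hx u = chartDeriv φ x u := rfl

theorem coordVec_eq (hφ : φ ∈ holCharts n X) {x : X} (hx : x ∈ φ.source) (j : Fin n) :
    coordVec φ x j = (chartDerivEquiv hφ hx).symm (Pi.single j 1) := by
  have h : mfderiv 𝓘(ℂ, Cn n) 𝓘(ℂ, Cn n) φ x =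
      ((chartDerivEquiv hφ hx : HTan n x ≃L[ℂ] Cn n) : HTan n x →L[ℂ] Cn n) := rfl
  rw [coordVec, h]
  exact congrArg (fun A : Cn n →L[ℂ] HTan n x => A (Pi.single j (1 : ℂ) : Cn n)) (ContinuousLinearMap.inverse_equiv _)

theorem chartDeriv_coordVec (hφ : φ ∈ holCharts n X) {x : X} (hx : x ∈ φ.source) (j : Fin n) :
    chartDeriv φ x (coordVec φ x j) = Pi.single j 1 := by
  rw [coordVec_eq hφ hx, ← chartDerivEquiv_apply hφ hx, ContinuousLinearEquiv.apply_symm_apply]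

theorem eq_sum_coordVec (hφ : φ ∈ holCharts n X) {x : X} (hx : x ∈ φ.source) (u : HTan n x) :
    u = ∑ j, chartDeriv φ x u j • coordVec φ x j := by
  apply (chartDerivEquiv hφ hx).injective
  simp only [map_sum, map_smul, chartDerivEquiv_apply, chartDeriv_coordVec hφ hx]
  exact (Finset.univ_sum_single (chartDeriv φ x u)).symm.trans
    (Finset.sum_congr rfl fun j _ => by simp [← Pi.single_smul])

theorem chartDeriv_trans (hφ : φ ∈ holCharts n X) (hφ' : φ' ∈ holCharts n X) {x : X}
    (hx : x ∈ φ.source) (hx' : x ∈ φ'.source) (u : HTan n x) :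
    chartDeriv φ' x u = fderiv ℂ (fun z => φ' (φ.symm z)) (φ x) (chartDeriv φ x u) := by
  have h1 : MDifferentiableAt 𝓘(ℂ, Cn n) 𝓘(ℂ, Cn n) (fun z => φ' (φ.symm z)) (φ x) :=
    (differentiableAt_trans hφ hφ' (φ.map_source hx)
      (by rwa [φ.left_inv hx])).mdifferentiableAt
  have h2 := (mdifferentiable_of_holCharts hφ).mdifferentiableAt hx
  have h3 := mfderiv_comp x h1 h2
  have h4 : (fun z => φ' (φ.symm z)) ∘ φ =ᶠ[nhds x] φ' := by
    filter_upwards [φ.open_source.mem_nhds hx] with y hy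
    simp [φ.left_inv hy]
  rw [h4.mfderiv_eq, mfderiv_eq_fderiv] at h3
  exact congrArg (fun A => A u) h3

/-- Both manifold derivatives are derivatives of the same map between model spaces, one being the
restriction of scalars of the other. Hence `part10` is compatible with charts. -/
theorem chartDeriv_real (hφ : φ ∈ holCharts n X) {x : X} (hx : x ∈ φ.source) (u : RTan n x) :
    (mfderiv 𝓘(ℝ, Cn n) 𝓘(ℝ, Cn n) φ x u : Cn n) = chartDeriv φ x (part10 x u) := by
  have h1 := (mdifferentiable_of_holCharts hφ).mdifferentiableAt hx
  have h2 := (mdifferentiable_real_of_holCharts hφ).mdifferentiableAt hx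
  have e1 := h1.mfderiv
  have e2 := h2.mfderiv
  have h3 := h1.differentiableWithinAt_writtenInExtChartAt
  simp only [modelWithCornersSelf_coe, Set.range_id, fderivWithin_univ] at h3 e1 e2
  rw [differentiableWithinAt_univ] at h3
  refine (congrArg (fun A : Cn n →L[ℝ] Cn n => A u) e2).trans ?_
  refine Eq.trans ?_ (congrArg (fun A : Cn n →L[ℂ] Cn n => A u) e1).symm
  exact congrArg (fun A : Cn n →L[ℝ] Cn n => A u) (h3.fderiv_restrictScalars ℝ)

theorem coordVec_trans (hφ : φ ∈ holCharts n X) (hφ' : φ' ∈ holCharts n X) {x : X}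
    (hx : x ∈ φ.source) (hx' : x ∈ φ'.source) (j : Fin n) :
    coordVec φ x j = ∑ a, jac (fun z => φ' (φ.symm z)) (φ x) a j • coordVec φ' x a := by
  rw [eq_sum_coordVec hφ' hx' (coordVec φ x j), chartDeriv_trans hφ hφ' hx hx',
    chartDeriv_coordVec hφ hx]
  rfl

variable (g : KahlerMetric n X)

theorem gCoeff_apply {x : X} (hx : x ∈ φ.source) (k j : Fin n) :
    gCoeff g φ (φ x) k j = g.form x (coordVec φ x k) (coordVec φ x j) := by
  rw [gCoeff, Matrix.of_apply, φ.left_inv hx]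

theorem form_eq_sum (hφ : φ ∈ holCharts n X) {x : X} (hx : x ∈ φ.source) (u w : HTan n x) :
    g.form x u w = star (chartDeriv φ x u) ⬝ᵥ (gCoeff g φ (φ x) *ᵥ chartDeriv φ x w) := by
  conv_lhs => rw [eq_sum_coordVec hφ hx u, eq_sum_coordVec hφ hx w]
  simp only [map_sum, LinearMap.sum_apply, map_smulₛₗ, LinearMap.smul_apply, smul_eq_mul,
    dotProduct, mulVec, Finset.mul_sum, gCoeff_apply g hx, RingHom.id_apply, Pi.star_apply,
    RCLike.star_def]
  rw [Finset.sum_comm]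
  refine Finset.sum_congr rfl fun i _ => Finset.sum_congr rfl fun j _ => ?_
  ring

theorem gCoeff_posDef (hφ : φ ∈ holCharts n X) {z : Cn n} (hz : z ∈ φ.target) :
    (gCoeff g φ z).PosDef := by
  have hx := φ.map_target hz
  refine PosDef.of_dotProduct_mulVec_pos ?_ fun u hu => ?_
  · ext i j
    exact g.symm _ _ _
  · set w := (chartDerivEquiv hφ hx).symm u with hw
    have hwu : chartDeriv φ (φ.symm z) w = u := by
      rw [← chartDerivEquiv_apply hφ hx, hw, ContinuousLinearEquiv.apply_symm_apply]
    have hw0 : w ≠ 0 := by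
      intro h
      rw [h, map_zero] at hwu
      exact hu hwu.symm
    have h1 := form_eq_sum g hφ hx w w
    rw [hwu, φ.right_inv hz] at h1
    rw [← h1, Complex.pos_iff]
    refine ⟨g.pos _ w hw0, ?_⟩
    have := congrArg Complex.im (g.symm _ w w)
    simp only [Complex.conj_im] at this
    linarith

theorem gCoeff_trans (hφ : φ ∈ holCharts n X) (hφ' : φ' ∈ holCharts n X) {z : Cn n}
    (hz : z ∈ φ.target) (hz' : φ.symm z ∈ φ'.source) :
    gCoeff g φ z = (jac (fun z => φ' (φ.symm z)) z)ᴴ * gCoeff g φ' (φ' (φ.symm z)) *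
      jac (fun z => φ' (φ.symm z)) z := by
  have hx := φ.map_target hz
  ext k j
  have hc : ∀ j, chartDeriv φ' (φ.symm z) (coordVec φ (φ.symm z) j) =
      fun a => jac (fun z => φ' (φ.symm z)) z a j := by
    intro j
    rw [chartDeriv_trans hφ hφ' hx hz', chartDeriv_coordVec hφ hx, φ.right_inv hz]
    rfl
  rw [gCoeff, Matrix.of_apply, form_eq_sum g hφ' hz', hc, hc, mul_assoc]
  simp only [dotProduct, mulVec, Matrix.mul_apply, conjTranspose_apply, Pi.star_apply]

theorem smoothM_gCoeff (hφ : φ ∈ holCharts n X) {z : Cn n} (hz : z ∈ φ.target) :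
    SmoothM (gCoeff g φ) z :=
  fun k j => (g.smooth φ hφ k j).contDiffAt (φ.open_target.mem_nhds hz)

theorem secCoeff_fst_trans (Y : Sec n X) (hφ : φ ∈ holCharts n X) (hφ' : φ' ∈ holCharts n X)
    {z : Cn n} (hz : z ∈ φ.target) (hz' : φ.symm z ∈ φ'.source) :
    (secCoeff Y φ' (φ' (φ.symm z))).1 =
      jac (fun z => φ' (φ.symm z)) z *ᵥ (secCoeff Y φ z).1 := by
  have hx := φ.map_target hz
  have h := chartDeriv_trans hφ hφ' hx hz' (Y (φ.symm z)).1
  rw [φ.right_inv hz, fderiv_eq_jac_mulVec] at h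
  have e : (secCoeff Y φ' (φ' (φ.symm z))).1 =
      chartDeriv φ' (φ'.symm (φ' (φ.symm z))) (Y (φ'.symm (φ' (φ.symm z)))).1 := rfl
  rw [e, φ'.left_inv hz', h]
  rfl

theorem secCoeff_snd_trans (Y : Sec n X) (hφ : φ ∈ holCharts n X) (hφ' : φ' ∈ holCharts n X)
    {z : Cn n} (hz : z ∈ φ.target) (hz' : φ.symm z ∈ φ'.source) :
    (secCoeff Y φ z).2 =
      (jac (fun z => φ' (φ.symm z)) z)ᴴ *ᵥ (secCoeff Y φ' (φ' (φ.symm z))).2 := by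
  have hx := φ.map_target hz
  ext j
  have e : (secCoeff Y φ z).2 j = (Y (φ.symm z)).2 (coordVec φ (φ.symm z) j) := rfl
  rw [e, coordVec_trans hφ hφ' hx hz', φ.right_inv hz]
  simp only [map_sum, map_smulₛₗ, smul_eq_mul, mulVec, dotProduct, conjTranspose_apply]
  refine Finset.sum_congr rfl fun a _ => ?_
  have e2 : (secCoeff Y φ' (φ' (φ.symm z))).2 a =
    (Y (φ'.symm (φ' (φ.symm z)))).2 (coordVec φ' (φ'.symm (φ' (φ.symm z))) a) := rfl
  rw [e2, φ'.left_inv hz']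
  rfl

theorem isUnit_jac_trans (hφ : φ ∈ holCharts n X) (hφ' : φ' ∈ holCharts n X) {z : Cn n}
    (hz : z ∈ φ.target) (hz' : φ.symm z ∈ φ'.source) :
    IsUnit (jac (fun z => φ' (φ.symm z)) z).det := by
  have hx := φ.map_target hz
  rw [isUnit_iff_ne_zero]
  intro h
  obtain ⟨u, hu, hu2⟩ := exists_mulVec_eq_zero_iff.2 h
  set w := (chartDerivEquiv hφ hx).symm u with hw
  have hwu : chartDeriv φ (φ.symm z) w = u := by
    rw [← chartDerivEquiv_apply hφ hx, hw, ContinuousLinearEquiv.apply_symm_apply]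
  have h1 := chartDeriv_trans hφ hφ' hx hz' w
  rw [φ.right_inv hz, hwu, fderiv_eq_jac_mulVec, hu2, ← chartDerivEquiv_apply hφ' hz'] at h1
  have h2 : w = 0 := (chartDerivEquiv hφ' hz').injective (by rw [h1, map_zero])
  rw [h2, map_zero] at hwu
  exact hu hwu.symm

end Charts

/-! ### The curvature in charts and frames -/

section Curvature

set_option linter.unusedSectionVars false

open Matrix

variable {n : ℕ} {X : Type*} [TopologicalSpace X] [ChartedSpace (Cn n) X]
  [IsManifold 𝓘(ℂ, Cn n) ω X]
  {L : X → Type*} [∀ x, AddCommGroup (L x)] [∀ x, Module ℂ (L x)]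
  [∀ x, TopologicalSpace (L x)] [TopologicalSpace (Bundle.TotalSpace ℂ L)]
  [FiberBundle ℂ L] [VectorBundle ℂ ℂ L]
  [ContMDiffVectorBundle ω ℂ L 𝓘(ℂ, Cn n)]
  {φ φ' : OpenPartialHomeomorph X (Cn n)}
  {t t' : Bundle.Trivialization ℂ (Bundle.TotalSpace.proj : Bundle.TotalSpace ℂ L → X)}
  (h : HermitianMetric n L)

theorem localFrame_ne_zero (ht : MemTrivializationAtlas t) {x : X} (hx : x ∈ t.baseSet) :
    localFrame t x ≠ 0 := by
  have : t.IsLinear ℂ := VectorBundle.trivialization_linear' t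
  have h1 : localFrame t x = (t.linearEquivAt ℂ x hx).symm 1 := by
    rw [Bundle.Trivialization.linearEquivAt_symm_apply]
    rfl
  rw [h1]
  exact (LinearEquiv.map_ne_zero_iff _).2 one_ne_zero

theorem localFrame_trans (ht : MemTrivializationAtlas t) (ht' : MemTrivializationAtlas t') {x : X}
    (hx : x ∈ t.baseSet) (hx' : x ∈ t'.baseSet) :
    localFrame t x = (t.coordChangeL ℂ t' x (1 : ℂ)) • localFrame t' x := by
  have : t.IsLinear ℂ := VectorBundle.trivialization_linear' t
  have : t'.IsLinear ℂ := VectorBundle.trivialization_linear' t'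
  have h1 : localFrame t x = (t.linearEquivAt ℂ x hx).symm 1 := by
    rw [Bundle.Trivialization.linearEquivAt_symm_apply]
    rfl
  have h2 : localFrame t' x = (t'.linearEquivAt ℂ x hx').symm 1 := by
    rw [Bundle.Trivialization.linearEquivAt_symm_apply]
    rfl
  rw [h2, ← map_smul, smul_eq_mul, mul_one, LinearEquiv.eq_symm_apply]
  rw [Bundle.Trivialization.coordChangeL_apply t t' ⟨hx, hx'⟩]
  rfl

theorem coordChangeL_ne_zero (ht : MemTrivializationAtlas t) (ht' : MemTrivializationAtlas t')
    {x : X} (hx : x ∈ t.baseSet) (hx' : x ∈ t'.baseSet) :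
    t.coordChangeL ℂ t' x (1 : ℂ) ≠ 0 := by
  intro h0
  have := localFrame_trans ht ht' hx hx'
  rw [h0, zero_smul] at this
  exact localFrame_ne_zero ht hx this

theorem contDiffAt_coordChange (hφ : φ ∈ holCharts n X) (ht : MemTrivializationAtlas t)
    (ht' : MemTrivializationAtlas t') {z : Cn n} (hz : z ∈ φ.target)
    (hx : φ.symm z ∈ t.baseSet) (hx' : φ.symm z ∈ t'.baseSet) :
    ContDiffAt ℂ ω (fun w => t.coordChangeL ℂ t' (φ.symm w) (1 : ℂ)) z := by
  have h1 := contMDiffOn_coordChangeL (IB := 𝓘(ℂ, Cn n)) (n := ω) (F := ℂ) t t'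
  have h2 := (h1.contMDiffAt ((t.open_baseSet.inter t'.open_baseSet).mem_nhds ⟨hx, hx'⟩)).comp z
    (contMDiffAt_symm_of_mem_maximalAtlas hφ hz)
  rw [contMDiffAt_iff_contDiffAt] at h2
  exact h2.clm_apply contDiffAt_const

theorem form_localFrame_pos (ht : MemTrivializationAtlas t) {x : X} (hx : x ∈ t.baseSet) :
    0 < (h.form x (localFrame t x) (localFrame t x)).re :=
  h.pos x _ (localFrame_ne_zero ht hx)

theorem isOpen_frameDomain (φ : OpenPartialHomeomorph X (Cn n))
    (t : Bundle.Trivialization ℂ (Bundle.TotalSpace.proj : Bundle.TotalSpace ℂ L → X)) :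
    IsOpen (φ.target ∩ φ.symm ⁻¹' t.baseSet) :=
  φ.symm.isOpen_inter_preimage t.open_baseSet

theorem contDiffAt_logH (hφ : φ ∈ holCharts n X) (ht : MemTrivializationAtlas t) {z : Cn n}
    (hz : z ∈ φ.target) (hx : φ.symm z ∈ t.baseSet) : ContDiffAt ℝ ∞ (logH h φ t) z := by
  have h1 := (h.smooth φ hφ t ht).contDiffAt ((isOpen_frameDomain φ t).mem_nhds ⟨hz, hx⟩)
  exact Complex.ofRealCLM.contDiff.contDiffAt.comp z
    ((Complex.reCLM.contDiff.contDiffAt.comp z h1).log (form_localFrame_pos h ht hx).ne')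

theorem logH_chart_trans {z : Cn n} (hz' : φ.symm z ∈ φ'.source) :
    logH h φ t z = logH h φ' t (φ' (φ.symm z)) := by
  rw [logH, logH, φ'.left_inv hz']

theorem logH_frame_trans (ht : MemTrivializationAtlas t) (ht' : MemTrivializationAtlas t')
    {z : Cn n} (hx : φ.symm z ∈ t.baseSet) (hx' : φ.symm z ∈ t'.baseSet) :
    logH h φ t z = logH h φ t' z +
      (Real.log (‖t.coordChangeL ℂ t' (φ.symm z) (1 : ℂ)‖ ^ 2) : ℂ) := by
  have h0 := coordChangeL_ne_zero ht ht' hx hx'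
  have hp := form_localFrame_pos h ht' hx'
  rw [logH, logH, localFrame_trans ht ht' hx hx']
  set c := t.coordChangeL ℂ t' (φ.symm z) (1 : ℂ)
  simp only [map_smulₛₗ, LinearMap.smul_apply, smul_eq_mul]
  have : (c * (conj c * h.form (φ.symm z) (localFrame t' (φ.symm z))
      (localFrame t' (φ.symm z)))).re =
      (h.form (φ.symm z) (localFrame t' (φ.symm z)) (localFrame t' (φ.symm z))).re * ‖c‖ ^ 2 := by
    rw [← mul_assoc, Complex.mul_conj, Complex.re_ofReal_mul,
      Complex.normSq_eq_norm_sq, mul_comm]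
  simp only [RingHom.id_apply] at this ⊢
  rw [this, Real.log_mul hp.ne' (pow_ne_zero _ (norm_ne_zero_iff.2 h0))]
  push_cast
  rfl

theorem curvCoeff_apply (z : Cn n) (k j : Fin n) :
    curvCoeff h φ t z k j = -dWirt j (dWirtBar k (logH h φ t)) z := rfl

/-- A change of frame adds log |c|² to log h, where c is a nonvanishing holomorphic transition
function, and log |c|² is pluriharmonic. -/
theorem curvCoeff_frame_trans (hφ : φ ∈ holCharts n X) (ht : MemTrivializationAtlas t)
    (ht' : MemTrivializationAtlas t') {z : Cn n} (hz : z ∈ φ.target)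
    (hx : φ.symm z ∈ t.baseSet) (hx' : φ.symm z ∈ t'.baseSet) :
    curvCoeff h φ t z = curvCoeff h φ t' z := by
  ext k j
  rw [curvCoeff_apply, curvCoeff_apply]
  set l : Cn n → ℂ := fun w => (Real.log (‖t.coordChangeL ℂ t' (φ.symm w) (1 : ℂ)‖ ^ 2) : ℂ)
  have hev : logH h φ t =ᶠ[nhds z] fun w => logH h φ t' w + l w := by
    filter_upwards [((isOpen_frameDomain φ t).inter (isOpen_frameDomain φ t')).mem_nhds
      ⟨⟨hz, hx⟩, ⟨hz, hx'⟩⟩] with w hw using logH_frame_trans h ht ht' hw.1.2 hw.2.2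
  have hs' := contDiffAt_logH h hφ ht' hz hx'
  have hl : ContDiffAt ℝ ∞ l z := by
    have h1 : ContDiffAt ℝ ∞ (fun w => logH h φ t w - logH h φ t' w) z :=
      (contDiffAt_logH h hφ ht hz hx).sub hs'
    refine h1.congr_of_eventuallyEq ?_
    filter_upwards [hev] with w hw
    rw [hw]; ring
  have e1 : dWirtBar k (logH h φ t) =ᶠ[nhds z]
      fun w => dWirtBar k (logH h φ t') w + dWirtBar k l w := by
    filter_upwards [hev.eventuallyEq_nhds, (hs'.of_le (m := 1) (by simp)).eventually (by simp),
      (hl.of_le (m := 1) (by simp)).eventually (by simp)] with w h1 h2 h3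
    rw [dWirtBar_eq_cder, cder_congr _ h1, cder_add _ (h2.differentiableAt (by simp))
      (h3.differentiableAt (by simp))]
    rfl
  rw [dWirt_eq_cder, cder_congr _ e1,
    cder_add _ ((contDiffAt_dWirtBar hs' k).differentiableAt (by simp))
      ((contDiffAt_dWirtBar hl k).differentiableAt (by simp)), ← dWirt_eq_cder, ← dWirt_eq_cder]
  have h0 := dWirt_dWirtBar_log_norm
    ((contDiffAt_coordChange hφ ht ht' hz hx hx').of_le (m := ∞) le_top)
    (coordChangeL_ne_zero ht ht' hx hx') j k
  have h0' : dWirt j (dWirtBar k l) z = 0 := h0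
  rw [h0', add_zero]

theorem contDiffAt_jac {κ : Cn n → Cn n} {z : Cn n} (hκ : ContDiffAt ℂ ω κ z) (a i : Fin n) :
    ContDiffAt ℂ ω (fun w => jac κ w a i) z := by
  have h1 := (hκ.fderiv_right (m := ω) (by simp)).clm_apply
    (contDiffAt_const (c := (Pi.single i 1 : Cn n)))
  exact contDiffAt_pi.1 h1 a

/-- The conjugated Jacobian entries produced by the ∂̄ derivative are antiholomorphic, so the
subsequent ∂ derivative does not see them and no second derivatives of the transition map occur. -/
theorem curvCoeff_chart_trans (hφ : φ ∈ holCharts n X) (hφ' : φ' ∈ holCharts n X)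
    (ht : MemTrivializationAtlas t) {z : Cn n} (hz : z ∈ φ.target)
    (hz' : φ.symm z ∈ φ'.source) (hx : φ.symm z ∈ t.baseSet) :
    curvCoeff h φ t z = (jac (fun z => φ' (φ.symm z)) z)ᴴ *
      curvCoeff h φ' t (φ' (φ.symm z)) * jac (fun z => φ' (φ.symm z)) z := by
  set κ : Cn n → Cn n := fun z => φ' (φ.symm z) with hκ
  have hdom : ∀ᶠ w in nhds z, w ∈ φ.target ∧ φ.symm w ∈ φ'.source ∧ φ.symm w ∈ t.baseSet := by
    filter_upwards [((isOpen_frameDomain φ t).inter (isOpen_transDomain φ φ')).mem_nhds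
      ⟨⟨hz, hx⟩, ⟨hz, hz'⟩⟩] with w hw using ⟨hw.1.1, hw.2.2, hw.1.2⟩
  have hℓ : ∀ w, φ.symm w ∈ φ'.source → φ.symm w ∈ t.baseSet →
      ContDiffAt ℝ ∞ (logH h φ' t) (κ w) := by
    intro w h1 h2
    refine contDiffAt_logH h hφ' ht (φ'.map_source h1) ?_
    rwa [hκ, φ'.left_inv h1]
  have hev : logH h φ t =ᶠ[nhds z] fun w => logH h φ' t (κ w) := by
    filter_upwards [hdom] with w hw using logH_chart_trans h hw.2.1
  have hκd : ∀ w, w ∈ φ.target → φ.symm w ∈ φ'.source → ContDiffAt ℂ ω κ w :=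
    fun w h1 h2 => contDiffAt_trans hφ hφ' h1 h2
  ext k j
  have e1 : dWirtBar k (logH h φ t) =ᶠ[nhds z]
      fun w => ∑ a, conj (jac κ w a k) * dWirtBar a (logH h φ' t) (κ w) := by
    filter_upwards [hev.eventuallyEq_nhds, hdom] with w h1 h2
    rw [dWirtBar_eq_cder, cder_congr _ h1, ← dWirtBar_eq_cder]
    exact dWirtBar_comp_hol ((hκd w h2.1 h2.2.1).differentiableAt (by simp))
      ((hℓ w h2.2.1 h2.2.2).differentiableAt (by simp)) k
  have hκz := hκd z hz hz'
  have hκz' : DifferentiableAt ℂ κ z := hκz.differentiableAt (by simp)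
  have hj : ∀ a, DifferentiableAt ℂ (fun w => jac κ w a k) z := fun a =>
    (contDiffAt_jac hκz a k).differentiableAt (by simp)
  have hB : ∀ a, DifferentiableAt ℝ (dWirtBar a (logH h φ' t)) (κ z) := fun a =>
    (contDiffAt_dWirtBar (hℓ z hz' hx) a).differentiableAt (by simp)
  have hB' : ∀ a, DifferentiableAt ℝ (fun w => dWirtBar a (logH h φ' t) (κ w)) z := fun a =>
    (hB a).comp z (hκz'.restrictScalars ℝ)
  have hjc : ∀ a, DifferentiableAt ℝ (fun w => conj (jac κ w a k)) z := fun a =>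
    DifferentiableAt.conj' ((hj a).restrictScalars ℝ)
  rw [curvCoeff_apply, dWirt_eq_cder, cder_congr _ e1,
    cder_sum _ fun a _ => (hjc a).fun_mul (hB' a)]
  have e2 : ∀ a, cder (wirtL j) (fun w => conj (jac κ w a k) *
      dWirtBar a (logH h φ' t) (κ w)) z =
      conj (jac κ z a k) * ∑ b, jac κ z b j * dWirt b (dWirtBar a (logH h φ' t)) (κ z) := by
    intro a
    rw [cder_mul _ (hjc a) (hB' a), ← dWirt_eq_cder, ← dWirt_eq_cder,
      dWirt_conj ((hj a).restrictScalars ℝ), dWirtBar_hol (hj a), map_zero, mul_zero, add_zero,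
      dWirt_comp_hol hκz' (hB a)]
  simp only [e2, Matrix.mul_apply, conjTranspose_apply, curvCoeff_apply, Finset.mul_sum,
    Finset.sum_mul, ← Finset.sum_neg_distrib]
  rw [Finset.sum_comm]
  refine Finset.sum_congr rfl fun b _ => Finset.sum_congr rfl fun a _ => ?_
  rw [RCLike.star_def]
  ring

theorem smoothM_curvCoeff (hφ : φ ∈ holCharts n X) (ht : MemTrivializationAtlas t) {z : Cn n}
    (hz : z ∈ φ.target) (hx : φ.symm z ∈ t.baseSet) : SmoothM (curvCoeff h φ t) z := by
  intro k j
  exact (contDiffAt_dWirt (contDiffAt_dWirtBar (contDiffAt_logH h hφ ht hz hx) k) j).neg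

/-- log h is real valued, and ∂ commutes with ∂̄. -/
theorem curvCoeff_isHermitian (hφ : φ ∈ holCharts n X) (ht : MemTrivializationAtlas t) {z : Cn n}
    (hz : z ∈ φ.target) (hx : φ.symm z ∈ t.baseSet) : (curvCoeff h φ t z).IsHermitian := by
  have hs := contDiffAt_logH h hφ ht hz hx
  ext k j
  rw [conjTranspose_apply, curvCoeff_apply, curvCoeff_apply, RCLike.star_def, map_neg,
    conj_dWirt ((contDiffAt_dWirtBar hs j).differentiableAt (by simp))]
  have e : (fun w => conj (dWirtBar j (logH h φ t) w)) =ᶠ[nhds z] dWirt j (logH h φ t) := by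
    filter_upwards [(hs.of_le (m := 1) (by simp)).eventually (by simp)] with w hw
    rw [conj_dWirtBar (hw.differentiableAt (by simp))]
    congr 1
    ext y
    exact Complex.conj_ofReal _
  rw [dWirtBar_eq_cder, cder_congr _ e, ← dWirtBar_eq_cder, dWirt_dWirtBar_comm hs]

/-- The symmetry is the commutation of ∂_i and ∂_j on the function ∂_{k̄} log h. -/
theorem curvCoeff_closed (hφ : φ ∈ holCharts n X) (ht : MemTrivializationAtlas t) {z : Cn n}
    (hz : z ∈ φ.target) (hx : φ.symm z ∈ t.baseSet) (i j k : Fin n) :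
    dWirt i (fun w => curvCoeff h φ t w k j) z = dWirt j (fun w => curvCoeff h φ t w k i) z := by
  have hs := contDiffAt_dWirtBar (contDiffAt_logH h hφ ht hz hx) k
  simp only [curvCoeff_apply]
  rw [dWirt_eq_cder, cder_neg, dWirt_eq_cder j, cder_neg, ← dWirt_eq_cder, ← dWirt_eq_cder,
    dWirt_comm hs]

theorem goodPair (g : KahlerMetric n X) (hφ : φ ∈ holCharts n X) (ht : MemTrivializationAtlas t)
    {z : Cn n} (hz : z ∈ φ.target) (hx : φ.symm z ∈ t.baseSet) :
    GoodPair (gCoeff g φ) (curvCoeff h φ t) z where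
  smoothG := smoothM_gCoeff g hφ hz
  smoothF := smoothM_curvCoeff h hφ ht hz hx
  pos := by
    filter_upwards [φ.open_target.mem_nhds hz] with w hw using gCoeff_posDef g hφ hw
  herm := by
    filter_upwards [(isOpen_frameDomain φ t).mem_nhds ⟨hz, hx⟩] with w hw using
      curvCoeff_isHermitian h hφ ht hw.1 hw.2

theorem goodData (g : KahlerMetric n X) {Y : Sec n X} (hY : IsSmoothSec Y)
    (hφ : φ ∈ holCharts n X) (ht : MemTrivializationAtlas t)
    {z : Cn n} (hz : z ∈ φ.target) (hx : φ.symm z ∈ t.baseSet) :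
    GoodData (gCoeff g φ) (curvCoeff h φ t) (secCoeff Y φ) z where
  toGoodPair := goodPair h g hφ ht hz hx
  closedG i j k := g.closed φ hφ i j k z hz
  closedF i j k := curvCoeff_closed h hφ ht hz hx i j k
  smoothY1 i := by
    have h1 := (hY φ hφ).contDiffAt (φ.open_target.mem_nhds hz)
    exact contDiffAt_pi.1 (contDiff_fst.contDiffAt.comp z h1) i
  smoothY2 i := by
    have h1 := (hY φ hφ).contDiffAt (φ.open_target.mem_nhds hz)
    exact contDiffAt_pi.1 (contDiff_snd.contDiffAt.comp z h1) i

/-- The pointwise divergence identity. -/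
theorem divVIn_eq (g : KahlerMetric n X) {Y : Sec n X} (hY : IsSmoothSec Y)
    (hφ : φ ∈ holCharts n X) (ht : MemTrivializationAtlas t) {x : X}
    (hx : x ∈ φ.source ∩ t.baseSet) :
    divVIn g h φ t Y x = divHIn g h φ t Y x + meanPairIn g h φ t Y x :=
  (goodData h g hY hφ ht (φ.map_source hx.1) (by rw [φ.left_inv hx.1]; exact hx.2)).divVLoc_eq

end Curvature

/-! ### Independence of charts and frames -/

section LinearInvariance

open Matrix

variable {n : ℕ} {J G F : Matrix (Fin n) (Fin n) ℂ}

theorem isUnit_det_conjTranspose (hJ : IsUnit J.det) : IsUnit Jᴴ.det := by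
  rw [det_conjTranspose]
  exact hJ.star

theorem etaMat_trans (hJ : IsUnit J.det) (G F : Matrix (Fin n) (Fin n) ℂ) :
    etaMat (Jᴴ * G * J) (Jᴴ * F * J) = Jᴴ * etaMat G F * J := by
  have hJ' := isUnit_det_conjTranspose hJ
  rw [etaMat, etaMat, Matrix.mul_inv_rev, Matrix.mul_inv_rev, mul_add, add_mul]
  congr 1
  have e : Jᴴ * F * J * (J⁻¹ * (G⁻¹ * Jᴴ⁻¹)) * (Jᴴ * F * J) =
      Jᴴ * F * (J * J⁻¹) * G⁻¹ * (Jᴴ⁻¹ * Jᴴ) * F * J := by simp only [Matrix.mul_assoc]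
  rw [e, mul_nonsing_inv _ hJ, nonsing_inv_mul _ hJ', Matrix.mul_one, Matrix.mul_one]
  simp only [Matrix.mul_assoc]

theorem det_trans (J G : Matrix (Fin n) (Fin n) ℂ) :
    (Jᴴ * G * J).det = (‖J.det‖ ^ 2 : ℝ) * G.det := by
  rw [det_mul, det_mul, det_conjTranspose, RCLike.star_def, mul_right_comm, Complex.conj_mul']
  push_cast
  rfl

theorem zetaLoc_trans (hJ : IsUnit J.det) (hG : G.det ≠ 0) (F : Matrix (Fin n) (Fin n) ℂ) :
    zetaLoc (Jᴴ * G * J) (Jᴴ * F * J) = zetaLoc G F := by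
  have hJ0 := hJ.ne_zero
  have hJ' := (isUnit_det_conjTranspose hJ).ne_zero
  have e : Jᴴ * G * J + Complex.I • (Jᴴ * F * J) = Jᴴ * (G + Complex.I • F) * J := by
    rw [mul_add, add_mul, Matrix.mul_smul, Matrix.smul_mul]
  rw [zetaLoc_eq _ _ hG, zetaLoc_eq _ _ (by
    rw [det_mul, det_mul]; exact mul_ne_zero (mul_ne_zero hJ' hG) hJ0), e, det_mul, det_mul,
    det_mul, det_mul]
  field_simp

/-- The endomorphism g⁻¹F is conjugated by J, which leaves its characteristic polynomial unchanged.
-/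
theorem thetaLoc_trans (hJ : IsUnit J.det) (G F : Matrix (Fin n) (Fin n) ℂ) :
    thetaLoc (Jᴴ * G * J) (Jᴴ * F * J) = thetaLoc G F := by
  have hJ' := isUnit_det_conjTranspose hJ
  have e : (Jᴴ * G * J)⁻¹ * (Jᴴ * F * J) = J⁻¹ * (G⁻¹ * F) * J := by
    rw [Matrix.mul_inv_rev, Matrix.mul_inv_rev]
    have : J⁻¹ * (G⁻¹ * Jᴴ⁻¹) * (Jᴴ * F * J) = J⁻¹ * (G⁻¹ * (Jᴴ⁻¹ * Jᴴ) * F) * J := by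
      simp only [Matrix.mul_assoc]
    rw [this, nonsing_inv_mul _ hJ', Matrix.mul_one]
  rw [thetaLoc, e, thetaLoc]
  have hu := Matrix.charpoly_units_conj' (nonsingInvUnit J hJ) (G⁻¹ * F)
  have e3 : (nonsingInvUnit J hJ).val = J := rfl
  rw [e3] at hu
  rw [hu]

theorem inv_eta_trans (hJ : IsUnit J.det) (G F : Matrix (Fin n) (Fin n) ℂ) :
    (etaMat (Jᴴ * G * J) (Jᴴ * F * J))⁻¹ * Jᴴ = J⁻¹ * (etaMat G F)⁻¹ := by
  have hJ' := isUnit_det_conjTranspose hJ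
  rw [etaMat_trans hJ, Matrix.mul_inv_rev, Matrix.mul_inv_rev, Matrix.mul_assoc, Matrix.mul_assoc,
    nonsing_inv_mul _ hJ', Matrix.mul_one]

theorem mul_inv_trans (hJ : IsUnit J.det) (G F : Matrix (Fin n) (Fin n) ℂ) :
    (Jᴴ * F * J) * (Jᴴ * G * J)⁻¹ * Jᴴ = Jᴴ * (F * G⁻¹) := by
  have hJ' := isUnit_det_conjTranspose hJ
  rw [Matrix.mul_inv_rev, Matrix.mul_inv_rev]
  have : Jᴴ * F * J * (J⁻¹ * (G⁻¹ * Jᴴ⁻¹)) * Jᴴ = Jᴴ * F * (J * J⁻¹) * G⁻¹ * (Jᴴ⁻¹ * Jᴴ) := by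
    simp only [Matrix.mul_assoc]
  rw [this, nonsing_inv_mul _ hJ', mul_nonsing_inv _ hJ, Matrix.mul_one, Matrix.mul_one,
    Matrix.mul_assoc]

theorem assocLoc_trans (hJ : IsUnit J.det) (hG : G.PosDef) (hF : F.IsHermitian)
    (hG' : (Jᴴ * G * J).PosDef) (y1 y2 : Fin n → ℂ) :
    J *ᵥ assocLoc (Jᴴ * G * J) (Jᴴ * F * J) (y1, Jᴴ *ᵥ y2) = assocLoc G F (J *ᵥ y1, y2) := by
  have hF' : (Jᴴ * F * J).IsHermitian := isHermitian_conjTranspose_mul_mul J hF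
  rw [assocLoc_eq hG' hF', assocLoc_eq hG hF]
  have e : (Jᴴ * G * J) *ᵥ y1 + (Jᴴ * F * J * (Jᴴ * G * J)⁻¹) *ᵥ (Jᴴ *ᵥ y2) =
      Jᴴ *ᵥ (G *ᵥ (J *ᵥ y1) + (F * G⁻¹) *ᵥ y2) := by
    rw [mulVec_mulVec, mul_inv_trans hJ, mulVec_add]
    simp only [mulVec_mulVec, Matrix.mul_assoc]
  dsimp only
  rw [e, mulVec_mulVec _ _ Jᴴ, inv_eta_trans hJ, mulVec_mulVec, ← Matrix.mul_assoc,
    mul_nonsing_inv _ hJ, Matrix.one_mul]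

/-- Invariance of a contraction: the factor J from the chain rule meets the factor J⁻¹ from the
inverse metric. -/
theorem sum_mulVec_trans (hJ : IsUnit J.det) (C : Matrix (Fin n) (Fin n) ℂ)
    (m : Fin n → Fin n → ℂ) :
    ∑ i, ((J⁻¹ * C) *ᵥ ∑ b, J b i • m b) i = ∑ b, (C *ᵥ m b) b := by
  have h1 : ∀ i, ((J⁻¹ * C) *ᵥ ∑ b, J b i • m b) i =
      ∑ a, ∑ b, (C *ᵥ m b) a * (J b i * J⁻¹ i a) := by
    intro i
    rw [← mulVec_mulVec, mulVec_sum, mulVec, dotProduct]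
    refine Finset.sum_congr rfl fun a _ => ?_
    rw [Finset.sum_apply, Finset.mul_sum]
    refine Finset.sum_congr rfl fun b _ => ?_
    rw [mulVec_smul, Pi.smul_apply, smul_eq_mul]
    ring
  simp only [h1]
  rw [Finset.sum_comm]
  have h2 : ∀ a, ∑ i, ∑ b, (C *ᵥ m b) a * (J b i * J⁻¹ i a) = (C *ᵥ m a) a := by
    intro a
    rw [Finset.sum_comm]
    simp only [← Finset.mul_sum]
    have : ∀ b, ∑ i, J b i * J⁻¹ i a = (1 : Matrix (Fin n) (Fin n) ℂ) b a := by
      intro b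
      rw [← mul_nonsing_inv _ hJ, Matrix.mul_apply]
    simp [this, Matrix.one_apply]
  exact Finset.sum_congr rfl fun a _ => h2 a

end LinearInvariance

/-! ### Tensoriality of the differential expressions under holomorphic coordinate changes -/

section LocalInvariance

open Matrix

variable {n : ℕ} {κ : Cn n → Cn n} {z : Cn n} {G F G' F' : Cn n → Matrix (Fin n) (Fin n) ℂ}
  {Y Y' : Cn n → Fib n}

/-- Components of type (0,1) transform by the conjugated Jacobian, which is antiholomorphic. So ∂ of
such a covector is tensorial and needs no connection. -/
theorem vder_covector_trans (hκ : ContDiffAt ℂ ω κ z) {a a' : Cn n → Fin n → ℂ}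
    (ha' : ∀ i, DifferentiableAt ℝ (fun w => a' w i) (κ z))
    (h : ∀ᶠ w in nhds z, a w = (jac κ w)ᴴ *ᵥ a' (κ w)) (i : Fin n) :
    vder (wirtL i) a z = (jac κ z)ᴴ *ᵥ ∑ b, jac κ z b i • vder (wirtL b) a' (κ z) := by
  have hκ' : DifferentiableAt ℂ κ z := hκ.differentiableAt (by simp)
  ext k
  have e : (fun w => a w k) =ᶠ[nhds z] fun w => ∑ c, conj (jac κ w c k) * a' (κ w) c := by
    filter_upwards [h] with w hw
    rw [hw]
    rfl
  have hj : ∀ c, DifferentiableAt ℂ (fun w => jac κ w c k) z := fun c =>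
    (contDiffAt_jac hκ c k).differentiableAt (by simp)
  have hjc : ∀ c, DifferentiableAt ℝ (fun w => conj (jac κ w c k)) z := fun c =>
    DifferentiableAt.conj' ((hj c).restrictScalars ℝ)
  have hB : ∀ c, DifferentiableAt ℝ (fun w => a' (κ w) c) z := fun c =>
    (ha' c).comp z (hκ'.restrictScalars ℝ)
  rw [vder, cder_congr _ e, cder_sum _ fun c _ => (hjc c).fun_mul (hB c), mulVec, dotProduct]
  refine Finset.sum_congr rfl fun c _ => ?_
  rw [cder_mul _ (hjc c) (hB c), ← dWirt_eq_cder, ← dWirt_eq_cder,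
    dWirt_conj ((hj c).restrictScalars ℝ), dWirtBar_hol (hj c), map_zero, mul_zero, add_zero,
    dWirt_comp_hol (f := fun v => a' v c) hκ' (ha' c), Finset.sum_apply]
  rfl

variable (hκ : ContDiffAt ℂ ω κ z) (hJ : IsUnit (jac κ z).det)
  (hG : ∀ᶠ w in nhds z, G w = (jac κ w)ᴴ * G' (κ w) * jac κ w)
  (hF : ∀ᶠ w in nhds z, F w = (jac κ w)ᴴ * F' (κ w) * jac κ w)
  (hY1 : ∀ᶠ w in nhds z, (Y' (κ w)).1 = jac κ w *ᵥ (Y w).1)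
  (hY2 : ∀ᶠ w in nhds z, (Y w).2 = (jac κ w)ᴴ *ᵥ (Y' (κ w)).2)
include hκ hJ hG hF hY1 hY2

theorem meanPair_trans (h : GoodData G F Y z) (h' : GoodData G' F' Y' (κ z)) :
    pairing (G z) (meanCurvLoc G F z) (Y z) =
      pairing (G' (κ z)) (meanCurvLoc G' F' (κ z)) (Y' (κ z)) := by
  rw [pairing_meanCurvLoc h.toGoodPair, pairing_meanCurvLoc h'.toGoodPair]
  have hκ' : DifferentiableAt ℂ κ z := hκ.differentiableAt (by simp)
  have hJn : ∀ᶠ w in nhds z, IsUnit (jac κ w).det := by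
    have hc : ContinuousAt (fun w => (jac κ w).det) z :=
      (SmoothM.det (A := jac κ) fun a i =>
        ((contDiffAt_jac hκ a i).restrict_scalars ℝ).of_le le_top).continuousAt
    filter_upwards [hc.eventually_ne hJ.ne_zero] with w hw using hw.isUnit
  have e : (fun w => (thetaLoc (G w) (F w) : ℂ)) =ᶠ[nhds z]
      fun w => (thetaLoc (G' (κ w)) (F' (κ w)) : ℂ) := by
    filter_upwards [hG, hF, hJn] with w h1 h2 h3
    rw [h1, h2, thetaLoc_trans h3]
  have e2 : ∀ p, dWirt p (fun w => (thetaLoc (G w) (F w) : ℂ)) z =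
      ∑ b, jac κ z b p * dWirt b (fun w => (thetaLoc (G' w) (F' w) : ℂ)) (κ z) := by
    intro p
    rw [dWirt_eq_cder, cder_congr _ e, ← dWirt_eq_cder]
    exact dWirt_comp_hol (f := fun w => (thetaLoc (G' w) (F' w) : ℂ)) hκ'
      (h'.toGoodPair.smooth_theta.differentiableAt (by simp)) p
  have e3 : (Y z).2 - F z *ᵥ (Y z).1 =
      (jac κ z)ᴴ *ᵥ ((Y' (κ z)).2 - F' (κ z) *ᵥ (Y' (κ z)).1) := by
    rw [hY2.self_of_nhds, hF.self_of_nhds, hY1.self_of_nhds, mulVec_sub]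
    simp only [mulVec_mulVec, Matrix.mul_assoc]
  have e4 : (etaMat (G z) (F z))⁻¹ *ᵥ ((Y z).2 - F z *ᵥ (Y z).1) =
      (jac κ z)⁻¹ *ᵥ ((etaMat (G' (κ z)) (F' (κ z)))⁻¹ *ᵥ
        ((Y' (κ z)).2 - F' (κ z) *ᵥ (Y' (κ z)).1)) := by
    rw [e3, mulVec_mulVec, hG.self_of_nhds, hF.self_of_nhds, inv_eta_trans hJ, mulVec_mulVec]
  set y := (etaMat (G' (κ z)) (F' (κ z)))⁻¹ *ᵥ ((Y' (κ z)).2 - F' (κ z) *ᵥ (Y' (κ z)).1)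
  rw [e4]
  simp only [e2, Finset.sum_mul]
  rw [Finset.sum_comm]
  refine Finset.sum_congr rfl fun b _ => ?_
  have e5 : y b = (jac κ z *ᵥ ((jac κ z)⁻¹ *ᵥ y)) b := by
    rw [mulVec_mulVec, mul_nonsing_inv _ hJ, one_mulVec]
  rw [e5, mulVec, dotProduct, Finset.mul_sum]
  refine Finset.sum_congr rfl fun p _ => ?_
  ring

/-- With the index lowered, gY₁ is a (0,1)-covector just as Y₂ is, and the tensoriality of ∂ on such
covectors handles both terms. -/
theorem divHLoc_trans (h : GoodData G F Y z) (h' : GoodData G' F' Y' (κ z)) :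
    divHLoc G F Y z = divHLoc G' F' Y' (κ z) := by
  have d1 : ∀ {G F : Cn n → Matrix (Fin n) (Fin n) ℂ} {Y : Cn n → Fib n} {z : Cn n},
      GoodData G F Y z → ∀ i, mder (wirtL i) G z *ᵥ (Y z).1 +
        G z *ᵥ vder (wirtL i) (fun w => (Y w).1) z =
        vder (wirtL i) (fun w => G w *ᵥ (Y w).1) z := fun hd i =>
    (vder_mulVec (wirtL i) hd.smoothG.diffM
      fun k => (hd.smoothY1 k).differentiableAt (by simp)).symm
  rw [divHLoc_eq (det_ne_zero_of_posDef h.posDef), divHLoc_eq (det_ne_zero_of_posDef h'.posDef)]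
  simp only [d1 h, d1 h']
  have e1 : ∀ᶠ w in nhds z, G w *ᵥ (Y w).1 =
      (jac κ w)ᴴ *ᵥ (fun v => G' v *ᵥ (Y' v).1) (κ w) := by
    filter_upwards [hG, hY1] with w h1 h2
    rw [h1, h2]
    simp only [mulVec_mulVec, Matrix.mul_assoc]
  have s1 : ∀ i, DifferentiableAt ℝ (fun w => (G' w *ᵥ (Y' w).1) i) (κ z) := fun i =>
    (h'.smoothG.mulVec h'.smoothY1 i).differentiableAt (by simp)
  have s2 : ∀ i, DifferentiableAt ℝ (fun w => (Y' w).2 i) (κ z) := fun i =>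
    (h'.smoothY2 i).differentiableAt (by simp)
  have t1 := vder_covector_trans (a' := fun v => G' v *ᵥ (Y' v).1) hκ s1 e1
  have t2 := vder_covector_trans (a' := fun v => (Y' v).2) hκ s2 hY2
  have key : ∀ i, (etaMat (G z) (F z))⁻¹ *ᵥ (vder (wirtL i) (fun w => G w *ᵥ (Y w).1) z +
      (F z * (G z)⁻¹) *ᵥ vder (wirtL i) (fun w => (Y w).2) z) =
      ((jac κ z)⁻¹ * (etaMat (G' (κ z)) (F' (κ z)))⁻¹) *ᵥ ∑ b, jac κ z b i •
        (vder (wirtL b) (fun w => G' w *ᵥ (Y' w).1) (κ z) + (F' (κ z) * (G' (κ z))⁻¹) *ᵥ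
          vder (wirtL b) (fun w => (Y' w).2) (κ z)) := by
    intro i
    rw [t1 i, t2 i, mulVec_mulVec, hG.self_of_nhds, hF.self_of_nhds, mul_inv_trans hJ,
      ← mulVec_mulVec _ (jac κ z)ᴴ, ← mulVec_add, mulVec_mulVec, inv_eta_trans hJ, mulVec_sum,
      ← Finset.sum_add_distrib]
    congr 1
    exact Finset.sum_congr rfl fun b _ => by rw [smul_add, mulVec_smul]
  simp only [key]
  exact sum_mulVec_trans hJ _ _

end LocalInvariance

/-! ### The global objects in charts -/

section LocalSmooth

open Matrix

variable {n : ℕ} {z : Cn n} {G F : Cn n → Matrix (Fin n) (Fin n) ℂ} {Y : Cn n → Fib n}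

theorem GoodData.continuousAt_meanPair (h : GoodData G F Y z)
    (hp : ∀ᶠ w in nhds z, GoodPair G F w) :
    ContinuousAt (fun w => pairing (G w) (meanCurvLoc G F w) (Y w)) z := by
  have e : (fun w => pairing (G w) (meanCurvLoc G F w) (Y w)) =ᶠ[nhds z] fun w =>
      ∑ p, dWirt p (fun w => (thetaLoc (G w) (F w) : ℂ)) w *
        ((etaMat (G w) (F w))⁻¹ *ᵥ ((Y w).2 - F w *ᵥ (Y w).1)) p := by
    filter_upwards [hp] with w hw using pairing_meanCurvLoc hw _
  refine ContinuousAt.congr ?_ e.symm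
  have hη0 := det_ne_zero_of_posDef (etaMat_posDef h.posDef h.isHermitian)
  have h1 := ((smoothM_eta h.toGoodPair).inv hη0).mulVec
    (v := fun w => (Y w).2 - F w *ᵥ (Y w).1)
    (fun j => (h.smoothY2 j).sub (h.smoothF.mulVec h.smoothY1 j))
  refine (ContDiffAt.sum (n := ∞) fun p _ => ?_ : ContDiffAt ℝ ∞ _ z).continuousAt
  exact (contDiffAt_dWirt h.toGoodPair.smooth_theta p).mul (h1 p)

theorem GoodData.smooth_densD_mul (h : GoodData G F Y z) (i : Fin n) :
    ContDiffAt ℝ ∞ (fun w => (densD (G w) (F w) : ℂ) * assocLoc (G w) (F w) (Y w) i) z :=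
  h.toGoodPair.smooth_densD.mul (h.smooth_assocLoc i)

/-- Read backwards, the divergence identity expresses div_h through the divergence of a smooth field
and the mean curvature pairing, both already known to be continuous. -/
theorem GoodData.continuousAt_divHLoc (h : GoodData G F Y z)
    (hp : ∀ᶠ w in nhds z, GoodData G F Y w) : ContinuousAt (divHLoc G F Y) z := by
  have e : divHLoc G F Y =ᶠ[nhds z] fun w =>
      (∑ i, dWirt i (fun w => (densD (G w) (F w) : ℂ) * assocLoc (G w) (F w) (Y w) i) w) /
        densD (G w) (F w) - pairing (G w) (meanCurvLoc G F w) (Y w) := by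
    filter_upwards [hp] with w hw
    have := (densD_pos hw.posDef hw.isHermitian).ne'
    rw [hw.sum_dWirt_densD_mul, mul_div_cancel_left₀ _ (by exact_mod_cast this)]
    ring
  refine ContinuousAt.congr ?_ e.symm
  refine ContinuousAt.sub (ContinuousAt.div ?_ h.toGoodPair.smooth_densD.continuousAt ?_)
    (h.continuousAt_meanPair (hp.mono fun w hw => hw.toGoodPair))
  · exact (ContDiffAt.sum (n := ∞) fun i _ =>
      contDiffAt_dWirt (h.smooth_densD_mul i) i : ContDiffAt ℝ ∞ _ z).continuousAt
  · exact_mod_cast (densD_pos h.posDef h.isHermitian).ne'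

end LocalSmooth

/-! ### Chart independence and the global field v times the associated field -/

section Global

set_option linter.unusedSectionVars false

open Matrix

variable {n : ℕ} {X : Type*} [TopologicalSpace X] [ChartedSpace (Cn n) X]
  [IsManifold 𝓘(ℂ, Cn n) ω X]
  {L : X → Type*} [∀ x, AddCommGroup (L x)] [∀ x, Module ℂ (L x)]
  [∀ x, TopologicalSpace (L x)] [TopologicalSpace (Bundle.TotalSpace ℂ L)]
  [FiberBundle ℂ L] [VectorBundle ℂ ℂ L]
  [ContMDiffVectorBundle ω ℂ L 𝓘(ℂ, Cn n)]
  {φ φ' : OpenPartialHomeomorph X (Cn n)}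
  {t t' : Bundle.Trivialization ℂ (Bundle.TotalSpace.proj : Bundle.TotalSpace ℂ L → X)}
  (g : KahlerMetric n X) (h : HermitianMetric n L) {Y : Sec n X}

theorem curvCoeff_trans (hφ : φ ∈ holCharts n X) (hφ' : φ' ∈ holCharts n X)
    (ht : MemTrivializationAtlas t) (ht' : MemTrivializationAtlas t') {x : X}
    (hx : x ∈ φ.source ∩ t.baseSet) (hx' : x ∈ φ'.source ∩ t'.baseSet) :
    ∀ᶠ w in nhds (φ x), curvCoeff h φ t w = (jac (fun z => φ' (φ.symm z)) w)ᴴ *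
      curvCoeff h φ' t' (φ' (φ.symm w)) * jac (fun z => φ' (φ.symm z)) w := by
  have hz := φ.map_source hx.1
  have hs := φ.left_inv hx.1
  have hz1 : φ.symm (φ x) ∈ t.baseSet := by rw [hs]; exact hx.2
  have hz2 : φ.symm (φ x) ∈ t'.baseSet := by rw [hs]; exact hx'.2
  have hz3 : φ.symm (φ x) ∈ φ'.source := by rw [hs]; exact hx'.1
  filter_upwards [(isOpen_frameDomain φ t).mem_nhds ⟨hz, hz1⟩,
    (isOpen_frameDomain φ t').mem_nhds ⟨hz, hz2⟩, (isOpen_transDomain φ φ').mem_nhds ⟨hz, hz3⟩]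
    with w h1 h2 h3
  rw [curvCoeff_frame_trans h hφ ht ht' h1.1 h1.2 h2.2]
  exact curvCoeff_chart_trans h hφ hφ' ht' h1.1 h3.2 h2.2

theorem eventually_transDomain {x : X} (hx : x ∈ φ.source) (hx' : x ∈ φ'.source) :
    ∀ᶠ w in nhds (φ x), w ∈ φ.target ∧ φ.symm w ∈ φ'.source := by
  have hz3 : φ.symm (φ x) ∈ φ'.source := by rwa [φ.left_inv hx]
  filter_upwards [(isOpen_transDomain φ φ').mem_nhds ⟨φ.map_source hx, hz3⟩] with w hw using hw

theorem goodData_eventually (hY : IsSmoothSec Y) (hφ : φ ∈ holCharts n X)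
    (ht : MemTrivializationAtlas t) {x : X} (hx : x ∈ φ.source ∩ t.baseSet) :
    ∀ᶠ w in nhds (φ x), GoodData (gCoeff g φ) (curvCoeff h φ t) (secCoeff Y φ) w := by
  have hz1 : φ.symm (φ x) ∈ t.baseSet := by rw [φ.left_inv hx.1]; exact hx.2
  filter_upwards [(isOpen_frameDomain φ t).mem_nhds ⟨φ.map_source hx.1, hz1⟩] with w hw using
    goodData h g hY hφ ht hw.1 hw.2

theorem isUnit_jac_trans' (hφ : φ ∈ holCharts n X) (hφ' : φ' ∈ holCharts n X) {x : X}
    (hx : x ∈ φ.source) (hx' : x ∈ φ'.source) :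
    IsUnit (jac (fun z => φ' (φ.symm z)) (φ x)).det :=
  isUnit_jac_trans hφ hφ' (φ.map_source hx) (by rwa [φ.left_inv hx])

theorem vIn_eq_vIn (hφ : φ ∈ holCharts n X) (hφ' : φ' ∈ holCharts n X)
    (ht : MemTrivializationAtlas t) (ht' : MemTrivializationAtlas t') {x : X}
    (hx : x ∈ φ.source ∩ t.baseSet) (hx' : x ∈ φ'.source ∩ t'.baseSet) :
    vIn g h φ t x = vIn g h φ' t' x := by
  have hJ := isUnit_jac_trans' hφ hφ' hx.1 hx'.1
  have hF := (curvCoeff_trans h hφ hφ' ht ht' hx hx').self_of_nhds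
  have hz3 : φ.symm (φ x) ∈ φ'.source := by rw [φ.left_inv hx.1]; exact hx'.1
  have hG := gCoeff_trans g hφ hφ' (φ.map_source hx.1) hz3
  rw [φ.left_inv hx.1] at hF hG
  rw [vIn, hF, hG, zetaLoc_trans hJ
    (det_ne_zero_of_posDef (gCoeff_posDef g hφ' (φ'.map_source hx'.1)))]
  rfl

theorem assocIn_trans (hY : IsSmoothSec Y) (hφ : φ ∈ holCharts n X) (hφ' : φ' ∈ holCharts n X)
    (ht : MemTrivializationAtlas t) (ht' : MemTrivializationAtlas t') {x : X}
    (hx : x ∈ φ.source ∩ t.baseSet) (hx' : x ∈ φ'.source ∩ t'.baseSet) :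
    jac (fun z => φ' (φ.symm z)) (φ x) *ᵥ assocIn g h φ t Y (φ x) =
      assocIn g h φ' t' Y (φ' x) := by
  have hJ := isUnit_jac_trans' hφ hφ' hx.1 hx'.1
  have hF := (curvCoeff_trans h hφ hφ' ht ht' hx hx').self_of_nhds
  have hz := φ.map_source hx.1
  have hz3 : φ.symm (φ x) ∈ φ'.source := by rw [φ.left_inv hx.1]; exact hx'.1
  have hG := gCoeff_trans g hφ hφ' hz hz3
  have h1 := secCoeff_fst_trans Y hφ hφ' hz hz3
  have h2 := secCoeff_snd_trans Y hφ hφ' hz hz3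
  have d := (goodData_eventually g h hY hφ ht hx).self_of_nhds
  have d' := (goodData_eventually g h hY hφ' ht' hx').self_of_nhds
  have hp := d.posDef
  rw [hG] at hp
  rw [φ.left_inv hx.1] at hF hG h1 h2 hp
  have key := assocLoc_trans hJ d'.posDef d'.isHermitian hp (secCoeff Y φ (φ x)).1
    (secCoeff Y φ' (φ' x)).2
  rw [← h1, ← h2, ← hF, ← hG] at key
  exact key

theorem divHIn_eq_divHIn (hY : IsSmoothSec Y) (hφ : φ ∈ holCharts n X) (hφ' : φ' ∈ holCharts n X)
    (ht : MemTrivializationAtlas t) (ht' : MemTrivializationAtlas t') {x : X}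
    (hx : x ∈ φ.source ∩ t.baseSet) (hx' : x ∈ φ'.source ∩ t'.baseSet) :
    divHIn g h φ t Y x = divHIn g h φ' t' Y x := by
  have hz := φ.map_source hx.1
  have hz3 : φ.symm (φ x) ∈ φ'.source := by rw [φ.left_inv hx.1]; exact hx'.1
  have hev := eventually_transDomain hx.1 hx'.1
  have e : φ' (φ.symm (φ x)) = φ' x := by rw [φ.left_inv hx.1]
  have key := divHLoc_trans (contDiffAt_trans hφ hφ' hz hz3)
    (isUnit_jac_trans' hφ hφ' hx.1 hx'.1)
    (hev.mono fun w hw => gCoeff_trans g hφ hφ' hw.1 hw.2)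
    (curvCoeff_trans h hφ hφ' ht ht' hx hx')
    (hev.mono fun w hw => secCoeff_fst_trans Y hφ hφ' hw.1 hw.2)
    (hev.mono fun w hw => secCoeff_snd_trans Y hφ hφ' hw.1 hw.2)
    (goodData_eventually g h hY hφ ht hx).self_of_nhds
    (by rw [e]; exact (goodData_eventually g h hY hφ' ht' hx').self_of_nhds)
  rwa [e] at key

theorem meanPairIn_eq_meanPairIn (hY : IsSmoothSec Y) (hφ : φ ∈ holCharts n X)
    (hφ' : φ' ∈ holCharts n X)
    (ht : MemTrivializationAtlas t) (ht' : MemTrivializationAtlas t') {x : X}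
    (hx : x ∈ φ.source ∩ t.baseSet) (hx' : x ∈ φ'.source ∩ t'.baseSet) :
    meanPairIn g h φ t Y x = meanPairIn g h φ' t' Y x := by
  have hz := φ.map_source hx.1
  have hz3 : φ.symm (φ x) ∈ φ'.source := by rw [φ.left_inv hx.1]; exact hx'.1
  have hev := eventually_transDomain hx.1 hx'.1
  have e : φ' (φ.symm (φ x)) = φ' x := by rw [φ.left_inv hx.1]
  have key := meanPair_trans (contDiffAt_trans hφ hφ' hz hz3)
    (isUnit_jac_trans' hφ hφ' hx.1 hx'.1)
    (hev.mono fun w hw => gCoeff_trans g hφ hφ' hw.1 hw.2)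
    (curvCoeff_trans h hφ hφ' ht ht' hx hx')
    (hev.mono fun w hw => secCoeff_fst_trans Y hφ hφ' hw.1 hw.2)
    (hev.mono fun w hw => secCoeff_snd_trans Y hφ hφ' hw.1 hw.2)
    (goodData_eventually g h hY hφ ht hx).self_of_nhds
    (by rw [e]; exact (goodData_eventually g h hY hφ' ht' hx').self_of_nhds)
  rwa [e] at key

theorem mem_preferred (x : X) :
    x ∈ (chartAt (Cn n) x).source ∩ (trivializationAt ℂ L x).baseSet :=
  ⟨mem_chart_source _ x, FiberBundle.mem_baseSet_trivializationAt' x⟩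

theorem vFun_eq (hφ : φ ∈ holCharts n X) (ht : MemTrivializationAtlas t) {x : X}
    (hx : x ∈ φ.source ∩ t.baseSet) : vFun g h x = vIn g h φ t x :=
  vIn_eq_vIn g h (chartAt_mem_holCharts x) hφ inferInstance ht (mem_preferred x) hx

theorem divH_eq (hY : IsSmoothSec Y) (hφ : φ ∈ holCharts n X) (ht : MemTrivializationAtlas t)
    {x : X} (hx : x ∈ φ.source ∩ t.baseSet) : divH g h Y x = divHIn g h φ t Y x :=
  divHIn_eq_divHIn g h hY (chartAt_mem_holCharts x) hφ inferInstance ht (mem_preferred x) hx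

theorem meanPair_eq (hY : IsSmoothSec Y) (hφ : φ ∈ holCharts n X) (ht : MemTrivializationAtlas t)
    {x : X} (hx : x ∈ φ.source ∩ t.baseSet) : meanPair g h Y x = meanPairIn g h φ t Y x :=
  meanPairIn_eq_meanPairIn g h hY (chartAt_mem_holCharts x) hφ inferInstance ht
    (mem_preferred x) hx

theorem chartDeriv_assocField (hY : IsSmoothSec Y) (hφ : φ ∈ holCharts n X)
    (ht : MemTrivializationAtlas t) {x : X} (hx : x ∈ φ.source ∩ t.baseSet) :
    chartDeriv φ x (assocField g h Y x) = assocIn g h φ t Y (φ x) := by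
  have hc := chartAt_mem_holCharts (n := n) x
  have hx0 := mem_chart_source (Cn n) x
  rw [← assocIn_trans g h hY hc hφ inferInstance ht (mem_preferred x) hx,
    chartDeriv_trans hc hφ hx0 hx.1, fderiv_eq_jac_mulVec]
  congr 1
  rw [assocField]
  simp only [map_sum, map_smul, chartDeriv_coordVec hc hx0]
  conv_rhs => rw [← Finset.univ_sum_single (assocIn g h (chartAt (Cn n) x) (trivializationAt ℂ L x) Y
    (chartAt (Cn n) x x))]
  exact Finset.sum_congr rfl fun j _ => by simp [← Pi.single_smul]

theorem continuous_of_charts {E : Type*} [TopologicalSpace E] {f : X → E}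
    (hf : ∀ x, ∃ a : Cn n → E, ContinuousAt a (chartAt (Cn n) x x) ∧
      ∀ᶠ y in nhds x, f y = a (chartAt (Cn n) x y)) : Continuous f := by
  rw [continuous_iff_continuousAt]
  intro x
  obtain ⟨a, ha, he⟩ := hf x
  exact ((ha.comp ((chartAt (Cn n) x).continuousAt (mem_chart_source _ x))).congr
    (he.mono fun y hy => hy.symm))

theorem eventually_preferred (x : X) :
    ∀ᶠ y in nhds x, y ∈ (chartAt (Cn n) x).source ∩ (trivializationAt ℂ L x).baseSet :=
  ((chartAt (Cn n) x).open_source.inter (trivializationAt ℂ L x).open_baseSet).mem_nhds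
    (mem_preferred x)

theorem continuous_divH (hY : IsSmoothSec Y) : Continuous (divH g h Y) := by
  refine continuous_of_charts (n := n) fun x => ?_
  have hev := goodData_eventually g h hY (chartAt_mem_holCharts x)
    (inferInstance : MemTrivializationAtlas (trivializationAt ℂ L x)) (mem_preferred x)
  refine ⟨_, hev.self_of_nhds.continuousAt_divHLoc hev, ?_⟩
  filter_upwards [eventually_preferred (n := n) (L := L) x] with y hy using
    divH_eq g h hY (chartAt_mem_holCharts x) inferInstance hy

theorem continuous_meanPair (hY : IsSmoothSec Y) : Continuous (meanPair g h Y) := by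
  refine continuous_of_charts (n := n) fun x => ?_
  have hev := goodData_eventually g h hY (chartAt_mem_holCharts x)
    (inferInstance : MemTrivializationAtlas (trivializationAt ℂ L x)) (mem_preferred x)
  refine ⟨_, hev.self_of_nhds.continuousAt_meanPair (hev.mono fun w hw => hw.toGoodPair), ?_⟩
  filter_upwards [eventually_preferred (n := n) (L := L) x] with y hy using
    meanPair_eq g h hY (chartAt_mem_holCharts x) inferInstance hy

theorem continuous_vFun : Continuous (vFun g h) := by
  have h1 : Continuous fun x => (vFun g h x : ℂ) := by
    refine continuous_of_charts (n := n) fun x => ?_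
    have hz1 : (chartAt (Cn n) x).symm (chartAt (Cn n) x x) ∈ (trivializationAt ℂ L x).baseSet := by
      rw [(chartAt (Cn n) x).left_inv (mem_chart_source _ x)]
      exact (mem_preferred (n := n) x).2
    have hp := goodPair h g (chartAt_mem_holCharts x)
      (inferInstance : MemTrivializationAtlas (trivializationAt ℂ L x))
      ((chartAt (Cn n) x).map_source (mem_chart_source _ x)) hz1
    refine ⟨_, hp.smooth_zeta.continuousAt, ?_⟩
    filter_upwards [eventually_preferred (n := n) (L := L) x] with y hy
    rw [vFun_eq g h (chartAt_mem_holCharts x) inferInstance hy]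
    rfl
  exact Complex.continuous_re.comp h1

/-- A field `Z` of type `(1,0)` is smooth with divergence `q`. -/
structure HasDivergence (Z : ∀ x : X, HTan n x) (q : X → ℂ) : Prop where
  smooth : ∀ φ ∈ holCharts n X, ∀ z ∈ φ.target, ∀ i, ContDiffAt ℝ ∞
    (fun w => (gCoeff g φ w).det * chartDeriv φ (φ.symm w) (Z (φ.symm w)) i) z
  div_eq : ∀ φ ∈ holCharts n X, ∀ z ∈ φ.target,
    ∑ i, dWirt i (fun w => (gCoeff g φ w).det * chartDeriv φ (φ.symm w) (Z (φ.symm w)) i) z =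
      (gCoeff g φ z).det * q (φ.symm z)

/-- In a chart v det g is the density D, so the smooth fields D Vⁱ of the local computation are the
components of the global field times det g. This carries the pointwise identity over to integration.
-/
theorem hasDivergence_assocField (hY : IsSmoothSec Y) :
    HasDivergence g (fun x => (vFun g h x : ℂ) • assocField g h Y x)
      (fun x => (vFun g h x : ℂ) * (divH g h Y x + meanPair g h Y x)) := by
  have key : ∀ φ ∈ holCharts n X, ∀ z ∈ φ.target, ∃ t : Bundle.Trivialization ℂ
      (Bundle.TotalSpace.proj : Bundle.TotalSpace ℂ L → X), MemTrivializationAtlas t ∧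
      φ.symm z ∈ t.baseSet ∧ GoodData (gCoeff g φ) (curvCoeff h φ t) (secCoeff Y φ) z ∧
      ∀ i, (fun w => (gCoeff g φ w).det * chartDeriv φ (φ.symm w)
        ((vFun g h (φ.symm w) : ℂ) • assocField g h Y (φ.symm w)) i) =ᶠ[nhds z]
        fun w => (densD (gCoeff g φ w) (curvCoeff h φ t w) : ℂ) *
          assocLoc (gCoeff g φ w) (curvCoeff h φ t w) (secCoeff Y φ w) i := by
    intro φ hφ z hz
    set t := trivializationAt ℂ L (φ.symm z)
    have ht : MemTrivializationAtlas t := inferInstance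
    have hzt : φ.symm z ∈ t.baseSet := FiberBundle.mem_baseSet_trivializationAt' _
    refine ⟨t, ht, hzt, goodData h g hY hφ ht hz hzt, fun i => ?_⟩
    filter_upwards [(isOpen_frameDomain φ t).mem_nhds ⟨hz, hzt⟩] with w hw
    have hx : φ.symm w ∈ φ.source ∩ t.baseSet := ⟨φ.map_target hw.1, hw.2⟩
    rw [map_smul, chartDeriv_assocField g h hY hφ ht hx, vFun_eq g h hφ ht hx, vIn,
      φ.right_inv hw.1, norm_zetaLoc_eq (gCoeff_posDef g hφ hw.1), Pi.smul_apply, smul_eq_mul]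
    have h0 := det_ne_zero_of_posDef (gCoeff_posDef g hφ hw.1)
    rw [← mul_assoc, mul_left_comm, mul_inv_cancel₀ h0, mul_one]
    rfl
  refine ⟨fun φ hφ z hz i => ?_, fun φ hφ z hz => ?_⟩
  · obtain ⟨t, ht, hzt, hd, he⟩ := key φ hφ z hz
    exact (hd.smooth_densD_mul i).congr_of_eventuallyEq (he i)
  · obtain ⟨t, ht, hzt, hd, he⟩ := key φ hφ z hz
    have hx : φ.symm z ∈ φ.source ∩ t.baseSet := ⟨φ.map_target hz, hzt⟩
    have e1 : ∀ i, dWirt i (fun w => (gCoeff g φ w).det * chartDeriv φ (φ.symm w)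
        ((vFun g h (φ.symm w) : ℂ) • assocField g h Y (φ.symm w)) i) z =
        dWirt i (fun w => (densD (gCoeff g φ w) (curvCoeff h φ t w) : ℂ) *
          assocLoc (gCoeff g φ w) (curvCoeff h φ t w) (secCoeff Y φ w) i) z := fun i => by
      rw [dWirt_eq_cder, cder_congr _ (he i), ← dWirt_eq_cder]
    have h0 := det_ne_zero_of_posDef (gCoeff_posDef g hφ hz)
    simp only [e1]
    rw [hd.sum_dWirt_densD_mul, divH_eq g h hY hφ ht hx, meanPair_eq g h hY hφ ht hx,
      vFun_eq g h hφ ht hx, vIn, divHIn, meanPairIn, φ.right_inv hz,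
      norm_zetaLoc_eq (gCoeff_posDef g hφ hz)]
    field_simp

end Global

/-! ### Measures defined by local parametrizations -/

section LocalMeasures

set_option linter.unusedSectionVars false

variable {V X : Type*} [NormedAddCommGroup V] [NormedSpace ℝ V] [FiniteDimensional ℝ V]
  [MeasurableSpace V] [BorelSpace V] (μ : Measure V) [μ.IsAddHaarMeasure]
  [TopologicalSpace X] [MeasurableSpace X] [BorelSpace X]

/-- The image under `ψ` of the measure with density `ρ` on `W`. -/
def paramMeasure (W : Set V) (ψ : V → X) (ρ : V → ℝ) : Measure X :=
  ((μ.restrict W).withDensity fun w => ENNReal.ofReal (ρ w)).map ψ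

variable {μ} {W W₀ : Set V} {ψ ψ₀ : V → X} {ρ ρ₀ : V → ℝ} {N : Set X}

theorem aemeasurable_param (hW : IsOpen W) (hψ : ContinuousOn ψ W) :
    AEMeasurable ψ ((μ.restrict W).withDensity fun w => ENNReal.ofReal (ρ w)) :=
  (hψ.aemeasurable hW.measurableSet).mono_ac (withDensity_absolutelyContinuous _ _)

theorem paramMeasure_apply (hW : IsOpen W) (hψ : ContinuousOn ψ W) {s : Set X}
    (hs : MeasurableSet s) :
    paramMeasure μ W ψ ρ s = ∫⁻ w in W ∩ ψ ⁻¹' s, ENNReal.ofReal (ρ w) ∂μ := by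
  have hm : NullMeasurableSet (ψ ⁻¹' s) (μ.restrict W) :=
    (hψ.aemeasurable hW.measurableSet).nullMeasurable hs
  rw [paramMeasure, Measure.map_apply_of_aemeasurable (aemeasurable_param hW hψ) hs,
    withDensity_apply₀ _ hm, Measure.restrict_restrict₀ hm, Set.inter_comm]

theorem measurableSet_inter_preimage_param (hW : IsOpen W) (hψ : ContinuousOn ψ W) {s : Set X}
    (hs : MeasurableSet s) : MeasurableSet (W ∩ ψ ⁻¹' s) := by
  have h1 : Measurable (W.domRestrict ψ) := (continuousOn_iff_continuous_domRestrict.1 hψ).measurable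
  have h2 : W ∩ ψ ⁻¹' s = Subtype.val '' ((W.domRestrict ψ) ⁻¹' s) := by
    ext w
    simp [Set.domRestrict_apply, and_comm]
  rw [h2]
  exact (MeasurableEmbedding.subtype_coe hW.measurableSet).measurableSet_image.2 (h1 hs)

/-- Change of variables along the transition map κ, which absorbs the factor |det κ'| in the
density. An inequality is all that a least upper bound requires. -/
theorem paramMeasure_restrict_le (hW : IsOpen W) (hψ : ContinuousOn ψ W) (hW₀ : IsOpen W₀)
    (hψ₀ : ContinuousOn ψ₀ W₀) (hN : MeasurableSet N) (κ : V → V) (κ' : V → V →L[ℝ] V)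
    (hκ : ∀ w ∈ W, ψ w ∈ N → κ w ∈ W₀ ∧ ψ₀ (κ w) = ψ w ∧ HasFDerivAt κ (κ' w) w ∧
      ρ w = |(κ' w).det| * ρ₀ (κ w))
    (hinj : Set.InjOn κ (W ∩ ψ ⁻¹' N)) :
    (paramMeasure μ W ψ ρ).restrict N ≤ paramMeasure μ W₀ ψ₀ ρ₀ := by
  refine Measure.le_iff.2 fun s hs => ?_
  rw [Measure.restrict_apply hs, paramMeasure_apply hW hψ (hs.inter hN),
    paramMeasure_apply hW₀ hψ₀ hs]
  set A := W ∩ ψ ⁻¹' (s ∩ N)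
  have hA : MeasurableSet A := measurableSet_inter_preimage_param hW hψ (hs.inter hN)
  have hAN : A ⊆ W ∩ ψ ⁻¹' N := fun w hw => ⟨hw.1, hw.2.2⟩
  calc ∫⁻ w in A, ENNReal.ofReal (ρ w) ∂μ
      = ∫⁻ w in A, ENNReal.ofReal |(κ' w).det| * ENNReal.ofReal (ρ₀ (κ w)) ∂μ := by
        refine setLIntegral_congr_fun hA fun w hw => ?_
        rw [(hκ w hw.1 hw.2.2).2.2.2, ENNReal.ofReal_mul (abs_nonneg _)]
    _ = ∫⁻ w in κ '' A, ENNReal.ofReal (ρ₀ w) ∂μ :=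
        (lintegral_image_eq_lintegral_abs_det_fderiv_mul μ hA
          (fun w hw => (hκ w hw.1 hw.2.2).2.2.1.hasFDerivWithinAt) (hinj.mono hAN) fun w => ENNReal.ofReal (ρ₀ w)).symm
    _ ≤ _ := by
        refine lintegral_mono_set ?_
        rintro _ ⟨w, hw, rfl⟩
        obtain ⟨h1, h2, -⟩ := hκ w hw.1 hw.2.2
        refine ⟨h1, ?_⟩
        rw [Set.mem_preimage, h2]
        exact hw.2.1

theorem paramMeasure_restrict_self (hW : IsOpen W) (hψ : ContinuousOn ψ W)
    (hN : MeasurableSet N) (hmaps : Set.MapsTo ψ W N) :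
    (paramMeasure μ W ψ ρ).restrict N = paramMeasure μ W ψ ρ := by
  ext s hs
  rw [Measure.restrict_apply hs, paramMeasure_apply hW hψ (hs.inter hN),
    paramMeasure_apply hW hψ hs]
  congr 2
  ext w
  exact ⟨fun h => ⟨h.1, h.2.1⟩, fun h => ⟨h.1, h.2, hmaps h.1⟩⟩

/-- Restriction of a least upper bound of measures to a set on which one of them dominates. -/
theorem restrict_eq_of_isLUB {S : Set (Measure X)} {ν m : Measure X} (hν : IsLUB S ν)
    (hm : m ∈ S) (hN : MeasurableSet N) (hmN : m.restrict N = m)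
    (hle : ∀ m' ∈ S, m'.restrict N ≤ m) : ν.restrict N = m := by
  refine le_antisymm ?_ ?_
  · have h1 : ν ≤ m + ν.restrict Nᶜ := by
      refine hν.2 fun m' hm' => ?_
      rw [← Measure.restrict_add_restrict_compl (μ := m') hN]
      exact add_le_add (hle m' hm') (Measure.restrict_mono le_rfl (hν.1 hm'))
    calc ν.restrict N ≤ (m + ν.restrict Nᶜ).restrict N := Measure.restrict_mono le_rfl h1
      _ = m := by
        rw [Measure.restrict_add, hmN, Measure.restrict_restrict hN, Set.inter_compl_self,
          Measure.restrict_empty, add_zero]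
  · rw [← hmN]
    exact Measure.restrict_mono le_rfl (hν.1 hm)

theorem integral_paramMeasure (hW : IsOpen W) (hψ : ContinuousOn ψ W) (hρ : ContinuousOn ρ W)
    (hρ0 : ∀ w ∈ W, 0 ≤ ρ w) {f : X → ℂ}
    (hf : AEStronglyMeasurable f (paramMeasure μ W ψ ρ)) :
    ∫ x, f x ∂(paramMeasure μ W ψ ρ) = ∫ w in W, (ρ w : ℂ) * f (ψ w) ∂μ := by
  rw [paramMeasure, integral_map (aemeasurable_param hW hψ) hf]
  have h1 : AEMeasurable (fun w => (ρ w).toNNReal) (μ.restrict W) :=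
    (hρ.aemeasurable hW.measurableSet).real_toNNReal
  have h2 := integral_withDensity_eq_integral_smul₀ h1 (fun w => f (ψ w))
  refine h2.trans (setIntegral_congr_fun hW.measurableSet fun w hw => ?_)
  rw [NNReal.smul_def, Real.coe_toNNReal _ (hρ0 w hw), Complex.real_smul]

end LocalMeasures

/-! ### The volume measure -/

section Volume

set_option linter.unusedSectionVars false

open Matrix

theorem abs_det_restrictScalars {n : ℕ} (A : Cn n →L[ℂ] Cn n) :
    |(A.restrictScalars ℝ).det| = ‖(A : Cn n →ₗ[ℂ] Cn n).det‖ ^ 2 := by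
  have h := LinearMap.det_restrictScalars (R := ℝ) (f := (A : Cn n →ₗ[ℂ] Cn n))
  rw [Algebra.norm_complex_eq] at h
  have h2 : (A.restrictScalars ℝ).det = Complex.normSq (A : Cn n →ₗ[ℂ] Cn n).det := h
  rw [h2, Complex.normSq_eq_norm_sq, abs_of_nonneg (by positivity)]

theorem det_jac {n : ℕ} (κ : Cn n → Cn n) (z : Cn n) :
    ((fderiv ℂ κ z : Cn n →L[ℂ] Cn n) : Cn n →ₗ[ℂ] Cn n).det = (jac κ z).det := by
  rw [← LinearMap.det_toMatrix']
  congr 1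

variable {n : ℕ} {X : Type*} [TopologicalSpace X] [ChartedSpace (Cn n) X]
  [IsManifold 𝓘(ℂ, Cn n) ω X] [MeasurableSpace X] [BorelSpace X]
  {φ φ' : OpenPartialHomeomorph X (Cn n)} (g : KahlerMetric n X)

/-- The density of the volume measure in a chart. -/
def gdet (φ : OpenPartialHomeomorph X (Cn n)) (z : Cn n) : ℝ := volDensity (gCoeff g φ z)

theorem ofReal_gdet (hφ : φ ∈ holCharts n X) {z : Cn n} (hz : z ∈ φ.target) :
    (gdet g φ z : ℂ) = (gCoeff g φ z).det := by
  rw [gdet, volDensity_eq]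
  exact (Complex.eq_re_of_ofReal_le (r := 0) (by
    simpa using (gCoeff_posDef g hφ hz).det_pos.le)).symm

theorem gdet_pos (hφ : φ ∈ holCharts n X) {z : Cn n} (hz : z ∈ φ.target) : 0 < gdet g φ z := by
  have h := (gCoeff_posDef g hφ hz).det_pos
  rw [← ofReal_gdet g hφ hz] at h
  exact_mod_cast h

theorem gdet_trans (hφ : φ ∈ holCharts n X) (hφ' : φ' ∈ holCharts n X) {z : Cn n}
    (hz : z ∈ φ.target) (hz' : φ.symm z ∈ φ'.source) :
    gdet g φ z = ‖(jac (fun z => φ' (φ.symm z)) z).det‖ ^ 2 * gdet g φ' (φ' (φ.symm z)) := by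
  have h := ofReal_gdet g hφ hz
  rw [gCoeff_trans g hφ hφ' hz hz', det_trans, ← ofReal_gdet g hφ' (φ'.map_source hz')] at h
  exact_mod_cast h

theorem continuousOn_gdet (φ : OpenPartialHomeomorph X (Cn n)) (hφ : φ ∈ holCharts n X) :
    ContinuousOn (gdet g φ) φ.target := by
  intro z hz
  have h := Complex.continuous_re.continuousAt.comp (smoothM_gCoeff g hφ hz).det.continuousAt
  have e : gdet g φ = fun z => (gCoeff g φ z).det.re := by
    ext z
    rw [gdet, volDensity_eq]
  rw [e]
  exact h.continuousWithinAt

/-- On overlaps det g changes by |det J|², which is the real Jacobian of a holomorphic transition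
map. Hence no other chart contributes more on this domain. -/
theorem volMeasure_restrict (hφ : φ ∈ holCharts n X) :
    (volMeasure g).restrict φ.source = paramMeasure volume φ.target φ.symm (gdet g φ) := by
  have hlub : IsLUB ((fun φ => paramMeasure volume φ.target φ.symm (gdet g φ)) '' holCharts n X)
      (volMeasure g) := isLUB_biSup
  refine restrict_eq_of_isLUB hlub ⟨φ, hφ, rfl⟩ φ.open_source.measurableSet
    (paramMeasure_restrict_self φ.open_target φ.continuousOn_symm φ.open_source.measurableSet
      fun z hz => φ.map_target hz) ?_
  rintro _ ⟨φ', hφ', rfl⟩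
  refine paramMeasure_restrict_le φ'.open_target φ'.continuousOn_symm φ.open_target
    φ.continuousOn_symm φ.open_source.measurableSet (fun z => φ (φ'.symm z))
    (fun z => (fderiv ℂ (fun z => φ (φ'.symm z)) z).restrictScalars ℝ) ?_ ?_
  · intro z hz hz'
    refine ⟨φ.map_source hz', φ.left_inv hz',
      (differentiableAt_trans hφ' hφ hz hz').hasFDerivAt.restrictScalars ℝ, ?_⟩
    rw [abs_det_restrictScalars, det_jac, gdet_trans g hφ' hφ hz hz']
  · intro z hz w hw h
    exact φ'.symm.injOn hz.1 hw.1 (φ.injOn hz.2 hw.2 h)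

instance isLocallyFiniteMeasure_volMeasure : IsLocallyFiniteMeasure (volMeasure g) := by
  refine ⟨fun x => ?_⟩
  set φ := chartAt (Cn n) x
  have hφ : φ ∈ holCharts n X := chartAt_mem_holCharts x
  have hx : x ∈ φ.source := mem_chart_source _ x
  obtain ⟨K, hK, hxK, hKt⟩ := exists_compact_subset φ.open_target (φ.map_source hx)
  refine ⟨φ.source ∩ φ ⁻¹' interior K,
    (φ.isOpen_inter_preimage isOpen_interior).mem_nhds ⟨hx, hxK⟩, ?_⟩
  set s := φ.source ∩ φ ⁻¹' interior K
  have hs : MeasurableSet s := (φ.isOpen_inter_preimage isOpen_interior).measurableSet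
  have h1 : volMeasure g s = (volMeasure g).restrict φ.source s := by
    rw [Measure.restrict_apply hs, Set.inter_eq_left.2 Set.inter_subset_left]
  rw [h1, volMeasure_restrict g hφ, paramMeasure_apply φ.open_target φ.continuousOn_symm hs]
  refine (lintegral_mono_set (t := K) ?_).trans_lt ?_
  · rintro z ⟨hz, hz2⟩
    have := hz2.2
    rw [Set.mem_preimage, φ.right_inv hz] at this
    exact interior_subset this
  · exact (((continuousOn_gdet g φ hφ).mono hKt).integrableOn_compact hK).lintegral_lt_top

theorem setIntegral_volMeasure (hφ : φ ∈ holCharts n X) {U : Set X} (hU : IsOpen U) {f : X → ℂ}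
    (hf : AEStronglyMeasurable f (volMeasure g)) (hs : Function.support f ⊆ φ.source) :
    ∫ x in U, f x ∂(volMeasure g) =
      ∫ z in φ.target ∩ φ.symm ⁻¹' U, (gdet g φ z : ℂ) * f (φ.symm z) := by
  have h1 : ∫ x in U, f x ∂(volMeasure g) =
      ∫ x in φ.source, U.indicator f x ∂(volMeasure g) := by
    rw [← integral_indicator hU.measurableSet]
    refine (setIntegral_eq_integral_of_forall_compl_eq_zero fun x hx => ?_).symm
    by_cases hxU : x ∈ U
    · rw [Set.indicator_of_mem hxU]
      by_contra h
      exact hx (hs h)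
    · exact Set.indicator_of_notMem hxU _
  have hf' : AEStronglyMeasurable (U.indicator f)
      (paramMeasure volume φ.target φ.symm (gdet g φ)) := by
    rw [← volMeasure_restrict g hφ]
    exact (hf.indicator hU.measurableSet).restrict
  rw [h1, volMeasure_restrict g hφ, integral_paramMeasure φ.open_target φ.continuousOn_symm
    (continuousOn_gdet g φ hφ) (fun z hz => (gdet_pos g hφ hz).le) hf']
  have hm : MeasurableSet (φ.target ∩ φ.symm ⁻¹' U) :=
    (φ.symm.isOpen_inter_preimage hU).measurableSet
  rw [← integral_indicator φ.open_target.measurableSet, ← integral_indicator hm]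
  refine integral_congr_ae (Filter.Eventually.of_forall fun z => ?_)
  by_cases hz : z ∈ φ.target <;> by_cases hzU : φ.symm z ∈ U <;>
    simp [hz, hzU]

end Volume

/-! ### Real coordinates adapted to a hypersurface -/

section Coordinates

open Matrix Module

variable {n : ℕ}

/-- The standard real basis of `ℂⁿ`. -/
def stdBasis (n : ℕ) : Basis (Σ _ : Fin n, Fin 2) ℝ (Cn n) := Pi.basis fun _ => Complex.basisOneI

theorem addHaar_stdBasis : (stdBasis n).addHaar = (volume : Measure (Cn n)) := by
  rw [Basis.addHaar_eq_iff, Basis.coe_parallelepiped]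
  have h1 : parallelepiped (stdBasis n) =
      Set.univ.pi fun _ => parallelepiped Complex.basisOneI := by
    ext z
    rw [parallelepiped_basis_eq, parallelepiped_basis_eq]
    simp only [stdBasis, Pi.basis_repr, Set.mem_ofPred_eq, Set.mem_pi, Set.mem_univ, true_imp_iff,
      Sigma.forall]
  have h2 : volume (parallelepiped Complex.basisOneI) = 1 := by
    rw [← Complex.toBasis_orthonormalBasisOneI]
    exact Complex.orthonormalBasisOneI.volume_parallelepiped
  rw [h1, volume_pi, Measure.pi_pi, Finset.prod_congr rfl fun _ _ => h2, Finset.prod_const_one]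

/-- The Riemannian inner product on `ℂⁿ` with coefficients `G`. -/
def reForm (G : Matrix (Fin n) (Fin n) ℂ) (u w : Cn n) : ℝ := (star u ⬝ᵥ (G *ᵥ w)).re

theorem reForm_one (u w : Cn n) :
    reForm 1 u w = ∑ k, (stdBasis n).repr u k * (stdBasis n).repr w k := by
  rw [reForm, one_mulVec, dotProduct, Complex.re_sum, Fintype.sum_sigma]
  refine Finset.sum_congr rfl fun j _ => ?_
  simp [stdBasis, Pi.basis_repr, Fin.sum_univ_two]

theorem reForm_conjTranspose_mul_self (C : Matrix (Fin n) (Fin n) ℂ) (u w : Cn n) :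
    reForm (Cᴴ * C) u w = reForm 1 (C *ᵥ u) (C *ᵥ w) := by
  rw [reForm, reForm, one_mulVec, star_mulVec, ← mulVec_mulVec, ← dotProduct_mulVec]

variable {ι : Type*} [Fintype ι] [DecidableEq ι]

theorem det_gram_one (b : Basis ι ℝ (Cn n)) (v : ι → Cn n) (σ : (Σ _ : Fin n, Fin 2) ≃ ι)
    (hb : b = (stdBasis n).reindex σ) :
    (Matrix.of fun i j => reForm 1 (v i) (v j)).det = (b.det v) ^ 2 := by
  have h : (Matrix.of fun i j => reForm 1 (v i) (v j)) = (b.toMatrix v)ᵀ * b.toMatrix v := by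
    ext i j
    rw [Matrix.of_apply, reForm_one, Matrix.mul_apply, ← σ.sum_comp]
    refine Finset.sum_congr rfl fun k _ => ?_
    simp [Basis.toMatrix_apply, hb]
  rw [h, det_mul, det_transpose, Basis.det_apply]
  ring

/-- The standard basis of `ℝ^{2n-1} × ℝ`. -/
def parBasis (n : ℕ) : Basis (Fin (2 * n - 1) ⊕ Unit) ℝ (HPar n × ℝ) :=
  (Pi.basisFun ℝ _).prod (Basis.singleton Unit ℝ)

theorem addHaar_parBasis : (parBasis n).addHaar = volume := by
  rw [parBasis, Basis.prod_addHaar]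
  congr 1
  · rw [Basis.addHaar_eq_iff, Basis.coe_parallelepiped, parallelepiped_basis_eq]
    have : {x : HPar n | ∀ i, (Pi.basisFun ℝ (Fin (2 * n - 1))).repr x i ∈ Set.Icc 0 1} =
        Set.univ.pi fun _ => Set.Icc 0 1 := by
      ext x
      simp [Pi.le_def, forall_and]
    rw [this, volume_pi, Measure.pi_pi]
    simp
  · rw [Basis.addHaar_eq_iff, Basis.coe_parallelepiped, parallelepiped_basis_eq]
    have : {x : ℝ | ∀ i, (Basis.singleton Unit ℝ).repr x i ∈ Set.Icc 0 1} = Set.Icc 0 1 := by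
      ext x
      simp
    rw [this]
    simp

theorem parBasis_inl (a : Fin (2 * n - 1)) : parBasis n (Sum.inl a) = (Pi.single a 1, 0) := by
  simp [parBasis]

theorem parBasis_inr (u : Unit) : parBasis n (Sum.inr u) = (0, 1) := by
  simp [parBasis]

variable (A : (HPar n × ℝ) ≃L[ℝ] Cn n)

/-- Write g = C*C. The Gram determinant is the square of the determinant of the image basis under C,
which is |det C|² up to sign; and |det C|² = det g. -/
theorem det_gram_of_measurePreserving (hA : MeasurePreserving A volume volume)
    {G : Matrix (Fin n) (Fin n) ℂ} (hG : G.PosDef) :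
    (Matrix.of fun i j => reForm G (A (parBasis n i)) (A (parBasis n j))).det =
      (G.det.re) ^ 2 := by
  obtain ⟨C, hC⟩ : ∃ C : Matrix (Fin n) (Fin n) ℂ, G = Cᴴ * C := by
    open scoped MatrixOrder Matrix.Norms.L2Operator in
    exact CStarAlgebra.nonneg_iff_eq_star_mul_self.1 hG.posSemidef.nonneg
  set β' := (parBasis n).map A.toLinearEquiv with hβ'
  set σ := (stdBasis n).indexEquiv β'
  set b := (stdBasis n).reindex σ with hb
  -- A measure preserving map sends the unit cube to a parallelepiped of volume one.
  have h1 : |b.det β'| = 1 := by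
    have h2 : volume (parallelepiped β') = 1 := by
      rw [← hA.map_eq, ← addHaar_parBasis, Basis.map_addHaar, Basis.addHaar_self]
    rw [← addHaar_stdBasis, ← Basis.addHaar_reindex (stdBasis n) σ, ← hb,
      Measure.addHaar_parallelepiped] at h2
    exact (ENNReal.ofReal_eq_one).1 h2
  have h2 : |(((Matrix.toLin' C).restrictScalars ℝ : Cn n →ₗ[ℝ] Cn n)).det| = ‖C.det‖ ^ 2 := by
    have h := abs_det_restrictScalars (LinearMap.toContinuousLinearMap (Matrix.toLin' C))
    rw [LinearMap.coe_toContinuousLinearMap, LinearMap.det_toLin'] at h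
    exact h
  have h3 : (fun i j => reForm G (A (parBasis n i)) (A (parBasis n j))) = fun i j =>
      reForm 1 (((Matrix.toLin' C).restrictScalars ℝ ∘ β') i)
        (((Matrix.toLin' C).restrictScalars ℝ ∘ β') j) := by
    ext i j
    rw [hC, reForm_conjTranspose_mul_self]
    simp [hβ']
  rw [h3, det_gram_one b _ σ hb, Basis.det_comp, ← sq_abs, abs_mul, h1, h2, mul_one, hC, det_mul,
    det_conjTranspose, RCLike.star_def, Complex.conj_mul']
  norm_cast

/-- Any isomorphism can be adjusted so that the last axis points to a vector on which ℓ is positive.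
A positive rescaling then normalises the volume and preserves that sign. -/
theorem exists_measurePreserving_coord (ℓ : Cn n →L[ℝ] ℝ) (hℓ : ℓ ≠ 0) :
    ∃ A : (HPar n × ℝ) ≃L[ℝ] Cn n, MeasurePreserving A volume volume ∧ 0 < ℓ (A (0, 1)) := by
  obtain ⟨u, hu⟩ : ∃ u, 0 < ℓ u := by
    obtain ⟨u, hu⟩ : ∃ u, ℓ u ≠ 0 := by
      by_contra! h
      exact hℓ (ContinuousLinearMap.ext h)
    rcases hu.lt_or_gt with h | h
    · exact ⟨-u, by rw [map_neg]; linarith⟩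
    · exact ⟨u, h⟩
  have hn : 1 ≤ n := by
    by_contra! h
    obtain rfl : n = 0 := by omega
    rw [Subsingleton.elim u 0, map_zero] at hu
    exact lt_irrefl _ hu
  have hfin : finrank ℝ (Cn n) = 2 * n := by
    rw [finrank_eq_card_basis (stdBasis n)]
    simp [mul_comm]
  have hd : finrank ℝ (HPar n × ℝ) = finrank ℝ (Cn n) := by
    rw [hfin]
    simp
    omega
  set A₀ := ContinuousLinearEquiv.ofFinrankEq hd
  have h0 : A₀ (0, 1) ≠ 0 := by
    rw [Ne, A₀.map_eq_zero_iff]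
    simp
  have hu0 : u ≠ 0 := by
    rintro rfl
    simp at hu
  obtain ⟨T, hT⟩ := SeparatingDual.exists_continuousLinearEquiv_apply_eq (R := ℝ) h0 hu0
  set A₁ := A₀.trans T
  have hA₁ : A₁ (0, 1) = u := hT
  set β₁ := (parBasis n).map A₁.toLinearEquiv with hβ₁
  set b := (stdBasis n).reindex ((stdBasis n).indexEquiv β₁) with hb
  set d := |b.det β₁| with hd
  have hd0 : 0 < d := abs_pos.2 (b.isUnit_det β₁).ne_zero
  set m := Fintype.card (Fin (2 * n - 1) ⊕ Unit) with hm
  have hm0 : m ≠ 0 := Fintype.card_ne_zero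
  -- The scale is an m-th root, m being the real dimension, since scaling by c multiplies volumes by
  -- cᵐ.
  set c : ℝ := d⁻¹ ^ ((m : ℝ)⁻¹) with hc
  have hc0 : 0 < c := Real.rpow_pos_of_pos (inv_pos.2 hd0) _
  have hcm : c ^ m = d⁻¹ := Real.rpow_inv_natCast_pow (inv_pos.2 hd0).le hm0
  set A := A₁.trans (ContinuousLinearEquiv.smulLeft (R₁ := ℝ) (Units.mk0 c hc0.ne'))
  have hA : ∀ x, A x = c • A₁ x := fun x => rfl
  refine ⟨A, ⟨A.continuous.measurable, ?_⟩, ?_⟩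
  · rw [← addHaar_parBasis, Basis.map_addHaar, Basis.addHaar_eq_iff, Basis.coe_parallelepiped,
      ← addHaar_stdBasis, ← Basis.addHaar_reindex (stdBasis n) ((stdBasis n).indexEquiv β₁), ← hb,
      Measure.addHaar_parallelepiped]
    have h1 : (((parBasis n).map A.toLinearEquiv : Basis _ ℝ (Cn n)) : _ → Cn n) =
        fun i => c • β₁ i := by
      ext1 i
      simp [hβ₁, hA]
    rw [h1, AlternatingMap.map_smul_univ b.det fun _ => c]
    rw [Finset.prod_const, Finset.card_univ, ← hm, hcm, smul_eq_mul, abs_mul, ← hd,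
      abs_of_pos (inv_pos.2 hd0), inv_mul_cancel₀ hd0.ne', ENNReal.ofReal_one]
  · rw [hA, hA₁, map_smul]
    exact mul_pos hc0 hu

end Coordinates

/-! ### Unit normals -/

section Shear

variable {E F : Type*} [MeasurableSpace E] [NormedAddCommGroup F] [MeasurableSpace F]
  [BorelSpace F] [SecondCountableTopology F]
  (μ : Measure E) (ν : Measure F) [SFinite μ] [SFinite ν] [ν.IsAddRightInvariant]

theorem measurePreserving_shear {D : E → F} (hD : Measurable D) :
    MeasurePreserving (fun p : E × F => (p.1, p.2 + D p.1)) (μ.prod ν) (μ.prod ν) :=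
  MeasurePreserving.skew_product (g := fun e t => t + D e) (MeasurePreserving.id μ)
    (measurable_snd.add (hD.comp measurable_fst))
    (Filter.Eventually.of_forall fun e => (measurePreserving_add_right ν (D e)).map_eq)

end Shear

/-! ### Normals, Gram determinants and the flux density -/

section Normals

open Matrix Module

variable {n : ℕ} {G : Matrix (Fin n) (Fin n) ℂ}

theorem reForm_add_left (u u' w : Cn n) :
    reForm G (u + u') w = reForm G u w + reForm G u' w := by
  simp [reForm, add_dotProduct]

theorem reForm_smul_left (c : ℝ) (u w : Cn n) : reForm G (c • u) w = c * reForm G u w := by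
  simp only [reForm, star_smul, star_trivial, smul_dotProduct, Complex.smul_re, smul_eq_mul]

theorem reForm_add_right (u w w' : Cn n) :
    reForm G u (w + w') = reForm G u w + reForm G u w' := by
  simp [reForm, mulVec_add]

theorem reForm_smul_right (c : ℝ) (u w : Cn n) : reForm G u (c • w) = c * reForm G u w := by
  simp only [reForm, mulVec_smul, dotProduct_smul, Complex.smul_re, smul_eq_mul]

theorem reForm_self_pos (hG : G.PosDef) {u : Cn n} (hu : u ≠ 0) : 0 < reForm G u u :=
  (Complex.pos_iff.1 (hG.dotProduct_mulVec_pos hu)).1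

/-- Riesz representation: a definite form is nondegenerate, so N has a gradient, which is nonzero
and can be normalised. -/
theorem exists_unit_normal (hG : G.PosDef) {N : Cn n →L[ℝ] ℝ} (hN : N ≠ 0) :
    ∃ ν : Cn n, reForm G ν ν = 1 ∧ ∃ c : ℝ, 0 < c ∧ ∀ u, reForm G ν u = c * N u := by
  set B : Cn n →ₗ[ℝ] Cn n →ₗ[ℝ] ℝ := LinearMap.mk₂ ℝ (reForm G) reForm_add_left
    reForm_smul_left reForm_add_right reForm_smul_right
  have hinj : Function.Injective B := by
    rw [← LinearMap.ker_eq_bot, LinearMap.ker_eq_bot']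
    intro u hu
    by_contra h
    have h1 : B u u = 0 := by rw [hu]; rfl
    exact (reForm_self_pos hG h).ne' h1
  have hsurj : Function.Surjective B :=
    (LinearMap.injective_iff_surjective_of_finrank_eq_finrank
      (Subspace.dual_finrank_eq (K := ℝ) (V := Cn n)).symm).1 hinj
  obtain ⟨ν₀, hν₀⟩ := hsurj (N : Cn n →ₗ[ℝ] ℝ)
  have h1 : ∀ u, reForm G ν₀ u = N u := fun u => LinearMap.congr_fun hν₀ u
  have h0 : ν₀ ≠ 0 := by
    rintro rfl
    refine hN (ContinuousLinearMap.ext fun u => ?_)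
    rw [← h1]
    simp [reForm]
  have hpos := reForm_self_pos hG h0
  set r := Real.sqrt (reForm G ν₀ ν₀) with hr
  have hr0 : 0 < r := Real.sqrt_pos.2 hpos
  have hrr : r * r = reForm G ν₀ ν₀ := Real.mul_self_sqrt hpos.le
  refine ⟨r⁻¹ • ν₀, ?_, r⁻¹, inv_pos.2 hr0, fun u => ?_⟩
  · rw [reForm_smul_left, reForm_smul_right, ← hrr]
    field_simp
  · rw [reForm_smul_left, h1]

variable {A : (HPar n × ℝ) ≃L[ℝ] Cn n} {D : HPar n →L[ℝ] ℝ} {N : Cn n →L[ℝ] ℝ} {ν : Cn n} {c : ℝ}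

/-- Volume equals area times height. Two volume preserving shears change the coordinates so that the
base axes become tangent to the graph and the last axis becomes cν. The Gram matrix is then block
triangular with diagonal blocks the tangential one and c², and its determinant is (det g)². -/
theorem mul_sqrt_det_gram (hG : G.PosDef) (hA : MeasurePreserving A volume volume)
    (hN : ∀ e s, N (A (e, s)) = s - D e) (hc : 0 < c) (hν : reForm G ν ν = 1)
    (hνN : ∀ u, reForm G ν u = c * N u) :
    c * Real.sqrt (Matrix.of fun a b => reForm G (A (Pi.single a 1, D (Pi.single a 1)))
      (A (Pi.single b 1, D (Pi.single b 1)))).det = G.det.re := by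
  -- Shearing the last axis by the base component of cν, and then by D, sends it to cν.
  set y := (A.symm (c • ν)).1
  set T₁ : (HPar n × ℝ) ≃L[ℝ] (HPar n × ℝ) :=
    (ContinuousLinearEquiv.refl ℝ _).skewProd (ContinuousLinearEquiv.refl ℝ _) D
  set T₂ : (ℝ × HPar n) ≃L[ℝ] (ℝ × HPar n) :=
    (ContinuousLinearEquiv.refl ℝ _).skewProd (ContinuousLinearEquiv.refl ℝ _)
      ((ContinuousLinearMap.id ℝ ℝ).smulRight y)
  set P := ContinuousLinearEquiv.prodComm ℝ (HPar n) ℝ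
  set A' := (((P.trans T₂).trans P.symm).trans T₁).trans A
  have hT₁ : MeasurePreserving T₁ volume volume := by
    exact measurePreserving_shear volume volume D.continuous.measurable
  have hT₂ : MeasurePreserving T₂ volume volume := by
    exact measurePreserving_shear volume volume (continuous_id.smul continuous_const).measurable
  have hP : MeasurePreserving P volume volume := Measure.measurePreserving_swap
  have hP' : MeasurePreserving P.symm volume volume := Measure.measurePreserving_swap
  have hA' : MeasurePreserving A' volume volume := hA.comp (hT₁.comp (hP'.comp (hT₂.comp hP)))
  have hval : ∀ e t, A' (e, t) = A (e + t • y, t + D (e + t • y)) := fun e t => rfl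
  have h1 : ∀ a, A' (parBasis n (Sum.inl a)) = A (Pi.single a 1, D (Pi.single a 1)) := by
    intro a
    rw [parBasis_inl, hval]
    simp
  have h2 : ∀ u, A' (parBasis n (Sum.inr u)) = c • ν := by
    intro u
    have e1 : A (y, (A.symm (c • ν)).2) = c • ν := A.apply_symm_apply _
    have e2 := hN y (A.symm (c • ν)).2
    have e3 : c * N ν = 1 := by rw [← hνN, hν]
    rw [e1, map_smul, smul_eq_mul, e3] at e2
    -- The height is 1 + D y because N takes the value 1 on cν: c N(ν) is the square length of ν.
    have e4 : (A.symm (c • ν)).2 = 1 + D y := by linarith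
    rw [parBasis_inr, hval, ← e1, e4]
    simp
  have hN0 : ∀ a, N (A (Pi.single a 1, D (Pi.single a 1))) = 0 := fun a => by
    rw [hN, sub_self]
  have key := det_gram_of_measurePreserving A' hA' hG
  set M := Matrix.of fun a b => reForm G (A (Pi.single a 1, D (Pi.single a 1)))
      (A (Pi.single b 1, D (Pi.single b 1)))
  have hblock : (Matrix.of fun i j => reForm G (A' (parBasis n i)) (A' (parBasis n j))) =
      Matrix.fromBlocks M (Matrix.of fun a _ => reForm G (A (Pi.single a 1, D (Pi.single a 1)))
        (c • ν)) 0 (Matrix.of fun (_ _ : Unit) => c ^ 2) := by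
    ext i j
    rcases i with i | i <;> rcases j with j | j
    · simp [h1, M]
    · simp [h1, h2]
    · simp [h1, h2, reForm_smul_left, hνN, hN0]
    · simp only [of_apply, h2, reForm_smul_left, reForm_smul_right, hν, fromBlocks_apply₂₂]
      ring
  have hunit : (Matrix.of fun (_ _ : Unit) => c ^ 2).det = c ^ 2 := by simp
  rw [hblock, det_fromBlocks_zero₂₁, hunit] at key
  have hdet : 0 ≤ G.det.re := (Complex.pos_iff.1 hG.det_pos).1.le
  rw [← Real.sqrt_sq hdet, ← key, Real.sqrt_mul' _ (sq_nonneg c), Real.sqrt_sq hc.le, mul_comm]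

/-- The Hermitian product is recovered from its real part, evaluated at V and at √-1V. -/
theorem dotProduct_eq_of_reForm (hνN : ∀ u, reForm G ν u = c * N u) (V : Cn n) :
    star ν ⬝ᵥ (G *ᵥ V) = c * ((N V : ℂ) - Complex.I * N (Complex.I • V)) := by
  have h1 := hνN V
  have h2 := hνN (Complex.I • V)
  simp only [reForm, mulVec_smul, dotProduct_smul, smul_eq_mul, Complex.mul_re, Complex.I_re,
    Complex.I_im, zero_mul, one_mul, zero_sub] at h1 h2
  apply Complex.ext
  · simp [h1]
  · have : (star ν ⬝ᵥ (G *ᵥ V)).im = -(c * N (Complex.I • V)) := by linarith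
    rw [this]
    simp

/-- The flux density through a graph. -/
theorem sqrt_det_gram_mul_flux (hG : G.PosDef) (hA : MeasurePreserving A volume volume)
    (hN : ∀ e s, N (A (e, s)) = s - D e) (hc : 0 < c) (hν : reForm G ν ν = 1)
    (hνN : ∀ u, reForm G ν u = c * N u) (V : Cn n) :
    ((Real.sqrt (Matrix.of fun a b => reForm G (A (Pi.single a 1, D (Pi.single a 1)))
      (A (Pi.single b 1, D (Pi.single b 1)))).det : ℝ) : ℂ) *
      ((1 / 2) * (star ν ⬝ᵥ (G *ᵥ V))) =
      ∑ a, (G.det * V a) * wirtL a (Complex.ofRealCLM.comp N) := by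
  have h1 := mul_sqrt_det_gram hG hA hN hc hν hνN
  have h2 := wirtL_apply_eq (Complex.ofRealCLM.comp N) V
  have h3 : (G.det.re : ℂ) = G.det :=
    (Complex.eq_re_of_ofReal_le (r := 0) (by simpa using hG.det_pos.le)).symm
  have h4 : ∑ a, (G.det * V a) * wirtL a (Complex.ofRealCLM.comp N) =
      G.det * ∑ a, V a * wirtL a (Complex.ofRealCLM.comp N) := by
    rw [Finset.mul_sum]
    exact Finset.sum_congr rfl fun a _ => mul_assoc _ _ _
  have h5 : ∀ u, (Complex.ofRealCLM.comp N) u = (N u : ℂ) := fun _ => rfl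
  rw [h4, ← h2, h5, h5, dotProduct_eq_of_reForm hνN, ← h3, ← h1]
  push_cast
  ring

end Normals

/-! ### Calculus on subgraphs -/

section Subgraph

open Set Filter Topology

variable {E : Type*} [NormedAddCommGroup E] [NormedSpace ℝ E] [FiniteDimensional ℝ E]

/-- The implicit function theorem for a function that increases in the last variable. -/
theorem exists_subgraph {Ω : Set (E × ℝ)} (hΩ : IsOpen Ω) {r : E × ℝ → ℝ}
    (hr : ∀ p ∈ Ω, ContDiffAt ℝ ∞ r p) (hpos : ∀ p ∈ Ω, 0 < fderiv ℝ r p (0, 1))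
    {p₀ : E × ℝ} (hp₀ : p₀ ∈ Ω) (h0 : r p₀ = 0) :
    ∃ (W : Set E) (a b : ℝ) (f : E → ℝ), IsOpen W ∧ p₀.1 ∈ W ∧ (∀ w ∈ W, ContDiffAt ℝ ∞ f w) ∧
      (∀ w ∈ W, f w ∈ Ioo a b) ∧ W ×ˢ Ioo a b ⊆ Ω ∧ f p₀.1 = p₀.2 ∧
      (∀ w ∈ W, r (w, f w) = 0) ∧ ∀ w ∈ W, ∀ s ∈ Ioo a b, r (w, s) < 0 ↔ s < f w := by
  have hD : ∀ p ∈ Ω, ∃ L : (E × ℝ) ≃L[ℝ] (E × ℝ),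
      HasStrictFDerivAt (fun p : E × ℝ => (p.1, r p)) (L : (E × ℝ) →L[ℝ] (E × ℝ)) p := by
    intro p hp
    have h1 : HasStrictFDerivAt r (fderiv ℝ r p) p := (hr p hp).hasStrictFDerivAt (by simp)
    -- The derivative of (w, s) ↦ (w, r(w, s)) is triangular, with the positive diagonal entry ∂_s
    -- r, hence invertible.
    set L := (ContinuousLinearEquiv.refl ℝ E).skewProd
      (ContinuousLinearEquiv.smulLeft (R₁ := ℝ) (Units.mk0 _ (hpos p hp).ne'))
      ((fderiv ℝ r p).comp (ContinuousLinearMap.inl ℝ E ℝ))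
    have h2 := (hasStrictFDerivAt_fst (𝕜 := ℝ) (p := p)).prodMk h1
    have hL : (L : (E × ℝ) →L[ℝ] (E × ℝ)) =
        (ContinuousLinearMap.fst ℝ E ℝ).prod (fderiv ℝ r p) := by
      refine ContinuousLinearMap.ext fun x => Prod.ext rfl ?_
      have h3 : L x = (x.1, fderiv ℝ r p (0, 1) • x.2 + fderiv ℝ r p (x.1, 0)) := rfl
      have h4 : x = x.2 • ((0, 1) : E × ℝ) + (x.1, 0) := by ext <;> simp
      rw [ContinuousLinearEquiv.coe_coe, h3]
      dsimp only [ContinuousLinearMap.prod_apply]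
      conv_rhs => rw [h4, map_add, map_smul]
      rw [smul_eq_mul, smul_eq_mul, mul_comm]
    exact ⟨L, hL ▸ h2⟩
  have hs : ∀ p ∈ Ω, ContDiffAt ℝ ∞ (fun p : E × ℝ => (p.1, r p)) p := fun p hp =>
    contDiffAt_fst.prodMk (hr p hp)
  obtain ⟨L₀, hL₀⟩ := hD p₀ hp₀
  set ψ := (hL₀.toOpenPartialHomeomorph _).restrOpen Ω hΩ with hψ
  have hψc : ∀ p, ψ p = (p.1, r p) := fun p => rfl
  have hψs : ψ.source ⊆ Ω := fun p hp => hp.2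
  have hp₀s : p₀ ∈ ψ.source := ⟨hL₀.mem_toOpenPartialHomeomorph_source, hp₀⟩
  set f : E → ℝ := fun w => (ψ.symm (w, 0)).2 with hf
  set V : Set E := {w | (w, (0 : ℝ)) ∈ ψ.target}
  have hV : IsOpen V := ψ.open_target.preimage (by fun_prop)
  have hVs : ∀ w ∈ V, (w, f w) ∈ ψ.source ∧ r (w, f w) = 0 ∧ ψ.symm (w, 0) = (w, f w) := by
    intro w hw
    have h1 := ψ.right_inv hw
    rw [hψc] at h1
    have h2 : ψ.symm (w, 0) = (w, f w) := Prod.ext (show (ψ.symm (w, 0)).1 = w from congrArg Prod.fst h1) rfl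
    have h3 := congrArg Prod.snd h1
    rw [h2] at h3
    exact ⟨h2 ▸ ψ.map_target hw, h3, h2⟩
  have hfs : ∀ w ∈ V, ContDiffAt ℝ ∞ f w := by
    intro w hw
    obtain ⟨L, hL⟩ := hD _ (hψs (ψ.map_target hw))
    have h1 : ContDiffAt ℝ ∞ ψ.symm (w, 0) :=
      ψ.contDiffAt_symm hw hL.hasFDerivAt (hs _ (hψs (ψ.map_target hw)))
    exact contDiffAt_snd.comp w (h1.comp w (contDiffAt_id.prodMk contDiffAt_const))
  have hp₀V : p₀.1 ∈ V := by
    have := ψ.map_source hp₀s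
    rwa [hψc, h0] at this
  have hf0 : f p₀.1 = p₀.2 := by
    have := ψ.left_inv hp₀s
    rw [hψc, h0] at this
    rw [hf]
    dsimp only
    rw [this]
  obtain ⟨u, v, hu, hp₀u, hv, hp₀v, huv⟩ := mem_nhds_prod_iff'.1 (ψ.open_source.mem_nhds hp₀s)
  obtain ⟨δ, hδ, hδv⟩ := Metric.isOpen_iff.1 hv _ hp₀v
  rw [Real.ball_eq_Ioo] at hδv
  have hfc : ContinuousOn f V := fun w hw => (hfs w hw).continuousAt.continuousWithinAt
  refine ⟨(V ∩ f ⁻¹' Ioo (p₀.2 - δ) (p₀.2 + δ)) ∩ u, p₀.2 - δ, p₀.2 + δ, f,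
    (hfc.isOpen_inter_preimage hV isOpen_Ioo).inter hu, ⟨⟨hp₀V, ?_⟩, hp₀u⟩,
    fun w hw => hfs w hw.1.1, fun w hw => hw.1.2, ?_, hf0, fun w hw => (hVs w hw.1.1).2.1, ?_⟩
  · rw [mem_preimage, hf0]
    constructor <;> linarith
  · rintro ⟨w, s⟩ ⟨hw, hs'⟩
    exact hψs (huv ⟨hw.2, hδv hs'⟩)
  · intro w hw s hs'
    have hΩ' : ∀ s ∈ Ioo (p₀.2 - δ) (p₀.2 + δ), (w, s) ∈ Ω := fun s hs' =>
      hψs (huv ⟨hw.2, hδv hs'⟩)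
    have hder : ∀ s ∈ Ioo (p₀.2 - δ) (p₀.2 + δ),
        HasDerivAt (fun s => r (w, s)) (fderiv ℝ r (w, s) (0, 1)) s := fun s hs' => by
      have h1 : HasFDerivAt r (fderiv ℝ r (w, s)) (w, s) :=
        ((hr _ (hΩ' s hs')).differentiableAt (by simp)).hasFDerivAt
      exact h1.comp_hasDerivAt s ((hasDerivAt_const s w).prodMk (hasDerivAt_id s))
    -- On each vertical segment r is strictly increasing with zero at f w, so its negative set is
    -- the part below the graph.
    have hmono : StrictMonoOn (fun s => r (w, s)) (Ioo (p₀.2 - δ) (p₀.2 + δ)) := by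
      refine strictMonoOn_of_deriv_pos (convex_Ioo _ _)
        (fun s hs' => (hder s hs').continuousAt.continuousWithinAt) fun s hs' => ?_
      rw [interior_Ioo] at hs'
      rw [(hder s hs').deriv]
      exact hpos _ (hΩ' s hs')
    have := hmono.lt_iff_lt hs' hw.1.2
    rw [← this]
    simp only [(hVs w hw.1.1).2.1]

variable [MeasurableSpace E] [BorelSpace E] (μ : Measure E) [μ.IsAddHaarMeasure]

theorem integral_fderiv_eq_zero {v : E → ℂ} (hv : ContDiff ℝ 1 v) (hc : HasCompactSupport v)
    (e : E) : ∫ w, fderiv ℝ v w e ∂μ = 0 := by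
  have h1 : Integrable (fun w => fderiv ℝ v w e) μ :=
    ((hv.continuous_fderiv (by simp)).clm_apply continuous_const).integrable_of_hasCompactSupport
      (hc.fderiv_apply (𝕜 := ℝ) e)
  have h2 := integral_mul_fderiv_eq_neg_fderiv_mul_of_integrable (μ := μ) (f := fun _ : E => (1 : ℂ))
    (g := v) (v := e) (by simp) (by simpa using h1)
    (by simpa using hv.continuous.integrable_of_hasCompactSupport hc)
    (fun x _ => differentiableAt_const _) fun x _ => hv.differentiable (by simp) x
  simpa using h2

/-- Fubini in two orders: the tangential derivative integrates to zero along each horizontal slice,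
and the vertical one leaves its boundary value since k does not depend on the height. -/
theorem integral_halfSpace {v : E × ℝ → ℂ} (hv : ContDiff ℝ 1 v) (hc : HasCompactSupport v)
    {k : E → ℂ} (hk : Continuous k) (e : E) :
    ∫ p in univ ×ˢ Iio 0, (fderiv ℝ v p (e, 0) + k p.1 * fderiv ℝ v p (0, 1)) ∂(μ.prod volume) =
      ∫ w, k w * v (w, 0) ∂μ := by
  have hfd : ∀ d, Continuous fun p => fderiv ℝ v p d := fun d =>
    (hv.continuous_fderiv (by simp)).clm_apply continuous_const
  have hI1 : Integrable (fun p => fderiv ℝ v p (e, 0)) (μ.prod volume) :=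
    (hfd _).integrable_of_hasCompactSupport (hc.fderiv_apply (𝕜 := ℝ) _)
  have hI2 : Integrable (fun p : E × ℝ => k p.1 * fderiv ℝ v p (0, 1)) (μ.prod volume) :=
    ((hk.comp continuous_fst).mul (hfd _)).integrable_of_hasCompactSupport
      (hc.fderiv_apply (𝕜 := ℝ) _).mul_left
  have hd1 : ∀ s w, fderiv ℝ v (w, s) (e, 0) = fderiv ℝ (fun w => v (w, s)) w e := by
    intro s w
    have h1 : HasFDerivAt v (fderiv ℝ v (w, s)) (w, s) :=
      (hv.differentiable (by simp) _).hasFDerivAt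
    have h3 : HasFDerivAt (fun w => v (w, s)) _ w := HasFDerivAt.comp (f := fun w => (w, s)) w h1
      ((hasFDerivAt_id w).prodMk (hasFDerivAt_const s w))
    rw [h3.fderiv]
    simp
  have hd2 : ∀ w s, fderiv ℝ v (w, s) (0, 1) = deriv (fun s => v (w, s)) s := by
    intro w s
    have h1 : HasFDerivAt v (fderiv ℝ v (w, s)) (w, s) :=
      (hv.differentiable (by simp) _).hasFDerivAt
    exact (h1.comp_hasDerivAt s ((hasDerivAt_const s w).prodMk (hasDerivAt_id s))).deriv.symm
  have hcs : ∀ s, HasCompactSupport fun w => v (w, s) := fun s =>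
    hc.comp_isClosedEmbedding ⟨isEmbedding_prodMkLeft s, by
      have : range (fun w : E => (w, s)) = {p | p.2 = s} := by
        ext ⟨a, b⟩
        simp [eq_comm]
      exact this ▸ isClosed_eq continuous_snd continuous_const⟩
  have hcw : ∀ w, HasCompactSupport fun s => v (w, s) := fun w =>
    hc.comp_isClosedEmbedding ⟨isEmbedding_prodMkRight w, by
      have : range (fun s : ℝ => (w, s)) = {p | p.1 = w} := by
        ext ⟨a, b⟩
        simp [eq_comm]
      exact this ▸ isClosed_eq continuous_fst continuous_const⟩
  rw [integral_add hI1.restrict hI2.restrict, ← Measure.prod_restrict, Measure.restrict_univ]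
  have hI1' : Integrable (fun p => fderiv ℝ v p (e, 0)) (μ.prod (volume.restrict (Iio 0))) := by
    have := hI1.restrict (s := univ ×ˢ Iio 0)
    rwa [← Measure.prod_restrict, Measure.restrict_univ] at this
  have hI2' : Integrable (fun p : E × ℝ => k p.1 * fderiv ℝ v p (0, 1))
      (μ.prod (volume.restrict (Iio 0))) := by
    have := hI2.restrict (s := univ ×ˢ Iio 0)
    rwa [← Measure.prod_restrict, Measure.restrict_univ] at this
  rw [integral_prod_symm _ hI1', integral_prod _ hI2']
  have e1 : ∀ s, ∫ w, fderiv ℝ v (w, s) (e, 0) ∂μ = 0 := fun s => by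
    simp only [hd1]
    exact integral_fderiv_eq_zero μ (hv.comp (contDiff_id.prodMk contDiff_const)) (hcs s) e
  have e2 : ∀ w, ∫ s in Iio 0, k w * fderiv ℝ v (w, s) (0, 1) = k w * v (w, 0) := fun w => by
    rw [integral_const_mul]
    simp only [hd2]
    have h1 : ContDiff ℝ 1 fun s => v (w, s) := hv.comp (contDiff_const.prodMk contDiff_id)
    rw [← integral_Iic_eq_integral_Iio, HasCompactSupport.integral_Iic_deriv_eq h1 (hcw w)]
  simp only [e1, e2, integral_zero, zero_add]

/-- The shear along the graph of a continuous function. -/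
def shearHomeo {f : E → ℝ} (hf : Continuous f) : E × ℝ ≃ₜ E × ℝ where
  toFun p := (p.1, p.2 + f p.1)
  invFun p := (p.1, p.2 - f p.1)
  left_inv p := by simp
  right_inv p := by simp
  continuous_toFun := by fun_prop
  continuous_invFun := by fun_prop

/-- The shear along f carries the half space to the subgraph and preserves measure; by the chain
rule the vertical part of the direction becomes c - f'(e). -/
theorem integral_subgraph_of_contDiff {v : E × ℝ → ℂ} (hv : ContDiff ℝ 1 v)
    (hc : HasCompactSupport v) {f : E → ℝ} (hf : ContDiff ℝ 1 f) (e : E) (c : ℝ) :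
    ∫ p in {p : E × ℝ | p.2 < f p.1}, fderiv ℝ v p (e, c) ∂(μ.prod volume) =
      ∫ w, ((c - fderiv ℝ f w e : ℝ) : ℂ) * v (w, f w) ∂μ := by
  set S := shearHomeo hf.continuous
  have hS : ∀ p, S p = (p.1, p.2 + f p.1) := fun p => rfl
  have hSm : MeasurePreserving S (μ.prod volume) (μ.prod volume) :=
    measurePreserving_shear μ volume hf.continuous.measurable
  rw [← hSm.setIntegral_preimage_emb S.measurableEmbedding]
  have hset : S ⁻¹' {p : E × ℝ | p.2 < f p.1} = univ ×ˢ Iio 0 := by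
    ext p
    simp [hS]
  have hvS : ContDiff ℝ 1 (v ∘ S) := by
    refine hv.comp ?_
    exact contDiff_fst.prodMk (contDiff_snd.add (hf.comp contDiff_fst))
  have hd : ∀ p, fderiv ℝ v (S p) (e, c) = fderiv ℝ (v ∘ S) p (e, 0) +
      ((c - fderiv ℝ f p.1 e : ℝ) : ℂ) * fderiv ℝ (v ∘ S) p (0, 1) := by
    intro p
    have h1 : HasFDerivAt v (fderiv ℝ v (S p)) (S p) := (hv.differentiable (by simp) _).hasFDerivAt
    have h2 : HasFDerivAt f (fderiv ℝ f p.1) p.1 := (hf.differentiable (by simp) _).hasFDerivAt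
    have h3 : HasFDerivAt S _ p := hasFDerivAt_fst.prodMk
      (hasFDerivAt_snd.add (h2.comp p hasFDerivAt_fst))
    rw [(h1.comp p h3).fderiv]
    rw [← Complex.real_smul, ← map_smul, ← map_add]
    simp only [ContinuousLinearMap.comp_apply]
    congr 1
    simp
  rw [hset]
  simp only [hd]
  have hk : Continuous fun w => ((c - fderiv ℝ f w e : ℝ) : ℂ) :=
    Complex.continuous_ofReal.comp (continuous_const.sub
      ((hf.continuous_fderiv (by simp)).clm_apply continuous_const))
  rw [integral_halfSpace μ hvS (hc.comp_homeomorph S) hk e]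
  simp [hS]

/-- The divergence theorem under a graph, for one direction. -/
theorem integral_subgraph {v : E × ℝ → ℂ} (hv : ContDiff ℝ 1 v) (hc : HasCompactSupport v)
    {W : Set E} (hW : IsOpen W) {f : E → ℝ} (hf : ∀ w ∈ W, ContDiffAt ℝ 1 f w)
    (hs : ∀ p ∈ tsupport v, p.1 ∈ W) (e : E) (c : ℝ) :
    ∫ p in {p : E × ℝ | p.1 ∈ W ∧ p.2 < f p.1}, fderiv ℝ v p (e, c) ∂(μ.prod volume) =
      ∫ w in W, ((c - fderiv ℝ f w e : ℝ) : ℂ) * v (w, f w) ∂μ := by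
  set K := Prod.fst '' tsupport v
  have hK : IsCompact K := hc.isCompact.image continuous_fst
  have hKW : K ⊆ W := by
    rintro _ ⟨p, hp, rfl⟩
    exact hs p hp
  -- As f is controlled only on W, it is multiplied by a cutoff equal to 1 near the projection of
  -- the support of v. Neither integral notices the change.
  obtain ⟨t, ht, hKt, htW⟩ := exists_compact_between hK hW hKW
  obtain ⟨χ, hχ1, hχ0, -⟩ := exists_contMDiffMap_one_nhds_of_subset_interior (n := 1) 𝓘(ℝ, E)
    hK.isClosed hKt
  have hχ : ContDiff ℝ 1 χ := χ.contMDiff.contDiff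
  set f₁ : E → ℝ := fun w => χ w * f w with hf₁
  have hf₁s : ContDiff ℝ 1 f₁ := by
    rw [contDiff_iff_contDiffAt]
    intro w
    by_cases hw : w ∈ W
    · exact hχ.contDiffAt.mul (hf w hw)
    · have h1 : f₁ =ᶠ[𝓝 w] fun _ => 0 := by
        filter_upwards [ht.isClosed.isOpen_compl.mem_nhds fun h => hw (htW h)] with x hx
        rw [hf₁]
        simp [hχ0 x hx]
      exact contDiffAt_const.congr_of_eventuallyEq h1
  have heq : ∀ w ∈ K, f₁ =ᶠ[𝓝 w] f := fun w hw => by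
    filter_upwards [hχ1.filter_mono (nhds_le_nhdsSet hw)] with x hx
    rw [hf₁]
    simp [hx]
  have hWf : IsOpen {p : E × ℝ | p.1 ∈ W ∧ p.2 < f p.1} := by
    have h1 : ContinuousOn (fun p : E × ℝ => p.2 - f p.1) (W ×ˢ univ) := by
      refine continuousOn_snd.sub (ContinuousOn.comp (t := W) (fun w hw =>
        (hf w hw).continuousAt.continuousWithinAt) continuousOn_fst fun p hp => hp.1)
    have h2 := h1.isOpen_inter_preimage (hW.prod isOpen_univ) (isOpen_Iio (a := 0))
    convert h2 using 1
    ext p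
    simp
  rw [← integral_indicator hWf.measurableSet, ← integral_indicator hW.measurableSet]
  have key := integral_subgraph_of_contDiff μ hv hc hf₁s e c
  have hlt : IsOpen {p : E × ℝ | p.2 < f₁ p.1} :=
    isOpen_lt continuous_snd (hf₁s.continuous.comp continuous_fst)
  rw [← integral_indicator hlt.measurableSet] at key
  convert key using 1
  · refine integral_congr_ae (Eventually.of_forall fun p => ?_)
    by_cases hp : p ∈ tsupport v
    · have hpK : p.1 ∈ K := ⟨p, hp, rfl⟩
      have h1 := (heq _ hpK).self_of_nhds
      simp only [indicator, mem_ofPred_eq, h1, hKW hpK, true_and]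
    · have h1 : fderiv ℝ v p = 0 := by
        by_contra h
        exact hp (support_fderiv_subset ℝ h)
      simp [indicator, h1]
  · refine integral_congr_ae (Eventually.of_forall fun w => ?_)
    by_cases hw : w ∈ K
    · dsimp only
      rw [indicator_of_mem (hKW hw), (heq w hw).self_of_nhds, (heq w hw).fderiv_eq]
    · have h1 : ∀ s, v (w, s) = 0 := fun s => by
        by_contra h
        exact hw ⟨(w, s), subset_tsupport _ h, rfl⟩
      simp [indicator, h1]

end Subgraph

/-! ### The smooth part of the boundary as a graph -/

section Gram

open Matrix

variable {n : ℕ}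

theorem det_gram_comp (G : Matrix (Fin n) (Fin n) ℂ) (T : HPar n →L[ℝ] Cn n)
    (K : HPar n →L[ℝ] HPar n) :
    (Matrix.of fun a b => reForm G (T (K (Pi.single a 1))) (T (K (Pi.single b 1)))).det =
      K.det ^ 2 * (Matrix.of fun a b => reForm G (T (Pi.single a 1)) (T (Pi.single b 1))).det := by
  set B : HPar n →ₗ[ℝ] HPar n →ₗ[ℝ] ℝ := (LinearMap.mk₂ ℝ (reForm G) reForm_add_left
    reForm_smul_left reForm_add_right reForm_smul_right).compl₁₂ (T : HPar n →ₗ[ℝ] Cn n)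
      (T : HPar n →ₗ[ℝ] Cn n)
  have h1 : (Matrix.of fun a b => reForm G (T (Pi.single a 1)) (T (Pi.single b 1))) =
      LinearMap.toMatrix₂' ℝ B := by
    ext a b
    rw [LinearMap.toMatrix₂'_apply]
    rfl
  have h2 : (Matrix.of fun a b => reForm G (T (K (Pi.single a 1))) (T (K (Pi.single b 1)))) =
      LinearMap.toMatrix₂' ℝ (B.compl₁₂ (K : HPar n →ₗ[ℝ] HPar n) (K : HPar n →ₗ[ℝ] HPar n)) := by
    ext a b
    rw [LinearMap.toMatrix₂'_apply]
    rfl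
  rw [h2, LinearMap.toMatrix₂'_compl₁₂, det_mul, det_mul, det_transpose, LinearMap.det_toMatrix',
    h1, ContinuousLinearMap.det]
  ring

end Gram

/-! ### Derivatives of functions and parametrizations in charts -/

section ChainRule

set_option linter.unusedSectionVars false

variable {n : ℕ} {X : Type*} [TopologicalSpace X] [ChartedSpace (Cn n) X]
  [IsManifold 𝓘(ℂ, Cn n) ω X] {φ : OpenPartialHomeomorph X (Cn n)}
  {F : Type*} [NormedAddCommGroup F] [NormedSpace ℝ F]

theorem differentiableAt_comp_symm (hφ : φ ∈ holCharts n X) {ρ : X → F} {x : X}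
    (hx : x ∈ φ.source) (hρ : MDifferentiableAt 𝓘(ℝ, Cn n) 𝓘(ℝ, F) ρ x) :
    DifferentiableAt ℝ (fun z => ρ (φ.symm z)) (φ x) := by
  rw [← mdifferentiableAt_iff_differentiableAt]
  refine MDifferentiableAt.comp (φ x) ?_
    ((mdifferentiable_real_of_holCharts hφ).mdifferentiableAt_symm (φ.map_source hx))
  rwa [φ.left_inv hx]

theorem mfderiv_eq_fderiv_comp_symm (hφ : φ ∈ holCharts n X) {ρ : X → F} {x : X}
    (hx : x ∈ φ.source) (hρ : MDifferentiableAt 𝓘(ℝ, Cn n) 𝓘(ℝ, F) ρ x) (u : RTan n x) :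
    (mfderiv 𝓘(ℝ, Cn n) 𝓘(ℝ, F) ρ x u : F) =
      fderiv ℝ (fun z => ρ (φ.symm z)) (φ x) (chartDeriv φ x (part10 x u)) := by
  have h1 : MDifferentiableAt 𝓘(ℝ, Cn n) 𝓘(ℝ, F) (fun z => ρ (φ.symm z)) (φ x) :=
    (differentiableAt_comp_symm hφ hx hρ).mdifferentiableAt
  have h2 := (mdifferentiable_real_of_holCharts hφ).mdifferentiableAt hx
  have h3 := mfderiv_comp x h1 h2
  have h4 : (fun z => ρ (φ.symm z)) ∘ φ =ᶠ[nhds x] ρ := by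
    filter_upwards [φ.open_source.mem_nhds hx] with y hy
    simp [φ.left_inv hy]
  rw [h4.mfderiv_eq, mfderiv_eq_fderiv] at h3
  rw [← chartDeriv_real hφ hx]
  exact congrArg (fun A => A u) h3

theorem contDiffAt_comp_symm (hφ : φ ∈ holCharts n X) {ρ : X → F} {z : Cn n}
    (hz : z ∈ φ.target) (hρ : ContMDiffAt 𝓘(ℝ, Cn n) 𝓘(ℝ, F) ∞ ρ (φ.symm z)) :
    ContDiffAt ℝ ∞ (fun z => ρ (φ.symm z)) z := by
  rw [← contMDiffAt_iff_contDiffAt]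
  exact hρ.comp z (contMDiffAt_symm_of_mem_maximalAtlas (mem_maximalAtlas_real hφ) hz)

variable {E : Type*} [NormedAddCommGroup E] [NormedSpace ℝ E]

theorem differentiableAt_chart_comp (hφ : φ ∈ holCharts n X) {ψ : E → X} {w : E}
    (hw : ψ w ∈ φ.source) (hψ : MDifferentiableAt 𝓘(ℝ, E) 𝓘(ℝ, Cn n) ψ w) :
    DifferentiableAt ℝ (fun w => φ (ψ w)) w := by
  rw [← mdifferentiableAt_iff_differentiableAt]
  exact ((mdifferentiable_real_of_holCharts hφ).mdifferentiableAt hw).comp w hψ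

theorem chartDeriv_mfderiv (hφ : φ ∈ holCharts n X) {ψ : E → X} {w : E}
    (hw : ψ w ∈ φ.source) (hψ : MDifferentiableAt 𝓘(ℝ, E) 𝓘(ℝ, Cn n) ψ w) (e : E) :
    chartDeriv φ (ψ w) (part10 (ψ w) (mfderiv 𝓘(ℝ, E) 𝓘(ℝ, Cn n) ψ w e)) =
      fderiv ℝ (fun w => φ (ψ w)) w e := by
  have h2 := (mdifferentiable_real_of_holCharts hφ).mdifferentiableAt hw
  have h3 := mfderiv_comp w h2 hψ
  have h4 : φ ∘ ψ = fun w => φ (ψ w) := rfl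
  rw [h4, mfderiv_eq_fderiv] at h3
  rw [← chartDeriv_real hφ hw]
  exact (congrArg (fun A => A e) h3).symm

end ChainRule

/-! ### The boundary as a graph over a hyperplane -/

section Graph

set_option linter.unusedSectionVars false

open Matrix Set

variable {n : ℕ} {X : Type*} [TopologicalSpace X] [ChartedSpace (Cn n) X]

/-- In the coordinates `A` of the chart `φ`, the set `U` is a subgraph over `W`. -/
structure GraphChart (U : Set X) (φ : OpenPartialHomeomorph X (Cn n))
    (A : (HPar n × ℝ) ≃L[ℝ] Cn n) (W : Set (HPar n)) (a b : ℝ) (f : HPar n → ℝ) : Prop where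
  chart : φ ∈ holCharts n X
  coord : MeasurePreserving A volume volume
  isOpen : IsOpen W
  smooth : ∀ w ∈ W, ContDiffAt ℝ ∞ f w
  mem_Ioo : ∀ w ∈ W, f w ∈ Ioo a b
  mem_target : ∀ w ∈ W, ∀ s ∈ Ioo a b, A (w, s) ∈ φ.target
  mem_iff : ∀ w ∈ W, ∀ s ∈ Ioo a b, φ.symm (A (w, s)) ∈ U ↔ s < f w
  defFun : ∀ w ∈ W, ∃ Wρ ρ, IsDefFun n U (φ.symm (A (w, f w))) Wρ ρ

/-- The parametrization of the boundary in a graph chart. -/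
def graphParam (φ : OpenPartialHomeomorph X (Cn n)) (A : (HPar n × ℝ) ≃L[ℝ] Cn n)
    (f : HPar n → ℝ) (w : HPar n) : X := φ.symm (A (w, f w))

/-- The open set of `ℂⁿ` in which the boundary is a graph. -/
def graphBox (A : (HPar n × ℝ) ≃L[ℝ] Cn n) (W : Set (HPar n)) (a b : ℝ) : Set (Cn n) :=
  A.symm ⁻¹' (W ×ˢ Ioo a b)

/-- The open set in which the boundary is a graph. -/
def graphNhd (φ : OpenPartialHomeomorph X (Cn n)) (A : (HPar n × ℝ) ≃L[ℝ] Cn n)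
    (W : Set (HPar n)) (a b : ℝ) : Set X := φ.source ∩ φ ⁻¹' graphBox A W a b

/-- The conormal of the graph of `f` over `w`. -/
def conormal (A : (HPar n × ℝ) ≃L[ℝ] Cn n) (f : HPar n → ℝ) (w : HPar n) : Cn n →L[ℝ] ℝ :=
  (ContinuousLinearMap.snd ℝ (HPar n) ℝ - (fderiv ℝ f w).comp
    (ContinuousLinearMap.fst ℝ (HPar n) ℝ)).comp (A.symm : Cn n →L[ℝ] (HPar n × ℝ))

theorem conormal_apply (A : (HPar n × ℝ) ≃L[ℝ] Cn n) (f : HPar n → ℝ) (w e : HPar n) (s : ℝ) :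
    conormal A f w (A (e, s)) = s - fderiv ℝ f w e := by
  simp [conormal]

variable [IsManifold 𝓘(ℂ, Cn n) ω X] {U : Set X} {φ : OpenPartialHomeomorph X (Cn n)}
  {A : (HPar n × ℝ) ≃L[ℝ] Cn n} {W : Set (HPar n)} {a b : ℝ} {f : HPar n → ℝ}

/-- Choose volume preserving coordinates whose last axis increases the defining function, and apply
the implicit function theorem. The domain is cut down to where that increase is strict, so the same
function is a defining function at every point of the graph. -/
theorem exists_graphChart {p : X} (hp : p ∈ smoothBdry n U) :
    ∃ (φ : OpenPartialHomeomorph X (Cn n)) (A : (HPar n × ℝ) ≃L[ℝ] Cn n) (W : Set (HPar n))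
      (a b : ℝ) (f : HPar n → ℝ), GraphChart U φ A W a b f ∧ p ∈ graphNhd φ A W a b := by
  obtain ⟨-, Wρ, ρ, hρ⟩ := hp
  set φ := chartAt (Cn n) p
  have hφ : φ ∈ holCharts n X := chartAt_mem_holCharts p
  have hpφ : p ∈ φ.source := mem_chart_source _ p
  have hρs : ∀ q ∈ Wρ, ContMDiffAt 𝓘(ℝ, Cn n) 𝓘(ℝ, ℝ) ∞ ρ q := fun q hq =>
    hρ.smooth.contMDiffAt (hρ.isOpen.mem_nhds hq)
  have hρd : ∀ q ∈ Wρ, MDifferentiableAt 𝓘(ℝ, Cn n) 𝓘(ℝ, ℝ) ρ q := fun q hq =>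
    (hρs q hq).mdifferentiableAt (by simp)
  set ρ₁ : Cn n → ℝ := fun z => ρ (φ.symm z)
  have hℓ : fderiv ℝ ρ₁ (φ p) ≠ 0 := by
    intro h
    refine hρ.deriv_ne (ContinuousLinearMap.ext fun u => ?_)
    have h1 := mfderiv_eq_fderiv_comp_symm hφ hpφ (hρd p hρ.mem) u
    have h2 : fderiv ℝ (fun z => ρ (φ.symm z)) (φ p) = 0 := h
    rw [h2] at h1
    exact h1
  obtain ⟨A, hA, hpos⟩ := exists_measurePreserving_coord _ hℓ
  set r : HPar n × ℝ → ℝ := fun q => ρ₁ (A q) with hr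
  set Ω₀ : Set (HPar n × ℝ) := A ⁻¹' (φ.target ∩ φ.symm ⁻¹' Wρ)
  have hΩ₀ : IsOpen Ω₀ := (φ.symm.isOpen_inter_preimage hρ.isOpen).preimage A.continuous
  have hρ₁s : ∀ q ∈ Ω₀, ContDiffAt ℝ ∞ ρ₁ (A q) := fun q hq =>
    contDiffAt_comp_symm hφ hq.1 (hρs _ hq.2)
  have hrs : ∀ q ∈ Ω₀, ContDiffAt ℝ ∞ r q := fun q hq =>
    (hρ₁s q hq).comp q A.contDiff.contDiffAt
  have hrd : ∀ q ∈ Ω₀, ∀ e, fderiv ℝ r q e = fderiv ℝ ρ₁ (A q) (A e) := by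
    intro q hq e
    have h1 : HasFDerivAt ρ₁ (fderiv ℝ ρ₁ (A q)) (A q) :=
      ((hρ₁s q hq).differentiableAt (by simp)).hasFDerivAt
    have h2 : HasFDerivAt r _ q := h1.comp q A.hasFDerivAt
    rw [h2.fderiv]
    rfl
  have hcont : ContinuousOn (fun q => fderiv ℝ r q (0, 1)) Ω₀ := fun q hq =>
    ((((hrs q hq).fderiv_right (m := 0) (by simp)).clm_apply
      contDiffAt_const).continuousAt).continuousWithinAt
  set Ω := Ω₀ ∩ (fun q => fderiv ℝ r q (0, 1)) ⁻¹' Ioi 0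
  have hΩ : IsOpen Ω := hcont.isOpen_inter_preimage hΩ₀ isOpen_Ioi
  set p₀ := A.symm (φ p)
  have hAp₀ : A p₀ = φ p := A.apply_symm_apply _
  have hp₀ : p₀ ∈ Ω := by
    have h1 : p₀ ∈ Ω₀ := by
      rw [mem_preimage, hAp₀]
      refine ⟨φ.map_source hpφ, ?_⟩
      rw [mem_preimage, φ.left_inv hpφ]
      exact hρ.mem
    refine ⟨h1, ?_⟩
    rw [mem_preimage, hrd p₀ h1, hAp₀]
    exact hpos
  have hr0 : r p₀ = 0 := by
    have : r p₀ = ρ (φ.symm (A p₀)) := rfl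
    rw [this, hAp₀, φ.left_inv hpφ, hρ.zero]
  obtain ⟨W, a, b, f, hW, hpW, hfs, hfI, hWΩ, hf0, hrf, hneg⟩ :=
    exists_subgraph hΩ (fun q hq => hrs q hq.1) (fun q hq => hq.2) hp₀ hr0
  have hΩ' : ∀ w ∈ W, ∀ s ∈ Ioo a b, (w, s) ∈ Ω := fun w hw s hs => hWΩ ⟨hw, hs⟩
  refine ⟨φ, A, W, a, b, f, ⟨hφ, hA, hW, hfs, hfI, fun w hw s hs => (hΩ' w hw s hs).1.1,
    fun w hw s hs => ?_, fun w hw => ⟨Wρ, ρ, ?_⟩⟩, hpφ, ?_⟩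
  · rw [hρ.neg_iff _ (hΩ' w hw s hs).1.2, ← hneg w hw s hs]
  · have h1 := hΩ' w hw _ (hfI w hw)
    refine ⟨hρ.isOpen, h1.1.2, hρ.smooth, hrf w hw, fun h0 => ?_, hρ.neg_iff⟩
    have hq := φ.map_target h1.1.1
    have h2 : fderiv ℝ r (w, f w) (0, 1) = 0 := by
      rw [hrd _ h1.1]
      set u : RTan n (φ.symm (A (w, f w))) := (chartDerivEquiv hφ hq).symm (A (0, 1)) with hu
      have h3 := mfderiv_eq_fderiv_comp_symm hφ hq (hρd _ h1.1.2) u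
      have h4 : chartDeriv φ (φ.symm (A (w, f w))) (part10 _ u) = A (0, 1) := by
        rw [← chartDerivEquiv_apply hφ hq]
        exact (chartDerivEquiv hφ hq).apply_symm_apply _
      rw [h4, φ.right_inv h1.1.1] at h3
      rw [← h3, h0]
      rfl
    exact (lt_irrefl (0 : ℝ)) (h2 ▸ h1.2)
  · refine ⟨hpW, ?_⟩
    have := hfI _ hpW
    rwa [hf0] at this

namespace GraphChart

variable (hg : GraphChart U φ A W a b f)
include hg

theorem graphParam_mem {w : HPar n} (hw : w ∈ W) : A (w, f w) ∈ φ.target :=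
  hg.mem_target w hw _ (hg.mem_Ioo w hw)

theorem graphParam_mem_source {w : HPar n} (hw : w ∈ W) : graphParam φ A f w ∈ φ.source :=
  φ.map_target (hg.graphParam_mem hw)

theorem chart_graphParam {w : HPar n} (hw : w ∈ W) : φ (graphParam φ A f w) = A (w, f w) :=
  φ.right_inv (hg.graphParam_mem hw)

theorem isOpen_graphBox : IsOpen (graphBox A W a b) :=
  (hg.isOpen.prod isOpen_Ioo).preimage A.symm.continuous

theorem isOpen_graphNhd : IsOpen (graphNhd φ A W a b) :=
  φ.isOpen_inter_preimage hg.isOpen_graphBox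

theorem graphBox_subset : graphBox A W a b ⊆ φ.target := by
  intro z hz
  have := hg.mem_target _ hz.1 _ hz.2
  rwa [Prod.mk.eta, A.apply_symm_apply] at this

theorem mem_iff_of_mem_graphBox {z : Cn n} (hz : z ∈ graphBox A W a b) :
    φ.symm z ∈ U ↔ (A.symm z).2 < f (A.symm z).1 := by
  have := hg.mem_iff _ hz.1 _ hz.2
  rwa [Prod.mk.eta, A.apply_symm_apply] at this

theorem graphParam_mem_graphNhd {w : HPar n} (hw : w ∈ W) :
    graphParam φ A f w ∈ graphNhd φ A W a b := by
  refine ⟨hg.graphParam_mem_source hw, ?_⟩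
  rw [mem_preimage, hg.chart_graphParam hw, graphBox, mem_preimage, A.symm_apply_apply]
  exact ⟨hw, hg.mem_Ioo w hw⟩

theorem continuousOn_f : ContinuousOn f W := fun w hw =>
  (hg.smooth w hw).continuousAt.continuousWithinAt

theorem contMDiffOn_graphParam :
    ContMDiffOn 𝓘(ℝ, HPar n) 𝓘(ℝ, Cn n) ∞ (graphParam φ A f) W := by
  intro w hw
  refine ContMDiffAt.contMDiffWithinAt ?_
  have h1 : ContDiffAt ℝ ∞ (fun w => A (w, f w)) w :=
    A.contDiff.contDiffAt.comp w (contDiffAt_id.prodMk (hg.smooth w hw))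
  exact (contMDiffAt_symm_of_mem_maximalAtlas (mem_maximalAtlas_real hg.chart)
    (hg.graphParam_mem hw)).comp w h1.contMDiffAt

/-- A boundary point does not lie below the graph because U is open, nor above it because the region
above is open and misses U. -/
theorem mem_of_mem_frontier (hU : IsOpen U) {q : X} (hq : q ∈ graphNhd φ A W a b)
    (hqf : q ∈ frontier U) : (A.symm (φ q)).1 ∈ W ∧ graphParam φ A f (A.symm (φ q)).1 = q := by
  refine ⟨hq.2.1, ?_⟩
  have hfr := hqf
  rw [hU.frontier_eq] at hfr
  have h1 : ¬ (A.symm (φ q)).2 < f (A.symm (φ q)).1 := by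
    rw [← hg.mem_iff_of_mem_graphBox hq.2, φ.left_inv hq.1]
    exact hfr.2
  have h2 : ¬ f (A.symm (φ q)).1 < (A.symm (φ q)).2 := by
    intro hlt
    have hc : ContinuousOn (fun z => (A.symm z).2 - f (A.symm z).1) (graphBox A W a b) := by
      refine (continuous_snd.comp A.symm.continuous).continuousOn.sub
        (hg.continuousOn_f.comp (continuous_fst.comp A.symm.continuous).continuousOn
          fun z hz => hz.1)
    have ho := φ.isOpen_inter_preimage
      (hc.isOpen_inter_preimage hg.isOpen_graphBox (isOpen_Ioi (a := 0)))
    obtain ⟨y, hy, hyU⟩ := mem_closure_iff.1 hfr.1 _ ho ⟨hq.1, hq.2, sub_pos.2 hlt⟩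
    have h3 := (hg.mem_iff_of_mem_graphBox hy.2.1).1 (by rwa [φ.left_inv hy.1])
    have h4 : 0 < (A.symm (φ y)).2 - f (A.symm (φ y)).1 := hy.2.2
    linarith
  have h3 : f (A.symm (φ q)).1 = (A.symm (φ q)).2 := le_antisymm (not_lt.1 h1) (not_lt.1 h2)
  rw [graphParam, h3, Prod.mk.eta, A.apply_symm_apply, φ.left_inv hq.1]

/-- A point of the graph is not in U, but it is approached from U along the vertical line from
below. -/
theorem graphParam_mem_smoothBdry (hU : IsOpen U) {w : HPar n} (hw : w ∈ W) :
    graphParam φ A f w ∈ smoothBdry n U := by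
  refine ⟨?_, hg.defFun w hw⟩
  rw [hU.frontier_eq]
  refine ⟨?_, fun h => lt_irrefl _ ((hg.mem_iff w hw _ (hg.mem_Ioo w hw)).1 h)⟩
  have h1 : Filter.Tendsto (fun s => φ.symm (A (w, s))) (nhdsWithin (f w) (Iio (f w)))
      (nhds (graphParam φ A f w)) := by
    have h2 : ContinuousAt (fun s => φ.symm (A (w, s))) (f w) := by
      refine ContinuousAt.comp (g := φ.symm) (φ.continuousAt_symm (hg.graphParam_mem hw)) ?_
      exact (A.continuous.comp (by fun_prop : Continuous fun s : ℝ => (w, s))).continuousAt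
    exact h2.tendsto.mono_left nhdsWithin_le_nhds
  refine mem_closure_of_tendsto h1 ?_
  filter_upwards [self_mem_nhdsWithin, nhdsWithin_le_nhds (isOpen_Ioo.mem_nhds (hg.mem_Ioo w hw))]
    with s hs hs'
  exact (hg.mem_iff w hw s hs').2 hs

theorem injOn_graphParam : InjOn (graphParam φ A f) W := by
  intro w hw w' hw' h
  have h1 := congrArg φ h
  rw [hg.chart_graphParam hw, hg.chart_graphParam hw'] at h1
  exact congrArg Prod.fst (A.injective h1)

/-- The derivative of the graph parametrization, in the chart. -/
theorem chartDeriv_graphParam {w : HPar n} (hw : w ∈ W) (e : HPar n) :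
    chartDeriv φ (graphParam φ A f w) (part10 _
      (mfderiv 𝓘(ℝ, HPar n) 𝓘(ℝ, Cn n) (graphParam φ A f) w e)) = A (e, fderiv ℝ f w e) := by
  have hd : MDifferentiableAt 𝓘(ℝ, HPar n) 𝓘(ℝ, Cn n) (graphParam φ A f) w :=
    (hg.contMDiffOn_graphParam.contMDiffAt (hg.isOpen.mem_nhds hw)).mdifferentiableAt (by simp)
  rw [chartDeriv_mfderiv hg.chart (hg.graphParam_mem_source hw) hd]
  have h1 : (fun w => φ (graphParam φ A f w)) =ᶠ[nhds w] fun w => A (w, f w) := by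
    filter_upwards [hg.isOpen.mem_nhds hw] with y hy using hg.chart_graphParam hy
  have h2 : HasFDerivAt f (fderiv ℝ f w) w :=
    ((hg.smooth w hw).differentiableAt (by simp)).hasFDerivAt
  have h3 : HasFDerivAt (fun w => A (w, f w)) _ w :=
    A.hasFDerivAt.comp w ((hasFDerivAt_id w).prodMk h2)
  rw [h1.fderiv_eq, h3.fderiv]
  rfl

theorem isHyperParam (hU : IsOpen U) : IsHyperParam (smoothBdry n U) W (graphParam φ A f) where
  isOpen := hg.isOpen
  smooth := hg.contMDiffOn_graphParam
  injOn := hg.injOn_graphParam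
  immersion := by
    intro w hw
    rw [injective_iff_map_eq_zero]
    intro e he
    have h1 := hg.chartDeriv_graphParam hw e
    rw [he] at h1
    have h2 : chartDeriv φ (graphParam φ A f w) (part10 (graphParam φ A f w) 0) = 0 :=
      map_zero _
    rw [h2] at h1
    have h3 := (A.map_eq_zero_iff.1 h1.symm)
    exact congrArg Prod.fst h3
  mapsTo := fun w hw => hg.graphParam_mem_smoothBdry hU hw

end GraphChart

end Graph

/-! ### The area measure and the outer normal in a graph chart -/

section LinearAlgebra

/-- Perturbing by -εe moves kernel vectors of N into the half space N < 0, so r vanishes on the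
kernel and is a multiple of N. This compares the differential of an arbitrary defining function with
the conormal of the graph. -/
theorem exists_pos_eq_mul_of_neg_imp_nonpos {E : Type*} [AddCommGroup E] [Module ℝ E]
    {N r : E →ₗ[ℝ] ℝ} {e : E} (he : N e = 1) (hr : r ≠ 0) (h : ∀ u, N u < 0 → r u ≤ 0) :
    ∃ c : ℝ, 0 < c ∧ ∀ u, r u = c * N u := by
  have hle : ∀ u, N u = 0 → r u ≤ 0 := by
    intro u hu
    by_contra! hpos
    have h1 : ∀ ε : ℝ, 0 < ε → r u ≤ ε * r e := by
      intro ε hε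
      have := h (u - ε • e) (by simp [hu, he, hε])
      simp only [map_sub, map_smul, smul_eq_mul] at this
      linarith
    rcases le_or_gt (r e) 0 with h2 | h2
    · linarith [h1 1 one_pos]
    · have := h1 (r u / (2 * r e)) (by positivity)
      field_simp at this
      linarith
  have heq : ∀ u, r u = r e * N u := by
    intro u
    have h1 := hle (u - N u • e) (by simp [he])
    have h2 := hle (-(u - N u • e)) (by simp [he])
    simp only [map_neg, map_sub, map_smul, smul_eq_mul] at h1 h2
    linarith
  refine ⟨r e, lt_of_le_of_ne ?_ ?_, heq⟩
  · have := h (-e) (by simp [he])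
    simpa using this
  · intro h0
    refine hr (LinearMap.ext fun u => ?_)
    rw [heq, ← h0]
    simp

theorem eventually_neg_of_hasDerivAt {k : ℝ → ℝ} {k' : ℝ} (hk : HasDerivAt k k' 0) (h0 : k 0 = 0)
    (hneg : k' < 0) : ∀ᶠ t in nhdsWithin 0 (Set.Ioi 0), k t < 0 := by
  filter_upwards [(hk.hasDerivWithinAt (s := Set.Ioi 0)).limsup_slope_le' (by simp) hneg,
    self_mem_nhdsWithin] with t ht htpos
  have htpos' : (0 : ℝ) < t := htpos
  rw [slope_def_field, h0, sub_zero, sub_zero] at ht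
  by_contra! h
  exact absurd ht (not_lt.2 (div_nonneg h htpos'.le))

end LinearAlgebra

/-! ### Outer normal and area measure in a graph chart -/

section Area

set_option linter.unusedSectionVars false

open Matrix Set

variable {n : ℕ} {X : Type*} [TopologicalSpace X] [ChartedSpace (Cn n) X]
  [IsManifold 𝓘(ℂ, Cn n) ω X] {U : Set X} {φ : OpenPartialHomeomorph X (Cn n)}
  {A : (HPar n × ℝ) ≃L[ℝ] Cn n} {W : Set (HPar n)} {a b : ℝ} {f : HPar n → ℝ}
  (g : KahlerMetric n X)

theorem riem_eq_reForm (hφ : φ ∈ holCharts n X) {x : X} (hx : x ∈ φ.source) (u w : RTan n x) :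
    riem g x u w = reForm (gCoeff g φ (φ x)) (chartDeriv φ x (part10 x u))
      (chartDeriv φ x (part10 x w)) := by
  rw [riem, form_eq_sum g hφ hx, reForm]

theorem areaDensity_eq (hφ : φ ∈ holCharts n X) {ψ : HPar n → X} {w : HPar n}
    (hw : ψ w ∈ φ.source) (hψ : MDifferentiableAt 𝓘(ℝ, HPar n) 𝓘(ℝ, Cn n) ψ w) :
    areaDensity g ψ w = Real.sqrt (Matrix.of fun a b => reForm (gCoeff g φ (φ (ψ w)))
      (fderiv ℝ (fun w => φ (ψ w)) w (Pi.single a 1))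
      (fderiv ℝ (fun w => φ (ψ w)) w (Pi.single b 1))).det := by
  rw [areaDensity]
  congr 3
  ext a b
  rw [riem_eq_reForm g hφ hw, chartDeriv_mfderiv hφ hw hψ, chartDeriv_mfderiv hφ hw hψ]

theorem fderiv_comp_symm_ne_zero (hφ : φ ∈ holCharts n X) {p : X} (hp : p ∈ φ.source)
    {Wρ : Set X} {ρ : X → ℝ} (hρ : IsDefFun n U p Wρ ρ) :
    fderiv ℝ (fun z => ρ (φ.symm z)) (φ p) ≠ 0 := by
  intro h
  refine hρ.deriv_ne (ContinuousLinearMap.ext fun u => ?_)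
  have h1 := mfderiv_eq_fderiv_comp_symm hφ hp ((hρ.smooth.contMDiffAt
    (hρ.isOpen.mem_nhds hρ.mem)).mdifferentiableAt (by simp)) u
  rw [h] at h1
  exact h1

theorem dirDeriv_defFun (hφ : φ ∈ holCharts n X) {p : X} (hp : p ∈ φ.source)
    {Wρ : Set X} {ρ : X → ℝ} (hρ : IsDefFun n U p Wρ ρ) (u : RTan n p) :
    dirDeriv ρ p u =
      fderiv ℝ (fun z => ρ (φ.symm z)) (φ p) (chartDeriv φ p (part10 p u)) :=
  mfderiv_eq_fderiv_comp_symm hφ hp ((hρ.smooth.contMDiffAt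
    (hρ.isOpen.mem_nhds hρ.mem)).mdifferentiableAt (by simp)) u

theorem exists_chartDeriv_eq (hφ : φ ∈ holCharts n X) {p : X} (hp : p ∈ φ.source) (v : Cn n) :
    ∃ u : RTan n p, chartDeriv φ p (part10 p u) = v :=
  ⟨(chartDerivEquiv hφ hp).symm v, (chartDerivEquiv hφ hp).apply_symm_apply v⟩

/-- Only existence is at stake, by the Riesz vector of a defining function. That the chosen vector
does not depend on that function is absorbed by `outerNormal_spec`, which treats an arbitrary
choice. -/
theorem isOuterUnitNormal_outerNormal {p : X} (hp : p ∈ smoothBdry n U) :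
    IsOuterUnitNormal g U p (outerNormal g U p) := by
  refine Classical.epsilon_spec (p := fun ν => IsOuterUnitNormal g U p ν) ?_
  obtain ⟨-, Wρ, ρ, hρ⟩ := hp
  set φ := chartAt (Cn n) p
  have hφ : φ ∈ holCharts n X := chartAt_mem_holCharts p
  have hpφ : p ∈ φ.source := mem_chart_source _ p
  obtain ⟨V, hV, c, hc, hVc⟩ := exists_unit_normal (gCoeff_posDef g hφ (φ.map_source hpφ))
    (fderiv_comp_symm_ne_zero hφ hpφ hρ)
  obtain ⟨ν, hν⟩ := exists_chartDeriv_eq hφ hpφ V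
  refine ⟨ν, ?_, Wρ, ρ, hρ, c, hc, fun u => ?_⟩
  · rw [riem_eq_reForm g hφ hpφ, hν, hV]
  · rw [riem_eq_reForm g hφ hpφ, hν, hVc, dirDeriv_defFun hφ hpφ hρ]

namespace GraphChart

variable (hg : GraphChart U φ A W a b f)
include hg

/-- A ray that starts below the tangent plane of the graph enters U at once, where ρ is negative,
while ρ vanishes at its origin. -/
theorem fderiv_defFun_nonpos {w : HPar n} (hw : w ∈ W) {Wρ : Set X} {ρ : X → ℝ}
    (hρ : IsDefFun n U (graphParam φ A f w) Wρ ρ) {u : Cn n} (hu : conormal A f w u < 0) :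
    fderiv ℝ (fun z => ρ (φ.symm z)) (A (w, f w)) u ≤ 0 := by
  set z₀ := A (w, f w) with hz₀
  set ρ₁ : Cn n → ℝ := fun z => ρ (φ.symm z)
  obtain ⟨q, rfl⟩ := A.surjective u
  obtain ⟨e, s⟩ := q
  rw [conormal_apply] at hu
  have hline : ∀ t : ℝ, z₀ + t • A (e, s) = A (w + t • e, f w + t * s) := by
    intro t
    rw [hz₀, ← map_smul, ← map_add]
    rfl
  have hz₀t : z₀ ∈ φ.target := hg.graphParam_mem hw
  have hfw : HasFDerivAt f (fderiv ℝ f w) (w + (0 : ℝ) • e) := by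
    simpa using ((hg.smooth w hw).differentiableAt (by simp)).hasFDerivAt
  have hlin : ∀ {E : Type _} [NormedAddCommGroup E] [NormedSpace ℝ E] (x v : E),
      HasDerivAt (fun t : ℝ => x + t • v) v 0 := fun x v => by
    simpa using ((hasDerivAt_id (0 : ℝ)).smul_const v).const_add x
  have hk : HasDerivAt (fun t : ℝ => (f w + t • s) - f (w + t • e)) (s - fderiv ℝ f w e) 0 :=
    (hlin (f w) s).sub (hfw.comp_hasDerivAt 0 (hlin w e))
  have h1 := eventually_neg_of_hasDerivAt hk (by simp) hu
  have hρd : HasFDerivAt ρ₁ (fderiv ℝ ρ₁ z₀) (z₀ + (0 : ℝ) • A (e, s)) := by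
    rw [zero_smul, add_zero]
    have := differentiableAt_comp_symm hg.chart (hg.graphParam_mem_source hw)
      ((hρ.smooth.contMDiffAt (hρ.isOpen.mem_nhds hρ.mem)).mdifferentiableAt (by simp))
    rw [hg.chart_graphParam hw] at this
    exact this.hasFDerivAt
  have hr : HasDerivAt (fun t : ℝ => -ρ₁ (z₀ + t • A (e, s))) (-(fderiv ℝ ρ₁ z₀ (A (e, s)))) 0 :=
    (hρd.comp_hasDerivAt 0 (hlin z₀ (A (e, s)))).neg
  by_contra! hpos
  have hρ0 : ρ₁ z₀ = 0 := hρ.zero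
  have h2 := eventually_neg_of_hasDerivAt hr (by simp [hρ0]) (by linarith)
  have hopen : IsOpen (graphBox A W a b ∩ (φ.target ∩ φ.symm ⁻¹' Wρ)) :=
    hg.isOpen_graphBox.inter (φ.symm.isOpen_inter_preimage hρ.isOpen)
  have hmem : z₀ ∈ graphBox A W a b ∩ (φ.target ∩ φ.symm ⁻¹' Wρ) := by
    refine ⟨?_, hz₀t, hρ.mem⟩
    rw [graphBox, mem_preimage, hz₀, A.symm_apply_apply]
    exact ⟨hw, hg.mem_Ioo w hw⟩
  have hcont : Continuous fun t : ℝ => z₀ + t • A (e, s) := by fun_prop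
  have h3 : ∀ᶠ t in nhdsWithin (0 : ℝ) (Ioi 0),
      z₀ + t • A (e, s) ∈ graphBox A W a b ∩ (φ.target ∩ φ.symm ⁻¹' Wρ) := by
    refine nhdsWithin_le_nhds (hcont.continuousAt.preimage_mem_nhds (hopen.mem_nhds ?_))
    simpa using hmem
  obtain ⟨t, ht1, ht2, ht3, -, ht5⟩ := (h1.and (h2.and h3)).exists
  have h4 : φ.symm (z₀ + t • A (e, s)) ∈ U := by
    rw [hg.mem_iff_of_mem_graphBox ht3, hline, A.symm_apply_apply]
    simp only [smul_eq_mul] at ht1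
    simp only
    linarith
  have h5 : ρ₁ (z₀ + t • A (e, s)) < 0 := (hρ.neg_iff _ ht5).1 h4
  linarith

/-- The outer unit normal in a graph chart. -/
theorem outerNormal_spec (hU : IsOpen U) {w : HPar n} (hw : w ∈ W) :
    ∃ c : ℝ, 0 < c ∧
      reForm (gCoeff g φ (A (w, f w))) (chartDeriv φ (graphParam φ A f w) (part10 _
          (outerNormal g U (graphParam φ A f w))))
        (chartDeriv φ (graphParam φ A f w) (part10 _
          (outerNormal g U (graphParam φ A f w)))) = 1 ∧
      ∀ u, reForm (gCoeff g φ (A (w, f w))) (chartDeriv φ (graphParam φ A f w) (part10 _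
          (outerNormal g U (graphParam φ A f w)))) u = c * conormal A f w u := by
  set p := graphParam φ A f w with hp
  have hps : p ∈ φ.source := hg.graphParam_mem_source hw
  have hφp : φ p = A (w, f w) := hg.chart_graphParam hw
  obtain ⟨h1, Wρ, ρ, hρ, c, hc, hνc⟩ :=
    isOuterUnitNormal_outerNormal g (hg.graphParam_mem_smoothBdry hU hw)
  have hne := fderiv_comp_symm_ne_zero hg.chart hps hρ
  rw [hφp] at hne
  obtain ⟨l, hl, hlN⟩ := exists_pos_eq_mul_of_neg_imp_nonpos
    (N := (conormal A f w : Cn n →ₗ[ℝ] ℝ))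
    (r := (fderiv ℝ (fun z => ρ (φ.symm z)) (A (w, f w)) : Cn n →ₗ[ℝ] ℝ)) (e := A (0, 1))
    (by simp [conormal_apply]) (fun h => hne (ContinuousLinearMap.coe_inj.1 h))
    (fun u hu => hg.fderiv_defFun_nonpos hw hρ hu)
  refine ⟨c * l, mul_pos hc hl, ?_, fun u => ?_⟩
  · rw [← h1, riem_eq_reForm g hg.chart hps, hφp]
  · obtain ⟨v, rfl⟩ := exists_chartDeriv_eq hg.chart hps u
    have h2 := hνc v
    rw [riem_eq_reForm g hg.chart hps, hφp, dirDeriv_defFun hg.chart hps hρ, hφp] at h2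
    rw [h2, mul_assoc]
    exact congrArg _ (hlN _)

theorem areaDensity_graphParam {w : HPar n} (hw : w ∈ W) :
    areaDensity g (graphParam φ A f) w = Real.sqrt (Matrix.of fun a b =>
      reForm (gCoeff g φ (A (w, f w))) (A (Pi.single a 1, fderiv ℝ f w (Pi.single a 1)))
        (A (Pi.single b 1, fderiv ℝ f w (Pi.single b 1)))).det := by
  rw [areaDensity]
  congr 3
  ext a b
  rw [riem_eq_reForm g hg.chart (hg.graphParam_mem_source hw), hg.chartDeriv_graphParam hw,
    hg.chartDeriv_graphParam hw, hg.chart_graphParam hw]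

/-- The flux of a field of type `(1,0)` through the boundary, in a graph chart. -/
theorem areaDensity_mul_riemC (hU : IsOpen U) {w : HPar n} (hw : w ∈ W)
    (V : HTan n (graphParam φ A f w)) :
    (areaDensity g (graphParam φ A f) w : ℂ) *
        riemC g (graphParam φ A f w) V (outerNormal g U (graphParam φ A f w)) =
      ∑ i, ((gCoeff g φ (A (w, f w))).det * chartDeriv φ (graphParam φ A f w) V i) *
        wirtL i (Complex.ofRealCLM.comp (conormal A f w)) := by
  obtain ⟨c, hc, h1, h2⟩ := hg.outerNormal_spec g hU hw
  rw [hg.areaDensity_graphParam g hw, riemC, form_eq_sum g hg.chart (hg.graphParam_mem_source hw),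
    hg.chart_graphParam hw]
  exact sqrt_det_gram_mul_flux (gCoeff_posDef g hg.chart (hg.graphParam_mem hw)) hg.coord
    (D := fderiv ℝ f w) (conormal_apply A f w) hc h1 h2 _

theorem continuousOn_fderiv : ContinuousOn (fderiv ℝ f) W := fun w hw =>
  ((hg.smooth w hw).fderiv_right (m := 0) (by simp)).continuousAt.continuousWithinAt

theorem continuousOn_areaDensity : ContinuousOn (areaDensity g (graphParam φ A f)) W := by
  have hre : Continuous fun q : Matrix (Fin n) (Fin n) ℂ × Cn n × Cn n =>
      reForm q.1 q.2.1 q.2.2 := by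
    refine Complex.continuous_re.comp (Continuous.dotProduct ?_ ?_)
    · exact continuous_star.comp (continuous_fst.comp continuous_snd)
    · exact continuous_fst.matrix_mulVec (continuous_snd.comp continuous_snd)
  have hAf : ContinuousOn (fun w => A (w, f w)) W :=
    A.continuous.comp_continuousOn (continuousOn_id.prodMk hg.continuousOn_f)
  have hG : ContinuousOn (fun w => gCoeff g φ (A (w, f w))) W := by
    have h1 : ContinuousOn (gCoeff g φ) φ.target :=
      continuousOn_pi.2 fun k => continuousOn_pi.2 fun j =>
        (g.smooth φ hg.chart k j).continuousOn
    exact h1.comp hAf fun w hw => hg.graphParam_mem hw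
  have hT : ∀ a : Fin (2 * n - 1), ContinuousOn (fun w =>
      A (Pi.single a 1, fderiv ℝ f w (Pi.single a 1))) W := fun a =>
    A.continuous.comp_continuousOn (continuousOn_const.prodMk
      (hg.continuousOn_fderiv.clm_apply continuousOn_const))
  have hM : ContinuousOn (fun w => (Matrix.of fun a b =>
      reForm (gCoeff g φ (A (w, f w))) (A (Pi.single a 1, fderiv ℝ f w (Pi.single a 1)))
        (A (Pi.single b 1, fderiv ℝ f w (Pi.single b 1))) :
          Matrix (Fin (2 * n - 1)) (Fin (2 * n - 1)) ℝ)) W := by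
    refine continuousOn_pi.2 fun a => continuousOn_pi.2 fun b => ?_
    exact hre.comp_continuousOn (f := fun w => (gCoeff g φ (A (w, f w)),
      A (Pi.single a 1, fderiv ℝ f w (Pi.single a 1)),
      A (Pi.single b 1, fderiv ℝ f w (Pi.single b 1)))) (hG.prodMk ((hT a).prodMk (hT b)))
  have hdet : Continuous fun M : Matrix (Fin (2 * n - 1)) (Fin (2 * n - 1)) ℝ => M.det :=
    Continuous.matrix_det continuous_id
  have h2 := (Real.continuous_sqrt.comp hdet).comp_continuousOn hM
  exact h2.congr fun w hw => hg.areaDensity_graphParam g hw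

/-- Near w the parametrization ψ is the graph parametrization composed with its own base coordinate
κ. The Gram matrix is therefore transformed by the derivative of κ, and its determinant by the
square of det κ'. -/
theorem areaDensity_comp (hU : IsOpen U) {W' : Set (HPar n)} {ψ : HPar n → X}
    (hψ : IsHyperParam (smoothBdry n U) W' ψ) {w : HPar n} (hw : w ∈ W')
    (hwN : ψ w ∈ graphNhd φ A W a b) :
    DifferentiableAt ℝ (fun w => (A.symm (φ (ψ w))).1) w ∧
    areaDensity g ψ w = |(fderiv ℝ (fun w => (A.symm (φ (ψ w))).1) w).det| *
      areaDensity g (graphParam φ A f) (A.symm (φ (ψ w))).1 := by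
  obtain ⟨κ, hκ₀⟩ : ∃ κ : HPar n → HPar n, κ = fun w => (A.symm (φ (ψ w))).1 := ⟨_, rfl⟩
  have hfront : ∀ w ∈ W', ψ w ∈ frontier U := fun w hw => (hψ.mapsTo hw).1
  obtain ⟨hκW, hκ⟩ := hg.mem_of_mem_frontier hU hwN (hfront w hw)
  rw [← hκ₀]
  have hκw : ∀ w, (A.symm (φ (ψ w))).1 = κ w := fun w => (congrFun hκ₀ w).symm
  rw [hκw]
  have hκ' : κ w ∈ W := hκw w ▸ hκW
  have hψd : MDifferentiableAt 𝓘(ℝ, HPar n) 𝓘(ℝ, Cn n) ψ w :=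
    (hψ.smooth.contMDiffAt (hψ.isOpen.mem_nhds hw)).mdifferentiableAt (by simp)
  have hφψ := (differentiableAt_chart_comp hg.chart hwN.1 hψd).hasFDerivAt
  have hκd : DifferentiableAt ℝ κ w := by
    rw [hκ₀]
    exact (ContinuousLinearMap.fst ℝ (HPar n) ℝ).hasFDerivAt.comp w
      (A.symm.hasFDerivAt.comp w hφψ) |>.differentiableAt
  refine ⟨hκd, ?_⟩
  set K := fderiv ℝ κ w
  have hK : HasFDerivAt κ K w := hκd.hasFDerivAt
  set T : HPar n →L[ℝ] Cn n := (A : (HPar n × ℝ) →L[ℝ] Cn n).comp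
    ((ContinuousLinearMap.id ℝ (HPar n)).prod (fderiv ℝ f (κ w)))
  have hloc : (fun w => φ (ψ w)) =ᶠ[nhds w] fun w => A (κ w, f (κ w)) := by
    have hopen : IsOpen (W' ∩ ψ ⁻¹' graphNhd φ A W a b) :=
      hψ.smooth.continuousOn.isOpen_inter_preimage hψ.isOpen hg.isOpen_graphNhd
    filter_upwards [hopen.mem_nhds ⟨hw, hwN⟩] with y hy
    obtain ⟨h1, h2⟩ := hg.mem_of_mem_frontier hU hy.2 (hfront y hy.1)
    rw [hκw] at h1 h2
    rw [← hg.chart_graphParam h1, h2]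
  have hfd : HasFDerivAt (fun w => A (κ w, f (κ w))) (T.comp K) w := by
    have h1 : HasFDerivAt f (fderiv ℝ f (κ w)) (κ w) :=
      ((hg.smooth _ hκ').differentiableAt (by simp)).hasFDerivAt
    have h2 : HasFDerivAt (fun w => f (κ w)) ((fderiv ℝ f (κ w)).comp K) w := h1.comp w hK
    have h3 : HasFDerivAt (fun w => (κ w, f (κ w))) (K.prod ((fderiv ℝ f (κ w)).comp K)) w :=
      hK.prodMk h2
    exact HasFDerivAt.comp (g := A) w A.hasFDerivAt h3
  rw [areaDensity_eq g hg.chart hwN.1 hψd, hg.areaDensity_graphParam g hκ', hloc.fderiv_eq,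
    hfd.fderiv]
  have hφψw : φ (ψ w) = A (κ w, f (κ w)) := hloc.self_of_nhds
  rw [hφψw]
  have := det_gram_comp (gCoeff g φ (A (κ w, f (κ w)))) T K
  refine (congrArg Real.sqrt this).trans ?_
  rw [Real.sqrt_mul (sq_nonneg _), Real.sqrt_sq_eq_abs]
  rfl

variable [MeasurableSpace X] [BorelSpace X]

/-- Every parametrization of the smooth boundary factors through the graph over this neighbourhood,
with compatible densities, so the graph dominates in the least upper bound. -/
theorem areaMeasure_restrict (hU : IsOpen U) :
    (areaMeasure g (smoothBdry n U)).restrict (graphNhd φ A W a b) =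
      paramMeasure volume W (graphParam φ A f) (areaDensity g (graphParam φ A f)) := by
  have hlub : IsLUB {m | ∃ W' ψ, IsHyperParam (smoothBdry n U) W' ψ ∧
      m = paramMeasure volume W' ψ (areaDensity g ψ)} (areaMeasure g (smoothBdry n U)) := by
    constructor
    · rintro _ ⟨W', ψ, hψ, rfl⟩
      exact le_iSup_of_le W' (le_iSup_of_le ψ (le_iSup_of_le hψ le_rfl))
    · intro m hm
      exact iSup_le fun W' => iSup_le fun ψ => iSup_le fun hψ => hm ⟨W', ψ, hψ, rfl⟩
  have hN := hg.isOpen_graphNhd.measurableSet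
  refine restrict_eq_of_isLUB hlub ⟨W, _, hg.isHyperParam hU, rfl⟩ hN
    (paramMeasure_restrict_self hg.isOpen hg.contMDiffOn_graphParam.continuousOn hN
      fun w hw => hg.graphParam_mem_graphNhd hw) ?_
  rintro _ ⟨W', ψ, hψ, rfl⟩
  refine paramMeasure_restrict_le hψ.isOpen hψ.smooth.continuousOn hg.isOpen
    hg.contMDiffOn_graphParam.continuousOn hN (fun w => (A.symm (φ (ψ w))).1)
    (fun w => fderiv ℝ (fun w => (A.symm (φ (ψ w))).1) w) (fun w hw hwN => ?_) ?_
  · obtain ⟨h1, h2⟩ := hg.mem_of_mem_frontier hU hwN (hψ.mapsTo hw).1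
    obtain ⟨h3, h4⟩ := hg.areaDensity_comp g hU hψ hw hwN
    exact ⟨h1, h2, h3.hasFDerivAt, h4⟩
  · intro w hw w' hw' h
    have h1 := (hg.mem_of_mem_frontier hU hw.2 (hψ.mapsTo hw.1).1).2
    have h2 := (hg.mem_of_mem_frontier hU hw'.2 (hψ.mapsTo hw'.1).1).2
    refine hψ.injOn hw.1 hw'.1 ?_
    rw [← h1, ← h2]
    exact congrArg _ h

end GraphChart

end Area

/-! ### The flux through the boundary -/

section Flux

set_option linter.unusedSectionVars false

open Matrix Set

variable {n : ℕ} {X : Type*} [TopologicalSpace X] [ChartedSpace (Cn n) X]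
  [IsManifold 𝓘(ℂ, Cn n) ω X] {U : Set X} {φ : OpenPartialHomeomorph X (Cn n)}
  {A : (HPar n × ℝ) ≃L[ℝ] Cn n} {W : Set (HPar n)} {a b : ℝ} {f : HPar n → ℝ}
  (g : KahlerMetric n X)

theorem form_self_nonneg (x : X) (u : HTan n x) : 0 ≤ (g.form x u u).re := by
  by_cases hu : u = 0
  · simp [hu]
  · exact (g.pos x u hu).le

/-- Cauchy–Schwarz for a unit vector: the part of V orthogonal to u has nonnegative square length.
-/
theorem normSq_form_le {x : X} {u : HTan n x} (hu : (g.form x u u).re = 1) (V : HTan n x) :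
    ‖g.form x u V‖ ^ 2 ≤ (g.form x V V).re := by
  have him : g.form x u u = 1 := by
    have h := g.symm x u u
    rw [Complex.conj_eq_iff_real] at h
    obtain ⟨r, hr⟩ := h
    rw [hr, Complex.ofReal_re] at hu
    rw [hr, hu, Complex.ofReal_one]
  have h1 := form_self_nonneg g x (V - g.form x u V • u)
  have h2 : g.form x (V - g.form x u V • u) (V - g.form x u V • u) =
      g.form x V V - g.form x u V * conj (g.form x u V) := by
    simp only [map_sub, map_smul, map_smulₛₗ, LinearMap.sub_apply, LinearMap.smul_apply,
      smul_eq_mul, him, ← g.symm x u V]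
    ring
  rw [h2, Complex.mul_conj, Complex.sub_re, Complex.ofReal_re, Complex.normSq_eq_norm_sq] at h1
  linarith

/-- The flux density of a field of type `(1,0)` through the boundary of `U`. -/
def fluxFun (U : Set X) (Z : ∀ x : X, HTan n x) (p : X) : ℂ :=
  riemC g p (Z p) (outerNormal g U p)

variable {g} {Z : ∀ x : X, HTan n x} {q : X → ℂ}

theorem norm_fluxFun_le {p : X} (hp : p ∈ smoothBdry n U) :
    ‖fluxFun g U Z p‖ ≤ Real.sqrt (g.form p (Z p) (Z p)).re := by
  obtain ⟨h1, -⟩ := isOuterUnitNormal_outerNormal g hp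
  have h2 := Real.le_sqrt_of_sq_le (normSq_form_le g h1 (Z p))
  rw [fluxFun, riemC, norm_mul]
  have h3 : ‖(1 / 2 : ℂ)‖ ≤ 1 := by norm_num
  calc _ ≤ 1 * ‖g.form p (part10 p (outerNormal g U p)) (Z p)‖ := by gcongr
    _ ≤ _ := by rwa [one_mul]

theorem HasDivergence.continuousAt_chartDeriv (hZ : HasDivergence g Z q) (hφ : φ ∈ holCharts n X)
    {z : Cn n} (hz : z ∈ φ.target) :
    ContinuousAt (fun w => chartDeriv φ (φ.symm w) (Z (φ.symm w))) z := by
  refine continuousAt_pi.2 fun i => ?_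
  have h1 := (hZ.smooth φ hφ z hz i).continuousAt
  have h2 := (smoothM_gCoeff g hφ hz).det.continuousAt
  have h3 : ∀ w ∈ φ.target, (gCoeff g φ w).det ≠ 0 := fun w hw => (gCoeff_posDef g hφ hw).det_pos.ne'
  refine (h1.div h2 (h3 z hz)).congr ?_
  filter_upwards [φ.open_target.mem_nhds hz] with w hw
  exact mul_div_cancel_left₀ _ (h3 w hw)

theorem HasDivergence.continuous_form (hZ : HasDivergence g Z q) :
    Continuous fun x => (g.form x (Z x) (Z x)).re := by
  rw [continuous_iff_continuousAt]
  intro x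
  set φ := chartAt (Cn n) x
  have hφ : φ ∈ holCharts n X := chartAt_mem_holCharts x
  have hx : x ∈ φ.source := mem_chart_source _ x
  have hz := φ.map_source hx
  have h1 := hZ.continuousAt_chartDeriv hφ hz
  have hG : ContinuousAt (gCoeff g φ) (φ x) := continuousAt_pi.2 fun k => continuousAt_pi.2 fun j =>
    ((g.smooth φ hφ k j).contDiffAt (φ.open_target.mem_nhds hz)).continuousAt
  have hre : Continuous fun q : Matrix (Fin n) (Fin n) ℂ × Cn n =>
      (star q.2 ⬝ᵥ (q.1 *ᵥ q.2)).re :=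
    Complex.continuous_re.comp (Continuous.dotProduct (continuous_star.comp continuous_snd)
      (continuous_fst.matrix_mulVec continuous_snd))
  have h2 := (hre.continuousAt.comp (hG.prodMk h1)).comp (φ.continuousAt hx)
  refine h2.congr ?_
  filter_upwards [φ.open_source.mem_nhds hx] with y hy
  simp only [Function.comp_apply]
  rw [form_eq_sum g hφ hy, φ.left_inv hy]

namespace GraphChart

variable (hg : GraphChart U φ A W a b f)
include hg

theorem areaDensity_pos (hU : IsOpen U) {w : HPar n} (hw : w ∈ W) :
    0 < areaDensity g (graphParam φ A f) w := by
  obtain ⟨c, hc, h1, h2⟩ := hg.outerNormal_spec g hU hw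
  have hG := gCoeff_posDef g hg.chart (hg.graphParam_mem hw)
  have h3 := mul_sqrt_det_gram hG hg.coord (D := fderiv ℝ f w) (conormal_apply A f w) hc h1 h2
  rw [← hg.areaDensity_graphParam g hw] at h3
  have h4 : 0 < (gCoeff g φ (A (w, f w))).det.re := (Complex.pos_iff.1 hG.det_pos).1
  rw [← h3] at h4
  exact pos_of_mul_pos_right h4 hc.le

theorem continuousOn_conormal (u : Cn n) : ContinuousOn (fun w => conormal A f w u) W := by
  obtain ⟨q, rfl⟩ := A.surjective u
  have h : ContinuousOn (fun w => q.2 - fderiv ℝ f w q.1) W :=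
    continuousOn_const.sub (hg.continuousOn_fderiv.clm_apply continuousOn_const)
  exact h.congr fun w _ => conormal_apply A f w q.1 q.2

/-- The outer normal is a pointwise choice and shows no continuity by itself. Flux times area
density, however, is an explicit continuous expression, and the area density is continuous and
positive. -/
theorem continuousOn_fluxFun_graphParam (hU : IsOpen U) (hZ : HasDivergence g Z q) :
    ContinuousOn (fun w => fluxFun g U Z (graphParam φ A f w)) W := by
  have hAf : ContinuousOn (fun w => A (w, f w)) W :=
    A.continuous.comp_continuousOn (continuousOn_id.prodMk hg.continuousOn_f)
  have h1 : ∀ i, ContinuousOn (fun z => (gCoeff g φ z).det *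
      chartDeriv φ (φ.symm z) (Z (φ.symm z)) i) φ.target := fun i z hz =>
    (hZ.smooth φ hg.chart z hz i).continuousAt.continuousWithinAt
  have h2 : ∀ i, ContinuousOn (fun w => wirtL i (Complex.ofRealCLM.comp (conormal A f w))) W := by
    intro i
    have h3 : ∀ u, ContinuousOn (fun w => (conormal A f w u : ℂ)) W := fun u =>
      Complex.continuous_ofReal.comp_continuousOn (hg.continuousOn_conormal u)
    exact continuousOn_const.mul ((h3 _).sub (continuousOn_const.mul (h3 _)))
  have h4 : ContinuousOn (fun w => ∑ i, ((gCoeff g φ (A (w, f w))).det *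
      chartDeriv φ (graphParam φ A f w) (Z (graphParam φ A f w)) i) *
        wirtL i (Complex.ofRealCLM.comp (conormal A f w))) W :=
    continuousOn_finsetSum _ fun i _ =>
      ((h1 i).comp hAf fun w hw => hg.graphParam_mem hw).mul (h2 i)
  have h5 : ContinuousOn (fun w => (areaDensity g (graphParam φ A f) w : ℂ)) W :=
    Complex.continuous_ofReal.comp_continuousOn (hg.continuousOn_areaDensity g)
  have h6 : ∀ w ∈ W, (areaDensity g (graphParam φ A f) w : ℂ) ≠ 0 := fun w hw =>
    Complex.ofReal_ne_zero.2 (hg.areaDensity_pos hU hw).ne'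
  refine (h4.div h5 h6).congr fun w hw => ?_
  rw [Pi.div_apply, eq_div_iff (h6 w hw), ← hg.areaDensity_mul_riemC g hU hw, mul_comm]
  rfl

end GraphChart

variable [SecondCountableTopology X] [MeasurableSpace X] [BorelSpace X]

/-- Second countability (Lindelöf) extracts countably many graph neighbourhoods, as measurability
arguments require. -/
theorem exists_graphCover (U : Set X) : ∃ 𝒩 : Set (Set X), 𝒩.Countable ∧ smoothBdry n U ⊆ ⋃₀ 𝒩 ∧
    ∀ N ∈ 𝒩, ∃ (φ : OpenPartialHomeomorph X (Cn n)) (A : (HPar n × ℝ) ≃L[ℝ] Cn n)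
      (W : Set (HPar n)) (a b : ℝ) (f : HPar n → ℝ), GraphChart U φ A W a b f ∧
        N = graphNhd φ A W a b := by
  obtain ⟨T, hT, hTc, hTU⟩ := TopologicalSpace.isOpen_sUnion_countable
    {N | ∃ (φ : OpenPartialHomeomorph X (Cn n)) (A : (HPar n × ℝ) ≃L[ℝ] Cn n)
      (W : Set (HPar n)) (a b : ℝ) (f : HPar n → ℝ), GraphChart U φ A W a b f ∧
        N = graphNhd φ A W a b} (by
      rintro _ ⟨φ, A, W, a, b, f, hg, rfl⟩
      exact hg.isOpen_graphNhd)
  refine ⟨T, hT, fun p hp => ?_, fun N hN => hTc hN⟩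
  rw [hTU]
  obtain ⟨φ, A, W, a, b, f, hg, hpN⟩ := exists_graphChart hp
  exact ⟨_, ⟨φ, A, W, a, b, f, hg, rfl⟩, hpN⟩

theorem smoothBdry_inter_graphNhd (hU : IsOpen U) (hg : GraphChart U φ A W a b f) :
    smoothBdry n U ∩ graphNhd φ A W a b = frontier U ∩ graphNhd φ A W a b := by
  refine Subset.antisymm (fun p hp => ⟨hp.1.1, hp.2⟩) fun p hp => ⟨?_, hp.2⟩
  obtain ⟨h1, h2⟩ := hg.mem_of_mem_frontier hU hp.2 hp.1
  rw [← h2]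
  exact hg.graphParam_mem_smoothBdry hU h1

/-- In a graph neighbourhood all boundary points are smooth, so the smooth part is relatively open
and the singular part is closed. -/
theorem exists_isOpen_smoothBdry_eq (hU : IsOpen U) :
    ∃ O, IsOpen O ∧ smoothBdry n U = frontier U ∩ O := by
  obtain ⟨𝒩, -, hc, hN⟩ := exists_graphCover (n := n) U
  refine ⟨⋃₀ 𝒩, isOpen_sUnion ?_, Subset.antisymm (fun p hp => ⟨hp.1, hc hp⟩) ?_⟩
  · intro N h
    obtain ⟨φ, A, W, a, b, f, hg, rfl⟩ := hN N h
    exact hg.isOpen_graphNhd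
  · rintro p ⟨hp, N, h, hpN⟩
    obtain ⟨φ, A, W, a, b, f, hg, rfl⟩ := hN N h
    exact ((smoothBdry_inter_graphNhd hU hg).ge ⟨hp, hpN⟩).1

theorem measurableSet_smoothBdry (hU : IsOpen U) : MeasurableSet (smoothBdry n U) := by
  obtain ⟨O, hO, h⟩ := exists_isOpen_smoothBdry_eq (n := n) hU
  rw [h]
  exact isClosed_frontier.measurableSet.inter hO.measurableSet

theorem areaMeasure_restrict_smoothBdry (hU : IsOpen U) :
    (areaMeasure g (smoothBdry n U)).restrict (smoothBdry n U) =
      areaMeasure g (smoothBdry n U) := by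
  refine le_antisymm Measure.restrict_le_self ?_
  refine iSup_le fun W' => iSup_le fun ψ => iSup_le fun hψ => ?_
  have h := paramMeasure_restrict_self (μ := volume) (ρ := areaDensity g ψ) hψ.isOpen
    hψ.smooth.continuousOn (measurableSet_smoothBdry hU) hψ.mapsTo
  refine h.symm.le.trans (Measure.restrict_mono le_rfl ?_)
  exact le_iSup_of_le W' (le_iSup_of_le ψ (le_iSup_of_le hψ le_rfl))

theorem ae_mem_smoothBdry (hU : IsOpen U) :
    ∀ᵐ p ∂(areaMeasure g (smoothBdry n U)), p ∈ smoothBdry n U := by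
  rw [← areaMeasure_restrict_smoothBdry hU]
  exact ae_restrict_mem (measurableSet_smoothBdry hU)

theorem aestronglyMeasurable_fluxFun (hU : IsOpen U) (hZ : HasDivergence g Z q) :
    AEStronglyMeasurable (fluxFun g U Z) (areaMeasure g (smoothBdry n U)) := by
  obtain ⟨𝒩, hcount, hc, hN⟩ := exists_graphCover (n := n) U
  have := hcount.to_subtype
  have h1 : (areaMeasure g (smoothBdry n U)).restrict (⋃ N : 𝒩, (N : Set X)) =
      areaMeasure g (smoothBdry n U) := by
    refine Measure.restrict_eq_self_of_ae_mem ?_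
    filter_upwards [ae_mem_smoothBdry hU] with p hp
    rw [← sUnion_eq_iUnion]
    exact hc hp
  rw [← h1, aestronglyMeasurable_iUnion_iff]
  rintro ⟨N, h⟩
  obtain ⟨φ, A, W, a, b, f, hg, rfl⟩ := hN N h
  have hm := hg.isOpen_graphNhd.measurableSet
  have h2 : ContinuousOn (fun p => fluxFun g U Z (graphParam φ A f (A.symm (φ p)).1))
      (graphNhd φ A W a b) :=
    (hg.continuousOn_fluxFun_graphParam hU hZ).comp (f := fun p => (A.symm (φ p)).1)
      (continuous_fst.comp_continuousOn
        (A.symm.continuous.comp_continuousOn (φ.continuousOn.mono inter_subset_left)))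
      fun p hp => hp.2.1
  refine (h2.aestronglyMeasurable hm).congr ?_
  filter_upwards [ae_restrict_of_ae (ae_mem_smoothBdry hU), ae_restrict_mem hm] with p hp hpN
  rw [(hg.mem_of_mem_frontier hU hpN hp.1).2]

/-- The flux density is bounded by the length of Z, which is bounded on the compact closure, and the
area is finite. -/
theorem integrable_fluxFun (hU : IsOpen U) (hc : IsCompact (closure U))
    (hfin : areaMeasure g (smoothBdry n U) univ < ⊤) (hZ : HasDivergence g Z q) :
    Integrable (fluxFun g U Z) (areaMeasure g (smoothBdry n U)) := by
  obtain ⟨C, hC⟩ := hc.exists_bound_of_continuousOn (f := fun x => (g.form x (Z x) (Z x)).re)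
    hZ.continuous_form.continuousOn
  have : IsFiniteMeasure (areaMeasure g (smoothBdry n U)) := ⟨hfin⟩
  refine Integrable.of_bound (aestronglyMeasurable_fluxFun hU hZ) (Real.sqrt C) ?_
  filter_upwards [ae_mem_smoothBdry hU] with p hp
  refine (norm_fluxFun_le hp).trans (Real.sqrt_le_sqrt ?_)
  exact (le_abs_self _).trans (hC p (frontier_subset_closure hp.1))

end Flux

/-! ### The divergence theorem for test functions with small support -/

section Derivation

set_option linter.unusedSectionVars false

open Matrix Set

variable {n : ℕ} {X : Type*} [TopologicalSpace X] [ChartedSpace (Cn n) X]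

/-- The derivative of a function along the real vector with given part of type `(1,0)`. -/
def realDeriv (τ : X → ℂ) (x : X) (V : HTan n x) : ℂ := mfderiv 𝓘(ℝ, Cn n) 𝓘(ℝ, ℂ) τ x V

/-- The derivative `Vʲ ∂_j τ` of a function along a vector of type `(1,0)`. -/
def dHol (τ : X → ℂ) (x : X) (V : HTan n x) : ℂ :=
  (1 / 2) * (realDeriv τ x V - Complex.I * realDeriv τ x (Complex.I • V))

/-- Smooth complex valued functions. -/
abbrev IsSmoothFun (n : ℕ) {X : Type*} [TopologicalSpace X] [ChartedSpace (Cn n) X]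
    (τ : X → ℂ) : Prop :=
  ContMDiff 𝓘(ℝ, Cn n) 𝓘(ℝ, ℂ) ∞ τ

theorem dHol_eq_zero {τ : X → ℂ} {x : X} (hx : x ∉ tsupport τ) (V : HTan n x) :
    dHol τ x V = 0 := by
  have h : ∀ V : HTan n x, realDeriv τ x V = 0 := by
    intro V
    have h1 : τ =ᶠ[nhds x] fun _ => 0 := notMem_tsupport_iff_eventuallyEq.1 hx
    rw [realDeriv, h1.mfderiv_eq, mfderiv_const]
    rfl
  rw [dHol, h, h]
  simp

/-- The integrand `div (τ Z)`. -/
def divMul (τ : X → ℂ) (Z : ∀ x : X, HTan n x) (q : X → ℂ) (x : X) : ℂ :=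
  τ x * q x + dHol τ x (Z x)

theorem support_divMul_subset (τ : X → ℂ) (Z : ∀ x : X, HTan n x) (q : X → ℂ) :
    Function.support (divMul τ Z q) ⊆ tsupport τ := by
  intro x hx
  by_contra h
  exact hx (by rw [divMul, dHol_eq_zero h, image_eq_zero_of_notMem_tsupport h, zero_mul, add_zero])

theorem divMul_add {σ τ : X → ℂ} (hσ : IsSmoothFun n σ) (hτ : IsSmoothFun n τ)
    (Z : ∀ x : X, HTan n x) (q : X → ℂ) (x : X) :
    divMul (fun x => σ x + τ x) Z q x = divMul σ Z q x + divMul τ Z q x := by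
  have h := mfderiv_add ((hσ x).mdifferentiableAt (by simp)) ((hτ x).mdifferentiableAt (by simp))
  have h1 : ∀ V : HTan n x, realDeriv (fun x => σ x + τ x) x V =
      realDeriv σ x V + realDeriv τ x V :=
    fun V => congrArg (fun A => A V) h
  rw [divMul, divMul, divMul, dHol, dHol, dHol, h1, h1]
  ring

variable [IsManifold 𝓘(ℂ, Cn n) ω X] {φ : OpenPartialHomeomorph X (Cn n)}
  {g : KahlerMetric n X} {Z : ∀ x : X, HTan n x} {q : X → ℂ} {τ : X → ℂ}

theorem dHol_eq (hφ : φ ∈ holCharts n X) {x : X} (hx : x ∈ φ.source) (hτ : IsSmoothFun n τ)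
    (V : HTan n x) :
    dHol τ x V = ∑ a, chartDeriv φ x V a * dWirt a (fun z => τ (φ.symm z)) (φ x) := by
  have h : ∀ V : HTan n x, realDeriv τ x V =
      fderiv ℝ (fun z => τ (φ.symm z)) (φ x) (chartDeriv φ x V) := fun V =>
    mfderiv_eq_fderiv_comp_symm hφ hx ((hτ x).mdifferentiableAt (by simp)) V
  rw [dHol, h, h, map_smul, wirtL_apply_eq]
  rfl

/-- The components of `τ Z` times the volume density, in the chart `φ`. -/
def chartField (g : KahlerMetric n X) (φ : OpenPartialHomeomorph X (Cn n)) (τ : X → ℂ)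
    (Z : ∀ x : X, HTan n x) (i : Fin n) : Cn n → ℂ :=
  φ.target.indicator fun z =>
    τ (φ.symm z) * ((gCoeff g φ z).det * chartDeriv φ (φ.symm z) (Z (φ.symm z)) i)

theorem chartField_eventuallyEq {z : Cn n} (hz : z ∈ φ.target) (i : Fin n) :
    chartField g φ τ Z i =ᶠ[nhds z] fun z =>
      τ (φ.symm z) * ((gCoeff g φ z).det * chartDeriv φ (φ.symm z) (Z (φ.symm z)) i) := by
  filter_upwards [φ.open_target.mem_nhds hz] with w hw using indicator_of_mem hw _

theorem contDiffAt_chartField (hZ : HasDivergence g Z q) (hφ : φ ∈ holCharts n X)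
    (hτ : IsSmoothFun n τ) {z : Cn n} (hz : z ∈ φ.target) (i : Fin n) :
    ContDiffAt ℝ ∞ (chartField g φ τ Z i) z :=
  ((contDiffAt_comp_symm hφ hz (hτ _)).mul (hZ.smooth φ hφ z hz i)).congr_of_eventuallyEq
    (chartField_eventuallyEq hz i)

theorem sum_dWirt_chartField (hZ : HasDivergence g Z q) (hφ : φ ∈ holCharts n X)
    (hτ : IsSmoothFun n τ) {z : Cn n} (hz : z ∈ φ.target) :
    ∑ i, dWirt i (chartField g φ τ Z i) z =
      (gCoeff g φ z).det * divMul τ Z q (φ.symm z) := by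
  have hd : DifferentiableAt ℝ (fun z => τ (φ.symm z)) z :=
    (contDiffAt_comp_symm hφ hz (hτ _)).differentiableAt (by simp)
  have h1 : ∀ i, dWirt i (chartField g φ τ Z i) z =
      τ (φ.symm z) * dWirt i (fun w => (gCoeff g φ w).det *
        chartDeriv φ (φ.symm w) (Z (φ.symm w)) i) z +
      (gCoeff g φ z).det * chartDeriv φ (φ.symm z) (Z (φ.symm z)) i *
        dWirt i (fun z => τ (φ.symm z)) z := by
    intro i
    rw [dWirt_eq_cder, cder, (chartField_eventuallyEq hz i).fderiv_eq]
    exact cder_mul _ hd ((hZ.smooth φ hφ z hz i).differentiableAt (by simp))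
  rw [Finset.sum_congr rfl fun i _ => h1 i, Finset.sum_add_distrib, ← Finset.mul_sum,
    hZ.div_eq φ hφ z hz, divMul, dHol_eq hφ (φ.map_target hz) hτ, φ.right_inv hz, mul_add,
    Finset.mul_sum]
  congr 1
  · ring
  · exact Finset.sum_congr rfl fun i _ => mul_assoc _ _ _

theorem continuousAt_dWirt {f : Cn n → ℂ} {z : Cn n} (hf : ContDiffAt ℝ 1 f z) (i : Fin n) :
    ContinuousAt (dWirt i f) z := by
  have h : ContinuousAt (fderiv ℝ f) z := (hf.fderiv_right (m := 0) (by simp)).continuousAt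
  have h1 : ∀ u : Cn n, ContinuousAt (fun w => fderiv ℝ f w u) z := fun u =>
    h.clm_apply continuousAt_const
  exact continuousAt_const.mul ((h1 _).sub (continuousAt_const.mul (h1 _)))

theorem HasDivergence.continuous_divMul (hZ : HasDivergence g Z q) (hτ : IsSmoothFun n τ) :
    Continuous (divMul τ Z q) := by
  rw [continuous_iff_continuousAt]
  intro x
  set φ := chartAt (Cn n) x
  have hφ : φ ∈ holCharts n X := chartAt_mem_holCharts x
  have hx : x ∈ φ.source := mem_chart_source _ x
  have hz := φ.map_source hx
  have h1 : ContinuousAt (fun z => ∑ i, dWirt i (chartField g φ τ Z i) z) (φ x) :=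
    tendsto_finsetSum _ fun i _ =>
      continuousAt_dWirt ((contDiffAt_chartField hZ hφ hτ hz i).of_le (by simp)) i
  have h2 := (smoothM_gCoeff g hφ hz).det.continuousAt
  have h3 : ∀ w ∈ φ.target, (gCoeff g φ w).det ≠ 0 := fun w hw => (gCoeff_posDef g hφ hw).det_pos.ne'
  have h4 := (h1.div h2 (h3 _ hz)).comp (φ.continuousAt hx)
  refine h4.congr ?_
  filter_upwards [φ.open_source.mem_nhds hx] with y hy
  have hy' := φ.map_source hy
  simp only [Function.comp_apply, Pi.div_apply]
  rw [sum_dWirt_chartField hZ hφ hτ hy', mul_div_cancel_left₀ _ (h3 _ hy'), φ.left_inv hy]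

theorem chartField_eq_zero {K : Set X} (hK : tsupport τ ⊆ K) {i : Fin n} {z : Cn n}
    (hz : z ∉ φ '' K) : chartField g φ τ Z i z = 0 := by
  rw [chartField]
  by_cases hzt : z ∈ φ.target
  · rw [indicator_of_mem hzt, image_eq_zero_of_notMem_tsupport (f := τ) (x := φ.symm z), zero_mul]
    exact fun h => hz ⟨_, hK h, φ.right_inv hzt⟩
  · exact indicator_of_notMem hzt _

variable (hc : HasCompactSupport τ) (hs : tsupport τ ⊆ φ.source)
include hc hs

theorem isCompact_image_tsupport : IsCompact (φ '' tsupport τ) :=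
  hc.isCompact.image_of_continuousOn (φ.continuousOn.mono hs)

theorem tsupport_chartField_subset (i : Fin n) :
    tsupport (chartField g φ τ Z i) ⊆ φ '' tsupport τ := by
  refine closure_minimal (fun z hz => ?_) (isCompact_image_tsupport hc hs).isClosed
  by_contra h
  exact hz (chartField_eq_zero Subset.rfl h)

theorem hasCompactSupport_chartField (i : Fin n) :
    HasCompactSupport (chartField g φ τ Z i) :=
  (isCompact_image_tsupport hc hs).of_isClosed_subset (isClosed_tsupport _)
    (tsupport_chartField_subset hc hs i)

theorem contDiff_chartField (hZ : HasDivergence g Z q) (hφ : φ ∈ holCharts n X)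
    (hτ : IsSmoothFun n τ) (i : Fin n) : ContDiff ℝ ∞ (chartField g φ τ Z i) := by
  rw [contDiff_iff_contDiffAt]
  intro z
  by_cases hz : z ∈ φ '' tsupport τ
  · obtain ⟨x, hx, rfl⟩ := hz
    exact contDiffAt_chartField hZ hφ hτ (φ.map_source (hs hx)) i
  · have h : z ∉ tsupport (chartField g φ τ Z i) := fun h =>
      hz (tsupport_chartField_subset hc hs i h)
    exact contDiffAt_const.congr_of_eventuallyEq (notMem_tsupport_iff_eventuallyEq.1 h)

end Derivation

/-! ### Integrals of Wirtinger derivatives on ℂⁿ -/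

section FlatIntegrals

open Set

variable {n : ℕ}

theorem dWirt_eq_zero_of_notMem_tsupport {v : Cn n → ℂ} {z : Cn n} (hz : z ∉ tsupport v)
    (i : Fin n) : dWirt i v z = 0 := by
  rw [dWirt, fderiv_of_notMem_tsupport (𝕜 := ℝ) hz]
  simp

theorem setIntegral_dWirt {v : Cn n → ℂ} (hv : ContDiff ℝ 1 v) (hc : HasCompactSupport v)
    (i : Fin n) (S : Set (Cn n)) :
    ∫ z in S, dWirt i v z = (1 / 2) * ((∫ z in S, fderiv ℝ v z (Pi.single i 1)) -
      Complex.I * ∫ z in S, fderiv ℝ v z (Pi.single i Complex.I)) := by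
  have h : ∀ u : Cn n, IntegrableOn (fun z => fderiv ℝ v z u) S := fun u =>
    (((hv.continuous_fderiv (by simp)).clm_apply continuous_const).integrable_of_hasCompactSupport
      (hc.fderiv_apply (𝕜 := ℝ) u)).integrableOn
  simp only [dWirt]
  rw [integral_const_mul, integral_sub (h _) ((h _).const_mul _), integral_const_mul]

theorem integrable_dWirt {v : Cn n → ℂ} (hv : ContDiff ℝ 1 v) (hc : HasCompactSupport v)
    (i : Fin n) : Integrable (dWirt i v) :=
  Continuous.integrable_of_hasCompactSupport
    (continuous_iff_continuousAt.2 fun _ => continuousAt_dWirt hv.contDiffAt i)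
    (hc.mono' fun z hz => by
      by_contra h
      exact hz (dWirt_eq_zero_of_notMem_tsupport h i))

theorem integral_dWirt_eq_zero {v : Cn n → ℂ} (hv : ContDiff ℝ 1 v) (hc : HasCompactSupport v)
    (i : Fin n) : ∫ z, dWirt i v z = 0 := by
  have h := setIntegral_dWirt hv hc i univ
  simp only [Measure.restrict_univ] at h
  rw [h, integral_fderiv_eq_zero _ hv hc, integral_fderiv_eq_zero _ hv hc]
  simp

theorem integrableOn_conormal_mul {A : (HPar n × ℝ) ≃L[ℝ] Cn n} {W : Set (HPar n)}
    (hW : IsOpen W) {f : HPar n → ℝ} (hf : ∀ w ∈ W, ContDiffAt ℝ 1 f w) {v : Cn n → ℂ}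
    (hv : ContDiff ℝ 1 v) (hc : HasCompactSupport v) (hs : ∀ z ∈ tsupport v, (A.symm z).1 ∈ W)
    (u : Cn n) : IntegrableOn (fun w => (conormal A f w u : ℂ) * v (A (w, f w))) W := by
  set K : Set (HPar n) := (fun z => (A.symm z).1) '' tsupport v
  have hK : IsCompact K := hc.isCompact.image (continuous_fst.comp A.symm.continuous)
  have hKW : K ⊆ W := by
    rintro _ ⟨z, hz, rfl⟩
    exact hs z hz
  have hcont : ContinuousOn (fun w => (conormal A f w u : ℂ) * v (A (w, f w))) W := by
    have h1 : ContinuousOn (fderiv ℝ f) W := fun w hw =>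
      ((hf w hw).fderiv_right (m := 0) (by simp)).continuousAt.continuousWithinAt
    have h2 : ContinuousOn f W := fun w hw => (hf w hw).continuousAt.continuousWithinAt
    have h3 : ContinuousOn (fun w => (A.symm u).2 - fderiv ℝ f w (A.symm u).1) W :=
      continuousOn_const.sub (h1.clm_apply continuousOn_const)
    have h4 : ContinuousOn (fun w => conormal A f w u) W := h3.congr fun w _ => by
      simp [conormal]
    exact (Complex.continuous_ofReal.comp_continuousOn h4).mul
      (hv.continuous.comp_continuousOn
        (A.continuous.comp_continuousOn (continuousOn_id.prodMk h2)))
  refine ((hcont.mono hKW).integrableOn_compact hK).of_forall_sdiff_eq_zero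
    hW.measurableSet fun w hw => ?_
  have h5 : A (w, f w) ∉ tsupport v := fun h => hw.2 ⟨_, h, by simp⟩
  rw [image_eq_zero_of_notMem_tsupport h5, mul_zero]

theorem mul_wirtL_conormal (A : (HPar n × ℝ) ≃L[ℝ] Cn n) (f : HPar n → ℝ) (w : HPar n) (c : ℂ)
    (i : Fin n) : c * wirtL i (Complex.ofRealCLM.comp (conormal A f w)) =
      (1 / 2) * ((conormal A f w (Pi.single i 1) : ℂ) * c -
        Complex.I * ((conormal A f w (Pi.single i Complex.I) : ℂ) * c)) := by
  simp only [wirtL, LinearMap.coe_mk, AddHom.coe_mk, ContinuousLinearMap.comp_apply,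
    Complex.ofRealCLM_apply]
  ring

theorem integrableOn_mul_wirtL {A : (HPar n × ℝ) ≃L[ℝ] Cn n} {W : Set (HPar n)}
    (hW : IsOpen W) {f : HPar n → ℝ} (hf : ∀ w ∈ W, ContDiffAt ℝ 1 f w) {v : Cn n → ℂ}
    (hv : ContDiff ℝ 1 v) (hc : HasCompactSupport v) (hs : ∀ z ∈ tsupport v, (A.symm z).1 ∈ W)
    (i : Fin n) : IntegrableOn (fun w =>
      v (A (w, f w)) * wirtL i (Complex.ofRealCLM.comp (conormal A f w))) W := by
  have hint := integrableOn_conormal_mul hW hf hv hc hs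
  simp only [mul_wirtL_conormal]
  exact ((hint _).sub ((hint _).const_mul _)).const_mul _

/-- The divergence theorem under a graph in the coordinates `A`. -/
theorem setIntegral_dWirt_subgraph {A : (HPar n × ℝ) ≃L[ℝ] Cn n}
    (hA : MeasurePreserving A volume volume) {W : Set (HPar n)} (hW : IsOpen W)
    {f : HPar n → ℝ} (hf : ∀ w ∈ W, ContDiffAt ℝ 1 f w) {v : Cn n → ℂ} (hv : ContDiff ℝ 1 v)
    (hc : HasCompactSupport v) (hs : ∀ z ∈ tsupport v, (A.symm z).1 ∈ W) (i : Fin n) :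
    ∫ z in {z | (A.symm z).1 ∈ W ∧ (A.symm z).2 < f (A.symm z).1}, dWirt i v z =
      ∫ w in W, v (A (w, f w)) * wirtL i (Complex.ofRealCLM.comp (conormal A f w)) := by
  set S := {z : Cn n | (A.symm z).1 ∈ W ∧ (A.symm z).2 < f (A.symm z).1}
  have hcA : HasCompactSupport (fun p => v (A p)) :=
    hc.comp_homeomorph A.toHomeomorph
  have hvA : ContDiff ℝ 1 (fun p => v (A p)) := hv.comp A.contDiff
  have hsA : ∀ p ∈ tsupport (fun p => v (A p)), p.1 ∈ W := by
    intro p hp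
    have h1 := hs (A p) (tsupport_comp_subset_preimage v A.continuous hp)
    rwa [A.symm_apply_apply] at h1
  have key : ∀ u : Cn n, ∫ z in S, fderiv ℝ v z u =
      ∫ w in W, (conormal A f w u : ℂ) * v (A (w, f w)) := by
    intro u
    rw [← hA.setIntegral_preimage_emb A.toHomeomorph.measurableEmbedding]
    have h1 : A ⁻¹' S = {p : HPar n × ℝ | p.1 ∈ W ∧ p.2 < f p.1} := by
      ext p
      simp [S]
    have h2 : ∀ p, fderiv ℝ v (A p) u =
        fderiv ℝ (fun p => v (A p)) p ((A.symm u).1, (A.symm u).2) := by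
      intro p
      have h3 : HasFDerivAt (fun p => v (A p)) _ p :=
        ((hv.differentiable (by simp)) (A p)).hasFDerivAt.comp p A.hasFDerivAt
      rw [h3.fderiv]
      simp
    simp only [h2, h1]
    refine (integral_subgraph volume hvA hcA hW hf hsA _ _).trans ?_
    simp only [← conormal_apply A f, Prod.mk.eta, A.apply_symm_apply]
  have hint := integrableOn_conormal_mul hW hf hv hc hs
  rw [setIntegral_dWirt hv hc, key, key, ← integral_const_mul, ← integral_sub (hint _)
    ((hint _).const_mul _), ← integral_const_mul]
  refine integral_congr_ae (Filter.Eventually.of_forall fun w => ?_)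
  exact (mul_wirtL_conormal A f w _ i).symm

end FlatIntegrals

/-! ### The divergence theorem for fields supported in one chart -/

section Stokes

set_option linter.unusedSectionVars false

open Matrix Set

variable {n : ℕ} {X : Type*} [TopologicalSpace X] [ChartedSpace (Cn n) X]
  [IsManifold 𝓘(ℂ, Cn n) ω X] [SecondCountableTopology X] [MeasurableSpace X] [BorelSpace X]

/-- The divergence theorem on `U` for the field `τ Z`. -/
def StokesFor (g : KahlerMetric n X) (U : Set X) (Z : ∀ x : X, HTan n x) (q : X → ℂ)
    (τ : X → ℂ) : Prop :=
  ∫ x in U, divMul τ Z q x ∂(volMeasure g) =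
    ∫ p, τ p * fluxFun g U Z p ∂(areaMeasure g (smoothBdry n U))

variable {g : KahlerMetric n X} {U : Set X} {φ : OpenPartialHomeomorph X (Cn n)}
  {Z : ∀ x : X, HTan n x} {q : X → ℂ} {τ : X → ℂ}

theorem setIntegral_divMul (hU : IsOpen U) (hZ : HasDivergence g Z q) (hφ : φ ∈ holCharts n X)
    (hτ : IsSmoothFun n τ) (hc : HasCompactSupport τ) (hs : tsupport τ ⊆ φ.source) :
    ∫ x in U, divMul τ Z q x ∂(volMeasure g) =
      ∑ i, ∫ z in φ.target ∩ φ.symm ⁻¹' U, dWirt i (chartField g φ τ Z i) z := by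
  rw [setIntegral_volMeasure g hφ hU (hZ.continuous_divMul hτ).aestronglyMeasurable
    ((support_divMul_subset τ Z q).trans hs), ← integral_finsetSum _ fun i _ =>
      (integrable_dWirt ((contDiff_chartField hc hs hZ hφ hτ i).of_le (by simp))
        (hasCompactSupport_chartField hc hs i) i).integrableOn]
  refine setIntegral_congr_fun (φ.symm.isOpen_inter_preimage hU).measurableSet fun z hz => ?_
  rw [sum_dWirt_chartField hZ hφ hτ hz.1, ofReal_gdet g hφ hz.1]

theorem stokesFor_of_disjoint (hU : IsOpen U)
    (h1 : ∫ x in U, divMul τ Z q x ∂(volMeasure g) = 0) (h2 : Disjoint (tsupport τ) (frontier U)) :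
    StokesFor g U Z q τ := by
  rw [StokesFor, h1]
  refine (integral_eq_zero_of_ae ?_).symm
  filter_upwards [ae_mem_smoothBdry hU] with p hp
  rw [image_eq_zero_of_notMem_tsupport fun h => h2.le_bot ⟨h, hp.1⟩, zero_mul]
  rfl

theorem stokesFor_exterior (hU : IsOpen U) (hs : tsupport τ ⊆ (closure U)ᶜ) :
    StokesFor g U Z q τ := by
  refine stokesFor_of_disjoint hU (setIntegral_eq_zero_of_forall_eq_zero fun x hx => ?_) ?_
  · by_contra h
    exact hs (support_divMul_subset τ Z q h) (subset_closure hx)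
  · exact disjoint_left.2 fun x hx hx' => hs hx (frontier_subset_closure hx')

theorem stokesFor_interior (hU : IsOpen U) (hZ : HasDivergence g Z q) (hφ : φ ∈ holCharts n X)
    (hτ : IsSmoothFun n τ) (hc : HasCompactSupport τ) (hs : tsupport τ ⊆ φ.source)
    (hsU : tsupport τ ⊆ U) : StokesFor g U Z q τ := by
  refine stokesFor_of_disjoint hU ?_ ?_
  · rw [setIntegral_divMul hU hZ hφ hτ hc hs]
    refine Finset.sum_eq_zero fun i _ => ?_
    rw [setIntegral_eq_integral_of_forall_compl_eq_zero, integral_dWirt_eq_zero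
      ((contDiff_chartField hc hs hZ hφ hτ i).of_le (by simp))
      (hasCompactSupport_chartField hc hs i)]
    intro z hz
    refine dWirt_eq_zero_of_notMem_tsupport (fun h => hz ?_) i
    obtain ⟨x, hx, rfl⟩ := tsupport_chartField_subset hc hs i h
    refine ⟨φ.map_source (hs hx), ?_⟩
    rw [mem_preimage, φ.left_inv (hs hx)]
    exact hsU hx
  · rw [hU.frontier_eq]
    exact disjoint_left.2 fun x hx hx' => hx'.2 (hsU hx)

variable {A : (HPar n × ℝ) ≃L[ℝ] Cn n} {W : Set (HPar n)} {a b : ℝ} {f : HPar n → ℝ}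

/-- On the support of τ the set U is a subgraph, so the flat theorem applies to each component of τZ
times det g. The resulting boundary integrand is the area density times the flux, by
`areaDensity_mul_riemC`. -/
theorem stokesFor_graph (hU : IsOpen U) (hg : GraphChart U φ A W a b f) (hZ : HasDivergence g Z q)
    (hτ : IsSmoothFun n τ) (hc : HasCompactSupport τ)
    (hs : tsupport τ ⊆ graphNhd φ A W a b) : StokesFor g U Z q τ := by
  have hsφ : tsupport τ ⊆ φ.source := hs.trans inter_subset_left
  have hsupp : ∀ i, ∀ z ∈ tsupport (chartField g φ τ Z i), z ∈ graphBox A W a b := by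
    intro i z hz
    obtain ⟨x, hx, rfl⟩ := tsupport_chartField_subset hc hsφ i hz
    exact (hs hx).2
  rw [StokesFor, setIntegral_divMul hU hZ hg.chart hτ hc hsφ]
  have h1 : ∀ i, ∫ z in φ.target ∩ φ.symm ⁻¹' U, dWirt i (chartField g φ τ Z i) z =
      ∫ w in W, chartField g φ τ Z i (A (w, f w)) *
        wirtL i (Complex.ofRealCLM.comp (conormal A f w)) := by
    intro i
    rw [← setIntegral_dWirt_subgraph hg.coord hg.isOpen
      (fun w hw => (hg.smooth w hw).of_le (by simp))
      ((contDiff_chartField hc hsφ hZ hg.chart hτ i).of_le (by simp))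
      (hasCompactSupport_chartField hc hsφ i) (fun z hz => (hsupp i z hz).1)]
    have hm : MeasurableSet {z : Cn n | (A.symm z).1 ∈ W ∧ (A.symm z).2 < f (A.symm z).1} := by
      have ho : IsOpen {z : Cn n | (A.symm z).1 ∈ W ∧ (A.symm z).2 < f (A.symm z).1} := by
        have hc1 : ContinuousOn (fun z => f (A.symm z).1 - (A.symm z).2)
            ((fun z => (A.symm z).1) ⁻¹' W) :=
          (hg.continuousOn_f.comp (f := fun z => (A.symm z).1)
            (continuous_fst.comp A.symm.continuous).continuousOn fun z hz => hz).sub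
            (continuous_snd.comp A.symm.continuous).continuousOn
        have := hc1.isOpen_inter_preimage
          (hg.isOpen.preimage (continuous_fst.comp A.symm.continuous)) (isOpen_Ioi (a := 0))
        convert this using 1
        ext z
        simp
      exact ho.measurableSet
    have hm' : MeasurableSet (φ.target ∩ φ.symm ⁻¹' U) :=
      (φ.symm.isOpen_inter_preimage hU).measurableSet
    rw [← integral_indicator hm', ← integral_indicator hm]
    refine integral_congr_ae (Filter.Eventually.of_forall fun z => ?_)
    by_cases hz : z ∈ tsupport (chartField g φ τ Z i)
    · have hzb := hsupp i z hz
      have hiff : z ∈ φ.target ∩ φ.symm ⁻¹' U ↔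
          z ∈ {z : Cn n | (A.symm z).1 ∈ W ∧ (A.symm z).2 < f (A.symm z).1} := by
        refine ⟨fun h => ⟨hzb.1, (hg.mem_iff_of_mem_graphBox hzb).1 h.2⟩,
          fun h => ⟨hg.graphBox_subset hzb, (hg.mem_iff_of_mem_graphBox hzb).2 h.2⟩⟩
      by_cases hz' : z ∈ φ.target ∩ φ.symm ⁻¹' U
      · rw [indicator_of_mem hz', indicator_of_mem (hiff.1 hz')]
      · rw [indicator_of_notMem hz', indicator_of_notMem fun h => hz' (hiff.2 h)]
    · have h0 := dWirt_eq_zero_of_notMem_tsupport hz i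
      simp only [indicator, h0, ite_self]
  have hmeas : AEStronglyMeasurable (fun p => τ p * fluxFun g U Z p)
      (areaMeasure g (smoothBdry n U)) :=
    hτ.continuous.aestronglyMeasurable.mul (aestronglyMeasurable_fluxFun hU hZ)
  have h2 : ∫ p, τ p * fluxFun g U Z p ∂(areaMeasure g (smoothBdry n U)) =
      ∫ w in W, (areaDensity g (graphParam φ A f) w : ℂ) *
        (τ (graphParam φ A f w) * fluxFun g U Z (graphParam φ A f w)) := by
    rw [← setIntegral_eq_integral_of_forall_compl_eq_zero (s := graphNhd φ A W a b),
      hg.areaMeasure_restrict g hU, integral_paramMeasure hg.isOpen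
        hg.contMDiffOn_graphParam.continuousOn (hg.continuousOn_areaDensity g)
        (fun w hw => (hg.areaDensity_pos hU hw).le)]
    · rw [← hg.areaMeasure_restrict g hU]
      exact hmeas.restrict
    · intro p hp
      rw [image_eq_zero_of_notMem_tsupport fun h => hp (hs h), zero_mul]
  rw [h2, Finset.sum_congr rfl fun i _ => h1 i, ← integral_finsetSum]
  · refine setIntegral_congr_fun hg.isOpen.measurableSet fun w hw => ?_
    have h3 := hg.areaDensity_mul_riemC g hU hw (Z (graphParam φ A f w))
    have h4 : (areaDensity g (graphParam φ A f) w : ℂ) *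
        (τ (graphParam φ A f w) * fluxFun g U Z (graphParam φ A f w)) =
        τ (graphParam φ A f w) * ((areaDensity g (graphParam φ A f) w : ℂ) *
          riemC g (graphParam φ A f w) (Z (graphParam φ A f w))
            (outerNormal g U (graphParam φ A f w))) := by
      rw [fluxFun]
      ring
    rw [h4, h3, Finset.mul_sum]
    refine Finset.sum_congr rfl fun i _ => ?_
    rw [chartField, indicator_of_mem (hg.graphParam_mem hw), mul_assoc]
    rfl
  · exact fun i _ => integrableOn_mul_wirtL hg.isOpen
      (fun w hw => (hg.smooth w hw).of_le (by simp))
      ((contDiff_chartField hc hsφ hZ hg.chart hτ i).of_le (by simp))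
      (hasCompactSupport_chartField hc hsφ i) (fun z hz => (hsupp i z hz).1) i

end Stokes

/-! ### Cutoff functions near sets of codimension greater than one -/

section Cutoff

open Set Metric

/-- A null set has countable covers with small sum of diamᵐ. Sets meeting K are enlarged to balls
centred in K, compactness leaves finitely many, and the enlargements cost a geometric series. -/
theorem exists_ball_cover {E : Type*} [MetricSpace E] [Nonempty E] [MeasurableSpace E] [BorelSpace E]
    {m : ℕ} {K : Set E} (hK : IsCompact K) (h0 : Measure.hausdorffMeasure (m : ℝ) K = 0)
    {ε : ℝ} (hε : 0 < ε) :
    ∃ (s : Finset ℕ) (x : ℕ → E) (r : ℕ → ℝ), (∀ i ∈ s, x i ∈ K ∧ 0 < r i ∧ r i ≤ ε) ∧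
      K ⊆ ⋃ i ∈ s, ball (x i) (r i) ∧ ∑ i ∈ s, r i ^ m ≤ ε := by
  rw [Measure.hausdorffMeasure_apply] at h0
  have h1 := (le_of_eq h0)
  have h2 := (iSup₂_le_iff.1 h1) (ENNReal.ofReal (ε / 2)) (by simpa using hε)
  have h3 := h2.trans_lt (show (0 : ENNReal) < ENNReal.ofReal (ε / 2) by simpa using hε)
  simp only [iInf_lt_iff] at h3
  obtain ⟨t, htK, htd, hts⟩ := h3
  have hfin : ∀ i, ediam (t i) ≠ ⊤ := fun i => ((htd i).trans_lt ENNReal.ofReal_lt_top).ne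
  have hD : ∀ i, diam (t i) < ε := by
    intro i
    have := ENNReal.toReal_mono ENNReal.ofReal_ne_top (htd i)
    rw [ENNReal.toReal_ofReal (by positivity)] at this
    have h' : diam (t i) ≤ ε / 2 := this
    linarith
  -- The radius must exceed the diameter strictly, as open balls are used and the diameter may be
  -- zero. The excesses add up to at most ε/2, the other half being spent on the diameters.
  have hr : ∀ i, ∃ r, diam (t i) < r ∧ r ≤ ε ∧ r ^ m < diam (t i) ^ m + ε / 2 / 2 / 2 ^ i := by
    intro i
    have hc : ContinuousAt (fun r : ℝ => r ^ m) (diam (t i)) := (continuous_pow m).continuousAt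
    have h4 : ∀ᶠ r in nhdsWithin (diam (t i)) (Ioi (diam (t i))),
        r ^ m < diam (t i) ^ m + ε / 2 / 2 / 2 ^ i :=
      nhdsWithin_le_nhds (hc.eventually_lt continuousAt_const (by
        have : 0 < ε / 2 / 2 / 2 ^ i := by positivity
        linarith))
    have h5 : ∀ᶠ r in nhdsWithin (diam (t i)) (Ioi (diam (t i))), r ≤ ε := by
      filter_upwards [nhdsWithin_le_nhds (Iio_mem_nhds (hD i))] with r hr using le_of_lt hr
    obtain ⟨r, h6, h7, h8⟩ := (h4.and (h5.and self_mem_nhdsWithin)).exists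
    exact ⟨r, h8, h7, h6⟩
  choose r hr1 hr2 hr3 using hr
  have hx : ∀ i, ∃ x, (t i ∩ K).Nonempty → x ∈ t i ∩ K := by
    intro i
    by_cases h : (t i ∩ K).Nonempty
    · exact ⟨h.some, fun _ => h.some_mem⟩
    · exact ⟨Classical.arbitrary E, fun h' => absurd h' h⟩
  choose x hx using hx
  obtain ⟨s, hs⟩ := hK.elim_finite_subcover
    (fun i : {i // (t i ∩ K).Nonempty} => ball (x i) (r i)) (fun i => isOpen_ball) (by
      intro y hy
      obtain ⟨i, hi⟩ := mem_iUnion.1 (htK hy)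
      refine mem_iUnion.2 ⟨⟨i, y, hi, hy⟩, ?_⟩
      rw [mem_ball]
      exact (dist_le_diam_of_mem' (hfin i) hi (hx i ⟨y, hi, hy⟩).1).trans_lt (hr1 i))
  set s' : Finset ℕ := s.map ⟨Subtype.val, Subtype.val_injective⟩
  have hs' : ∀ i ∈ s', (t i ∩ K).Nonempty := by
    intro i hi
    obtain ⟨j, -, rfl⟩ := Finset.mem_map.1 hi
    exact j.2
  refine ⟨s', x, r, fun i hi => ⟨(hx i (hs' i hi)).2, diam_nonneg.trans_lt (hr1 i), hr2 i⟩,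
    fun y hy => ?_, ?_⟩
  · obtain ⟨i, hi, hy'⟩ := mem_iUnion₂.1 (hs hy)
    exact mem_iUnion₂.2 ⟨i, Finset.mem_map.2 ⟨i, hi, rfl⟩, hy'⟩
  · have h4 : ∑ i ∈ s', diam (t i) ^ m ≤ ε / 2 := by
      have h5 : ENNReal.ofReal (∑ i ∈ s', diam (t i) ^ m) ≤ ENNReal.ofReal (ε / 2) := by
        rw [ENNReal.ofReal_sum_of_nonneg fun i _ => pow_nonneg diam_nonneg m]
        refine le_trans ?_ hts.le
        refine le_trans (Finset.sum_le_sum fun i hi => ?_) (ENNReal.sum_le_tsum s')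
        refine le_trans ?_ (le_iSup _ ((hs' i hi).mono inter_subset_left))
        rw [ENNReal.rpow_natCast, ENNReal.ofReal_pow diam_nonneg, diam,
          ENNReal.ofReal_toReal (hfin i)]
      exact (ENNReal.ofReal_le_ofReal_iff (by positivity)).1 h5
    have h6 : ∑ i ∈ s', ε / 2 / 2 / 2 ^ i ≤ ε / 2 := by
      refine ((summable_geometric_two' (ε / 2)).sum_le_tsum s' fun i _ => by positivity).trans ?_
      rw [tsum_geometric_two']
    calc ∑ i ∈ s', r i ^ m ≤ ∑ i ∈ s', (diam (t i) ^ m + ε / 2 / 2 / 2 ^ i) :=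
          Finset.sum_le_sum fun i _ => (hr3 i).le
      _ ≤ ε := by rw [Finset.sum_add_distrib]; linarith

variable {E : Type*} [NormedAddCommGroup E] [NormedSpace ℝ E]

/-- Leibniz rule: all the undifferentiated factors lie in [0, 1]. -/
theorem norm_fderiv_prod_one_sub_le (b : ℕ → E → ℝ) (hb : ∀ i, ContDiff ℝ 1 (b i))
    (h0 : ∀ i z, 0 ≤ b i z) (h1 : ∀ i z, b i z ≤ 1) (s : Finset ℕ) (z : E) :
    ‖fderiv ℝ (fun z => ∏ i ∈ s, (1 - b i z)) z‖ ≤ ∑ i ∈ s, ‖fderiv ℝ (b i) z‖ := by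
  induction s using Finset.induction_on with
  | empty => simp
  | insert a s ha ih =>
    have hd : DifferentiableAt ℝ (fun z => ∏ i ∈ s, (1 - b i z)) z :=
      (contDiff_prod fun i _ => contDiff_const.sub (hb i)).differentiable one_ne_zero z
    have hbz : DifferentiableAt ℝ (b a) z := (hb a).differentiable one_ne_zero z
    have hp0 : 0 ≤ ∏ i ∈ s, (1 - b i z) := Finset.prod_nonneg fun i _ => sub_nonneg.2 (h1 i z)
    have hp1 : ∏ i ∈ s, (1 - b i z) ≤ 1 :=
      Finset.prod_le_one (fun i _ => sub_nonneg.2 (h1 i z)) fun i _ => by linarith [h0 i z]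
    simp only [Finset.prod_insert ha, Finset.sum_insert ha]
    rw [fderiv_fun_mul (hbz.const_sub 1) hd, fderiv_const_sub]
    have e1 : ‖(1 - b a z) • fderiv ℝ (fun z => ∏ i ∈ s, (1 - b i z)) z‖ ≤
        ‖fderiv ℝ (fun z => ∏ i ∈ s, (1 - b i z)) z‖ := by
      rw [norm_smul, Real.norm_of_nonneg (sub_nonneg.2 (h1 a z))]
      exact mul_le_of_le_one_left (norm_nonneg _) (by linarith [h0 a z])
    have e2 : ‖(∏ i ∈ s, (1 - b i z)) • -fderiv ℝ (b a) z‖ ≤ ‖fderiv ℝ (b a) z‖ := by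
      rw [norm_smul, norm_neg, Real.norm_of_nonneg hp0]
      exact mul_le_of_le_one_left (norm_nonneg _) hp1
    calc _ ≤ _ := norm_add_le _ _
      _ ≤ _ := by linarith

variable [FiniteDimensional ℝ E] [MeasurableSpace E] [BorelSpace E] (μ : Measure E)
  [μ.IsAddHaarMeasure]

/-- The volume scales as r to the power m + 1 and the gradient as r⁻¹. The net exponent m is that of
the Hausdorff measure. -/
theorem integral_norm_fderiv_rescale {m : ℕ} (hm : Module.finrank ℝ E = m + 1) {b : E → ℝ}
    (hb : Differentiable ℝ b) (x : E) {r : ℝ} (hr : 0 < r) :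
    ∫ z, ‖fderiv ℝ (fun z => b (r⁻¹ • (z - x))) z‖ ∂μ = r ^ m * ∫ z, ‖fderiv ℝ b z‖ ∂μ := by
  have h1 : ∀ z, ‖fderiv ℝ (fun z => b (r⁻¹ • (z - x))) z‖ =
      r⁻¹ * ‖fderiv ℝ b (r⁻¹ • (z - x))‖ := by
    intro z
    have h2 : HasFDerivAt (fun z => r⁻¹ • (z - x)) (r⁻¹ • ContinuousLinearMap.id ℝ E) z :=
      ((hasFDerivAt_id z).sub_const x).const_smul r⁻¹
    have h3 : HasFDerivAt (fun z => b (r⁻¹ • (z - x))) _ z := (hb _).hasFDerivAt.comp z h2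
    rw [h3.fderiv, ContinuousLinearMap.comp_smul, ContinuousLinearMap.comp_id, norm_smul,
      Real.norm_of_nonneg (inv_pos.2 hr).le]
  simp only [h1]
  rw [integral_const_mul, integral_sub_right_eq_self (fun z => ‖fderiv ℝ b (r⁻¹ • z)‖) x,
    Measure.integral_comp_inv_smul μ (fun z => ‖fderiv ℝ b z‖) r, hm,
    abs_of_pos (pow_pos hr _), smul_eq_mul, ← mul_assoc, pow_succ]
  congr 1
  field_simp

/-- The cutoff is the product of 1 - bump over a ball cover of K. Its gradient has L¹ norm at most a
constant times Σ rᵢᵐ, which is small since K is null in codimension one. -/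
theorem exists_cutoff {m : ℕ} (hm : Module.finrank ℝ E = m + 1) {K : Set E} (hK : IsCompact K)
    (h0 : Measure.hausdorffMeasure (m : ℝ) K = 0) {ε : ℝ} (hε : 0 < ε) :
    ∃ χ : E → ℝ, ContDiff ℝ ∞ χ ∧ (∀ z, 0 ≤ χ z) ∧ (∀ z, χ z ≤ 1) ∧
      (∃ O, IsOpen O ∧ K ⊆ O ∧ ∀ z ∈ O, χ z = 0) ∧
      (∀ z, (∀ x ∈ K, ε ≤ dist z x) → χ z = 1) ∧
      Integrable (fun z => ‖fderiv ℝ χ z‖) μ ∧ ∫ z, ‖fderiv ℝ χ z‖ ∂μ ≤ ε := by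
  set β : ContDiffBump (0 : E) := ⟨1, 2, one_pos, one_lt_two⟩
  have hβ : ContDiff ℝ ∞ β := β.contDiff
  set I := ∫ z, ‖fderiv ℝ β z‖ ∂μ
  have hI : 0 ≤ I := integral_nonneg fun z => norm_nonneg _
  -- The first bound keeps the bumps, of radius twice rᵢ, within distance ε of K; the second makes
  -- δI at most ε, also when I = 0.
  set δ := min (ε / 2) (ε / (I + 1))
  have hδ : 0 < δ := lt_min (by positivity) (by positivity)
  obtain ⟨s, x, r, hs, hcov, hsum⟩ := exists_ball_cover hK h0 hδ
  set b : ℕ → E → ℝ := fun i z => β ((r i)⁻¹ • (z - x i))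
  have hb : ∀ i, ContDiff ℝ ∞ (b i) := fun i => hβ.comp (by fun_prop)
  have hb0 : ∀ i z, 0 ≤ b i z := fun i z => β.nonneg
  have hb1 : ∀ i z, b i z ≤ 1 := fun i z => β.le_one
  have hnorm : ∀ i ∈ s, ∀ z, ‖(r i)⁻¹ • (z - x i)‖ = dist z (x i) / r i := by
    intro i hi z
    rw [norm_smul, Real.norm_of_nonneg (inv_pos.2 (hs i hi).2.1).le, dist_eq_norm, div_eq_inv_mul]
  have hint : ∀ i ∈ s, Integrable (fun z => ‖fderiv ℝ (b i) z‖) μ := by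
    intro i hi
    refine Integrable.norm (((hb i).continuous_fderiv (by simp)).integrable_of_hasCompactSupport
      (HasCompactSupport.fderiv (𝕜 := ℝ) ?_))
    refine HasCompactSupport.of_support_subset_isCompact
      (isCompact_closedBall (x i) (2 * r i)) fun z hz => ?_
    by_contra h
    refine hz (β.zero_of_le_dist ?_)
    rw [dist_zero_right, hnorm i hi, le_div_iff₀ (hs i hi).2.1]
    exact (not_le.1 h).le
  have hle := norm_fderiv_prod_one_sub_le b (fun i => (hb i).of_le (by simp)) hb0 hb1 s
  have hχ : ContDiff ℝ ∞ fun z => ∏ i ∈ s, (1 - b i z) :=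
    contDiff_prod fun i _ => contDiff_const.sub (hb i)
  have hintχ : Integrable (fun z => ‖fderiv ℝ (fun z => ∏ i ∈ s, (1 - b i z)) z‖) μ := by
    refine (integrable_finsetSum s hint).mono'
      ((hχ.continuous_fderiv (by simp)).norm.aestronglyMeasurable)
      (Filter.Eventually.of_forall fun z => ?_)
    rw [norm_norm]
    exact hle z
  refine ⟨fun z => ∏ i ∈ s, (1 - b i z), hχ,
    fun z => Finset.prod_nonneg fun i _ => sub_nonneg.2 (hb1 i z),
    fun z => Finset.prod_le_one (fun i _ => sub_nonneg.2 (hb1 i z)) fun i _ => by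
      linarith [hb0 i z],
    ⟨_, isOpen_biUnion fun i _ => isOpen_ball, hcov, fun z hz => ?_⟩, fun z hz => ?_, hintχ, ?_⟩
  · obtain ⟨i, hi, hzi⟩ := mem_iUnion₂.1 hz
    refine Finset.prod_eq_zero hi ?_
    rw [sub_eq_zero]
    refine (β.one_of_mem_closedBall ?_).symm
    rw [mem_closedBall, dist_zero_right, hnorm i hi, div_le_iff₀ (hs i hi).2.1]
    show _ ≤ 1 * r i
    rw [one_mul]
    exact (mem_ball.1 hzi).le
  · refine Finset.prod_eq_one fun i hi => ?_
    rw [sub_eq_self]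
    refine β.zero_of_le_dist ?_
    rw [dist_zero_right, hnorm i hi, le_div_iff₀ (hs i hi).2.1]
    show 2 * r i ≤ _
    have h1 := (hs i hi).2.2.trans (min_le_left _ _)
    linarith [hz _ (hs i hi).1]
  · calc ∫ z, ‖fderiv ℝ (fun z => ∏ i ∈ s, (1 - b i z)) z‖ ∂μ
        ≤ ∫ z, ∑ i ∈ s, ‖fderiv ℝ (b i) z‖ ∂μ :=
          integral_mono hintχ (integrable_finsetSum s hint) hle
      _ = ∑ i ∈ s, r i ^ m * I := by
          rw [integral_finsetSum s hint]
          exact Finset.sum_congr rfl fun i hi => integral_norm_fderiv_rescale μ hm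
            (hβ.differentiable (by simp)) (x i) (hs i hi).2.1
      _ = (∑ i ∈ s, r i ^ m) * I := (Finset.sum_mul _ _ _).symm
      _ ≤ ε / (I + 1) * I := by
          gcongr
          exact hsum.trans (min_le_right _ _)
      _ ≤ ε := by
          rw [div_mul_eq_mul_div, div_le_iff₀ (by positivity)]
          nlinarith

end Cutoff

/-! ### The divergence theorem on domains with piecewise smooth boundary -/

section Global

set_option linter.unusedSectionVars false

open Matrix Set Filter Topology

variable {n : ℕ} {X : Type*} [TopologicalSpace X] [T2Space X] [SecondCountableTopology X]
  [MeasurableSpace X] [BorelSpace X] [ChartedSpace (Cn n) X] [IsManifold 𝓘(ℂ, Cn n) ω X]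
  {g : KahlerMetric n X} {U : Set X} {φ : OpenPartialHomeomorph X (Cn n)}
  {Z : ∀ x : X, HTan n x} {q : X → ℂ} {σ τ : X → ℂ}

theorem integrable_divMul (hZ : HasDivergence g Z q) (hτ : IsSmoothFun n τ)
    (hc : HasCompactSupport τ) : Integrable (divMul τ Z q) (volMeasure g) :=
  (hZ.continuous_divMul hτ).integrable_of_hasCompactSupport
    (hc.mono' (support_divMul_subset τ Z q))

theorem integrable_mul_fluxFun (hfl : Integrable (fluxFun g U Z) (areaMeasure g (smoothBdry n U)))
    (hτ : IsSmoothFun n τ) (hc : HasCompactSupport τ) :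
    Integrable (fun p => τ p * fluxFun g U Z p) (areaMeasure g (smoothBdry n U)) := by
  obtain ⟨C, hC⟩ := hc.exists_bound_of_continuous hτ.continuous
  exact hfl.bdd_mul hτ.continuous.aestronglyMeasurable (Eventually.of_forall hC)

omit [T2Space X] [SecondCountableTopology X] [MeasurableSpace X] [BorelSpace X]
  [IsManifold 𝓘(ℂ, Cn n) ω X] in
theorem contMDiffAt_ofReal_mul {c : X → ℝ} {x : X}
    (hc : ContMDiffAt 𝓘(ℝ, Cn n) 𝓘(ℝ, ℝ) ∞ c x) (hτ : ContMDiffAt 𝓘(ℝ, Cn n) 𝓘(ℝ, ℂ) ∞ τ x) :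
    ContMDiffAt 𝓘(ℝ, Cn n) 𝓘(ℝ, ℂ) ∞ (fun x => (c x : ℂ) * τ x) x := by
  simp only [← Complex.real_smul]
  exact hc.smul hτ

section Sums

variable (hfl : Integrable (fluxFun g U Z) (areaMeasure g (smoothBdry n U)))
  (hZ : HasDivergence g Z q)
include hfl hZ

theorem StokesFor.add (hσ : IsSmoothFun n σ) (hcσ : HasCompactSupport σ) (hτ : IsSmoothFun n τ)
    (hcτ : HasCompactSupport τ) (h1 : StokesFor g U Z q σ) (h2 : StokesFor g U Z q τ) :
    StokesFor g U Z q (fun x => σ x + τ x) := by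
  rw [StokesFor] at h1 h2 ⊢
  simp only [divMul_add hσ hτ, add_mul]
  rw [integral_add (integrable_divMul hZ hσ hcσ).integrableOn
    (integrable_divMul hZ hτ hcτ).integrableOn, h1, h2,
    integral_add (integrable_mul_fluxFun hfl hσ hcσ) (integrable_mul_fluxFun hfl hτ hcτ)]

theorem stokesFor_zero (hU : IsOpen U) : StokesFor g U Z q (fun _ => 0) :=
  stokesFor_exterior hU (by simp [tsupport])

theorem stokesFor_sum (hU : IsOpen U) {ι : Type*} (s : Finset ι) {σ : ι → X → ℂ}
    (hσ : ∀ i, IsSmoothFun n (σ i)) (hc : ∀ i, HasCompactSupport (σ i))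
    (h : ∀ i, StokesFor g U Z q (σ i)) :
    IsSmoothFun n (fun x => ∑ i ∈ s, σ i x) ∧ HasCompactSupport (fun x => ∑ i ∈ s, σ i x) ∧
      StokesFor g U Z q (fun x => ∑ i ∈ s, σ i x) := by
  classical
  induction s using Finset.induction_on with
  | empty =>
    simp only [Finset.sum_empty]
    exact ⟨contMDiff_const, HasCompactSupport.zero, stokesFor_zero hfl hZ hU⟩
  | insert a s ha ih =>
    simp only [Finset.sum_insert ha]
    exact ⟨(hσ a).add ih.1, (hc a).add ih.2.1,
      (h a).add hfl hZ (hσ a) (hc a) ih.1 ih.2.1 ih.2.2⟩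

/-- Both sides of the divergence theorem are additive in τ, so a finite smooth partition of unity on
the compact support localises it. -/
theorem stokesFor_of_local (hU : IsOpen U) (hτ : IsSmoothFun n τ) (hc : HasCompactSupport τ)
    (h : ∀ x ∈ tsupport τ, ∃ N : Set X, IsOpen N ∧ x ∈ N ∧ ∀ σ : X → ℂ, IsSmoothFun n σ →
      HasCompactSupport σ → tsupport σ ⊆ N → StokesFor g U Z q σ) : StokesFor g U Z q τ := by
  choose! N hN hxN hσ using h
  obtain ⟨s, hs⟩ := hc.isCompact.elim_finite_subcover (fun x : tsupport τ => N x)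
    (fun x => hN x x.2) fun x hx => mem_iUnion.2 ⟨⟨x, hx⟩, hxN x hx⟩
  have : LocallyCompactSpace X := ChartedSpace.locallyCompactSpace (Cn n) X
  obtain ⟨f, hf⟩ := SmoothPartitionOfUnity.exists_isSubordinate 𝓘(ℝ, Cn n)
    (isClosed_tsupport τ) (fun i : s => N i.1) (fun i => hN i.1 i.1.2) fun x hx => by
      obtain ⟨i, hi, hxi⟩ := mem_iUnion₂.1 (hs hx)
      exact mem_iUnion.2 ⟨⟨i, hi⟩, hxi⟩
  have hfs : ∀ i, IsSmoothFun n fun x => ((f i x : ℝ) : ℂ) * τ x := fun i x =>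
    contMDiffAt_ofReal_mul ((f i).contMDiff x) (hτ x)
  have hfc : ∀ i, HasCompactSupport fun x => ((f i x : ℝ) : ℂ) * τ x := fun i => hc.mul_left
  have hfN : ∀ i, tsupport (fun x => ((f i x : ℝ) : ℂ) * τ x) ⊆ N i.1 := by
    intro i
    refine (closure_mono fun x hx => ?_).trans (hf i)
    intro h0
    exact hx (by simp [h0])
  have hsum := (stokesFor_sum hfl hZ hU Finset.univ hfs hfc fun i =>
    hσ i.1 i.1.2 _ (hfs i) (hfc i) (hfN i)).2.2
  convert hsum using 1
  ext x
  rw [← Finset.sum_mul, ← Complex.ofReal_sum]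
  by_cases hx : x ∈ tsupport τ
  · have h1 := f.sum_eq_one hx
    rw [finsum_eq_sum_of_fintype] at h1
    rw [h1, Complex.ofReal_one, one_mul]
  · rw [image_eq_zero_of_notMem_tsupport hx, mul_zero]

/-- Away from the singular set each point is interior, exterior or a smooth boundary point, and each
kind has a neighbourhood in which the theorem is known. -/
theorem stokesFor_of_disjoint_singular (hU : IsOpen U) (hτ : IsSmoothFun n τ)
    (hc : HasCompactSupport τ) (hd : Disjoint (tsupport τ) (frontier U \ smoothBdry n U)) :
    StokesFor g U Z q τ := by
  refine stokesFor_of_local hfl hZ hU hτ hc fun x hx => ?_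
  by_cases hxU : x ∈ closure U
  · by_cases hxU' : x ∈ U
    · refine ⟨U ∩ (chartAt (Cn n) x).source, hU.inter (chartAt (Cn n) x).open_source,
        ⟨hxU', mem_chart_source _ x⟩, fun σ hσ hcσ hs => ?_⟩
      exact stokesFor_interior hU hZ (chartAt_mem_holCharts x) hσ hcσ
        (hs.trans inter_subset_right) (hs.trans inter_subset_left)
    · have hxf : x ∈ frontier U := by
        rw [hU.frontier_eq]
        exact ⟨hxU, hxU'⟩
      have hxS : x ∈ smoothBdry n U := by
        by_contra h
        exact disjoint_left.1 hd hx ⟨hxf, h⟩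
      obtain ⟨φ, A, W, a, b, f, hg, hxN⟩ := exists_graphChart hxS
      exact ⟨_, hg.isOpen_graphNhd, hxN, fun σ hσ hcσ hs => stokesFor_graph hU hg hZ hσ hcσ hs⟩
  · exact ⟨(closure U)ᶜ, isClosed_closure.isOpen_compl, hxU, fun σ hσ hcσ hs =>
      stokesFor_exterior hU hs⟩

end Sums

/-- In dimension zero every chart domain has at most one point, so X is discrete. The case is needed
since 2n - 1 is then negative. -/
theorem frontier_eq_empty_of_subsingleton [Subsingleton (Cn n)] (hU : IsOpen U) :
    frontier U = ∅ := by
  rw [hU.frontier_eq]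
  refine eq_empty_of_forall_notMem fun x hx => hx.2 ?_
  obtain ⟨y, hy, hyU⟩ := mem_closure_iff.1 hx.1 _ (chartAt (Cn n) x).open_source
    (mem_chart_source _ x)
  rwa [(chartAt (Cn n) x).injOn (mem_chart_source _ x) hy (Subsingleton.elim _ _)]

theorem norm_dWirt_ofReal_le {χ : Cn n → ℝ} {z : Cn n} (hχ : DifferentiableAt ℝ χ z) (i : Fin n) :
    ‖dWirt i (fun z => (χ z : ℂ)) z‖ ≤ ‖fderiv ℝ χ z‖ := by
  have h1 : ∀ u, fderiv ℝ (fun z => (χ z : ℂ)) z u = (fderiv ℝ χ z u : ℂ) := by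
    intro u
    have h2 : HasFDerivAt (fun z => (χ z : ℂ)) _ z :=
      Complex.ofRealCLM.hasFDerivAt.comp z hχ.hasFDerivAt
    rw [h2.fderiv]
    rfl
  have h3 : ∀ c : ℂ, ‖c‖ = 1 → ‖(fderiv ℝ χ z (Pi.single i c) : ℂ)‖ ≤ ‖fderiv ℝ χ z‖ := by
    intro c hc
    have := (fderiv ℝ χ z).le_opNorm (Pi.single i c)
    rwa [Pi.norm_single, hc, mul_one, ← Complex.norm_real] at this
  have h4 := h3 1 (by simp)
  have h5 := h3 Complex.I (by simp)
  rw [dWirt, h1, h1, norm_mul]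
  have h6 := norm_sub_le (fderiv ℝ χ z (Pi.single i 1) : ℂ)
    (Complex.I * (fderiv ℝ χ z (Pi.single i Complex.I) : ℂ))
  rw [norm_mul, Complex.norm_I, one_mul] at h6
  have h7 : ‖(1 / 2 : ℂ)‖ = 1 / 2 := by norm_num
  rw [h7]
  linarith

theorem eventually_le_dist {E : Type*} [PseudoMetricSpace E] {K : Set E} (hK : IsClosed K) {z : E}
    (hz : z ∉ K) : ∀ᶠ k : ℕ in atTop, ∀ x ∈ K, 1 / ((k : ℝ) + 1) ≤ dist z x := by
  obtain ⟨δ, hδ, hball⟩ := Metric.isOpen_iff.1 hK.isOpen_compl z hz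
  filter_upwards [tendsto_one_div_add_atTop_nhds_zero_nat.eventually (gt_mem_nhds hδ)] with k hk x hx
  by_contra! h
  exact hball (by rw [Metric.mem_ball, dist_comm]; exact h.trans hk) hx

/-- By the product rule, χ_k ∂v converges by domination, and v ∂χ_k is bounded in L¹ by sup |v|
times the L¹ norm of the gradient of χ_k, which tends to zero. -/
theorem tendsto_setIntegral_dWirt_mul {T : Set (Cn n)} (hT : MeasurableSet T) {v : Cn n → ℂ}
    (hv : ContDiff ℝ 1 v) (hc : HasCompactSupport v) {χ : ℕ → Cn n → ℝ}
    (hχ : ∀ k, ContDiff ℝ ∞ (χ k)) (h0 : ∀ k z, 0 ≤ χ k z) (h1 : ∀ k z, χ k z ≤ 1)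
    (hlim : ∀ z ∈ T, ∀ᶠ k in atTop, χ k z = 1)
    (hint : ∀ k, Integrable (fun z => ‖fderiv ℝ (χ k) z‖))
    (hle : ∀ k : ℕ, ∫ z, ‖fderiv ℝ (χ k) z‖ ≤ 1 / ((k : ℝ) + 1)) (i : Fin n) :
    Tendsto (fun k => ∫ z in T, dWirt i (fun z => (χ k z : ℂ) * v z) z) atTop
      (𝓝 (∫ z in T, dWirt i v z)) := by
  have hχc : ∀ k, ContDiff ℝ ∞ fun z => (χ k z : ℂ) := fun k =>
    Complex.ofRealCLM.contDiff.comp (hχ k)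
  have hvd : ∀ z, DifferentiableAt ℝ v z := hv.differentiable one_ne_zero
  have hdχ : ∀ k, Continuous (dWirt i fun z => (χ k z : ℂ)) := fun k =>
    continuous_iff_continuousAt.2 fun z => continuousAt_dWirt ((hχc k).of_le (by simp)).contDiffAt i
  obtain ⟨C, hC⟩ := hc.exists_bound_of_continuous hv.continuous
  have hnχ : ∀ k z, ‖(χ k z : ℂ)‖ ≤ 1 := fun k z => by
    rw [Complex.norm_real, Real.norm_of_nonneg (h0 k z)]
    exact h1 k z
  have hI1 : ∀ k, Integrable fun z => (χ k z : ℂ) * dWirt i v z := fun k =>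
    (integrable_dWirt hv hc i).bdd_mul (hχc k).continuous.aestronglyMeasurable
      (Eventually.of_forall (hnχ k))
  have hI2 : ∀ k, Integrable fun z => v z * dWirt i (fun z => (χ k z : ℂ)) z := fun k =>
    Integrable.bdd_mul ((hint k).mono' (hdχ k).aestronglyMeasurable (Eventually.of_forall fun z =>
      norm_dWirt_ofReal_le ((hχ k).differentiable (by simp) z) i))
      hv.continuous.aestronglyMeasurable (Eventually.of_forall hC)
  have hsplit : ∀ k, ∫ z in T, dWirt i (fun z => (χ k z : ℂ) * v z) z =
      (∫ z in T, (χ k z : ℂ) * dWirt i v z) +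
        ∫ z in T, v z * dWirt i (fun z => (χ k z : ℂ)) z := by
    intro k
    rw [← integral_add (hI1 k).integrableOn (hI2 k).integrableOn]
    refine integral_congr_ae (Eventually.of_forall fun z => ?_)
    exact cder_mul (wirtL i) ((hχc k).differentiable (by simp) z) (hvd z)
  have hlim1 : Tendsto (fun k => ∫ z in T, (χ k z : ℂ) * dWirt i v z) atTop
      (𝓝 (∫ z in T, dWirt i v z)) := by
    refine tendsto_integral_of_dominated_convergence (fun z => ‖dWirt i v z‖)
      (fun k => (hI1 k).aestronglyMeasurable.restrict) (integrable_dWirt hv hc i).norm.integrableOn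
      (fun k => Eventually.of_forall fun z => ?_) ?_
    · rw [norm_mul]
      exact mul_le_of_le_one_left (norm_nonneg _) (hnχ k z)
    · filter_upwards [ae_restrict_mem hT] with z hz
      refine tendsto_const_nhds.congr' ?_
      filter_upwards [hlim z hz] with k hk
      rw [hk, Complex.ofReal_one, one_mul]
  have hlim2 : Tendsto (fun k => ∫ z in T, v z * dWirt i (fun z => (χ k z : ℂ)) z) atTop
      (𝓝 0) := by
    have hC0 : 0 ≤ C := (norm_nonneg _).trans (hC 0)
    refine squeeze_zero_norm (a := fun k : ℕ => C * (1 / ((k : ℝ) + 1))) (fun k => ?_) ?_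
    · calc ‖∫ z in T, v z * dWirt i (fun z => (χ k z : ℂ)) z‖
          ≤ ∫ z in T, ‖v z * dWirt i (fun z => (χ k z : ℂ)) z‖ := norm_integral_le_integral_norm _
        _ ≤ ∫ z, ‖v z * dWirt i (fun z => (χ k z : ℂ)) z‖ :=
            setIntegral_le_integral (hI2 k).norm (Eventually.of_forall fun z => norm_nonneg _)
        _ ≤ ∫ z, C * ‖fderiv ℝ (χ k) z‖ := by
            refine integral_mono (hI2 k).norm ((hint k).const_mul C) fun z => ?_
            simp only [norm_mul]
            exact mul_le_mul (hC z) (norm_dWirt_ofReal_le ((hχ k).differentiable (by simp) z) i)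
              (norm_nonneg _) hC0
        _ ≤ C * (1 / ((k : ℝ) + 1)) := by
            rw [integral_const_mul]
            exact mul_le_mul_of_nonneg_left (hle k) hC0
    · simpa using tendsto_one_div_add_atTop_nhds_zero_nat.const_mul C
  simp only [hsplit]
  simpa using hlim1.add hlim2

/-- The cutoffs χ_k remove the singular points from the support of τ, so the theorem holds for χ_k
τ. Letting k grow restores it for τ. -/
theorem stokesFor_chart (hn : 1 ≤ n) (hU : IsOpen U)
    (hnull : Measure.hausdorffMeasure (2 * (n : ℝ) - 1)
      (φ '' (φ.source ∩ (frontier U \ smoothBdry n U))) = 0)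
    (hfl : Integrable (fluxFun g U Z) (areaMeasure g (smoothBdry n U)))
    (hZ : HasDivergence g Z q) (hφ : φ ∈ holCharts n X) (hτ : IsSmoothFun n τ)
    (hc : HasCompactSupport τ) (hs : tsupport τ ⊆ φ.source) : StokesFor g U Z q τ := by
  obtain ⟨O, hO, hSO⟩ := exists_isOpen_smoothBdry_eq (n := n) hU
  have hclosed : IsClosed (frontier U \ smoothBdry n U) := by
    have : frontier U \ smoothBdry n U = frontier U ∩ Oᶜ := by
      ext x
      simp [hSO]
    rw [this]
    exact isClosed_frontier.inter hO.isClosed_compl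
  set K₀ := tsupport τ ∩ (frontier U \ smoothBdry n U)
  have hK₀ : IsCompact K₀ := hc.isCompact.inter_right hclosed
  have hK₀s : K₀ ⊆ φ.source := inter_subset_left.trans hs
  have hK : IsCompact (φ '' K₀) := hK₀.image_of_continuousOn (φ.continuousOn.mono hK₀s)
  have hK0 : Measure.hausdorffMeasure ((2 * n - 1 : ℕ) : ℝ) (φ '' K₀) = 0 := by
    have e : ((2 * n - 1 : ℕ) : ℝ) = 2 * (n : ℝ) - 1 := by
      rw [Nat.cast_sub (by omega)]
      push_cast
      ring
    rw [e]
    have hsub : K₀ ⊆ φ.source ∩ (frontier U \ smoothBdry n U) := fun x hx => ⟨hK₀s hx, hx.2⟩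
    exact measure_mono_null (image_mono hsub) hnull
  have hdim : Module.finrank ℝ (Cn n) = (2 * n - 1) + 1 := by
    rw [Module.finrank_pi_fintype]
    simp only [Complex.finrank_real_complex, Finset.sum_const, Finset.card_univ, Fintype.card_fin,
      smul_eq_mul]
    omega
  choose χ hχ h0 h1 hχO hχ1 hint hle using fun k : ℕ =>
    exists_cutoff (volume : Measure (Cn n)) hdim hK hK0 (ε := 1 / ((k : ℝ) + 1)) (by positivity)
  -- Both limits need this only off the singular set: U avoids it because U is open and the set lies
  -- in the frontier, and the area measure lives on the smooth part of the boundary.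
  have hχlim : ∀ z, z ∉ φ '' K₀ → ∀ᶠ k in atTop, χ k z = 1 := by
    intro z hz
    filter_upwards [eventually_le_dist hK.isClosed hz] with k hk using hχ1 k z hk
  set τ' : ℕ → X → ℂ := fun k x => (χ k (φ x) : ℂ) * τ x
  have hτ'supp : ∀ k, tsupport (τ' k) ⊆ tsupport τ := fun k =>
    closure_mono fun x hx h0 => hx (by simp [τ', h0])
  have hτ' : ∀ k, IsSmoothFun n (τ' k) := by
    intro k x
    by_cases hx : x ∈ tsupport τ
    · have h2 : ContMDiffAt 𝓘(ℝ, Cn n) 𝓘(ℝ, Cn n) ∞ φ x :=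
        contMDiffAt_of_mem_maximalAtlas (mem_maximalAtlas_real hφ) (hs hx)
      exact contMDiffAt_ofReal_mul ((hχ k).contMDiff.contMDiffAt.comp x h2) (hτ x)
    · have h2 : τ' k =ᶠ[𝓝 x] fun _ => 0 :=
        notMem_tsupport_iff_eventuallyEq.1 fun h => hx (hτ'supp k h)
      exact contMDiffAt_const.congr_of_eventuallyEq h2
  have hcτ' : ∀ k, HasCompactSupport (τ' k) := fun k => hc.mul_left
  have hst : ∀ k, StokesFor g U Z q (τ' k) := by
    intro k
    refine stokesFor_of_disjoint_singular hfl hZ hU (hτ' k) (hcτ' k)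
      (disjoint_left.2 fun x hx hxs => ?_)
    have hx' := hτ'supp k hx
    obtain ⟨O, hO, hKO, hO0⟩ := hχO k
    refine notMem_tsupport_iff_eventuallyEq.2 ?_ hx
    have hxO : x ∈ φ.source ∩ φ ⁻¹' O := ⟨hs hx', hKO ⟨x, ⟨hx', hxs⟩, rfl⟩⟩
    filter_upwards [(φ.isOpen_inter_preimage hO).mem_nhds hxO] with y hy
    simp [τ', hO0 _ hy.2]
  have hcf : ∀ k i, chartField g φ (τ' k) Z i =
      fun z => (χ k z : ℂ) * chartField g φ τ Z i z := by
    intro k i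
    ext z
    by_cases hz : z ∈ φ.target
    · simp only [chartField, indicator_of_mem hz, τ', φ.right_inv hz, mul_assoc]
    · simp only [chartField, indicator_of_notMem hz, mul_zero]
  have hTm : MeasurableSet (φ.target ∩ φ.symm ⁻¹' U) :=
    (φ.symm.isOpen_inter_preimage hU).measurableSet
  have hL : Tendsto (fun k => ∫ x in U, divMul (τ' k) Z q x ∂(volMeasure g)) atTop
      (𝓝 (∫ x in U, divMul τ Z q x ∂(volMeasure g))) := by
    rw [setIntegral_divMul hU hZ hφ hτ hc hs]
    simp only [fun k => setIntegral_divMul hU hZ hφ (hτ' k) (hcτ' k) ((hτ'supp k).trans hs), hcf]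
    refine tendsto_finsetSum _ fun i _ => tendsto_setIntegral_dWirt_mul hTm
      ((contDiff_chartField hc hs hZ hφ hτ i).of_le (by simp))
      (hasCompactSupport_chartField hc hs i) hχ h0 h1 (fun z hz => hχlim z ?_) hint hle i
    rintro ⟨x, hx, rfl⟩
    have h2 := hz.2
    rw [mem_preimage, φ.left_inv (hK₀s hx)] at h2
    have h3 := hx.2.1
    rw [hU.frontier_eq] at h3
    exact h3.2 h2
  have hR : Tendsto (fun k => ∫ p, τ' k p * fluxFun g U Z p ∂(areaMeasure g (smoothBdry n U)))
      atTop (𝓝 (∫ p, τ p * fluxFun g U Z p ∂(areaMeasure g (smoothBdry n U)))) := by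
    refine tendsto_integral_of_dominated_convergence (fun p => ‖τ p * fluxFun g U Z p‖)
      (fun k => (integrable_mul_fluxFun hfl (hτ' k) (hcτ' k)).aestronglyMeasurable)
      (integrable_mul_fluxFun hfl hτ hc).norm (fun k => Eventually.of_forall fun p => ?_) ?_
    · have h2 : ‖(χ k (φ p) : ℂ)‖ ≤ 1 := by
        rw [Complex.norm_real, Real.norm_of_nonneg (h0 k _)]
        exact h1 k _
      rw [mul_assoc, norm_mul]
      exact mul_le_of_le_one_left (norm_nonneg _) h2
    · filter_upwards [ae_mem_smoothBdry hU] with p hp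
      by_cases hpt : p ∈ tsupport τ
      · have hpK : φ p ∉ φ '' K₀ := by
          rintro ⟨y, hy, hyp⟩
          rw [φ.injOn (hK₀s hy) (hs hpt) hyp] at hy
          exact hy.2.2 hp
        refine tendsto_const_nhds.congr' ?_
        filter_upwards [hχlim _ hpK] with k hk
        simp [τ', hk]
      · simp [τ', image_eq_zero_of_notMem_tsupport hpt]
  rw [StokesFor]
  exact tendsto_nhds_unique hL (hR.congr fun k => (hst k).symm)

theorem stokesFor_of_hasPiecewiseSmoothBdry (hU : IsOpen U) (hb : HasPiecewiseSmoothBdry g U)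
    (hfl : Integrable (fluxFun g U Z) (areaMeasure g (smoothBdry n U)))
    (hZ : HasDivergence g Z q) (hτ : IsSmoothFun n τ) (hc : HasCompactSupport τ) :
    StokesFor g U Z q τ := by
  rcases Nat.eq_zero_or_pos n with hn | hn
  · refine stokesFor_of_disjoint_singular hfl hZ hU hτ hc ?_
    subst hn
    rw [frontier_eq_empty_of_subsingleton (n := 0) hU, empty_sdiff]
    exact disjoint_bot_right
  · refine stokesFor_of_local hfl hZ hU hτ hc fun x _ => ⟨(chartAt (Cn n) x).source,
      (chartAt (Cn n) x).open_source, mem_chart_source _ x, fun σ hσ hcσ hs => ?_⟩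
    have hφ : chartAt (Cn n) x ∈ holCharts n X := chartAt_mem_holCharts x
    exact stokesFor_chart hn hU (hb.null _ hφ) hfl hZ hφ hσ hcσ hs

theorem divMul_of_eventuallyEq_one {x : X} (h : τ =ᶠ[𝓝 x] fun _ => 1) :
    divMul τ Z q x = q x := by
  have h1 : ∀ V : HTan n x, realDeriv τ x V = 0 := by
    intro V
    rw [realDeriv, h.mfderiv_eq, mfderiv_const]
    rfl
  rw [divMul, dHol, h1, h1, h.self_of_nhds]
  simp

/-- The divergence theorem on a domain with piecewise smooth boundary. -/
theorem setIntegral_eq_integral_fluxFun (hU : IsOpen U) (hcl : IsCompact (closure U))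
    (hb : HasPiecewiseSmoothBdry g U) (hZ : HasDivergence g Z q) :
    ∫ x in U, q x ∂(volMeasure g) =
      ∫ p, fluxFun g U Z p ∂(areaMeasure g (smoothBdry n U)) := by
  have : LocallyCompactSpace X := ChartedSpace.locallyCompactSpace (Cn n) X
  obtain ⟨K, hK, hUK⟩ := exists_compact_superset hcl
  -- The cutoff equals 1 in a neighbourhood of the closure of U, so its derivative contributes
  -- nothing there and the compactly supported version yields the full statement.
  obtain ⟨f, hf1, hf0, -⟩ := exists_contMDiffMap_one_nhds_of_subset_interior (n := ⊤)
    𝓘(ℝ, Cn n) isClosed_closure hUK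
  set τ : X → ℂ := fun x => ((f x : ℝ) : ℂ)
  have hτ : IsSmoothFun n τ := Complex.ofRealCLM.contDiff.contMDiff.comp f.contMDiff
  have hc : HasCompactSupport τ := HasCompactSupport.intro hK fun x hx => by simp [τ, hf0 x hx]
  have hτ1 : ∀ x ∈ closure U, τ =ᶠ[𝓝 x] fun _ => 1 := by
    intro x hx
    filter_upwards [eventually_nhdsSet_iff_forall.1 hf1 x hx] with y hy
    simp [τ, hy]
  have h := stokesFor_of_hasPiecewiseSmoothBdry hU hb (integrable_fluxFun hU hcl hb.finite hZ)
    hZ hτ hc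
  rw [StokesFor] at h
  rw [← setIntegral_congr_fun hU.measurableSet fun x hx =>
    divMul_of_eventuallyEq_one (Z := Z) (q := q) (hτ1 x (subset_closure hx)), h]
  refine integral_congr_ae ?_
  filter_upwards [ae_mem_smoothBdry hU] with p hp
  rw [(hτ1 p (frontier_subset_closure hp.1)).self_of_nhds, one_mul]

end Global

/-! ### Integrals against the measure of a Hermitian metric -/

section Weighted

variable {n : ℕ} {X : Type*} [TopologicalSpace X] [ChartedSpace (Cn n) X]
  [IsManifold 𝓘(ℂ, Cn n) ω X] [MeasurableSpace X] [BorelSpace X]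
  {L : X → Type*} [∀ x, AddCommGroup (L x)] [∀ x, Module ℂ (L x)]
  [∀ x, TopologicalSpace (L x)] [TopologicalSpace (Bundle.TotalSpace ℂ L)]
  [FiberBundle ℂ L] [VectorBundle ℂ ℂ L] [ContMDiffVectorBundle ω ℂ L 𝓘(ℂ, Cn n)]
  (g : KahlerMetric n X) (h : HermitianMetric n L)

omit [TopologicalSpace X] [ChartedSpace (Cn n) X] [IsManifold 𝓘(ℂ, Cn n) ω X] [MeasurableSpace X]
  [BorelSpace X] in
theorem toNNReal_smul_eq {v : X → ℝ} (hv : ∀ x, 0 ≤ v x) (f : X → ℂ) (x : X) :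
    (v x).toNNReal • f x = (v x : ℂ) * f x := by
  rw [NNReal.smul_def, Real.coe_toNNReal _ (hv x), Complex.real_smul]

omit [IsManifold 𝓘(ℂ, Cn n) ω X] [MeasurableSpace X] [BorelSpace X] [VectorBundle ℂ ℂ L]
  [ContMDiffVectorBundle ω ℂ L 𝓘(ℂ, Cn n)] in
theorem vFun_nonneg (x : X) : 0 ≤ vFun g h x := norm_nonneg _

theorem setIntegral_muMeasure {U : Set X} (hU : IsOpen U) (f : X → ℂ) :
    ∫ x in U, f x ∂(muMeasure g h) = ∫ x in U, (vFun g h x : ℂ) * f x ∂(volMeasure g) := by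
  rw [muMeasure, restrict_withDensity hU.measurableSet]
  have := integral_withDensity_eq_integral_smul (μ := (volMeasure g).restrict U)
    (continuous_vFun g h).measurable.real_toNNReal f
  simp only [toNNReal_smul_eq (vFun_nonneg g h)] at this
  exact this

theorem integrableOn_muMeasure {U : Set X} (hU : IsOpen U) (hc : IsCompact (closure U)) {f : X → ℂ}
    (hf : Continuous f) : IntegrableOn f U (muMeasure g h) ∧
      IntegrableOn (fun x => (vFun g h x : ℂ) * f x) U (volMeasure g) := by
  have h1 : IntegrableOn (fun x => (vFun g h x : ℂ) * f x) U (volMeasure g) :=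
    (((Complex.continuous_ofReal.comp (continuous_vFun g h)).mul
      hf).continuousOn.integrableOn_compact' hc isClosed_closure.measurableSet).mono_set
        subset_closure
  refine ⟨?_, h1⟩
  rw [IntegrableOn, muMeasure, restrict_withDensity hU.measurableSet]
  refine (integrable_withDensity_iff_integrable_smul
    (continuous_vFun g h).measurable.real_toNNReal).2 ?_
  simp only [toNNReal_smul_eq (vFun_nonneg g h)]
  exact h1

end Weighted

end HermDiv

end

theorem mainTheorem5 {n : ℕ} {X : Type*} [TopologicalSpace X] [T2Space X]
    [SecondCountableTopology X] [MeasurableSpace X] [BorelSpace X]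
    [ChartedSpace (HermDiv.Cn n) X] [IsManifold 𝓘(ℂ, HermDiv.Cn n) ω X]
    (g : HermDiv.KahlerMetric n X)
    {L : X → Type*} [∀ x, AddCommGroup (L x)] [∀ x, Module ℂ (L x)]
    [∀ x, TopologicalSpace (L x)] [TopologicalSpace (Bundle.TotalSpace ℂ L)]
    [FiberBundle ℂ L] [VectorBundle ℂ ℂ L]
    [ContMDiffVectorBundle ω ℂ L 𝓘(ℂ, HermDiv.Cn n)]
    (h : HermDiv.HermitianMetric n L)
    (Y : HermDiv.Sec n X) (hY : HermDiv.IsSmoothSec Y) :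
    (∀ φ ∈ HermDiv.holCharts n X,
      ∀ t : Bundle.Trivialization ℂ (Bundle.TotalSpace.proj : Bundle.TotalSpace ℂ L → X),
      MemTrivializationAtlas t → ∀ x ∈ φ.source ∩ t.baseSet,
        HermDiv.divVIn g h φ t Y x =
          HermDiv.divHIn g h φ t Y x + HermDiv.meanPairIn g h φ t Y x) ∧
    ∀ U : Set X, IsOpen U → IsCompact (closure U) → HermDiv.HasPiecewiseSmoothBdry g U →
      IntegrableOn (HermDiv.divH g h Y) U (HermDiv.muMeasure g h) ∧
      IntegrableOn (HermDiv.meanPair g h Y) U (HermDiv.muMeasure g h) ∧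
      Integrable
        (fun p => HermDiv.riemC g p
          ((HermDiv.vFun g h p : ℂ) • HermDiv.assocField g h Y p) (HermDiv.outerNormal g U p))
        (HermDiv.areaMeasure g (HermDiv.smoothBdry n U)) ∧
      ∫ x in U, HermDiv.divH g h Y x ∂(HermDiv.muMeasure g h) =
        -(∫ x in U, HermDiv.meanPair g h Y x ∂(HermDiv.muMeasure g h)) +
        ∫ p, HermDiv.riemC g p
          ((HermDiv.vFun g h p : ℂ) • HermDiv.assocField g h Y p) (HermDiv.outerNormal g U p)
          ∂(HermDiv.areaMeasure g (HermDiv.smoothBdry n U)) := by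
  refine ⟨fun φ hφ t ht x hx => HermDiv.divVIn_eq h g hY hφ ht hx, fun U hU hc hb => ?_⟩
  have hZ := HermDiv.hasDivergence_assocField g h hY
  obtain ⟨hd1, hd2⟩ := HermDiv.integrableOn_muMeasure g h hU hc (HermDiv.continuous_divH g h hY)
  obtain ⟨hm1, hm2⟩ := HermDiv.integrableOn_muMeasure g h hU hc (HermDiv.continuous_meanPair g h hY)
  refine ⟨hd1, hm1, HermDiv.integrable_fluxFun hU hc hb.finite hZ, ?_⟩
  have key := HermDiv.setIntegral_eq_integral_fluxFun hU hc hb hZ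
  simp only [mul_add] at key
  rw [integral_add hd2 hm2, ← HermDiv.setIntegral_muMeasure g h hU,
    ← HermDiv.setIntegral_muMeasure g h hU] at key
  rw [eq_neg_add_iff_add_eq, add_comm]
  exact key
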